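/- Let $V_C=\{1,\dots,n\}$ be a set of customers. For a set $\mathcal Q\subseteq\mathbb R^n$ of possible demand vectors, the worst-case load of a route that visits the set $S\subseteq V_C$ of customers is $\max_{q\in\mathcal Q}\sum_{i\in S}q_i$. Consider the following uncertainty sets. * Budget sets $\mathcal Q_B=\{q\in[\underline q,\overline q]:\sum_{i\in B_l}q_i\le b_l,\ l=1,\dots,L\}$, where $\underline q\le\overline q$, $b_l\ge 0$, the sets $B_l\subseteq V_C$ are pairwise disjoint and $\sum_{i\in B_l}\underline q_i\le b_l$ for all $l$. * Factor models $\mathcal Q_F=\{q^0+\Psi\xi:\xi\in[-1,1]^F,\ |\sum_{f}\xi_f|\le\beta F\}$, where $q^0\in\mathbb R^n_+$, $F\ge 1$, $\Psi\in\mathbb R^{n\times F}$ and $\beta\in[0,1]$. * Ellipsoids $\mathcal Q_E=\{q^0+\Sigma^{1/2}\xi:\xi\in\mathbb R^n,\ \xi^\top\xi\le1\}$, where $q^0\in\mathbb R^n_+$ and $\Sigma\in\mathbb R^{n\times n}$ is symmetric positive semidefinite with positive semidefinite square root $\Sigma^{1/2}$; the ellipsoid is axis-parallel if $\Sigma$ is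 diagonal. * Cardinality-constrained sets $\mathcal Q_G=\{q\in[q^0,q^0+\hat q]:q=q^0+\hat q\circ\xi,\ \xi\in[0,1]^n,\ \sum_i\xi_i\le\Gamma\}$, where $q^0,\hat q\in\mathbb R^n_+$, $\Gamma\in[0,n]$ and $\circ$ is the componentwise product. * Discrete sets $\mathcal Q_D=\operatorname{conv}\{q^{(1)},\dots,q^{(D)}\}$, where $D\ge1$ and $q^{(d)}\in\mathbb R^n_+$. The model of computation is a real random access machine: it performs in unit time the operations $+,-,\times,\sqrt{\cdot}$ and comparisons on real numbers, operations on integers of logarithmically many bits that serve as indices, and accesses to memory. The parameters of the uncertainty set (for a budget set: $\underline q$, $\overline q$, the $b_l$, and for each customer the index $l$ with $i\in B_l$, if there is one; for a general ellipsoid: $q^0$, $\Sigma$ and $\Sigma^{1/2}$; for an axis-parallel one: $q^0$ and the diagonal of $\Sigma$) are stored in read-only arrays, which do not count as storage. Then the worst-case load of a route that visits a set $S$ of customers can be computed from scratch within the times in the second column of the table. Moreover, there are data structures that hold the worst-case load of a route visiting $S$ and that can be initialized for $S=\emptyset$ in time linear in the dimensions of the parameters ($n$, plus $L$, $F$ or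 $D$ where it applies), can be updated within the time in the third column when a single customer is added to or removed from $S$, and occupy the storage in the fourth column (including the working storage of the updates). $$\begin{array}{lccc} \mathcal Q & \text{from scratch: time} & \text{incremental update: time} & \text{incremental update: storage}\\\hline \mathcal Q_B & \mathcal O(|S|) & \mathcal O(1) & \mathcal O(L)\\ \mathcal Q_F & \mathcal O(|S|F+F\log F) & \mathcal O(F\log F) & \mathcal O(F)\\ \mathcal Q_E\text{ (axis-parallel)} & \mathcal O(|S|) & \mathcal O(1) & \mathcal O(1)\\ \mathcal Q_E\text{ (general)} & \mathcal O(|S|n) & \mathcal O(n) & \mathcal O(n)\\ \mathcal Q_G & \mathcal O(|S|) & \mathcal O(\log|S|) & \mathcal O(n)\\ \mathcal Q_D & \mathcal O(|S|D) & \mathcal O(D) & \mathcal O(D) \end{array}$$ For $\mathcal Q_G$, the update time and the storage can be improved to $\mathcal O(\log\Gamma)$ and $\mathcal O(\Gamma)$, respectively, if customers are only added to $S$. For $\mathcal Q_B$, the time for the computation from scratch is understood after a single preprocessing of the parameters of the uncertainty set, which does not depend on the route and takes time $\mathcal O(n+L)$. The algorithms are the same for all sets of a class, and the constants in $\mathcal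 O(\cdot)$ are universal; a bound $\mathcal O(x)$ is read as $\mathcal O(x+1)$ where $x$ may vanish, and $\log\Gamma$ as $0$ for $\Gamma<1$. -/

import Mathlib

open scoped MatrixOrder

namespace RobustVRP

/-! ### Real random access machine

Integers (used for indices) and reals are kept apart. The machine has integer registers, real
registers, an integer memory and a real memory, and it reads its input from read-only arrays.
A program mentions finitely many registers and its only constants are natural numbers. There is no
rounding operation from reals to integers. -/

/-- The read-only input: `nat k i` is entry `i` of the `k`-th integer array and `real k i j` is
entry `(i, j)` of the `k`-th real array. -/
structure Input where
  nat : ℕ → ℕ → ℕ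
  real : ℕ → ℕ → ℕ → ℝ

/-- Contents of the registers and of the two memories. -/
structure State where
  nreg : ℕ → ℕ
  rreg : ℕ → ℝ
  nmem : ℕ → ℕ
  rmem : ℕ → ℝ

/-- Resource limits: each of the two memories has `mem` cells, integers may not exceed `word`. -/
structure Limits where
  mem : ℕ
  word : ℕ

/-- Elementary instructions; `d` is the number of the destination register. -/
inductive Instr where
  | nconst (d k : ℕ)
  | nmove (d a : ℕ)
  | nadd (d a b : ℕ)
  | nsub (d a b : ℕ)
  | nhalf (d a : ℕ)
  | nload (d a : ℕ)
  | nstore (a b : ℕ)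
  | ninput (d k a : ℕ)
  | rcast (d a : ℕ)
  | rmove (d a : ℕ)
  | radd (d a b : ℕ)
  | rsub (d a b : ℕ)
  | rmul (d a b : ℕ)
  | rsqrt (d a : ℕ)
  | rload (d a : ℕ)
  | rstore (a b : ℕ)
  | rinput (d k a b : ℕ)

/-- Write `v` into integer register `d`. -/
def State.setN (s : State) (d v : ℕ) : State :=
  { s with nreg := Function.update s.nreg d v }

/-- Write `v` into real register `d`. -/
noncomputable def State.setR (s : State) (d : ℕ) (v : ℝ) : State :=
  { s with rreg := Function.update s.rreg d v }

/-- The state after an instruction. Integer subtraction is truncated at `0`. -/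
noncomputable def Instr.next (inp : Input) (s : State) : Instr → State
  | .nconst d k => s.setN d k
  | .nmove d a => s.setN d (s.nreg a)
  | .nadd d a b => s.setN d (s.nreg a + s.nreg b)
  | .nsub d a b => s.setN d (s.nreg a - s.nreg b)
  | .nhalf d a => s.setN d (s.nreg a / 2)
  | .nload d a => s.setN d (s.nmem (s.nreg a))
  | .nstore a b => { s with nmem := Function.update s.nmem (s.nreg a) (s.nreg b) }
  | .ninput d k a => s.setN d (inp.nat k (s.nreg a))
  | .rcast d a => s.setR d (s.nreg a : ℝ)
  | .rmove d a => s.setR d (s.rreg a)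
  | .radd d a b => s.setR d (s.rreg a + s.rreg b)
  | .rsub d a b => s.setR d (s.rreg a - s.rreg b)
  | .rmul d a b => s.setR d (s.rreg a * s.rreg b)
  | .rsqrt d a => s.setR d (Real.sqrt (s.rreg a))
  | .rload d a => s.setR d (s.rmem (s.nreg a))
  | .rstore a b => { s with rmem := Function.update s.rmem (s.nreg a) (s.rreg b) }
  | .rinput d k a b => s.setR d (inp.real k (s.nreg a) (s.nreg b))

/-- An instruction may be executed only if it respects the limits (every accessed memory address is
below `mem`, every integer put into a register is at most `word`) and takes no square root of a
negative number; otherwise the machine is stuck. -/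
def Instr.Safe (lim : Limits) (inp : Input) (s : State) : Instr → Prop
  | .nconst _ k => k ≤ lim.word
  | .nmove _ a => s.nreg a ≤ lim.word
  | .nadd _ a b => s.nreg a + s.nreg b ≤ lim.word
  | .nsub _ a b => s.nreg a - s.nreg b ≤ lim.word
  | .nhalf _ a => s.nreg a / 2 ≤ lim.word
  | .nload _ a => s.nreg a < lim.mem ∧ s.nmem (s.nreg a) ≤ lim.word
  | .nstore a b => s.nreg a < lim.mem ∧ s.nreg b ≤ lim.word
  | .ninput _ k a => inp.nat k (s.nreg a) ≤ lim.word
  | .rsqrt _ a => 0 ≤ s.rreg a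
  | .rload _ a => s.nreg a < lim.mem
  | .rstore a _ => s.nreg a < lim.mem
  | _ => True

/-- Comparisons of two registers. -/
inductive Test where
  | nle (a b : ℕ)
  | rle (a b : ℕ)

/-- Truth value of a comparison. -/
def Test.Holds (s : State) : Test → Prop
  | .nle a b => s.nreg a ≤ s.nreg b
  | .rle a b => s.rreg a ≤ s.rreg b

/-- Programs: instructions, sequencing, branching and loops. -/
inductive Program where
  | skip
  | instr (i : Instr)
  | seq (p q : Program)
  | branch (b : Test) (p q : Program)
  | loop (b : Test) (p : Program)

/-- `Exec lim inp p s s' t`: started in state `s`, the program `p` halts in state `s'` after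
`t` steps without violating the limits. Every instruction and every comparison is one step. -/
inductive Exec (lim : Limits) (inp : Input) : Program → State → State → ℕ → Prop
  | skip (s : State) : Exec lim inp .skip s s 0
  | instr (i : Instr) (s : State) (h : i.Safe lim inp s) :
      Exec lim inp (.instr i) s (i.next inp s) 1
  | seq {p q : Program} {s₁ s₂ s₃ : State} {t u : ℕ}
      (hp : Exec lim inp p s₁ s₂ t) (hq : Exec lim inp q s₂ s₃ u) :
      Exec lim inp (.seq p q) s₁ s₃ (t + u)
  | branchTrue {b : Test} {p q : Program} {s s' : State} {t : ℕ} (hb : b.Holds s)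
      (hp : Exec lim inp p s s' t) : Exec lim inp (.branch b p q) s s' (t + 1)
  | branchFalse {b : Test} {p q : Program} {s s' : State} {t : ℕ} (hb : ¬ b.Holds s)
      (hq : Exec lim inp q s s' t) : Exec lim inp (.branch b p q) s s' (t + 1)
  | loopDone {b : Test} {p : Program} {s : State} (hb : ¬ b.Holds s) :
      Exec lim inp (.loop b p) s s 1
  | loopStep {b : Test} {p : Program} {s₁ s₂ s₃ : State} {t u : ℕ} (hb : b.Holds s₁)
      (hp : Exec lim inp p s₁ s₂ t) (hl : Exec lim inp (.loop b p) s₂ s₃ u) :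
      Exec lim inp (.loop b p) s₁ s₃ (t + u + 1)

/-- The real number returned by the machine: the content of real register `0`. -/
def State.output (s : State) : ℝ := s.rreg 0

/-! ### Uncertainty sets and their descriptions -/

/-- `v` is the worst-case load, `max_{q ∈ Q} ∑_{i ∈ S} q i`, of a route visiting the customers `S`
(in particular the maximum is attained). -/
def IsWorstCaseLoad {n : ℕ} (Q : Set (Fin n → ℝ)) (S : Finset (Fin n)) (v : ℝ) : Prop :=
  IsGreatest ((fun q : Fin n → ℝ => ∑ i ∈ S, q i) '' Q) v

/-- An uncertainty set for `n` customers together with the arrays that describe it to the machine.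
`size` is the sum of the dimensions of these arrays. -/
structure Instance where
  n : ℕ
  Q : Set (Fin n → ℝ)
  size : ℕ
  nat : ℕ → ℕ → ℕ
  real : ℕ → ℕ → ℕ → ℝ

/-- The input that consists of a query, in integer array `0`, and of the description of the
uncertainty set, whose integer arrays are numbered from `1` on. -/
def Instance.input (a : Instance) (query : List ℕ) : Input where
  nat
    | 0 => fun i => query.getD i 0
    | k + 1 => a.nat k
  real := a.real

/-- A vector as a one-dimensional array (the second index is ignored), padded with zeros. -/
noncomputable def array1 {n : ℕ} (v : Fin n → ℝ) : ℕ → ℕ → ℝ :=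
  fun i _ => if h : i < n then v ⟨i, h⟩ else 0

/-- A matrix as a two-dimensional array, padded with zeros. -/
noncomputable def array2 {m n : ℕ} (A : Fin m → Fin n → ℝ) : ℕ → ℕ → ℝ :=
  fun i j => if h : i < m ∧ j < n then A ⟨i, h.1⟩ ⟨j, h.2⟩ else 0

/-- Parameters of a budget set with pairwise disjoint customer subsets `B l`. -/
structure Budget where
  n : ℕ
  L : ℕ
  lower : Fin n → ℝ
  upper : Fin n → ℝ
  B : Fin L → Finset (Fin n)
  b : Fin L → ℝ
  lower_le_upper : ∀ i, lower i ≤ upper i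
  b_nonneg : ∀ l, 0 ≤ b l
  lower_le_b : ∀ l, ∑ i ∈ B l, lower i ≤ b l
  disjoint : ∀ l l', l ≠ l' → Disjoint (B l) (B l')

/-- The budget set. -/
def Budget.set (a : Budget) : Set (Fin a.n → ℝ) :=
  {q | (∀ i, a.lower i ≤ q i ∧ q i ≤ a.upper i) ∧ ∀ l, ∑ i ∈ a.B l, q i ≤ a.b l}

open Classical in
/-- `l + 1` for the (only) `l` with `i ∈ B l`, and `0` if customer `i` is in none of the subsets. -/
noncomputable def Budget.label (a : Budget) (i : Fin a.n) : ℕ :=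
  if h : ∃ l, i ∈ a.B l then (h.choose : ℕ) + 1 else 0

/-- Described by `n`, `L`, the labels of the customers, the two bound vectors and the budgets. -/
noncomputable def Budget.toInstance (a : Budget) : Instance where
  n := a.n
  Q := a.set
  size := a.n + a.L
  nat
    | 0 => fun i => [a.n, a.L].getD i 0
    | 1 => fun i => if h : i < a.n then a.label ⟨i, h⟩ else 0
    | _ => fun _ => 0
  real
    | 0 => array1 a.lower
    | 1 => array1 a.upper
    | 2 => array1 a.b
    | _ => fun _ _ => 0

/-- Parameters of a factor model with `F ≥ 1` factors. -/
structure FactorModel where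
  n : ℕ
  F : ℕ
  q0 : Fin n → ℝ
  Psi : Matrix (Fin n) (Fin F) ℝ
  beta : ℝ
  F_pos : 0 < F
  q0_nonneg : ∀ i, 0 ≤ q0 i
  beta_nonneg : 0 ≤ beta
  beta_le_one : beta ≤ 1

/-- The factor model uncertainty set. -/
def FactorModel.set (a : FactorModel) : Set (Fin a.n → ℝ) :=
  {q | ∃ xi : Fin a.F → ℝ, (∀ f, -1 ≤ xi f ∧ xi f ≤ 1) ∧ |∑ f, xi f| ≤ a.beta * a.F ∧
    q = a.q0 + a.Psi.mulVec xi}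

/-- Described by `n`, `F`, the nominal demands, the factor loadings and `beta`. -/
noncomputable def FactorModel.toInstance (a : FactorModel) : Instance where
  n := a.n
  Q := a.set
  size := a.n + a.F
  nat
    | 0 => fun i => [a.n, a.F].getD i 0
    | _ => fun _ => 0
  real
    | 0 => array1 a.q0
    | 1 => array2 a.Psi
    | 2 => fun _ _ => a.beta
    | _ => fun _ _ => 0

/-- Parameters of an ellipsoidal set. -/
structure Ellipsoid where
  n : ℕ
  q0 : Fin n → ℝ
  Sigma : Matrix (Fin n) (Fin n) ℝ
  q0_nonneg : ∀ i, 0 ≤ q0 i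
  posSemidef : Sigma.PosSemidef

/-- The positive semidefinite square root of `Sigma`. -/
noncomputable def Ellipsoid.root (a : Ellipsoid) : Matrix (Fin a.n) (Fin a.n) ℝ :=
  CFC.sqrt a.Sigma

/-- The ellipsoidal set. -/
def Ellipsoid.set (a : Ellipsoid) : Set (Fin a.n → ℝ) :=
  {q | ∃ xi : Fin a.n → ℝ, xi ⬝ᵥ xi ≤ 1 ∧ q = a.q0 + a.root.mulVec xi}

/-- Described by `n`, the center, the matrix and its square root. -/
noncomputable def Ellipsoid.toInstance (a : Ellipsoid) : Instance where
  n := a.n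
  Q := a.set
  size := a.n
  nat
    | 0 => fun i => [a.n].getD i 0
    | _ => fun _ => 0
  real
    | 0 => array1 a.q0
    | 1 => array2 a.Sigma
    | 2 => array2 a.root
    | _ => fun _ _ => 0

/-- Parameters of an axis-parallel ellipsoidal set: the matrix is diagonal. -/
structure AxisParallelEllipsoid extends Ellipsoid where
  isDiag : Sigma.IsDiag

/-- Described by `n`, the center and the diagonal of the matrix. -/
noncomputable def AxisParallelEllipsoid.toInstance (a : AxisParallelEllipsoid) : Instance where
  n := a.n
  Q := a.toEllipsoid.set
  size := a.n
  nat
    | 0 => fun i => [a.n].getD i 0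
    | _ => fun _ => 0
  real
    | 0 => array1 a.q0
    | 1 => array1 a.Sigma.diag
    | _ => fun _ _ => 0

/-- Parameters of a cardinality-constrained set. -/
structure Cardinality where
  n : ℕ
  q0 : Fin n → ℝ
  qhat : Fin n → ℝ
  Gamma : ℝ
  q0_nonneg : ∀ i, 0 ≤ q0 i
  qhat_nonneg : ∀ i, 0 ≤ qhat i
  Gamma_nonneg : 0 ≤ Gamma
  Gamma_le : Gamma ≤ n

/-- The cardinality-constrained set. -/
def Cardinality.set (a : Cardinality) : Set (Fin a.n → ℝ) :=
  {q | q ∈ Set.Icc a.q0 (a.q0 + a.qhat) ∧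
    ∃ xi : Fin a.n → ℝ, (∀ i, 0 ≤ xi i ∧ xi i ≤ 1) ∧ ∑ i, xi i ≤ a.Gamma ∧
      q = a.q0 + a.qhat * xi}

/-- Described by `n`, the nominal demands, the maximal deviations and `Gamma`. -/
noncomputable def Cardinality.toInstance (a : Cardinality) : Instance where
  n := a.n
  Q := a.set
  size := a.n
  nat
    | 0 => fun i => [a.n].getD i 0
    | _ => fun _ => 0
  real
    | 0 => array1 a.q0
    | 1 => array1 a.qhat
    | 2 => fun _ _ => a.Gamma
    | _ => fun _ _ => 0

/-- Parameters of a discrete set: `D ≥ 1` demand vectors. -/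
structure Discrete where
  n : ℕ
  D : ℕ
  q : Fin D → Fin n → ℝ
  D_pos : 0 < D
  q_nonneg : ∀ d i, 0 ≤ q d i

/-- The discrete set: the convex hull of the given demand vectors. -/
def Discrete.set (a : Discrete) : Set (Fin a.n → ℝ) :=
  convexHull ℝ (Set.range a.q)

/-- Described by `n`, `D` and the demand vectors. -/
noncomputable def Discrete.toInstance (a : Discrete) : Instance where
  n := a.n
  Q := a.set
  size := a.n + a.D
  nat
    | 0 => fun i => [a.n, a.D].getD i 0
    | _ => fun _ => 0
  real
    | 0 => array2 a.q
    | _ => fun _ _ => 0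

/-! ### Complexity of computing and of updating worst-case loads

In each definition the programs and the constant `c` are the same for all sets of the class. The
integers of the machine have `O(log (size))` bits: they are at most `(size + 2) ^ c`. All programs
work from arbitrary (uninitialized) registers and memory. -/

/-- The query for a route: its number of customers, followed by the customers. -/
def routeQuery {n : ℕ} (R : List (Fin n)) : List ℕ :=
  R.length :: R.map Fin.val

/-- Some program computes from scratch, in time `O(T a |S|)`, the worst-case load over the
uncertainty set of `a` of every route, where `S` is the set of customers visited. -/
def ComputableFromScratch {ι : Type} (inst : ι → Instance) (T : ι → ℕ → ℕ) : Prop :=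
  ∃ (scratch : Program) (c : ℕ), ∀ (a : ι) (R : List (Fin (inst a).n)), R.Nodup →
    ∀ s : State, ∃ (s' : State) (t : ℕ),
      Exec ⟨((inst a).size + 2) ^ c, ((inst a).size + 2) ^ c⟩ ((inst a).input (routeQuery R))
        scratch s s' t ∧
      IsWorstCaseLoad (inst a).Q R.toFinset s'.output ∧
      t ≤ c * T a R.length

/-- The same, except that beforehand a preprocessing of the description of the uncertainty set,
which does not see any route and takes time linear in `size`, is carried out once. After it, any
number of routes can be evaluated one after the other, each in time `O(T a |S|)`; `Ready` are the
states in which the machine is ready for the next route. -/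
def ComputableAfterPreprocessing {ι : Type} (inst : ι → Instance) (T : ι → ℕ → ℕ) : Prop :=
  ∃ (prep scratch : Program) (c : ℕ), ∀ a : ι, ∃ Ready : State → Prop,
    (∀ s : State, ∃ (s' : State) (t : ℕ),
      Exec ⟨((inst a).size + 2) ^ c, ((inst a).size + 2) ^ c⟩ ((inst a).input []) prep s s' t ∧
      Ready s' ∧ t ≤ c * ((inst a).size + 1)) ∧
    ∀ s : State, Ready s → ∀ R : List (Fin (inst a).n), R.Nodup →
      ∃ (s' : State) (t : ℕ),
        Exec ⟨((inst a).size + 2) ^ c, ((inst a).size + 2) ^ c⟩ ((inst a).input (routeQuery R))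
          scratch s s' t ∧
        IsWorstCaseLoad (inst a).Q R.toFinset s'.output ∧
        Ready s' ∧ t ≤ c * T a R.length

/-- Some data structure for a set `S` of customers keeps the worst-case load in the output register
and can be updated in time `O(T a |S|)` when a customer is added to `S` or, if `removals` is true,
removed from `S`. It uses `O(M a)` memory cells throughout (temporary ones included), and the
structure for `S = ∅` is set up in time linear in `size`. `Rep S s` says that the state `s` holds
the data structure for `S`. -/
def IncrementallyUpdatable {ι : Type} (removals : Prop) (inst : ι → Instance) (T : ι → ℕ → ℕ)
    (M : ι → ℕ) : Prop :=
  ∃ (start add remove : Program) (c : ℕ), ∀ a : ι,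
    ∃ Rep : Finset (Fin (inst a).n) → State → Prop,
      (∀ s : State, ∃ (s' : State) (t : ℕ),
        Exec ⟨c * M a, ((inst a).size + 2) ^ c⟩ ((inst a).input []) start s s' t ∧
        Rep ∅ s' ∧ t ≤ c * ((inst a).size + 1)) ∧
      ∀ (S : Finset (Fin (inst a).n)) (s : State), Rep S s →
        IsWorstCaseLoad (inst a).Q S s.output ∧
        (∀ j, j ∉ S → ∃ (s' : State) (t : ℕ),
          Exec ⟨c * M a, ((inst a).size + 2) ^ c⟩ ((inst a).input [j.val]) add s s' t ∧
          Rep (insert j S) s' ∧ t ≤ c * T a S.card) ∧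
        (removals → ∀ j, j ∈ S → ∃ (s' : State) (t : ℕ),
          Exec ⟨c * M a, ((inst a).size + 2) ^ c⟩ ((inst a).input [j.val]) remove s s' t ∧
          Rep (S.erase j) s' ∧ t ≤ c * T a S.card)

end RobustVRP

set_option linter.unusedSimpArgs false

namespace RobustVRP

/-! ### Reasoning about programs -/

section Runs

variable {lim : Limits} {inp : Input}

/-! For every class the worst-case load has a closed form or a dual certificate, and a data
structure keeps the ingredients of that formula up to date.

Ellipsoids: by Cauchy–Schwarz the load is `q⁰(S) + √(1_Sᵀ Σ 1_S)` (`Ellipsoid.isWorstCaseLoad`).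
Toggling customer `j` changes the quadratic form by twice the sum of row `j` over `S` and by `Σ_jj`,
so it suffices to maintain the row sums; a diagonal `Σ` needs none of them. Discrete sets: a linear
function attains its maximum over a convex hull at a generator. Budget sets: as the `B_l` are
disjoint, the problem decouples, and the customers of `S` in `B_l` gain, beyond their lower bounds,
the minimum of their total deviation and of what all lower bounds leave of `b_l`
(`Budget.isWorstCaseLoad`); an update changes at most one of these minima.

Factor models and cardinality-constrained sets have a single coupling constraint. With its
multiplier `x` the dual is one-dimensional: minimize `|x| β F + ∑_f |c_f - x|`, where `c_f` is the
total loading of factor `f`, or `Γ x + ∑_{i ∈ S} max(0, q̂_i - x)`. An optimal `x` is a quantile in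
the sense of `Splits`, or `0`. The program `select` finds quantiles in linear time, so nothing is
ever sorted, and factor models even get updates in time `O(F)`.

Selection takes as pivot the median of the `⌊n/9⌋` medians of triples of medians of triples. At most
`n - 2⌊n/9⌋` elements lie strictly on either side of it, so the recursive calls have sizes about
`n/9` and `7n/9`, with sum below `n`. The recursion is run on an explicit stack and its time is
bounded by a potential (`runs_select`).

For updates of cardinality-constrained sets, `S` is split into a set `T` of `⌊Γ⌋` customers with the
largest deviations and the rest `R`; the load is `q⁰(S) + q̂(T) + (Γ - ⌊Γ⌋) max_R q̂`
(`Cardinality.Top.isWorstCaseLoad`). One tournament tree has the smallest deviation of `T` at its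
root, another one the largest deviation of `R`. If customers are only added, a customer that has
left `T` never returns, so `R` shrinks to its maximum and `T` fits into `⌊Γ⌋ + 1` slots.

On the side of the machine, `Runs` is total correctness with a time bound. Loop-free code is reduced
to `Program.Pre`, loops to `Runs.counted` and `Runs.amortized`. A `Maintenance` yields the
incremental bounds and, by inserting the customers of a route one by one, the bounds from scratch
for factor models, ellipsoids and discrete sets. Budget sets insert the route, record the load and
remove the route again; cardinality-constrained sets use `select` directly. -/

/-- Started in `s`, the program `p` halts within `T` steps in a state that satisfies `Q`. -/
def Runs (lim : Limits) (inp : Input) (p : Program) (s : State) (T : ℕ) (Q : State → Prop) :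
    Prop :=
  ∃ (s' : State) (t : ℕ), Exec lim inp p s s' t ∧ t ≤ T ∧ Q s'

theorem Runs.mono {p : Program} {s : State} {T T' : ℕ} {Q Q' : State → Prop}
    (h : Runs lim inp p s T Q) (hT : T ≤ T') (hQ : ∀ s', Q s' → Q' s') :
    Runs lim inp p s T' Q' := by
  obtain ⟨s', t, he, ht, hq⟩ := h
  exact ⟨s', t, he, ht.trans hT, hQ _ hq⟩

theorem Runs.seq {p q : Program} {s : State} {T U V : ℕ} {P Q : State → Prop}
    (hp : Runs lim inp p s T P) (hq : ∀ s', P s' → Runs lim inp q s' U Q) (hV : T + U ≤ V) :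
    Runs lim inp (.seq p q) s V Q := by
  obtain ⟨s₁, t, he, ht, h⟩ := hp
  obtain ⟨s₂, u, he', hu, h'⟩ := hq s₁ h
  exact ⟨s₂, t + u, .seq he he', by omega, h'⟩

theorem Runs.branch {b : Test} {p q : Program} {s : State} {T U : ℕ} {Q : State → Prop}
    (hp : b.Holds s → Runs lim inp p s T Q) (hq : ¬ b.Holds s → Runs lim inp q s T Q)
    (hU : T + 1 ≤ U) : Runs lim inp (.branch b p q) s U Q := by
  by_cases h : b.Holds s
  · obtain ⟨s', t, he, ht, hQ⟩ := hp h
    exact ⟨s', t + 1, .branchTrue h he, by omega, hQ⟩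
  · obtain ⟨s', t, he, ht, hQ⟩ := hq h
    exact ⟨s', t + 1, .branchFalse h he, by omega, hQ⟩

theorem Runs.loop_done {b : Test} {p : Program} {s : State} {T : ℕ} {Q : State → Prop}
    (hb : ¬ b.Holds s) (hQ : Q s) (hT : 1 ≤ T) : Runs lim inp (.loop b p) s T Q :=
  ⟨s, 1, .loopDone hb, hT, hQ⟩

theorem Runs.loop_step {b : Test} {p : Program} {s : State} {T U V : ℕ} {P Q : State → Prop}
    (hb : b.Holds s) (hp : Runs lim inp p s T P)
    (hl : ∀ s', P s' → Runs lim inp (.loop b p) s' U Q) (hV : T + U + 1 ≤ V) :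
    Runs lim inp (.loop b p) s V Q := by
  obtain ⟨s₁, t, he, ht, h⟩ := hp
  obtain ⟨s₂, u, he', hu, h'⟩ := hl s₁ h
  exact ⟨s₂, t + u + 1, .loopStep hb he he', by omega, h'⟩

/-- A loop that runs while its counter is below `n`. -/
theorem Runs.counted {b : Test} {p : Program} {T n : ℕ} (I : ℕ → State → Prop)
    (hb : ∀ i s, i ≤ n → I i s → (b.Holds s ↔ i < n))
    (hp : ∀ i s, i < n → I i s → Runs lim inp p s T (I (i + 1))) {i : ℕ} (hi : i ≤ n)
    {s : State} (hs : I i s) {U : ℕ} (hU : (n - i) * (T + 1) + 1 ≤ U) :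
    Runs lim inp (.loop b p) s U (I n) := by
  induction hk : n - i generalizing i s U with
  | zero =>
    obtain rfl : i = n := by omega
    exact .loop_done (by rw [hb _ s le_rfl hs]; omega) hs (by omega)
  | succ k ih =>
    have hin : i < n := by omega
    have hk' : n - (i + 1) = k := by omega
    refine .loop_step (U := k * (T + 1) + 1) ((hb i s hi hs).2 hin) (hp i s hin hs)
      (fun s' hs' => ih hin hs' (by rw [hk']) hk') ?_
    rw [hk] at hU
    linarith [hU, add_mul k 1 (T + 1)]

/-- A loop with an amortized time bound. -/
theorem Runs.amortized {α : Type*} {b : Test} {p : Program} (I : α → State → Prop) (pot : α → ℕ)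
    {Q : State → Prop} (hQ : ∀ x s, I x s → ¬ b.Holds s → Q s)
    (hp : ∀ x s, I x s → b.Holds s → ∃ T, Runs lim inp p s T
      (fun s' => ∃ y, I y s' ∧ T + 1 + pot y ≤ pot x))
    {x : α} {s : State} (hs : I x s) {T : ℕ} (hT : pot x + 1 ≤ T) :
    Runs lim inp (.loop b p) s T Q := by
  -- Every iteration pays at least the step of its test, so the potential strictly decreases and the
  -- loop halts.
  induction hk : pot x using Nat.strong_induction_on generalizing x s T with
  | _ k ih =>
    by_cases h : b.Holds s
    · obtain ⟨t, s₁, u, he, hu, y, hy, hle⟩ := hp x s hs h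
      obtain ⟨s₂, w, he', hw, hq⟩ := ih (pot y) (by omega) hy le_rfl rfl
      exact ⟨s₂, u + w + 1, .loopStep h he he', by omega, hq⟩
    · exact .loop_done h (hQ x s hs h) (by omega)

section Simp

variable (s : State) (d e v : ℕ) (x : ℝ)

@[simp] theorem State.setN_nreg : (s.setN d v).nreg e = if e = d then v else s.nreg e := by
  simp [State.setN, Function.update_apply]
@[simp] theorem State.setN_rreg : (s.setN d v).rreg = s.rreg := rfl
@[simp] theorem State.setN_nmem : (s.setN d v).nmem = s.nmem := rfl
@[simp] theorem State.setN_rmem : (s.setN d v).rmem = s.rmem := rfl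
@[simp] theorem State.setR_rreg : (s.setR d x).rreg e = if e = d then x else s.rreg e := by
  simp [State.setR, Function.update_apply]
@[simp] theorem State.setR_nreg : (s.setR d x).nreg = s.nreg := rfl
@[simp] theorem State.setR_nmem : (s.setR d x).nmem = s.nmem := rfl
@[simp] theorem State.setR_rmem : (s.setR d x).rmem = s.rmem := rfl
end Simp

/-- Running time of a program without loops. -/
def Program.cost : Program → ℕ
  | .skip => 0
  | .instr _ => 1
  | .seq p q => p.cost + q.cost
  | .branch _ p q => max p.cost q.cost + 1
  -- A junk value: `Program.Pre` is `False` for loops, so `Runs.of_pre'` never relies on it.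
  | .loop _ _ => 0

/-- Weakest precondition of a program without loops. -/
def Program.Pre (lim : Limits) (inp : Input) : Program → (State → Prop) → State → Prop
  | .skip, Q, s => Q s
  | .instr i, Q, s => i.Safe lim inp s ∧ Q (i.next inp s)
  | .seq p q, Q, s => p.Pre lim inp (q.Pre lim inp Q) s
  | .branch b p q, Q, s => (b.Holds s → p.Pre lim inp Q s) ∧ (¬ b.Holds s → q.Pre lim inp Q s)
  | .loop _ _, _, _ => False

theorem Runs.of_pre' {p : Program} {s : State} {Q : State → Prop} (h : p.Pre lim inp Q s) :
    Runs lim inp p s p.cost Q := by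
  induction p generalizing s Q with
  | skip => exact ⟨s, 0, .skip s, le_rfl, h⟩
  | instr i => exact ⟨_, 1, .instr i s h.1, le_rfl, h.2⟩
  | seq p q hp hq => exact .seq (hp h) (fun _ hs => hq hs) le_rfl
  | branch b p q hp hq =>
    exact .branch (fun hb => (hp (h.1 hb)).mono (le_max_left _ _) fun _ => id)
      (fun hb => (hq (h.2 hb)).mono (le_max_right _ _) fun _ => id) le_rfl
  | loop => exact h.elim

theorem Runs.of_pre {p : Program} {s : State} {Q : State → Prop} {T : ℕ}
    (h : p.Pre lim inp Q s) (hT : p.cost ≤ T) : Runs lim inp p s T Q :=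
  (Runs.of_pre' h).mono hT fun _ => id

/-- A sequence of instructions. -/
def block : List Instr → Program
  | [] => .skip
  | [i] => .instr i
  | i :: j :: l => .seq (.instr i) (block (j :: l))

end Runs

/-- The programs are verified under limits that are linear in the dimensions; this fits them into
the polynomial limits of the complexity definitions. -/
theorem word_bound (m c : ℕ) : c * (m + 2) ≤ (m + 2) ^ c := by
  induction c with
  | zero => simp
  | succ c ih =>
    rcases Nat.eq_zero_or_pos c with rfl | hc
    · simp
    · calc (c + 1) * (m + 2) ≤ (c * (m + 2)) * 2 := by nlinarith
        _ ≤ (m + 2) ^ c * (m + 2) := Nat.mul_le_mul ih (by omega)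
        _ = (m + 2) ^ (c + 1) := (pow_succ _ _).symm

/-! ### Data structures that maintain the worst-case load -/

/-- The states agree except for the integer registers `0`, `1` and `2`. -/
structure State.Agree (s s' : State) : Prop where
  rreg : s'.rreg = s.rreg
  nmem : s'.nmem = s.nmem
  rmem : s'.rmem = s.rmem
  nreg : ∀ r, 3 ≤ r → s'.nreg r = s.nreg r

/-- The integer registers `1` and `2` have the same contents. -/
def State.Keeps (s s' : State) : Prop :=
  s'.nreg 1 = s.nreg 1 ∧ s'.nreg 2 = s.nreg 2

/-- A data structure for the worst-case load of a route. Its programs ignore the query: the customer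
to be added or removed is expected in the integer register `0`. -/
structure Maintenance {ι : Type} (removals : Prop) (inst : ι → Instance) (D : ι → ℕ)
    (T : ι → ℕ → ℕ) (M : ι → ℕ) where
  start : Program
  add : Program
  remove : Program
  c : ℕ
  Rep : ∀ a, Finset (Fin (inst a).n) → State → Prop
  agree : ∀ a S s s', s.Agree s' → Rep a S s → Rep a S s'
  load : ∀ a S s, Rep a S s → IsWorstCaseLoad (inst a).Q S s.output
  start_runs : ∀ a lim query s, c * M a ≤ lim.mem → c * ((inst a).size + 2) ≤ lim.word →
    Runs lim ((inst a).input query) start s (c * D a) (fun s' => Rep a ∅ s' ∧ s.Keeps s')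
  add_runs : ∀ a lim query S s j, c * M a ≤ lim.mem → c * ((inst a).size + 2) ≤ lim.word →
    Rep a S s → j ∉ S → s.nreg 0 = j.val →
    Runs lim ((inst a).input query) add s (c * T a S.card)
      (fun s' => Rep a (insert j S) s' ∧ s.Keeps s')
  remove_runs : removals → ∀ a lim query S s j, c * M a ≤ lim.mem →
    c * ((inst a).size + 2) ≤ lim.word → Rep a S s → j ∈ S → s.nreg 0 = j.val →
    Runs lim ((inst a).input query) remove s (c * T a S.card)
      (fun s' => Rep a (S.erase j) s' ∧ s.Keeps s')

variable {ι : Type} {removals : Prop} {inst : ι → Instance} {D : ι → ℕ} {T : ι → ℕ → ℕ}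
  {M : ι → ℕ}

/-- Fetch the customer at position `k` of the query. -/
def fetch (k : ℕ) : Program := block [.nconst 0 k, .ninput 0 0 0]

/-- The two-step prologue of every update: it moves the customer of the query to where a
`Maintenance` expects it and disturbs nothing that a representation may depend on. -/
theorem runs_fetch_then (a : Instance) (hn : a.n ≤ a.size) {lim : Limits} {c : ℕ} (hc : 2 ≤ c)
    (hw : c * (a.size + 2) ≤ lim.word) (j : Fin a.n) {p : Program} {s : State} {t u : ℕ}
    {Q : State → Prop}
    (h : ∀ s', s.Agree s' → s'.nreg 0 = j.val → Runs lim (a.input [j.val]) p s' t Q)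
    (hu : t + 2 ≤ u) : Runs lim (a.input [j.val]) (.seq (fetch 0) p) s u Q := by
  have hj := j.2
  have h2 : 2 * (a.size + 2) ≤ lim.word := (Nat.mul_le_mul_right _ hc).trans hw
  refine Runs.seq (T := 2) (P := fun s' => s.Agree s' ∧ s'.nreg 0 = j.val) (Runs.of_pre ?_ le_rfl)
    (fun s' hs' => h s' hs'.1 hs'.2) (by omega)
  simp [fetch, block, Program.Pre, Instr.Safe, Instr.next, Instance.input]
  refine ⟨by omega, ⟨rfl, rfl, rfl, fun r hr => ?_⟩⟩
  simp [show r ≠ 0 by omega]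

theorem Maintenance.incrementallyUpdatable (m : Maintenance removals inst D T M)
    (hn : ∀ a, (inst a).n ≤ (inst a).size) (hD : ∀ a, D a ≤ (inst a).size + 1)
    (hT : ∀ a (S : Finset (Fin (inst a).n)), 1 ≤ T a S.card) :
    IncrementallyUpdatable removals inst T M := by
  -- The constant grows by `2` for the two steps of `fetch`, which `1 ≤ T` absorbs.
  refine ⟨m.start, .seq (fetch 0) m.add, .seq (fetch 0) m.remove, m.c + 2, fun a => ⟨m.Rep a, ?_⟩⟩
  have hw := word_bound (inst a).size (m.c + 2)
  have hw' : m.c * ((inst a).size + 2) ≤ ((inst a).size + 2) ^ (m.c + 2) :=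
    (Nat.mul_le_mul_right _ (by omega)).trans hw
  have hm : m.c * M a ≤ (m.c + 2) * M a := Nat.mul_le_mul_right _ (by omega)
  have ht : ∀ S : Finset (Fin (inst a).n),
      m.c * T a S.card + 2 ≤ (m.c + 2) * T a S.card := fun S => by
    have := hT a S
    rw [add_mul]; omega
  refine ⟨fun s => ?_, fun S s hs => ⟨m.load a S s hs, fun j hj => ?_, fun hr j hj => ?_⟩⟩
  · obtain ⟨s', t, he, ht, h⟩ := m.start_runs a ⟨(m.c + 2) * M a, _⟩ [] s hm hw'
    exact ⟨s', t, he, h.1, ht.trans (Nat.mul_le_mul (by omega) (hD a))⟩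
  · obtain ⟨s', t, he, ht, h⟩ := runs_fetch_then (inst a) (hn a) (lim := ⟨(m.c + 2) * M a, _⟩)
      (by omega) hw j (s := s) (Q := m.Rep a (insert j S)) (fun s' hs' h0 =>
        (m.add_runs a ⟨(m.c + 2) * M a, _⟩ [j.val] S s' j hm hw' (m.agree a S _ _ hs' hs) hj h0).mono le_rfl fun _ h => h.1) (ht S)
    exact ⟨s', t, he, h, ht⟩
  · obtain ⟨s', t, he, ht, h⟩ := runs_fetch_then (inst a) (hn a) (lim := ⟨(m.c + 2) * M a, _⟩)
      (by omega) hw j (s := s) (Q := m.Rep a (S.erase j)) (fun s' hs' h0 =>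
        (m.remove_runs hr a ⟨(m.c + 2) * M a, _⟩ [j.val] S s' j hm hw' (m.agree a S _ _ hs' hs) hj h0).mono le_rfl fun _ h => h.1) (ht S)
    exact ⟨s', t, he, h, ht⟩

/-- Execute `p` for every customer of the query, in integer register `0`. -/
def forQuery (p : Program) : Program :=
  .seq (block [.nconst 1 0, .ninput 1 0 1, .nconst 2 1])
    (.loop (.nle 2 1) (.seq (block [.ninput 0 0 2]) (.seq p (block [.nconst 0 1, .nadd 2 2 0]))))

theorem length_le {n : ℕ} {R : List (Fin n)} (hR : R.Nodup) : R.length ≤ n := by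
  simpa using hR.length_le_card

/-- The loop keeps the length of the route in integer register `1` and its position in register `2`,
which is why the body has to respect `State.Keeps`. The position is one ahead of the index of the
customer because entry `0` of the query is the length. -/
theorem runs_forQuery (a : Instance) (hn : a.n ≤ a.size) {lim : Limits} {c : ℕ} (hc : 2 ≤ c)
    (hw : c * (a.size + 2) ≤ lim.word) {R : List (Fin a.n)} (hR : R.Nodup) {p : Program} {t : ℕ}
    (I : ℕ → State → Prop) (hI : ∀ i s s', s.Agree s' → I i s → I i s')
    (hp : ∀ i (hi : i < R.length) s, I i s → s.nreg 0 = (R[i] : ℕ) →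
      Runs lim (a.input (routeQuery R)) p s t (fun s' => I (i + 1) s' ∧ s.Keeps s'))
    {s : State} (hs : I 0 s) {u : ℕ} (hu : R.length * (t + 4) + 4 ≤ u) :
    Runs lim (a.input (routeQuery R)) (forQuery p) s u (I R.length) := by
  have hl := length_le hR
  have h2 : 2 * (a.size + 2) ≤ lim.word := (Nat.mul_le_mul_right _ hc).trans hw
  let J : ℕ → State → Prop := fun i s => I i s ∧ s.nreg 1 = R.length ∧ s.nreg 2 = i + 1
  refine Runs.seq (T := 3) (P := J 0) (Runs.of_pre ?_ le_rfl) (fun s' hs' =>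
    (Runs.counted (T := t + 3) (n := R.length) J (fun i s _ h => ?_) (fun i s hi h => ?_)
      (Nat.zero_le _) hs' (U := u - 3) ?_).mono le_rfl fun _ h => h.1) ?_
  · simp [block, Program.Pre, Instr.Safe, Instr.next, Instance.input, J]
    refine ⟨by simp [routeQuery]; omega, by omega, hI 0 s _ ⟨rfl, rfl, rfl, fun r hr => ?_⟩ hs,
      by simp [routeQuery]⟩
    simp [show r ≠ 2 by omega, show r ≠ 1 by omega]
  · simp [Test.Holds, h.2.1, h.2.2]
  · refine Runs.seq (T := 1) (U := t + 2)
      (P := fun s' => s.Agree s' ∧ s.Keeps s' ∧ s'.nreg 0 = (R[i] : ℕ))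
      (Runs.of_pre ?_ le_rfl) (fun s' hs' => Runs.seq (hp i hi s' (hI _ _ _ hs'.1 h.1) hs'.2.2)
        (U := 2) (fun s₂ h₂ => Runs.of_pre ?_ le_rfl) le_rfl) (by omega)
    · have := R[i].2
      simp [block, Program.Pre, Instr.Safe, Instr.next, Instance.input, h.2.2,
        State.Keeps, List.getElem?_cons, routeQuery, hi]
      refine ⟨by omega, ⟨rfl, rfl, rfl, fun r hr => ?_⟩⟩
      simp [show r ≠ 0 by omega]
    · have h1 : s₂.nreg 1 = R.length := by rw [h₂.2.1, hs'.2.1.1, h.2.1]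
      have h2 : s₂.nreg 2 = i + 1 := by rw [h₂.2.2, hs'.2.1.2, h.2.2]
      simp [block, Program.Pre, Instr.Safe, Instr.next, h1, h2, J]
      refine ⟨by omega, by omega, hI _ s₂ _ ⟨rfl, rfl, rfl, fun r hr => ?_⟩ h₂.1⟩
      simp [show r ≠ 0 by omega, show r ≠ 2 by omega]
  · rw [show t + 3 + 1 = t + 4 by rfl, Nat.sub_zero]; omega
  · omega

/-- Evaluate a route by adding its customers one after the other. -/
def evaluate (start add : Program) : Program :=
  .seq (block [.nconst 0 0, .ninput 1 0 0])
    (.branch (.nle 1 0) (block [.rcast 0 0]) (.seq start (forQuery add)))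

theorem isWorstCaseLoad_empty {n : ℕ} {Q : Set (Fin n → ℝ)} {v : ℝ} (h : IsWorstCaseLoad Q ∅ v) :
    IsWorstCaseLoad Q ∅ 0 := by
  obtain ⟨⟨q, hq, h0⟩, -⟩ := id h
  have : v = 0 := by rw [← h0]; simp
  exact this ▸ h

/-- Insertion one by one costs `D a` for the empty structure and at most `τ a` per customer. The
setup alone may exceed `U a 0`, hence `hDU` is only asked for `1 ≤ k`, and `evaluate` answers an
empty route with `0` without any setup. -/
theorem Maintenance.computableFromScratch (m : Maintenance removals inst D T M) {C : ℕ}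
    {U : ι → ℕ → ℕ} (hn : ∀ a, (inst a).n ≤ (inst a).size) (hM : ∀ a, M a ≤ (inst a).size + 2)
    (hU : ∀ a k, 1 ≤ U a k) {τ : ι → ℕ} (hT : ∀ a k, T a k ≤ τ a) (hτ : ∀ a, 1 ≤ τ a)
    (hDU : ∀ a k, 1 ≤ k → k ≤ (inst a).n → D a + k * τ a ≤ C * U a k) :
    ComputableFromScratch inst U := by
  refine ⟨evaluate m.start m.add, (m.c + 10) * (C + 1), fun a R hR s => ?_⟩
  set c := (m.c + 10) * (C + 1) with hc
  have hcm : m.c + 10 ≤ c := Nat.le_mul_of_pos_right _ (by omega)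
  have hw := word_bound (inst a).size c
  have hw' : m.c * ((inst a).size + 2) ≤ ((inst a).size + 2) ^ c :=
    (Nat.mul_le_mul_right _ (by omega)).trans hw
  have hm : m.c * M a ≤ ((inst a).size + 2) ^ c := (Nat.mul_le_mul_left _ (hM a)).trans hw'
  have hl := (length_le hR).trans (hn a)
  have h2 : 2 * ((inst a).size + 2) ≤ ((inst a).size + 2) ^ c :=
    (Nat.mul_le_mul_right _ (by omega)).trans hw
  suffices Runs ⟨((inst a).size + 2) ^ c, ((inst a).size + 2) ^ c⟩
      ((inst a).input (routeQuery R)) (evaluate m.start m.add) s (c * U a R.length)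
      (fun s' => IsWorstCaseLoad (inst a).Q R.toFinset s'.output) by
    obtain ⟨s', t, he, ht, h⟩ := this
    exact ⟨s', t, he, h, ht⟩
  have hU1 := hU a R.length
  have h10 : 10 * 1 ≤ c * U a R.length := Nat.mul_le_mul (by omega) hU1
  have hcU : (m.c + 10) * (C * U a R.length) + (m.c + 10) * U a R.length = c * U a R.length := by
    rw [hc]; ring
  refine Runs.seq (T := 2) (U := c * U a R.length - 2)
    (P := fun s' => s'.nreg 1 = R.length ∧ s'.nreg 0 = 0)
    (Runs.of_pre ?_ le_rfl) (fun s₁ hs₁ => ?_) (by omega)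
  · simp [block, Program.Pre, Instr.Safe, Instr.next, Instance.input, routeQuery]
    omega
  · refine Runs.branch (T := c * U a R.length - 3) (fun h => ?_) (fun h => ?_) ?_
    · have hR0 : R = [] := by
        rw [← List.length_eq_zero_iff]; simpa [Test.Holds, hs₁] using h
      -- This run is not executed: it only provides a state that represents `∅`, which shows that
      -- the maximum is attained, so that it equals `0`.
      obtain ⟨s', -, -, -, h', -⟩ := m.start_runs a ⟨_, _⟩ (routeQuery R) s₁ hm hw'
      refine Runs.of_pre ?_ (T := c * U a R.length - 3) (show 1 ≤ c * U a R.length - 3 by omega)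
      simp [block, Program.Pre, Instr.Safe, Instr.next, State.output, hs₁, hR0]
      exact isWorstCaseLoad_empty (m.load a ∅ _ h')
    · have hpos : 1 ≤ R.length := by simp only [Test.Holds, hs₁] at h; omega
      have hk := hDU a R.length hpos (length_le hR)
      have hτ1 := hτ a
      refine Runs.seq (m.start_runs a ⟨_, _⟩ (routeQuery R) s₁ hm hw')
        (U := R.length * (m.c * τ a + 4) + 4) (fun s₂ h₂ => ?_) ?_
      · refine (runs_forQuery (inst a) (hn a) (c := c) (by omega) hw hR (t := m.c * τ a)
          (fun i s => m.Rep a (R.take i).toFinset s) (fun i s s' hA => m.agree a _ s s' hA)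
          (fun i hi s hs hj => ?_) (by simpa using h₂.1) le_rfl).mono le_rfl fun s' hs' => ?_
        · have hnot : R[i] ∉ (R.take i).toFinset := by
            rw [List.mem_toFinset, List.mem_take_iff_getElem]
            rintro ⟨k, hk, h⟩
            have := (hR.getElem_inj_iff).1 h
            omega
          refine (m.add_runs a ⟨_, _⟩ (routeQuery R) _ s R[i] hm hw' hs hnot hj).mono
            (Nat.mul_le_mul_left _ (hT _ _)) fun s' hs' => ?_
          rw [List.take_succ_eq_append_getElem hi, List.toFinset_append]
          rw [show (R.take i).toFinset ∪ [R[i]].toFinset = insert R[i] (R.take i).toFinset by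
            ext; simp [or_comm]]
          exact hs'
        · exact m.load a _ _ (by simpa using hs')
      · have h1 : (m.c + 10) * (D a + R.length * τ a) ≤ (m.c + 10) * (C * U a R.length) :=
          Nat.mul_le_mul_left _ hk
        have h3 : R.length * 1 ≤ R.length * τ a := Nat.mul_le_mul_left _ hτ1
        have h4 : m.c * D a + (R.length * (m.c * τ a + 4) + 4) + 3 ≤ c * U a R.length := by
          nlinarith
        omega
    · omega

/-! ### Ellipsoids -/

/-- Positive semidefiniteness, tested on the indicator vector of `S`. It is needed for the safety of
`rsqrt`, on which the machine is stuck at negative arguments. -/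
theorem quadratic_nonneg {n : ℕ} {A : Matrix (Fin n) (Fin n) ℝ} (hA : A.PosSemidef)
    (S : Finset (Fin n)) : 0 ≤ ∑ i ∈ S, ∑ j ∈ S, A i j := by
  have h := hA.dotProduct_mulVec_nonneg (fun i => if i ∈ S then 1 else 0)
  simpa [dotProduct, Matrix.mulVec, Finset.sum_ite_mem] using h

/-- The variable part of the load is `v · ξ` with `v = Σ^{1/2} 1_S` and `|v|² = 1_Sᵀ Σ 1_S`.
Cauchy–Schwarz bounds it by `|v|`, which is attained at `v / |v|`, or at `0` if `v = 0`. -/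
theorem Ellipsoid.isWorstCaseLoad (a : Ellipsoid) (S : Finset (Fin a.n)) :
    IsWorstCaseLoad a.set S
      (∑ i ∈ S, a.q0 i + Real.sqrt (∑ i ∈ S, ∑ j ∈ S, a.Sigma i j)) := by
  let v : Fin a.n → ℝ := fun k => ∑ i ∈ S, a.root i k
  have hsymm : ∀ i k, a.root i k = a.root k i := fun i k => by
    have h : a.root.IsHermitian := (Matrix.nonneg_iff_posSemidef.1 (CFC.sqrt_nonneg a.Sigma)).isHermitian
    simpa using h.apply k i
  have hsq : a.root * a.root = a.Sigma :=
    CFC.sqrt_mul_sqrt_self a.Sigma a.posSemidef.nonneg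
  have hload : ∀ xi : Fin a.n → ℝ,
      ∑ i ∈ S, (a.q0 + a.root.mulVec xi) i = ∑ i ∈ S, a.q0 i + ∑ k, v k * xi k := fun xi => by
    simp only [Pi.add_apply, Finset.sum_add_distrib, Matrix.mulVec, dotProduct, v, Finset.sum_mul]
    rw [Finset.sum_comm]
  have hv : ∑ k, v k ^ 2 = ∑ i ∈ S, ∑ j ∈ S, a.Sigma i j := by
    simp only [v, sq, Finset.sum_mul_sum, ← hsq, Matrix.mul_apply]
    rw [Finset.sum_comm]
    refine Finset.sum_congr rfl fun i _ => ?_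
    rw [Finset.sum_comm]
    exact Finset.sum_congr rfl fun j _ => Finset.sum_congr rfl fun k _ => by rw [hsymm j k]
  rw [← hv]
  have hv0 : 0 ≤ ∑ k, v k ^ 2 := Finset.sum_nonneg fun k _ => sq_nonneg _
  constructor
  · rcases hv0.eq_or_lt with h | h
    · exact ⟨_, ⟨0, by simp, rfl⟩, by simp only [hload]; simp [← h]⟩
    · refine ⟨_, ⟨fun k => v k / Real.sqrt (∑ k, v k ^ 2), ?_, rfl⟩, ?_⟩
      · simp only [dotProduct, ← sq, div_pow, Real.sq_sqrt hv0, ← Finset.sum_div]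
        rw [div_self h.ne']
      · simp only [hload]
        congr 1
        simp only [← mul_div_assoc, ← Finset.sum_div, ← sq]
        exact Real.div_sqrt
  · rintro _ ⟨_, ⟨xi, hxi, rfl⟩, rfl⟩
    simp only [hload]
    have h := Real.sum_mul_le_sqrt_mul_sqrt Finset.univ v xi
    have h1 : Real.sqrt (∑ k, xi k ^ 2) ≤ 1 := by
      exact Real.sqrt_le_one.2 (by simpa [dotProduct, sq] using hxi)
    nlinarith [Real.sqrt_nonneg (∑ k, v k ^ 2)]

/-! ### Updates with a sign, and counting loops -/

/-- `S'` arises from `S` by adding (`σ = 1`) or removing (`σ = -1`) the customer `j`. -/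
structure Toggle {n : ℕ} (S S' : Finset (Fin n)) (j : Fin n) (σ : ℝ) : Prop where
  sum : ∀ f : Fin n → ℝ, ∑ i ∈ S', f i = ∑ i ∈ S, f i + σ * f j
  sq : σ * σ = 1

theorem Toggle.insert {n : ℕ} {S : Finset (Fin n)} {j : Fin n} (hj : j ∉ S) :
    Toggle S (insert j S) j 1 :=
  ⟨fun f => by rw [Finset.sum_insert hj]; ring, by norm_num⟩

theorem Toggle.erase {n : ℕ} {S : Finset (Fin n)} {j : Fin n} (hj : j ∈ S) :
    Toggle S (S.erase j) j (-1) :=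
  ⟨fun f => by rw [← Finset.add_sum_erase S f hj]; ring, by norm_num⟩

/-- Set real register `3` to `1`. -/
def plus : Program := block [.nconst 3 1, .rcast 3 3]

/-- Set real register `3` to `-1`. -/
def minus : Program := block [.nconst 3 0, .rcast 4 3, .nconst 3 1, .rcast 3 3, .rsub 3 4 3]

/-- The states agree on the memories, the real registers except `3` and `4`, and the integer
registers except `3`. -/
structure State.Signed (s s' : State) (σ : ℝ) : Prop where
  rreg : ∀ r, r ≠ 3 → r ≠ 4 → s'.rreg r = s.rreg r
  nmem : s'.nmem = s.nmem
  rmem : s'.rmem = s.rmem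
  nreg : ∀ r, r ≠ 3 → s'.nreg r = s.nreg r
  sign : s'.rreg 3 = σ

theorem runs_plus {lim : Limits} {inp : Input} (h : 1 ≤ lim.word) (s : State) :
    Runs lim inp plus s 5 (fun s' => s.Signed s' 1) := by
  refine Runs.of_pre ?_ (show 2 ≤ 5 by omega)
  simp [plus, block, Program.Pre, Instr.Safe, Instr.next, Function.update_apply, h]
  constructor <;> simp +contextual

theorem runs_minus {lim : Limits} {inp : Input} (h : 1 ≤ lim.word) (s : State) :
    Runs lim inp minus s 5 (fun s' => s.Signed s' (-1)) := by
  refine Runs.of_pre ?_ (show 5 ≤ 5 by omega)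
  simp [minus, block, Program.Pre, Instr.Safe, Instr.next, Function.update_apply, h]
  constructor <;> simp +contextual

/-- A maintenance scheme whose updates differ only in a sign. -/
def Maintenance.ofToggle {ι : Type} (inst : ι → Instance) (D : ι → ℕ) (T : ι → ℕ)
    (M : ι → ℕ) (start update : Program) (c : ℕ) (hT : ∀ a, 1 ≤ T a)
    (Rep : ∀ a, Finset (Fin (inst a).n) → State → Prop)
    (agree : ∀ a S s s', s.Agree s' → Rep a S s → Rep a S s')
    (signed : ∀ a S s s' σ, s.Signed s' σ → Rep a S s → Rep a S s')
    (load : ∀ a S s, Rep a S s → IsWorstCaseLoad (inst a).Q S s.output)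
    (start_runs : ∀ a lim query s, (c + 5) * M a ≤ lim.mem →
      (c + 5) * ((inst a).size + 2) ≤ lim.word → Runs lim ((inst a).input query) start s (c * D a)
        (fun s' => Rep a ∅ s' ∧ s.Keeps s'))
    (update_runs : ∀ a lim query S S' s j σ, (c + 5) * M a ≤ lim.mem →
      (c + 5) * ((inst a).size + 2) ≤ lim.word → Rep a S s → Toggle S S' j σ → s.nreg 0 = j.val →
      s.rreg 3 = σ →
      Runs lim ((inst a).input query) update s (c * T a) (fun s' => Rep a S' s' ∧ s.Keeps s')) :
    Maintenance True inst D (fun a _ => T a) M where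
  start := start
  add := .seq plus update
  remove := .seq minus update
  -- The additional `5` pays for setting the sign, which takes at most five steps.
  c := c + 5
  Rep := Rep
  agree := agree
  load := load
  start_runs := fun a lim query s hm hw =>
    (start_runs a lim query s hm hw).mono (Nat.mul_le_mul_right _ (by omega)) fun _ => id
  add_runs := fun a lim query S s j hm hw hs hj h0 =>
    (runs_plus (by nlinarith) s).seq (U := c * T a) (fun s' h => (update_runs a lim query S
      (insert j S) s' j 1 hm hw (signed a S s s' 1 h hs) (.insert hj) (by rw [h.nreg 0, h0]; simp)
      h.sign).mono le_rfl fun s₂ h₂ => ⟨h₂.1, by rw [h₂.2.1, h.nreg 1 (by simp)],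
        by rw [h₂.2.2, h.nreg 2 (by simp)]⟩) (by nlinarith [hT a])
  remove_runs := fun _ a lim query S s j hm hw hs hj h0 =>
    (runs_minus (by nlinarith) s).seq (U := c * T a) (fun s' h => (update_runs a lim query S
      (S.erase j) s' j (-1) hm hw (signed a S s s' (-1) h hs) (.erase hj)
      (by rw [h.nreg 0, h0]; simp)
      h.sign).mono le_rfl fun s₂ h₂ => ⟨h₂.1, by rw [h₂.2.1, h.nreg 1 (by simp)],
        by rw [h₂.2.2, h.nreg 2 (by simp)]⟩) (by nlinarith [hT a])

/-- Loop that counts integer register `4` down to `0`; register `3` contains `1`. -/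
def countdown (p : Program) : Program :=
  .loop (.nle 3 4) (.seq (block [.nsub 4 4 3]) p)

/-- The counter is decremented before the body runs, so the body sees the index `i` and extends an
invariant about the indices from `i + 1` on to those from `i` on. The decrement itself is harmless
by `hI`. -/
theorem runs_countdown {lim : Limits} {inp : Input} {p : Program} {t n : ℕ} (I : ℕ → State → Prop)
    (hI : ∀ i s v, I i s → I i (s.setN 4 v)) (hn : n ≤ lim.word)
    (hp : ∀ i s, i < n → I (i + 1) s → s.nreg 3 = 1 → s.nreg 4 = i →
      Runs lim inp p s t (fun s' => I i s' ∧ s'.nreg 3 = 1 ∧ s'.nreg 4 = i)) {s : State}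
    (hs : I n s) (h3 : s.nreg 3 = 1) (h4 : s.nreg 4 = n) {u : ℕ} (hu : n * (t + 2) + 1 ≤ u) :
    Runs lim inp (countdown p) s u (I 0) := by
  refine (Runs.counted (T := t + 1) (n := n) (i := 0)
    -- `Runs.counted` counts upwards, hence the reflected index.
    (fun k s => I (n - k) s ∧ s.nreg 3 = 1 ∧ s.nreg 4 = n - k)
    (fun i s hi h => ?_) (fun k s hk h => ?_) (Nat.zero_le _) (by simp [hs, h3, h4]) hu).mono le_rfl
    (by simp +contextual)
  · simp [Test.Holds, h.2.1, h.2.2]; omega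
  · refine Runs.seq (T := 1) (U := t)
      (P := fun s' => I (n - k) s' ∧ s'.nreg 3 = 1 ∧ s'.nreg 4 = n - (k + 1))
      (Runs.of_pre ?_ le_rfl) (fun s' hs' => hp _ s' (by omega) ?_ hs'.2.1 hs'.2.2) (by omega)
    · simp [block, Program.Pre, Instr.Safe, Instr.next, Function.update_apply, h.2.1, h.2.2]
      exact ⟨by omega, hI _ _ _ h.1, by omega⟩
    · rw [show n - (k + 1) + 1 = n - k by omega]
      exact hs'.1

@[simp] theorem array1_val {n : ℕ} (v : Fin n → ℝ) (i : Fin n) (k : ℕ) : array1 v i k = v i := by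
  simp [array1]

@[simp] theorem array2_val {m n : ℕ} (A : Fin m → Fin n → ℝ) (i : Fin m) (j : Fin n) :
    array2 A i j = A i j := by
  simp [array2]

@[simp] theorem array2_matrix {m n : ℕ} (A : Matrix (Fin m) (Fin n) ℝ) (i : Fin m) (j : Fin n) :
    array2 A i j = A i j :=
  array2_val A i j

/-- Set the cells below integer register `4` to real register `5`. -/
def fill : Program := countdown (block [.rstore 4 5])

theorem runs_fill {lim : Limits} {inp : Input} {n : ℕ} {s : State} (hn : n ≤ lim.word)
    (hm : n ≤ lim.mem) (h3 : s.nreg 3 = 1) (h4 : s.nreg 4 = n) {u : ℕ} (hu : n * 3 + 1 ≤ u) :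
    Runs lim inp fill s u (fun s' => s'.rreg = s.rreg ∧ s'.nmem = s.nmem ∧
      (∀ r, r ≠ 4 → s'.nreg r = s.nreg r) ∧ ∀ i < n, s'.rmem i = s.rreg 5) := by
  refine (runs_countdown (t := 1) (fun i s' => s'.rreg = s.rreg ∧ s'.nmem = s.nmem ∧
      (∀ r, r ≠ 4 → s'.nreg r = s.nreg r) ∧ ∀ k < n, i ≤ k → s'.rmem k = s.rreg 5)
    (fun i s' v h => ⟨h.1, h.2.1, fun r hr => by simp [hr, h.2.2.1 r hr], h.2.2.2⟩) hn
    (fun i s' hi h h3 h4 => Runs.of_pre ?_ le_rfl)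
    ⟨rfl, rfl, fun _ _ => rfl, fun k hk hk' => by omega⟩ h3 h4 hu).mono le_rfl
    fun s' h => ⟨h.1, h.2.1, h.2.2.1, fun i hi => h.2.2.2 i hi (Nat.zero_le _)⟩
  simp [block, Program.Pre, Instr.Safe, Instr.next, Function.update_apply, h3, h4]
  refine ⟨by omega, h.1, h.2.1, h.2.2.1, fun k hk hik => ?_⟩
  split_ifs with hki
  · rw [h.1]
  · exact h.2.2.2 k hk (by omega)

namespace Ellipsoid

/-- Contents of the machine when it holds the data structure for `S`. -/
structure Rep (a : Ellipsoid) (S : Finset (Fin a.n)) (s : State) : Prop where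
  nominal : s.rreg 1 = ∑ i ∈ S, a.q0 i
  variance : s.rreg 2 = ∑ i ∈ S, ∑ j ∈ S, a.Sigma i j
  out : s.rreg 0 = ∑ i ∈ S, a.q0 i + Real.sqrt (∑ i ∈ S, ∑ j ∈ S, a.Sigma i j)
  row : ∀ i : Fin a.n, s.rmem i = ∑ j ∈ S, a.Sigma j i

/-- Initialization. -/
def start : Program :=
  .seq (block [.nconst 3 0, .rcast 0 3, .rcast 1 3, .rcast 2 3, .rcast 5 3, .ninput 4 1 3,
    .nconst 3 1]) fill

/-- Addition or removal of the customer in integer register `0`, depending on real register `3`. -/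
def update : Program :=
  .seq (block [.nconst 3 0, .ninput 4 1 3, .nconst 3 1, .rinput 4 0 0 0, .rmul 4 4 3, .radd 1 1 4,
    .rload 4 0, .radd 4 4 4, .rmul 4 4 3, .radd 2 2 4, .rinput 4 1 0 0, .radd 2 2 4, .rsqrt 4 2,
    .radd 0 1 4])
    (countdown (block [.rinput 4 1 0 4, .rmul 4 4 3, .rload 5 4, .radd 5 5 4, .rstore 4 5]))

/-- Expansion of the double sum over `S ± j`: by symmetry the two cross terms coincide, and the
diagonal term carries `σ² = 1`. The row sum of `j` that enters is the one before the update, so the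
program reads it before it changes the rows. -/
theorem sum_toggle (a : Ellipsoid) {S S' : Finset (Fin a.n)} {j : Fin a.n} {σ : ℝ}
    (h : Toggle S S' j σ) : ∑ i ∈ S', ∑ k ∈ S', a.Sigma i k =
      ∑ i ∈ S, ∑ k ∈ S, a.Sigma i k + (∑ i ∈ S, a.Sigma i j + ∑ i ∈ S, a.Sigma i j) * σ
        + a.Sigma j j := by
  have hsymm : ∀ i k, a.Sigma i k = a.Sigma k i := fun i k => by
    simpa using a.posSemidef.isHermitian.apply k i
  simp only [h.sum, Finset.sum_add_distrib, ← Finset.mul_sum]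
  simp only [hsymm j]
  linear_combination a.Sigma j j * h.sq

theorem runs_start (a : Ellipsoid) {lim : Limits} {query : List ℕ} {s : State}
    (hm : 20 * (a.n + 1) ≤ lim.mem) (hw : 20 * (a.n + 2) ≤ lim.word) :
    Runs lim (a.toInstance.input query) start s (15 * (a.n + 1))
      (fun s' => a.Rep ∅ s' ∧ s.Keeps s') := by
  refine Runs.seq (T := 7) (U := a.n * 3 + 1) (P := fun s' => s'.rreg 0 = 0 ∧ s'.rreg 1 = 0 ∧
      s'.rreg 2 = 0 ∧ s'.rreg 5 = 0 ∧ s'.nreg 3 = 1 ∧ s'.nreg 4 = a.n ∧ s.Keeps s')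
    (Runs.of_pre ?_ le_rfl) (fun s₁ h₁ => (runs_fill (n := a.n) (by omega) (by omega)
      h₁.2.2.2.2.1 h₁.2.2.2.2.2.1 le_rfl).mono le_rfl fun s₂ h₂ => ?_) (by omega)
  · simp [block, Program.Pre, Instr.Safe, Instr.next, Function.update_apply, Instance.input, toInstance, State.Keeps]
    omega
  · obtain ⟨h0, h1, h2, h5, -, -, hk⟩ := h₁
    refine ⟨⟨by simp [h₂.1, h1], by simp [h₂.1, h2], by simp [h₂.1, h0],
      fun i => by simp [h₂.2.2.2 i i.2, h5]⟩, ?_, ?_⟩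
    · rw [h₂.2.2.1 _ (by omega), hk.1]
    · rw [h₂.2.2.1 _ (by omega), hk.2]

theorem runs_update (a : Ellipsoid) {lim : Limits} {query : List ℕ} {s : State}
    (hm : 20 * (a.n + 1) ≤ lim.mem) (hw : 20 * (a.n + 2) ≤ lim.word) {S S' : Finset (Fin a.n)}
    {j : Fin a.n} {σ : ℝ} (hs : a.Rep S s) (h : Toggle S S' j σ) (h0 : s.nreg 0 = j.val)
    (hσ : s.rreg 3 = σ) :
    Runs lim (a.toInstance.input query) update s (15 * (a.n + 1))
      (fun s' => a.Rep S' s' ∧ s.Keeps s') := by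
  have hj := j.2
  have hrow := hs.row j
  refine Runs.seq (T := 14) (U := a.n * 7 + 1) (P := fun s' => s'.rreg 1 = ∑ i ∈ S', a.q0 i ∧
      s'.rreg 2 = ∑ i ∈ S', ∑ j ∈ S', a.Sigma i j ∧
      s'.rreg 0 = ∑ i ∈ S', a.q0 i + Real.sqrt (∑ i ∈ S', ∑ j ∈ S', a.Sigma i j) ∧
      s'.rmem = s.rmem ∧ s'.nreg 0 = j.val ∧ s'.rreg 3 = σ ∧ s'.nreg 3 = 1 ∧ s'.nreg 4 = a.n ∧
      s.Keeps s')
    (Runs.of_pre ?_ le_rfl) (fun s₁ h₁ => ?_) (by omega)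
  · have hq := quadratic_nonneg a.posSemidef S'
    rw [a.sum_toggle h, h.sum]
    rw [a.sum_toggle h] at hq
    simp [block, Program.Pre, Instr.Safe, Instr.next, Function.update_apply, Instance.input, toInstance, State.Keeps, h0,
      hrow, hσ, hs.nominal, hs.variance, mul_comm σ]
    exact ⟨by omega, by omega, by omega, hq⟩
  · obtain ⟨h1, h2, h00, hmem, hj0, h3, hn3, hn4, hk⟩ := h₁
    -- The rows from `i` on already belong to `S'`, the others still to `S`.
    refine (runs_countdown (t := 5) (n := a.n) (fun i s' => s'.rreg 0 = s₁.rreg 0 ∧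
      s'.rreg 1 = s₁.rreg 1 ∧ s'.rreg 2 = s₁.rreg 2 ∧ s'.rreg 3 = s₁.rreg 3 ∧
      s'.nreg 0 = s₁.nreg 0 ∧ s₁.Keeps s' ∧
      ∀ k : Fin a.n, s'.rmem k = if i ≤ k then ∑ j ∈ S', a.Sigma j k else ∑ j ∈ S, a.Sigma j k)
      (fun i s v h => by simpa [State.Keeps] using h) (by omega)
      (fun i s₂ hi h₂ hn3 hn4 => Runs.of_pre ?_ le_rfl) ?_ hn3 hn4 le_rfl).mono le_rfl fun s' h' => ?_
    · obtain ⟨g0, g1, g2, g3, gn, gk, gm⟩ := h₂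
      have hi' := gm ⟨i, hi⟩
      have ha := array2_matrix a.Sigma j ⟨i, hi⟩
      simp only at hi' ha
      simp [block, Program.Pre, Instr.Safe, Instr.next, Function.update_apply, Instance.input, toInstance, State.Keeps,
        g0, g1, g2, g3, gn, gk.1, gk.2, hn3, hn4, hj0, h3]
      refine ⟨by omega, fun k => ?_⟩
      rcases eq_or_ne (k : ℕ) i with hki | hki
      · obtain rfl : k = ⟨i, hi⟩ := Fin.ext hki
        simp [hi', ha, h.sum, mul_comm σ]
      · rw [if_neg hki, gm k]
        by_cases hik : i + 1 ≤ k
        · rw [if_pos hik, if_pos (by omega)]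
        · rw [if_neg hik, if_neg (by omega)]
    · refine ⟨rfl, rfl, rfl, rfl, rfl, ⟨rfl, rfl⟩, fun k => ?_⟩
      rw [if_neg (by omega), hmem, hs.row]
    · obtain ⟨g0, g1, g2, g3, gn, gk, gm⟩ := h'
      exact ⟨⟨by rw [g1, h1], by rw [g2, h2], by rw [g0, h00], fun i => by simp [gm i]⟩,
        by rw [gk.1, hk.1], by rw [gk.2, hk.2]⟩

/-- The data structure for general ellipsoids. -/
noncomputable def maintenance : Maintenance True Ellipsoid.toInstance (fun a => a.n + 1)
    (fun a _ => a.n + 1) (fun a => a.n + 1) :=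
  .ofToggle _ _ (fun a => a.n + 1) _ start update 15 (fun _ => by omega) Rep
    (fun (a : Ellipsoid) S s s' h hs => ⟨by rw [h.rreg, hs.nominal], by rw [h.rreg, hs.variance],
      by rw [h.rreg, hs.out], fun i => by rw [h.rmem, hs.row]⟩)
    (fun (a : Ellipsoid) S s s' σ h hs => ⟨by rw [h.rreg _ (by simp) (by simp), hs.nominal],
      by rw [h.rreg _ (by simp) (by simp), hs.variance],
      by rw [h.rreg _ (by simp) (by simp), hs.out], fun i => by rw [h.rmem, hs.row]⟩)
    (fun (a : Ellipsoid) S s hs => by rw [State.output, hs.out]; exact a.isWorstCaseLoad S)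
    (fun (a : Ellipsoid) lim query s hm hw => a.runs_start hm hw)
    (fun (a : Ellipsoid) lim query S S' s j σ hm hw hs h h0 hσ => a.runs_update hm hw hs h h0 hσ)

theorem incrementallyUpdatable : IncrementallyUpdatable True Ellipsoid.toInstance
    (fun a _ => a.n + 1) (fun a => a.n + 1) :=
  maintenance.incrementallyUpdatable (fun _ => le_rfl) (fun _ => le_rfl) (fun _ _ => by simp)

theorem computableFromScratch :
    ComputableFromScratch Ellipsoid.toInstance (fun a k => k * a.n + 1) :=
  -- For `1 ≤ k ≤ n` both `n` and `k` are at most `k n`, so `(k + 1)(n + 1) ≤ 3 (k n + 1)`.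
  maintenance.computableFromScratch (C := 3) (τ := fun a => a.n + 1) (fun _ => le_rfl)
    (fun a => by simp [toInstance]) (fun _ _ => by omega) (fun _ _ => le_rfl) (fun _ => by omega)
    (fun a k hk hn => by
      have : k ≤ a.n := hn
      nlinarith)

end Ellipsoid

namespace AxisParallelEllipsoid

/-- Contents of the machine when it holds the data structure for `S`. -/
structure Rep (a : AxisParallelEllipsoid) (S : Finset (Fin a.n)) (s : State) : Prop where
  nominal : s.rreg 1 = ∑ i ∈ S, a.q0 i
  variance : s.rreg 2 = ∑ i ∈ S, a.Sigma i i
  out : s.rreg 0 = ∑ i ∈ S, a.q0 i + Real.sqrt (∑ i ∈ S, a.Sigma i i)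

/-- Initialization. -/
def start : Program := block [.nconst 3 0, .rcast 0 3, .rcast 1 3, .rcast 2 3]

/-- Addition or removal of the customer in integer register `0`, depending on real register `3`. -/
def update : Program :=
  block [.rinput 4 0 0 0, .rmul 4 4 3, .radd 1 1 4, .rinput 4 1 0 0, .rmul 4 4 3, .radd 2 2 4,
    .rsqrt 4 2, .radd 0 1 4]

theorem isWorstCaseLoad (a : AxisParallelEllipsoid) (S : Finset (Fin a.n)) :
    IsWorstCaseLoad a.set S (∑ i ∈ S, a.q0 i + Real.sqrt (∑ i ∈ S, a.Sigma i i)) := by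
  have h : ∑ i ∈ S, a.Sigma i i = ∑ i ∈ S, ∑ j ∈ S, a.Sigma i j :=
    Finset.sum_congr rfl fun i hi => (Finset.sum_eq_single_of_mem i hi
      fun j _ hj => a.isDiag hj.symm).symm
  rw [h]
  exact a.toEllipsoid.isWorstCaseLoad S

theorem runs_start (a : AxisParallelEllipsoid) {lim : Limits} {query : List ℕ} {s : State} :
    Runs lim (a.toInstance.input query) start s (8 * 1) (fun s' => a.Rep ∅ s' ∧ s.Keeps s') := by
  refine Runs.of_pre ?_ (show 4 ≤ 8 by omega)
  simp [start, block, Program.Pre, Instr.Safe, Instr.next, State.Keeps]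
  constructor <;> simp

theorem runs_update (a : AxisParallelEllipsoid) {lim : Limits} {query : List ℕ} {s : State}
    {S S' : Finset (Fin a.n)} {j : Fin a.n} {σ : ℝ} (hs : a.Rep S s) (h : Toggle S S' j σ)
    (h0 : s.nreg 0 = j.val) (hσ : s.rreg 3 = σ) :
    Runs lim (a.toInstance.input query) update s (8 * 1)
      (fun s' => a.Rep S' s' ∧ s.Keeps s') := by
  have hq : 0 ≤ ∑ i ∈ S', a.Sigma i i :=
    Finset.sum_nonneg fun i _ => by simpa using quadratic_nonneg a.posSemidef {i}
  refine Runs.of_pre ?_ le_rfl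
  simp [update, block, Program.Pre, Instr.Safe, Instr.next, Instance.input, toInstance, h0, hσ,
    State.Keeps, hs.nominal, hs.variance, mul_comm _ σ]
  simp only [h.sum] at hq
  exact ⟨hq, by simp [h.sum], by simp [h.sum], by simp [h.sum]⟩

/-- The data structure for axis-parallel ellipsoids. -/
noncomputable def maintenance : Maintenance True AxisParallelEllipsoid.toInstance (fun _ => 1)
    (fun _ _ => 1) (fun _ => 1) :=
  .ofToggle _ _ (fun _ => 1) _ start update 8 (fun _ => by omega) Rep
    (fun (a : AxisParallelEllipsoid) S s s' h hs => ⟨by rw [h.rreg, hs.nominal],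
      by rw [h.rreg, hs.variance], by rw [h.rreg, hs.out]⟩)
    (fun (a : AxisParallelEllipsoid) S s s' σ h hs =>
      ⟨by rw [h.rreg _ (by simp) (by simp), hs.nominal],
      by rw [h.rreg _ (by simp) (by simp), hs.variance],
      by rw [h.rreg _ (by simp) (by simp), hs.out]⟩)
    (fun (a : AxisParallelEllipsoid) S s hs => by
      rw [State.output, hs.out]; exact a.isWorstCaseLoad S)
    (fun (a : AxisParallelEllipsoid) _ _ _ _ _ => a.runs_start)
    (fun (a : AxisParallelEllipsoid) lim query S S' s j σ _ _ hs h h0 hσ =>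
      a.runs_update hs h h0 hσ)

theorem incrementallyUpdatable : IncrementallyUpdatable True AxisParallelEllipsoid.toInstance
    (fun _ _ => 1) (fun _ => 1) :=
  maintenance.incrementallyUpdatable (fun _ => le_rfl) (fun _ => by omega) (fun _ _ => le_rfl)

theorem computableFromScratch :
    ComputableFromScratch AxisParallelEllipsoid.toInstance (fun _ k => k + 1) :=
  maintenance.computableFromScratch (C := 1) (τ := fun _ => 1) (fun _ => le_rfl)
    (fun _ => by omega) (fun _ _ => by omega) (fun _ _ => le_rfl) (fun _ => le_rfl)
    (fun _ _ _ _ => by omega)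

end AxisParallelEllipsoid

/-! ### Discrete sets -/

namespace Discrete

/-- The maximum of the loads of `S` under the given demand vectors, and `0`. -/
noncomputable def maxLoad (a : Discrete) (S : Finset (Fin a.n)) (k : ℕ) : ℝ :=
  (Finset.univ.filter fun d : Fin a.D => k ≤ d).fold max 0 fun d => ∑ i ∈ S, a.q d i

/-- A half-space that contains the generators contains their hull. The initial value `0` of the
maximum does no harm because there is a demand vector and its load is nonnegative. -/
theorem isWorstCaseLoad (a : Discrete) (S : Finset (Fin a.n)) :
    IsWorstCaseLoad a.set S (a.maxLoad S 0) := by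
  have hle : ∀ d, ∑ i ∈ S, a.q d i ≤ a.maxLoad S 0 := fun d =>
    Finset.le_fold_max _ |>.2 (Or.inr ⟨d, by simp, le_rfl⟩)
  constructor
  · have h : a.maxLoad S 0 ≤ a.maxLoad S 0 := le_rfl
    have hex : ∃ d, a.maxLoad S 0 ≤ ∑ i ∈ S, a.q d i := by
      rcases (Finset.le_fold_max _).1 h with h | ⟨d, -, h⟩
      · exact ⟨⟨0, a.D_pos⟩, h.trans (Finset.sum_nonneg fun i _ => a.q_nonneg _ i)⟩
      · exact ⟨d, h⟩
    obtain ⟨d, hd⟩ := hex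
    exact ⟨a.q d, subset_convexHull ℝ _ ⟨d, rfl⟩, le_antisymm (hle d) hd⟩
  · rintro _ ⟨q, hq, rfl⟩
    have hconv : Convex ℝ {q : Fin a.n → ℝ | ∑ i ∈ S, q i ≤ a.maxLoad S 0} :=
      convex_halfSpace_le (f := fun q : Fin a.n → ℝ => ∑ i ∈ S, q i)
        ⟨fun x y => by simp [Finset.sum_add_distrib], fun c x => by simp [Finset.mul_sum]⟩ _
    exact convexHull_min (by rintro _ ⟨d, rfl⟩; exact hle d) hconv hq

/-- Contents of the machine when it holds the data structure for `S`. -/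
structure Rep (a : Discrete) (S : Finset (Fin a.n)) (s : State) : Prop where
  out : s.rreg 0 = a.maxLoad S 0
  load : ∀ d : Fin a.D, s.rmem d = ∑ i ∈ S, a.q d i

/-- Initialization. -/
def start : Program :=
  .seq (block [.nconst 3 0, .rcast 0 3, .rcast 5 3, .nconst 3 1, .ninput 4 1 3]) fill

/-- Addition or removal of the customer in integer register `0`, depending on real register `3`. -/
def update : Program :=
  .seq (block [.nconst 3 0, .rcast 0 3, .nconst 3 1, .ninput 4 1 3])
    (countdown (.seq (block [.rinput 4 0 4 0, .rmul 4 4 3, .rload 5 4, .radd 5 5 4, .rstore 4 5])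
      (.branch (.rle 5 0) .skip (.instr (.rmove 0 5)))))

/-- Maxima over the vectors from an index on are what a loop that runs from the last vector to the
first can accumulate. A removal may lower the maximum, so each update recomputes it in full. -/
theorem maxLoad_eq (a : Discrete) (S : Finset (Fin a.n)) (d : Fin a.D) :
    a.maxLoad S d = max (∑ i ∈ S, a.q d i) (a.maxLoad S (d + 1)) := by
  have h : (Finset.univ.filter fun e : Fin a.D => (d : ℕ) ≤ e) =
      insert d (Finset.univ.filter fun e : Fin a.D => (d : ℕ) + 1 ≤ e) := by
    ext e
    simp [Fin.ext_iff]
    omega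
  rw [maxLoad, h, Finset.fold_insert (by simp)]
  rfl

theorem maxLoad_top (a : Discrete) (S : Finset (Fin a.n)) : a.maxLoad S a.D = 0 := by
  rw [maxLoad, Finset.filter_false_of_mem (fun d _ => by have := d.2; omega)]
  rfl

theorem runs_start (a : Discrete) {lim : Limits} {query : List ℕ} {s : State}
    (hm : 20 * a.D ≤ lim.mem) (hw : 20 * (a.n + a.D + 2) ≤ lim.word) :
    Runs lim (a.toInstance.input query) start s (15 * a.D)
      (fun s' => a.Rep ∅ s' ∧ s.Keeps s') := by
  have hD := a.D_pos
  refine Runs.seq (T := 5) (U := a.D * 3 + 1) (P := fun s' => s'.rreg 0 = 0 ∧ s'.rreg 5 = 0 ∧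
      s'.nreg 3 = 1 ∧ s'.nreg 4 = a.D ∧ s.Keeps s')
    (Runs.of_pre ?_ le_rfl) (fun s₁ h₁ => (runs_fill (n := a.D) (by omega) (by omega)
      h₁.2.2.1 h₁.2.2.2.1 le_rfl).mono le_rfl fun s₂ h₂ => ?_) (by omega)
  · simp [block, Program.Pre, Instr.Safe, Instr.next, Instance.input, toInstance, State.Keeps]
    omega
  · obtain ⟨h0, h5, -, -, hk⟩ := h₁
    refine ⟨⟨?_, fun i => by simp [h₂.2.2.2 i i.2, h5]⟩, ?_, ?_⟩
    · rw [h₂.1, h0]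
      have := (a.isWorstCaseLoad ∅).1
      obtain ⟨q, -, h⟩ := this
      simpa using h
    · rw [h₂.2.2.1 _ (by omega), hk.1]
    · rw [h₂.2.2.1 _ (by omega), hk.2]

theorem runs_update (a : Discrete) {lim : Limits} {query : List ℕ} {s : State}
    (hm : 20 * a.D ≤ lim.mem) (hw : 20 * (a.n + a.D + 2) ≤ lim.word) {S S' : Finset (Fin a.n)}
    {j : Fin a.n} {σ : ℝ} (hs : a.Rep S s) (h : Toggle S S' j σ) (h0 : s.nreg 0 = j.val)
    (hσ : s.rreg 3 = σ) :
    Runs lim (a.toInstance.input query) update s (15 * a.D)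
      (fun s' => a.Rep S' s' ∧ s.Keeps s') := by
  have hD := a.D_pos
  refine Runs.seq (T := 4) (U := a.D * 9 + 1) (P := fun s' => s'.rreg 0 = 0 ∧
      s'.rmem = s.rmem ∧ s'.nreg 0 = j.val ∧ s'.rreg 3 = σ ∧ s'.nreg 3 = 1 ∧ s'.nreg 4 = a.D ∧
      s.Keeps s')
    (Runs.of_pre ?_ le_rfl) (fun s₁ h₁ => ?_) (by omega)
  · simp [block, Program.Pre, Instr.Safe, Instr.next, Instance.input, toInstance, State.Keeps, h0,
      hσ]
    omega
  · obtain ⟨h00, hmem, hj0, h3, hn3, hn4, hk⟩ := h₁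
    refine (runs_countdown (t := 7) (n := a.D) (fun i s' => s'.rreg 0 = a.maxLoad S' i ∧
      s'.rreg 3 = s₁.rreg 3 ∧ s'.nreg 0 = s₁.nreg 0 ∧ s₁.Keeps s' ∧
      ∀ k : Fin a.D, s'.rmem k = if i ≤ k then ∑ j ∈ S', a.q k j else ∑ j ∈ S, a.q k j)
      (fun i s v h => by simpa [State.Keeps] using h) (by omega)
      (fun i s₂ hi h₂ hn3 hn4 => Runs.of_pre ?_ le_rfl) ?_ hn3 hn4 le_rfl).mono le_rfl fun s' h' => ?_
    · obtain ⟨g0, g3, gn, gk, gm⟩ := h₂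
      have hi' := gm ⟨i, hi⟩
      have ha := array2_val a.q ⟨i, hi⟩ j
      have hq := a.maxLoad_eq S' ⟨i, hi⟩
      simp only at hi' ha hq
      have hval : ∑ j ∈ S, a.q ⟨i, hi⟩ j + a.q ⟨i, hi⟩ j * σ = ∑ j ∈ S', a.q ⟨i, hi⟩ j := by
        rw [h.sum]; ring
      rw [if_neg (by omega)] at hi'
      simp [block, Program.Pre, Instr.Safe, Instr.next, Instance.input, toInstance, State.Keeps,
        g0, g3, gn, gk.1, gk.2, hn3, hn4, hj0, h3, Test.Holds, hi', ha, hval,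
        Function.update_apply]
      have hrow : ∀ k : Fin a.D, (if (k : ℕ) = i then ∑ j ∈ S', a.q ⟨i, hi⟩ j else s₂.rmem k) =
          if i ≤ k then ∑ j ∈ S', a.q k j else ∑ j ∈ S, a.q k j := fun k => by
        rcases eq_or_ne (k : ℕ) i with hki | hki
        · obtain rfl : k = ⟨i, hi⟩ := Fin.ext hki
          simp
        · rw [if_neg hki, gm k]
          by_cases hik : i + 1 ≤ k
          · rw [if_pos hik, if_pos (by omega)]
          · rw [if_neg hik, if_neg (by omega)]
      exact ⟨by omega, fun hle => ⟨by rw [hq, max_eq_right hle], hrow⟩,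
        fun hlt => ⟨by rw [hq, max_eq_left hlt.le], hrow⟩⟩
    · refine ⟨by rw [h00, maxLoad_top], rfl, rfl, ⟨rfl, rfl⟩, fun k => ?_⟩
      rw [if_neg (by omega), hmem, hs.load]
    · obtain ⟨g0, g3, gn, gk, gm⟩ := h'
      exact ⟨⟨g0, fun i => by simp [gm i]⟩, by rw [gk.1, hk.1], by rw [gk.2, hk.2]⟩

/-- The data structure for discrete sets. -/
noncomputable def maintenance : Maintenance True Discrete.toInstance (fun a => a.D)
    (fun a _ => a.D) (fun a => a.D) :=
  .ofToggle _ _ (fun a => a.D) _ start update 15 (fun a => a.D_pos) Rep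
    (fun (a : Discrete) S s s' h hs => ⟨by rw [h.rreg, hs.out], fun d => by rw [h.rmem, hs.load]⟩)
    (fun (a : Discrete) S s s' σ h hs => ⟨by rw [h.rreg _ (by simp) (by simp), hs.out],
      fun d => by rw [h.rmem, hs.load]⟩)
    (fun (a : Discrete) S s hs => by rw [State.output, hs.out]; exact a.isWorstCaseLoad S)
    (fun (a : Discrete) lim query s hm hw => a.runs_start hm hw)
    (fun (a : Discrete) lim query S S' s j σ hm hw hs h h0 hσ => a.runs_update hm hw hs h h0 hσ)

theorem incrementallyUpdatable :
    IncrementallyUpdatable True Discrete.toInstance (fun a _ => a.D) (fun a => a.D) :=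
  maintenance.incrementallyUpdatable (fun a => by simp [toInstance])
    (fun a => by simp [toInstance]; omega) (fun a _ => a.D_pos)

theorem computableFromScratch :
    ComputableFromScratch Discrete.toInstance (fun a k => k * a.D + 1) :=
  maintenance.computableFromScratch (C := 3) (τ := fun a => a.D) (fun a => by simp [toInstance])
    (fun a => by simp [toInstance]; omega) (fun _ _ => by omega) (fun _ _ => le_rfl)
    (fun a => a.D_pos) (fun a k hk _ => by nlinarith)

end Discrete

/-! ### Budget sets -/

namespace Budget

theorem label_eq_succ (a : Budget) (i : Fin a.n) (l : Fin a.L) :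
    a.label i = l + 1 ↔ i ∈ a.B l := by
  rw [label]
  split_ifs with h
  · constructor
    · intro hl
      obtain rfl : h.choose = l := Fin.ext (by omega)
      exact h.choose_spec
    · intro hi
      by_contra hne
      exact Finset.disjoint_left.1 (a.disjoint h.choose l fun heq => hne (by rw [heq]))
        h.choose_spec hi
  · simpa using fun hi => h ⟨l, hi⟩

theorem label_le (a : Budget) (i : Fin a.n) : a.label i ≤ a.L := by
  rw [label]
  split_ifs with h
  · exact h.choose.2
  · omega

/-- Contribution of customer `i` to the load, apart from the deviations that share a budget. -/
noncomputable def base (a : Budget) (i : Fin a.n) : ℝ :=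
  if a.label i = 0 then a.upper i else a.lower i

/-- Maximal deviation of the customers of `S` with label `t`. -/
noncomputable def dev (a : Budget) (S : Finset (Fin a.n)) (t : ℕ) : ℝ :=
  ∑ i ∈ S, if a.label i = t then a.upper i - a.lower i else 0

/-- What the lower bounds leave of the budget with label `t`. -/
noncomputable def slack (a : Budget) (t : ℕ) : ℝ :=
  array1 a.b (t - 1) 0 - ∑ i, if a.label i = t then a.lower i else 0

/-- The worst-case load. -/
noncomputable def value (a : Budget) (S : Finset (Fin a.n)) : ℝ :=
  ∑ i ∈ S, a.base i + ∑ t ∈ Finset.range a.L, min (a.dev S (t + 1)) (a.slack (t + 1))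

theorem sum_B (a : Budget) (l : Fin a.L) (f : Fin a.n → ℝ) :
    ∑ i ∈ a.B l, f i = ∑ i, if a.label i = l + 1 then f i else 0 := by
  simp only [a.label_eq_succ, Finset.sum_ite_mem, Finset.univ_inter]

theorem slack_succ (a : Budget) (l : Fin a.L) : a.slack (l + 1) = a.b l - ∑ i ∈ a.B l, a.lower i := by
  simp [slack, sum_B]

/-- The labels partition the customers; label `0` collects those outside all budgets. -/
theorem sum_eq (a : Budget) (S : Finset (Fin a.n)) (f : Fin a.n → ℝ) :
    ∑ i ∈ S, f i = (∑ i ∈ S, if a.label i = 0 then f i else 0) +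
      ∑ t ∈ Finset.range a.L, ∑ i ∈ S, if a.label i = t + 1 then f i else 0 := by
  rw [add_comm, ← Finset.sum_range_succ' (fun t => ∑ i ∈ S, if a.label i = t then f i else 0),
    Finset.sum_comm]
  refine Finset.sum_congr rfl fun i _ => ?_
  rw [Finset.sum_ite_eq, if_pos (by have := a.label_le i; simp; omega)]

/-- The common fraction of their deviations, with total `x`, that the customers sharing a budget
with slack `y` can afford. -/
theorem exists_fraction {x y : ℝ} (hy : 0 ≤ y) :
    ∃ θ : ℝ, 0 ≤ θ ∧ θ ≤ 1 ∧ θ * x = min x y := by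
  rcases le_or_gt x y with h | h
  · exact ⟨1, by norm_num, le_rfl, by rw [min_eq_left h, one_mul]⟩
  · have hx' : 0 < x := hy.trans_lt h
    exact ⟨y / x, by positivity, (div_le_one hx').2 h.le, by
      rw [min_eq_right h.le, div_mul_cancel₀ _ hx'.ne']⟩

/-- Each budget can be treated on its own because the subsets are disjoint. Beyond their lower
bounds the visited customers of `B_l` gain at most their total deviation, and at most what the lower
bounds of all customers of `B_l`, visited or not, leave of the budget. The smaller of the two is
attained by scaling the deviations of the visited ones by a common factor and keeping the others at
their lower bounds. -/
theorem isWorstCaseLoad (a : Budget) (S : Finset (Fin a.n)) :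
    IsWorstCaseLoad a.set S (a.value S) := by
  have hdev : ∀ t, 0 ≤ a.dev S t := fun t => Finset.sum_nonneg fun i _ => by
    split_ifs
    · exact sub_nonneg.2 (a.lower_le_upper i)
    · exact le_rfl
  have hslack : ∀ l : Fin a.L, 0 ≤ a.slack (l + 1) := fun l => by
    rw [slack_succ]; exact sub_nonneg.2 (a.lower_le_b l)
  constructor
  -- A factor is chosen for every number, with the junk value `0` outside the labels `1, …, L`, so
  -- that `θ (a.label i)` makes sense without a proof.
  · have : ∀ t, ∃ θ : ℝ, 0 ≤ θ ∧ θ ≤ 1 ∧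
        (1 ≤ t → t ≤ a.L → θ * a.dev S t = min (a.dev S t) (a.slack t)) := fun t => by
      by_cases ht : 1 ≤ t ∧ t ≤ a.L
      · have := hslack ⟨t - 1, by omega⟩
        simp only [Nat.sub_add_cancel ht.1] at this
        obtain ⟨θ, h0, h1, h⟩ := exists_fraction this
        exact ⟨θ, h0, h1, fun _ _ => h⟩
      · exact ⟨0, le_rfl, zero_le_one, fun h h' => (ht ⟨h, h'⟩).elim⟩
    choose θ h0 h1 hθ using this
    let w : Fin a.n → ℝ := fun i => if i ∈ S then (if a.label i = 0 then 1 else θ (a.label i)) else 0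
    have hw : ∀ i, 0 ≤ w i ∧ w i ≤ 1 := fun i => by
      simp only [w]
      split_ifs
      · norm_num
      · exact ⟨h0 _, h1 _⟩
      · norm_num
    have hfib : ∀ t, 1 ≤ t → t ≤ a.L → (∑ i ∈ S, if a.label i = t
        then w i * (a.upper i - a.lower i) else 0) = min (a.dev S t) (a.slack t) := fun t ht ht' => by
      rw [← hθ t ht ht', dev, Finset.mul_sum]
      refine Finset.sum_congr rfl fun i hi => ?_
      by_cases hl : a.label i = t
      · simp [w, hi, hl, show t ≠ 0 by omega]
      · simp [hl]
    refine ⟨fun i => a.lower i + w i * (a.upper i - a.lower i), ⟨fun i => ?_, fun l => ?_⟩, ?_⟩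
    · have := a.lower_le_upper i
      have := hw i
      constructor <;> nlinarith
    · rw [Finset.sum_add_distrib, ← le_sub_iff_add_le', ← slack_succ, sum_B]
      refine le_trans (le_of_eq ?_) (min_le_right (a.dev S (l + 1)) _)
      rw [← hfib _ (by omega) l.2]
      symm
      refine Finset.sum_subset (Finset.subset_univ S) fun i _ hi => ?_
      simp [w, hi]
    · have hsum : ∑ i ∈ S, (a.lower i + w i * (a.upper i - a.lower i)) = ∑ i ∈ S, a.base i +
          ∑ i ∈ S, if a.label i = 0 then 0 else w i * (a.upper i - a.lower i) := by
        rw [← Finset.sum_add_distrib]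
        refine Finset.sum_congr rfl fun i hi => ?_
        by_cases hl : a.label i = 0
        · simp [w, hi, hl, base]
        · simp [hl, base]
      simp only [hsum, value]
      congr 1
      rw [a.sum_eq, Finset.sum_eq_zero (fun i _ => by split_ifs <;> rfl), zero_add]
      refine Finset.sum_congr rfl fun t ht => ?_
      rw [← hfib _ (by omega) (Finset.mem_range.1 ht)]
      refine Finset.sum_congr rfl fun i hi => ?_
      by_cases hl : a.label i = t + 1
      · simp [hl]
      · simp [hl]
  · rintro _ ⟨q, ⟨hq, hB⟩, rfl⟩
    have hsum : ∑ i ∈ S, q i = ∑ i ∈ S, a.base i + ∑ i ∈ S, (q i - a.base i) := by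
      rw [← Finset.sum_add_distrib]; simp
    simp only [hsum, value]
    rw [a.sum_eq S fun i => q i - a.base i]
    gcongr
    -- Customers without a budget already count with their upper bounds in `base`, so their
    -- difference to `q` is at most `0`.
    refine le_trans (add_le_of_nonpos_left ?_) (Finset.sum_le_sum fun t ht => le_min ?_ ?_)
    · refine Finset.sum_nonpos fun i _ => ?_
      split_ifs with hl
      · simpa [base, hl] using (hq i).2
      · exact le_rfl
    · refine Finset.sum_le_sum fun i _ => ?_
      split_ifs with hl
      · simpa [base, hl] using (hq i).2
      · exact le_rfl
    · have hl := a.slack_succ ⟨t, Finset.mem_range.1 ht⟩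
      have hb := hB ⟨t, Finset.mem_range.1 ht⟩
      simp only at hl
      rw [hl]
      -- The budget limits the sum over all of `B_l`; since `q` is at least `lower`, the customers
      -- outside `S` can be dropped.
      refine le_trans ?_ (sub_le_sub_right hb _)
      rw [← Finset.sum_sub_distrib, sum_B]
      refine le_trans (le_of_eq ?_) (Finset.sum_le_sum_of_subset_of_nonneg (Finset.subset_univ S)
        fun i _ _ => ?_)
      · refine Finset.sum_congr rfl fun i _ => ?_
        by_cases hl : a.label i = t + 1 <;> simp [hl, base]
      · split_ifs
        · exact sub_nonneg.2 (hq i).1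
        · exact le_rfl

theorem dev_toggle (a : Budget) {S S' : Finset (Fin a.n)} {j : Fin a.n} {σ : ℝ}
    (h : Toggle S S' j σ) (t : ℕ) : a.dev S' t =
      a.dev S t + if t = a.label j then (a.upper j - a.lower j) * σ else 0 := by
  rw [dev, h.sum, dev]
  simp only [eq_comm (a := t)]
  split_ifs <;> ring

theorem value_toggle_zero (a : Budget) {S S' : Finset (Fin a.n)} {j : Fin a.n} {σ : ℝ}
    (h : Toggle S S' j σ) (hj : a.label j = 0) : a.value S' = a.value S + a.upper j * σ := by
  rw [value, value, h.sum]
  simp only [a.dev_toggle h, hj, base, if_true, Nat.succ_ne_zero, if_false, add_zero]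
  ring

/-- Only the minimum that belongs to the label of `j` changes. The form, old minimum out and new
minimum in, is the order in which `update` works. -/
theorem value_toggle_pos (a : Budget) {S S' : Finset (Fin a.n)} {j : Fin a.n} {σ : ℝ}
    (h : Toggle S S' j σ) (hj : 1 ≤ a.label j) : a.value S' = a.value S + a.lower j * σ -
      min (a.dev S (a.label j)) (a.slack (a.label j)) +
      min (a.dev S (a.label j) + (a.upper j - a.lower j) * σ) (a.slack (a.label j)) := by
  have hL := a.label_le j
  have hmem : a.label j - 1 ∈ Finset.range a.L := by simp; omega
  rw [value, value, h.sum, ← Finset.add_sum_erase _ _ hmem, ← Finset.add_sum_erase _ _ hmem,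
    Nat.sub_add_cancel hj]
  have : ∀ t ∈ (Finset.range a.L).erase (a.label j - 1), min (a.dev S' (t + 1)) (a.slack (t + 1)) =
      min (a.dev S (t + 1)) (a.slack (t + 1)) := fun t ht => by
    rw [a.dev_toggle h, if_neg (by have := Finset.ne_of_mem_erase ht; omega), add_zero]
  rw [Finset.sum_congr rfl this, a.dev_toggle h, if_pos rfl, base, if_neg (by omega)]
  ring

/-- The part of the data structure for `S` that resides in the memory. -/
structure Tables (a : Budget) (S : Finset (Fin a.n)) (s : State) : Prop where
  slack : ∀ t, 1 ≤ t → t ≤ a.L → s.rmem t = a.slack t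
  dev : ∀ t, 1 ≤ t → t ≤ a.L → s.rmem (a.L + t) = a.dev S t

/-- Contents of the machine when it holds the data structure for `S`. -/
structure Rep (a : Budget) (S : Finset (Fin a.n)) (s : State) : Prop extends Tables a S s where
  out : s.rreg 0 = a.value S

/-- Initialization. -/
def start : Program :=
  .seq (block [.nconst 3 0, .rcast 0 3, .rcast 5 3, .nconst 3 1, .ninput 4 1 3, .nmove 5 4])
    (.seq (countdown (block [.rinput 4 2 4 4, .nadd 6 4 3, .rstore 6 4, .nadd 6 6 5, .rstore 6 5]))
      (.seq (block [.nconst 6 0, .ninput 4 1 6, .nconst 3 1])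
        (countdown (block [.ninput 6 2 4, .rload 4 6, .rinput 5 0 4 4, .rsub 4 4 5, .rstore 6 4]))))

/-- Addition or removal of the customer in integer register `0`, depending on real register `3`. -/
def update : Program :=
  .seq (block [.nconst 3 1, .ninput 5 2 0])
    (.branch (.nle 3 5)
      (.seq (block [.ninput 4 1 3, .nadd 4 4 5, .rload 4 5, .rload 5 4, .rinput 6 0 0 0,
        .rmul 7 6 3, .radd 0 0 7])
        (.seq (.branch (.rle 5 4) (.instr (.rsub 0 0 5)) (.instr (.rsub 0 0 4)))
          (.seq (block [.rinput 7 1 0 0, .rsub 7 7 6, .rmul 7 7 3, .radd 5 5 7, .rstore 4 5])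
            (.branch (.rle 5 4) (.instr (.radd 0 0 5)) (.instr (.radd 0 0 4))))))
      (block [.rinput 6 1 0 0, .rmul 6 6 3, .radd 0 0 6]))

/-- Real register `1` has to survive because `scratch` keeps the recorded load there while it
removes the route. -/
theorem runs_update (a : Budget) {lim : Limits} {query : List ℕ} {s : State}
    (hm : 3 * (a.L + 1) ≤ lim.mem) (hw : 3 * (a.n + a.L + 2) ≤ lim.word) {S S' : Finset (Fin a.n)}
    {j : Fin a.n} {σ : ℝ} (hs : a.Rep S s) (h : Toggle S S' j σ) (h0 : s.nreg 0 = j.val)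
    (hσ : s.rreg 3 = σ) :
    Runs lim (a.toInstance.input query) update s 20
      (fun s' => a.Rep S' s' ∧ s.Keeps s' ∧ s'.rreg 1 = s.rreg 1) := by
  have hj := j.2
  have hL := a.label_le j
  refine Runs.of_pre ?_ (show 19 ≤ 20 by omega)
  simp only [update, block, Program.Pre, Instr.Safe, Instr.next, Instance.input, toInstance,
    Test.Holds]
  simp [State.Keeps, h0, hσ]
  refine ⟨by omega, by omega, fun hl => ?_, fun hl => ?_⟩
  · have hv := a.value_toggle_pos h hl
    have hsl := hs.slack _ hl hL
    have hdv := hs.dev _ hl hL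
    have hd : ∀ t, 1 ≤ t → t ≤ a.L → (if a.L + t = a.L + a.label j then
        a.dev S (a.label j) + (a.upper j - a.lower j) * σ else s.rmem (a.L + t)) = a.dev S' t :=
      fun t h1 h2 => by
        rw [a.dev_toggle h]
        by_cases ht : t = a.label j
        · simp [ht]
        · rw [if_neg (by omega), if_neg ht, hs.dev t h1 h2, add_zero]
    have hc : ∀ t, 1 ≤ t → t ≤ a.L → (if t = a.L + a.label j then
        a.dev S (a.label j) + (a.upper j - a.lower j) * σ else s.rmem t) = a.slack t :=
      fun t h1 h2 => by rw [if_neg (by omega), hs.slack t h1 h2]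
    simp [hsl, hdv, hs.out]
    refine ⟨by omega, by omega, by omega, by omega, fun hle => ⟨by omega, fun hle' => ?_, fun hlt' => ?_⟩,
      fun hlt => ⟨by omega, fun hle' => ?_, fun hlt' => ?_⟩⟩
    all_goals
      refine ⟨⟨fun t h1 h2 => ?_, fun t h1 h2 => ?_⟩, ?_⟩
      · simpa [Function.update_apply] using hc t h1 h2
      · simpa [Function.update_apply] using hd t h1 h2
      · simp [hv, min_def]
        split_ifs <;> linarith
  · have hv := a.value_toggle_zero h hl
    refine ⟨⟨fun t h1 h2 => ?_, fun t h1 h2 => ?_⟩, ?_⟩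
    · simpa using hs.slack t h1 h2
    · rw [a.dev_toggle h, if_neg (by omega)]
      simpa using hs.dev t h1 h2
    · simp [hv, hs.out]

theorem runs_start (a : Budget) {lim : Limits} {query : List ℕ} {s : State}
    (hm : 3 * (a.L + 1) ≤ lim.mem) (hw : 3 * (a.n + a.L + 2) ≤ lim.word) :
    Runs lim (a.toInstance.input query) start s (20 * (a.n + a.L + 1))
      (fun s' => a.Rep ∅ s' ∧ s.Keeps s') := by
  refine Runs.seq (T := 6) (U := a.L * 7 + 1 + (3 + (a.n * 7 + 1))) (P := fun s' => s'.rreg 0 = 0 ∧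
      s'.rreg 5 = 0 ∧ s'.nreg 3 = 1 ∧ s'.nreg 4 = a.L ∧ s'.nreg 5 = a.L ∧ s.Keeps s')
    (Runs.of_pre ?_ le_rfl) (fun s₁ h₁ => ?_) (by omega)
  · simp [block, Program.Pre, Instr.Safe, Instr.next, Instance.input, toInstance, State.Keeps]
    omega
  obtain ⟨h0, h5, hn3, hn4, hn5, hk⟩ := h₁
  refine Runs.seq (U := 3 + (a.n * 7 + 1)) (runs_countdown (t := 5) (n := a.L) (fun i s' =>
    s'.rreg 0 = 0 ∧ s'.rreg 5 = 0 ∧ s'.nreg 5 = a.L ∧ s.Keeps s' ∧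
    ∀ t, i < t → t ≤ a.L → s'.rmem t = array1 a.b (t - 1) 0 ∧ s'.rmem (a.L + t) = 0)
    (fun i s v h => by simpa [State.Keeps] using h) (by omega)
    (fun i s₂ hi h₂ hn3 hn4 => Runs.of_pre ?_ le_rfl) ?_ hn3 hn4 le_rfl) (fun s₂ h₂ => ?_) le_rfl
  · obtain ⟨g0, g5, gn, gk, gm⟩ := h₂
    simp [block, Program.Pre, Instr.Safe, Instr.next, Instance.input, toInstance, State.Keeps,
      g0, g5, gn, gk.1, gk.2, hn3, hn4, Function.update_apply]
    refine ⟨by omega, by omega, by omega, by omega, fun t h1 h2 => ⟨?_, fun hne => ?_⟩⟩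
    · rw [if_neg (by omega)]
      split_ifs with ht
      · simp [ht, array1]
      · exact (gm t (by omega) h2).1
    · rw [if_neg (by omega)]
      exact (gm t (by omega) h2).2
  · exact ⟨h0, h5, hn5, hk, fun t h1 h2 => by omega⟩
  obtain ⟨g0, g5, gn, gk, gm⟩ := h₂
  refine Runs.seq (T := 3) (P := fun s' => s'.rreg 0 = 0 ∧ s'.nreg 3 = 1 ∧ s'.nreg 4 = a.n ∧
    s.Keeps s' ∧ s'.rmem = s₂.rmem) (Runs.of_pre ?_ le_rfl) (fun s₃ h₃ => ?_) le_rfl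
  · simp [block, Program.Pre, Instr.Safe, Instr.next, Instance.input, toInstance, State.Keeps, g0,
      gk.1, gk.2]
    omega
  obtain ⟨f0, fn3, fn4, fk, fm⟩ := h₃
  -- The slacks of all budgets are reduced in one pass over the customers, with the labels as
  -- addresses. Customers without a budget write to cell `0`, which `Tables` does not mention.
  refine (runs_countdown (t := 5) (n := a.n) (fun i s' =>
    s'.rreg 0 = 0 ∧ s.Keeps s' ∧ ∀ t, 1 ≤ t → t ≤ a.L →
      s'.rmem t = array1 a.b (t - 1) 0 - (∑ k with i ≤ k.val, if a.label k = t then a.lower k else 0)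
        ∧ s'.rmem (a.L + t) = 0)
    (fun i s v h => by simpa [State.Keeps] using h) (by omega)
    (fun i s₄ hi h₄ hn3 hn4 => Runs.of_pre ?_ le_rfl) ?_ fn3 fn4 le_rfl).mono le_rfl fun s' h' => ?_
  · obtain ⟨e0, ek, em⟩ := h₄
    have hL := a.label_le ⟨i, hi⟩
    have ha := array1_val a.lower ⟨i, hi⟩ i
    simp only at ha
    simp [block, Program.Pre, Instr.Safe, Instr.next, Instance.input, toInstance, State.Keeps,
      e0, ek.1, ek.2, hn3, hn4, Function.update_apply, hi, ha]
    refine ⟨by omega, by omega, fun t h1 h2 => ⟨?_, ?_⟩⟩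
    · have hset : (Finset.univ.filter fun k : Fin a.n => i ≤ k.val) =
          insert ⟨i, hi⟩ (Finset.univ.filter fun k : Fin a.n => i + 1 ≤ k.val) := by
        ext k
        simp [Fin.ext_iff]
        omega
      rw [hset, Finset.sum_insert (by simp)]
      have := (em t h1 h2).1
      by_cases ht : t = a.label ⟨i, hi⟩
      · rw [if_pos ht, if_pos ht.symm, ← ht, this]
        ring
      · rw [if_neg ht, if_neg (Ne.symm ht), this]
        ring
    · rw [if_neg (by omega)]
      exact (em t h1 h2).2
  · refine ⟨f0, fk, fun t h1 h2 => ?_⟩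
    rw [fm, Finset.filter_false_of_mem (fun k _ => by have := k.2; omega)]
    simpa using gm t h1 h2
  · obtain ⟨e0, ek, em⟩ := h'
    refine ⟨⟨⟨fun t h1 h2 => ?_, fun t h1 h2 => ?_⟩, ?_⟩, ek⟩
    · rw [(em t h1 h2).1]
      simp [slack]
    · rw [(em t h1 h2).2]
      simp [dev]
    · obtain ⟨q, -, hq⟩ := (a.isWorstCaseLoad ∅).1
      rw [e0]
      simpa using hq

/-- The data structure for budget sets. -/
noncomputable def maintenance : Maintenance True Budget.toInstance (fun a => a.n + a.L + 1)
    (fun _ _ => 1) (fun a => a.L + 1) :=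
  .ofToggle _ _ (fun _ => 1) _ start update 20 (fun _ => le_rfl) Rep
    (fun (a : Budget) S s s' h hs => ⟨⟨by rw [h.rmem]; exact hs.slack, by rw [h.rmem]; exact hs.dev⟩,
      by rw [h.rreg, hs.out]⟩)
    (fun (a : Budget) S s s' σ h hs => ⟨⟨by rw [h.rmem]; exact hs.slack,
      by rw [h.rmem]; exact hs.dev⟩, by rw [h.rreg _ (by simp) (by simp), hs.out]⟩)
    (fun (a : Budget) S s hs => by rw [State.output, hs.out]; exact a.isWorstCaseLoad S)
    (fun (a : Budget) lim query s hm hw => a.runs_start (le_trans (by omega) hm)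
      (le_trans (by simp [toInstance]) hw))
    (fun (a : Budget) lim query S S' s j σ hm hw hs h h0 hσ =>
      (a.runs_update (le_trans (by omega) hm) (le_trans (by simp [toInstance]) hw) hs h h0
        hσ).mono (by omega) fun _ h => ⟨h.1, h.2.1⟩)

theorem incrementallyUpdatable : IncrementallyUpdatable True Budget.toInstance
    (fun _ _ => 1) (fun a => a.L + 1) :=
  maintenance.incrementallyUpdatable (fun a => by simp [toInstance]) (fun _ => le_rfl)
    (fun _ _ => le_rfl)

/-- Evaluation of a route: its customers are added, the load is recorded, and the customers are
removed again. -/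
def scratch : Program :=
  .seq (block [.nconst 3 0, .rcast 0 3]) (.seq (forQuery (.seq plus update))
    (.seq (.instr (.rmove 1 0)) (.seq (forQuery (.seq minus update)) (.instr (.rmove 0 1)))))

/-- Removing the route again restores the preprocessed tables in time `O(|S|)`, whereas rebuilding
them would take time `O(n + L)`. Only `Tables ∅` is assumed, as the output register still holds the
load of the previous route and is reset first. -/
theorem runs_scratch (a : Budget) {lim : Limits} {s : State}
    (hm : 3 * (a.L + 1) ≤ lim.mem) (hw : 3 * (a.n + a.L + 2) ≤ lim.word) (hs : a.Tables ∅ s)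
    {R : List (Fin a.n)} (hR : R.Nodup) :
    Runs lim (a.toInstance.input (routeQuery R)) scratch s (100 * (R.length + 1))
      (fun s' => s'.rreg 0 = a.value R.toFinset ∧ a.Tables ∅ s') := by
  have hnot : ∀ i (hi : i < R.length), R[i] ∉ (R.take i).toFinset := fun i hi => by
    rw [List.mem_toFinset, List.mem_take_iff_getElem]
    rintro ⟨k, hk, h⟩
    have := (hR.getElem_inj_iff).1 h
    omega
  have htake : ∀ i (hi : i < R.length),
      Toggle (R.take i).toFinset (R.take (i + 1)).toFinset R[i] 1 := fun i hi => by
    rw [List.take_succ_eq_append_getElem hi, List.toFinset_append,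
      show (R.take i).toFinset ∪ [R[i]].toFinset = insert R[i] (R.take i).toFinset by
        ext; simp [or_comm]]
    exact .insert (hnot i hi)
  -- The second pass visits the route in the same order, so after `i` removals the customers from
  -- position `i` on are left.
  have hdrop : ∀ i (hi : i < R.length),
      Toggle (R.drop i).toFinset (R.drop (i + 1)).toFinset R[i] (-1) := fun i hi => by
    have hd : R.drop i = R[i] :: R.drop (i + 1) := List.drop_eq_getElem_cons hi
    have hnd : R[i] ∉ (R.drop (i + 1)).toFinset := by
      have := hR.sublist (List.drop_sublist i R)
      rw [hd, List.nodup_cons] at this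
      simpa using this.1
    have := Toggle.erase (S := (R.drop i).toFinset) (j := R[i]) (by rw [hd]; exact List.mem_toFinset.2 List.mem_cons_self)
    rwa [hd, List.toFinset_cons, Finset.erase_insert hnd, ← List.toFinset_cons, ← hd] at this
  have hw' : 3 * (a.toInstance.size + 2) ≤ lim.word := hw
  have hn : a.toInstance.n ≤ a.toInstance.size := by simp [toInstance]
  refine Runs.seq (T := 2) (P := fun s' => a.Rep ∅ s') (U := 80 * R.length + 20)
    (Runs.of_pre ?_ le_rfl) (fun s₁ h₁ => ?_) (by omega)
  · simp [block, Program.Pre, Instr.Safe, Instr.next]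
    refine ⟨⟨by simpa using hs.slack, by simpa using hs.dev⟩, ?_⟩
    obtain ⟨q, -, hq⟩ := (a.isWorstCaseLoad ∅).1
    simpa using hq
  refine Runs.seq (T := R.length * 29 + 4) (U := 40 * R.length + 10)
    (P := fun s' => a.Rep R.toFinset s')
    ((runs_forQuery a.toInstance hn (c := 3) (by omega) hw' hR (t := 25)
      (fun i s => a.Rep (R.take i).toFinset s)
      (fun i s s' h hs => ⟨⟨by rw [h.rmem]; exact hs.slack, by rw [h.rmem]; exact hs.dev⟩,
        by rw [h.rreg, hs.out]⟩) (fun i hi s hs hj => ?_) (by simpa using h₁) le_rfl).mono le_rfl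
          fun s' hs' => by
            have h : a.Rep (R.take R.length).toFinset s' := hs'
            simpa using h)
    (fun s₂ h₂ => ?_) (by omega)
  · refine (runs_plus (by omega) s).seq (U := 20) (fun s' h => (a.runs_update hm hw
      (j := (R[i] : Fin a.n)) (S' := (R.take (i + 1)).toFinset) ⟨⟨by rw [h.rmem]; exact hs.slack,
      by rw [h.rmem]; exact hs.dev⟩, by rw [h.rreg _ (by simp) (by simp), hs.out]⟩ ?_
      ((h.nreg 0 (by simp)).trans hj) h.sign).mono le_rfl fun s₂ h₂ => ⟨h₂.1,
        by rw [h₂.2.1.1, h.nreg 1 (by simp)], by rw [h₂.2.1.2, h.nreg 2 (by simp)]⟩) (by omega)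
    exact htake i hi
  refine Runs.seq (T := 1) (U := 40 * R.length + 9) (P := fun s' => a.Rep R.toFinset s' ∧
    s'.rreg 1 = a.value R.toFinset) (Runs.of_pre ?_ le_rfl) (fun s₃ h₃ => ?_) (by omega)
  · simp [Program.Pre, Instr.Safe, Instr.next, h₂.out]
    exact ⟨⟨by simpa using h₂.slack, by simpa using h₂.dev⟩, by simp [h₂.out]⟩
  refine Runs.seq (T := R.length * 29 + 4) (U := 1)
    (P := fun s' => a.Rep ∅ s' ∧ s'.rreg 1 = a.value R.toFinset)
    ((runs_forQuery a.toInstance hn (c := 3) (by omega) hw' hR (t := 25)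
      (fun i s => a.Rep (R.drop i).toFinset s ∧ s.rreg 1 = a.value R.toFinset)
      (fun i s s' h hs => ⟨⟨⟨by rw [h.rmem]; exact hs.1.slack, by rw [h.rmem]; exact hs.1.dev⟩,
        by rw [h.rreg, hs.1.out]⟩, by rw [h.rreg, hs.2]⟩) (fun i hi s hs hj => ?_)
        (by simpa using h₃) le_rfl).mono le_rfl fun s' hs' => by
          have h : a.Rep (R.drop R.length).toFinset s' ∧ s'.rreg 1 = a.value R.toFinset := hs'
          simpa using h)
    (fun s₄ h₄ => Runs.of_pre ?_ le_rfl) (by omega)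
  · obtain ⟨hs, hs1⟩ := hs
    refine (runs_minus (by omega) s).seq (U := 20) (fun s' h => (a.runs_update hm hw
      (j := (R[i] : Fin a.n)) (S' := (R.drop (i + 1)).toFinset) ⟨⟨by rw [h.rmem]; exact hs.slack,
      by rw [h.rmem]; exact hs.dev⟩, by rw [h.rreg _ (by simp) (by simp), hs.out]⟩ ?_
      ((h.nreg 0 (by simp)).trans hj) h.sign).mono le_rfl fun s₂ h₂ => ⟨⟨h₂.1,
        by rw [h₂.2.2, h.rreg _ (by simp) (by simp), hs1]⟩,
        by rw [h₂.2.1.1, h.nreg 1 (by simp)], by rw [h₂.2.1.2, h.nreg 2 (by simp)]⟩) (by omega)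
    exact hdrop i hi
  · simp [Program.Pre, Instr.Safe, Instr.next, h₄.2]
    exact ⟨by simpa using h₄.1.slack, by simpa using h₄.1.dev⟩

theorem computableAfterPreprocessing :
    ComputableAfterPreprocessing Budget.toInstance (fun _ k => k + 1) := by
  refine ⟨start, scratch, 100, fun a => ⟨a.Tables ∅, fun s => ?_, fun s hs R hR => ?_⟩⟩
  · have hw := word_bound a.toInstance.size 100
    have hsize : a.toInstance.size = a.n + a.L := rfl
    obtain ⟨s', t, he, ht, h⟩ := a.runs_start (query := []) (s := s)
      (lim := ⟨(a.toInstance.size + 2) ^ 100, (a.toInstance.size + 2) ^ 100⟩)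
      (le_trans (by omega) hw) (le_trans (by omega) hw)
    exact ⟨s', t, he, h.1.toTables, ht.trans (by rw [hsize]; omega)⟩
  · have hw := word_bound a.toInstance.size 100
    have hsize : a.toInstance.size = a.n + a.L := rfl
    obtain ⟨s', t, he, ht, h⟩ := a.runs_scratch (s := s)
      (lim := ⟨(a.toInstance.size + 2) ^ 100, (a.toInstance.size + 2) ^ 100⟩)
      (le_trans (by omega) hw) (le_trans (by omega) hw) hs hR
    exact ⟨s', t, he, by rw [State.output, h.1]; exact a.isWorstCaseLoad _, h.2, ht⟩

end Budget

/-! ### Selection in linear time -/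

section Selection

/-- The cells from `p` on contain the list. -/
def Seg (m : ℕ → ℝ) : ℕ → List ℝ → Prop
  | _, [] => True
  | p, v :: A => m p = v ∧ Seg m (p + 1) A

theorem Seg.congr {m m' : ℕ → ℝ} {p : ℕ} {A : List ℝ} (h : Seg m p A)
    (hm : ∀ i, p ≤ i → i < p + A.length → m' i = m i) : Seg m' p A := by
  induction A generalizing p with
  | nil => trivial
  | cons v A ih =>
    simp only [List.length_cons] at hm
    exact ⟨(hm p le_rfl (by omega)).trans h.1,
      ih h.2 fun i h1 h2 => hm i (by omega) (by omega)⟩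

/-- The median of three numbers. -/
noncomputable def med3 (a b c : ℝ) : ℝ := max (min a b) (min (max a b) c)

/-- The medians of the consecutive triples of a list. -/
noncomputable def med3s : List ℝ → List ℝ
  | a :: b :: c :: l => med3 a b c :: med3s l
  | _ => []

theorem length_med3s (A : List ℝ) : (med3s A).length = A.length / 3 := by
  induction A using med3s.induct with
  | case1 a b c l ih => simp only [med3s, List.length_cons, ih]; omega
  | case2 A h =>
    rcases A with _ | ⟨a, _ | ⟨b, _ | ⟨c, l⟩⟩⟩
    · simp [med3s]
    · simp [med3s]
    · simp [med3s]
    · exact (h a b c l rfl).elim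

open Classical in
/-- The number of elements of the list that satisfy `P`. -/
noncomputable def count (P : ℝ → Prop) (A : List ℝ) : ℕ := A.countP fun v => decide (P v)

open Classical in
/-- The elements of the list that satisfy `P`. -/
noncomputable def keep (P : ℝ → Prop) (A : List ℝ) : List ℝ := A.filter fun v => decide (P v)

open Classical in
theorem count_cons (P : ℝ → Prop) (v : ℝ) (A : List ℝ) :
    count P (v :: A) = count P A + if P v then 1 else 0 := by
  simp [count, List.countP_cons]

theorem count_nil (P : ℝ → Prop) : count P [] = 0 := rfl

open Classical in
theorem keep_cons (P : ℝ → Prop) (v : ℝ) (A : List ℝ) :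
    keep P (v :: A) = if P v then v :: keep P A else keep P A := by
  simp [keep, List.filter_cons]

theorem length_keep (P : ℝ → Prop) (A : List ℝ) : (keep P A).length = count P A := by
  simp [keep, count, List.countP_eq_length_filter]

theorem count_keep (P Q : ℝ → Prop) (A : List ℝ) :
    count P (keep Q A) = count (fun v => P v ∧ Q v) A := by
  simp only [keep, count, List.countP_filter]
  exact List.countP_congr fun v _ => by simp

theorem count_le_length (P : ℝ → Prop) (A : List ℝ) : count P A ≤ A.length :=
  List.countP_le_length

theorem count_mono {P Q : ℝ → Prop} (h : ∀ v, P v → Q v) (A : List ℝ) : count P A ≤ count Q A :=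
  List.countP_mono_left fun v _ => by simpa using h v

theorem count_le_add {P Q R : ℝ → Prop} (h : ∀ v, P v → Q v ∨ R v) (A : List ℝ) :
    count P A ≤ count Q A + count R A := by
  induction A with
  | nil => simp [count_nil]
  | cons v A ih =>
    have := h v
    simp only [count_cons]
    split_ifs <;> first | omega | tauto

theorem count_add_not (P : ℝ → Prop) (A : List ℝ) :
    count P A + count (fun v => ¬ P v) A = A.length := by
  induction A with
  | nil => rfl
  | cons v A ih =>
    simp only [count_cons, List.length_cons]
    split_ifs <;> omega

theorem exists_of_count_pos {P : ℝ → Prop} {A : List ℝ} (h : 0 < count P A) : ∃ v, P v := by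
  rw [count, List.countP_pos_iff] at h
  obtain ⟨v, -, hv⟩ := h
  exact ⟨v, by simpa using hv⟩

/-- For `P` of the form `x ≤ ·` or `· ≤ x`, a median with `P` passes it on to two of the three
elements of its triple. Leftover elements outside the triples only help. -/
theorem two_mul_count_med3s {P : ℝ → Prop} (hP : ∀ a b c, P (med3 a b c) →
    P a ∧ P b ∨ P a ∧ P c ∨ P b ∧ P c) (A : List ℝ) :
    2 * count P (med3s A) ≤ count P A := by
  induction A using med3s.induct with
  | case1 a b c l ih =>
    have := hP a b c
    simp only [med3s, count_cons]
    split_ifs <;> first | omega | tauto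
  | case2 A h =>
    rcases A with _ | ⟨a, _ | ⟨b, _ | ⟨c, l⟩⟩⟩
    · simp [med3s, count_nil]
    · simp [med3s, count_nil]
    · simp [med3s, count_nil]
    · exact (h a b c l rfl).elim

theorem le_med3 (x a b c : ℝ) (h : x ≤ med3 a b c) :
    x ≤ a ∧ x ≤ b ∨ x ≤ a ∧ x ≤ c ∨ x ≤ b ∧ x ≤ c := by
  simp only [med3, le_max_iff, le_min_iff] at h
  tauto

theorem med3_le (x a b c : ℝ) (h : med3 a b c ≤ x) :
    a ≤ x ∧ b ≤ x ∨ a ≤ x ∧ c ≤ x ∨ b ≤ x ∧ c ≤ x := by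
  simp only [med3, max_le_iff, min_le_iff] at h
  tauto

/-- `x` is a threshold that splits off `τ / 2` elements of the list. -/
def Splits (A : List ℝ) (τ x : ℝ) : Prop :=
  2 * (count (fun v => x < v) A : ℝ) ≤ τ ∧ τ ≤ 2 * (count (fun v => x ≤ v) A : ℝ)

/-- At most `k` elements of the list are on either side of `x`. -/
def Balanced (A : List ℝ) (k : ℕ) (x : ℝ) : Prop :=
  count (fun v => x < v) A ≤ k ∧ count (fun v => v < x) A ≤ k

theorem count_le_add_count_lt (A : List ℝ) (x : ℝ) :
    count (fun v => x ≤ v) A + count (fun v => v < x) A = A.length := by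
  simpa using count_add_not (fun v => x ≤ v) A

theorem count_lt_add_count_le (A : List ℝ) (x : ℝ) :
    count (fun v => x < v) A + count (fun v => v ≤ x) A = A.length := by
  simpa using count_add_not (fun v => x < v) A

/-- The pivot of short lists: any element leaves at least itself on neither side. -/
theorem balanced_head (v : ℝ) (A : List ℝ) : Balanced (v :: A) A.length v := by
  constructor
  · rw [count_cons, if_neg (lt_irrefl v)]; exact count_le_length _ _
  · rw [count_cons, if_neg (lt_irrefl v)]; exact count_le_length _ _

/-- Let `m = ⌊n/9⌋` be the number of medians of medians. At least `m/2` of them are at least `x`,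
and each accounts for four such elements of `A` by two applications of `two_mul_count_med3s`; hence
at least `2m` elements of `A` are at least `x`. By symmetry as many are at most `x`. -/
theorem balanced_of_splits_medians {A : List ℝ} {x : ℝ}
    (h : Splits (med3s (med3s A)) (A.length / 9 : ℕ) x) :
    Balanced A (A.length - 2 * (A.length / 9)) x := by
  have hlen : (med3s (med3s A)).length = A.length / 9 := by
    rw [length_med3s, length_med3s, Nat.div_div_eq_div_mul]
  obtain ⟨h1, h2⟩ := h
  have h1' : 2 * count (fun v => x < v) (med3s (med3s A)) ≤ A.length / 9 := by exact_mod_cast h1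
  have h2' : A.length / 9 ≤ 2 * count (fun v => x ≤ v) (med3s (med3s A)) := by exact_mod_cast h2
  have e1 := count_lt_add_count_le (med3s (med3s A)) x
  have e2 := count_le_add_count_lt A x
  have e3 := count_lt_add_count_le A x
  have f1 := two_mul_count_med3s (P := fun v => x ≤ v) (le_med3 x) A
  have f2 := two_mul_count_med3s (P := fun v => x ≤ v) (le_med3 x) (med3s A)
  have f3 := two_mul_count_med3s (P := fun v => v ≤ x) (med3_le x) A
  have f4 := two_mul_count_med3s (P := fun v => v ≤ x) (med3_le x) (med3s A)
  constructor <;> omega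

/-- Discarding the elements up to `x` changes no count above a threshold `y ≥ x`. A threshold `y <
x` is impossible: all kept elements would exceed it, which is too many for `τ`. -/
theorem splits_of_keep_gt {A : List ℝ} {τ x y : ℝ} (hτ : τ < 2 * (count (fun v => x < v) A : ℝ))
    (h : Splits (keep (fun v => x < v) A) τ y) : Splits A τ y := by
  obtain ⟨h1, h2⟩ := h
  rw [count_keep] at h1 h2
  have hxy : x ≤ y := by
    by_contra hlt
    rw [not_le] at hlt
    have : count (fun v => x < v) A ≤ count (fun v => y < v ∧ x < v) A :=
      count_mono (fun v hv => ⟨hlt.trans hv, hv⟩) A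
    have : (count (fun v => x < v) A : ℝ) ≤ count (fun v => y < v ∧ x < v) A := by exact_mod_cast this
    linarith
  constructor
  · have : count (fun v => y < v) A ≤ count (fun v => y < v ∧ x < v) A :=
      count_mono (fun v hv => ⟨hv, hxy.trans_lt hv⟩) A
    have : (count (fun v => y < v) A : ℝ) ≤ count (fun v => y < v ∧ x < v) A := by exact_mod_cast this
    linarith
  · have : count (fun v => y ≤ v ∧ x < v) A ≤ count (fun v => y ≤ v) A :=
      count_mono (fun v hv => hv.1) A
    have : (count (fun v => y ≤ v ∧ x < v) A : ℝ) ≤ count (fun v => y ≤ v) A := by exact_mod_cast this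
    linarith

/-- The discarded elements are at least `x` and lie above the threshold, so their number, doubled as
in `Splits`, is deducted from the target. Since the remaining target is positive, some kept element
is at least `y`, which gives `y < x`. -/
theorem splits_of_keep_lt {A : List ℝ} {τ x y : ℝ} (hτ : 2 * (count (fun v => x ≤ v) A : ℝ) < τ)
    (h : Splits (keep (fun v => v < x) A) (τ - 2 * (count (fun v => x ≤ v) A : ℝ)) y) :
    Splits A τ y := by
  obtain ⟨h1, h2⟩ := h
  rw [count_keep] at h1 h2
  constructor
  · have : count (fun v => y < v) A ≤ count (fun v => x ≤ v) A + count (fun v => y < v ∧ v < x) A :=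
      count_le_add (fun v hv => (le_or_gt x v).imp id fun h => ⟨hv, h⟩) A
    have : (count (fun v => y < v) A : ℝ) ≤
      count (fun v => x ≤ v) A + count (fun v => y < v ∧ v < x) A := by exact_mod_cast this
    linarith
  · have hpos : 0 < count (fun v => y ≤ v ∧ v < x) A := by
      have : (0 : ℝ) < count (fun v => y ≤ v ∧ v < x) A := by linarith
      exact_mod_cast this
    obtain ⟨v, hyv, hvx⟩ := exists_of_count_pos hpos
    -- Elements that are at least `x` are also at least `y`, and they are disjoint from those below
    -- `x`.
    have hsum : count (fun v => x ≤ v) A + count (fun v => y ≤ v ∧ v < x) A ≤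
        count (fun v => y ≤ v) A := by
      clear h1 h2 hτ hpos
      induction A with
      | nil => rfl
      | cons w A ih =>
        simp only [count_cons]
        have : x ≤ w → y ≤ w := fun h => (hyv.trans_lt hvx).le.trans h
        split_ifs <;> first | omega | (exfalso; grind)
    have : (count (fun v => x ≤ v) A + count (fun v => y ≤ v ∧ v < x) A : ℝ) ≤
      count (fun v => y ≤ v) A := by exact_mod_cast hsum
    linarith

end Selection

/-! ### Loops that filter a segment and form medians of triples -/

section SelectionPrograms

variable {lim : Limits} {inp : Input}

/-- The states agree except for the integer registers `14` to `16`, the real registers from `12` on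
and the real memory. -/
structure State.LoopFrame (s s' : State) : Prop where
  nmem : s'.nmem = s.nmem
  nreg : ∀ r, r ≠ 14 → r ≠ 15 → r ≠ 16 → s'.nreg r = s.nreg r
  rreg : ∀ r, r < 12 → s'.rreg r = s.rreg r

theorem State.LoopFrame.trans {s₁ s₂ s₃ : State} (h : s₁.LoopFrame s₂) (h' : s₂.LoopFrame s₃) :
    s₁.LoopFrame s₃ :=
  ⟨h'.nmem.trans h.nmem, fun r h1 h2 h3 => (h'.nreg r h1 h2 h3).trans (h.nreg r h1 h2 h3),
    fun r hr => (h'.rreg r hr).trans (h.rreg r hr)⟩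

/-- Copies the elements for which `b` fails from cell `N14` on (`N15` elements) to `N16`. -/
def filterLoop (b : Test) : Program :=
  .loop (.nle 18 15) (.seq (block [.rload 12 14, .nadd 14 14 18, .nsub 15 15 18])
    (.branch b .skip (block [.rstore 16 12, .nadd 16 16 18])))

/-- By `hd` the output either starts at or below the input, where writing never overtakes reading,
or lies behind it. The first case prunes in place, the second one counts without destroying the
list. -/
theorem runs_filterLoop {b : Test} {P : ℝ → ℝ → Prop}
    (hb : ∀ s : State, b.Holds s ↔ ¬ P (s.rreg 10) (s.rreg 12)) {K : ℕ} (hm : K ≤ lim.mem)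
    (hw : K ≤ lim.word) {A : List ℝ} {s : State} (hseg : Seg s.rmem (s.nreg 14) A)
    (h15 : s.nreg 15 = A.length) (h18 : s.nreg 18 = 1)
    (hd : s.nreg 16 ≤ s.nreg 14 ∨ s.nreg 14 + A.length ≤ s.nreg 16)
    (hp : s.nreg 14 + A.length ≤ K) (hq : s.nreg 16 + A.length ≤ K) :
    Runs lim inp (filterLoop b) s (7 * A.length + 1) (fun s' => s.LoopFrame s' ∧
      s'.nreg 16 = s.nreg 16 + count (P (s.rreg 10)) A ∧
      Seg s'.rmem (s.nreg 16) (keep (P (s.rreg 10)) A) ∧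
      ∀ i, i < s.nreg 16 ∨ s.nreg 16 + A.length ≤ i → s'.rmem i = s.rmem i) := by
  induction A generalizing s with
  | nil =>
    refine Runs.loop_done (by simp [Test.Holds, h15, h18]) ⟨⟨rfl, fun _ _ _ _ => rfl, fun _ _ => rfl⟩,
      by simp [count_nil], trivial, fun _ _ => rfl⟩ (by omega)
  | cons v A ih =>
    obtain ⟨hv, hA⟩ := hseg
    simp only [List.length_cons] at *
    refine Runs.loop_step (T := 6) (U := 7 * A.length + 1) (P := fun s' => s.LoopFrame s' ∧
      s'.nreg 14 = s.nreg 14 + 1 ∧ s'.nreg 15 = A.length ∧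
      s'.nreg 16 = s.nreg 16 + count (P (s.rreg 10)) [v] ∧
      (P (s.rreg 10) v → s'.rmem (s.nreg 16) = v) ∧
      ∀ i, i ≠ s.nreg 16 → s'.rmem i = s.rmem i)
      (by simp only [Test.Holds, h15, h18]; omega) (Runs.of_pre ?_ (by simp [block, Program.cost]))
      (fun s' h => ?_) (by omega)
    · simp [block, Program.Pre, Instr.Safe, Instr.next, Function.update_apply, h15, h18, hb, hv,
        count_cons, count_nil]
      refine ⟨by omega, by omega, by omega, fun hP => ⟨⟨?_, ?_, ?_⟩, ?_⟩,
        fun hP => ⟨by omega, by omega, ⟨?_, ?_, ?_⟩, ?_⟩⟩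
      · rfl
      · intro r h1 h2 h3; simp [h1, h2, h3]
      · intro r hr; simp [show r ≠ 12 by omega]
      · simp [hP]
      · rfl
      · intro r h1 h2 h3; simp [h1, h2, h3]
      · intro r hr; simp [show r ≠ 12 by omega]
      · simp +contextual [hP]
    · obtain ⟨hf, h14', h15', h16', hst, hmem⟩ := h
      have hc : count (P (s.rreg 10)) [v] ≤ 1 := by
        simpa using count_le_length (P (s.rreg 10)) [v]
      have hx : s'.rreg 10 = s.rreg 10 := hf.rreg 10 (by omega)
      have hseg' : Seg s'.rmem (s'.nreg 14) A := by
        rw [h14']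
        exact hA.congr fun i h1 h2 => hmem i (by omega)
      refine (ih hseg' h15'
        (by rw [hf.nreg 18 (by omega) (by omega) (by omega), h18]) (by omega) (by omega)
        (by omega)).mono le_rfl fun s₂ h₂ => ?_
      · obtain ⟨gf, g16, gs, gm⟩ := h₂
        rw [hx] at g16 gs
        refine ⟨hf.trans gf, ?_, ?_, fun i hi => ?_⟩
        · rw [g16, h16']
          simp only [count_cons, count_nil]
          omega
        · rw [keep_cons]
          split_ifs with hP
          · have h1 : s'.nreg 16 = s.nreg 16 + 1 := by simpa [count_cons, count_nil, hP] using h16'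
            rw [h1] at gs
            exact ⟨by rw [gm _ (by omega), hst hP], gs⟩
          · have h1 : s'.nreg 16 = s.nreg 16 := by simpa [count_cons, count_nil, hP] using h16'
            rwa [h1] at gs
        · rw [gm i (by omega), hmem i (by omega)]

/-- Replaces real register `12` by the median of the real registers `12`, `13` and `14`. -/
def median3 : Program :=
  .seq (.branch (.rle 12 13) .skip (block [.rmove 15 12, .rmove 12 13, .rmove 13 15]))
    (.branch (.rle 13 14) (.instr (.rmove 12 13)) (.branch (.rle 12 14) (.instr (.rmove 12 14)) .skip))

theorem runs_median3 (s : State) : Runs lim inp median3 s 7 (fun s' => s'.nmem = s.nmem ∧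
    s'.rmem = s.rmem ∧ s'.nreg = s.nreg ∧ (∀ r, r < 12 → s'.rreg r = s.rreg r) ∧
    s'.rreg 12 = med3 (s.rreg 12) (s.rreg 13) (s.rreg 14)) := by
  refine Runs.of_pre ?_ (by simp [median3, block, Program.cost])
  simp [median3, block, Program.Pre, Instr.Safe, Instr.next, Test.Holds]
  have key : ∀ a b c : ℝ, a ≤ b → (b ≤ c → b = med3 a b c) ∧ (c < b → (a ≤ c → c = med3 a b c) ∧
      (c < a → a = med3 a b c)) := fun a b c hab => by
    simp only [med3, min_eq_left hab, max_eq_right hab]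
    refine ⟨fun h => ?_, fun h => ⟨fun h' => ?_, fun h' => ?_⟩⟩
    · rw [min_eq_left h, max_eq_right hab]
    · rw [min_eq_right h.le, max_eq_right h']
    · rw [min_eq_right h.le, max_eq_left h'.le]
  have hcomm : ∀ a b c : ℝ, med3 a b c = med3 b a c := fun a b c => by
    rw [med3, med3, min_comm a, max_comm a]
  constructor
  · intro hab
    obtain ⟨k1, k2⟩ := key _ _ (s.rreg 14) hab
    refine ⟨fun h => ⟨fun r hr => by simp [show r ≠ 12 by omega], k1 h⟩, fun h => ⟨fun h' =>
      ⟨fun r hr => by simp [show r ≠ 12 by omega], (k2 h).1 h'⟩, fun h' => (k2 h).2 h'⟩⟩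
  · intro hab
    obtain ⟨k1, k2⟩ := key _ _ (s.rreg 14) hab.le
    rw [hcomm]
    refine ⟨fun h => ⟨fun r hr => ?_, k1 h⟩, fun h => ⟨fun h' => ⟨fun r hr => ?_, (k2 h).1 h'⟩,
      fun h' => ⟨fun r hr => ?_, (k2 h).2 h'⟩⟩⟩ <;>
    simp [show r ≠ 12 by omega, show r ≠ 13 by omega, show r ≠ 15 by omega]

/-- Writes the medians of the triples of the `N15` elements from cell `N14` on to `N16`. -/
def medianLoop : Program :=
  .loop (.nle 19 15) (.seq (block [.rload 12 14, .nadd 14 14 18, .rload 13 14, .nadd 14 14 18,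
    .rload 14 14, .nadd 14 14 18, .nsub 15 15 19])
    (.seq median3 (block [.rstore 16 12, .nadd 16 16 18])))

/-- Also correct in place, because three elements are read for every median written. The `17` steps
per triple fit into `6` per element. -/
theorem runs_medianLoop {K : ℕ} (hm : K ≤ lim.mem) (hw : K ≤ lim.word) {A : List ℝ} {s : State}
    (hseg : Seg s.rmem (s.nreg 14) A) (h15 : s.nreg 15 = A.length) (h18 : s.nreg 18 = 1)
    (h19 : s.nreg 19 = 3) (hd : s.nreg 16 ≤ s.nreg 14 ∨ s.nreg 14 + A.length ≤ s.nreg 16)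
    (hp : s.nreg 14 + A.length ≤ K) (hq : s.nreg 16 + A.length / 3 ≤ K) :
    Runs lim inp medianLoop s (6 * A.length + 1) (fun s' => s.LoopFrame s' ∧
      s'.nreg 16 = s.nreg 16 + A.length / 3 ∧ Seg s'.rmem (s.nreg 16) (med3s A) ∧
      ∀ i, i < s.nreg 16 ∨ s.nreg 16 + A.length ≤ i → s'.rmem i = s.rmem i) := by
  induction A using med3s.induct generalizing s with
  | case2 A h =>
    have hlen : A.length < 3 ∧ med3s A = [] := by
      rcases A with _ | ⟨a, _ | ⟨b, _ | ⟨c, l⟩⟩⟩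
      · simp [med3s]
      · simp [med3s]
      · simp [med3s]
      · exact (h a b c l rfl).elim
    refine Runs.loop_done (by simp only [Test.Holds, h15, h19]; omega)
      ⟨⟨rfl, fun _ _ _ _ => rfl, fun _ _ => rfl⟩, by omega, ?_, fun _ _ => rfl⟩ (by omega)
    rw [hlen.2]
    trivial
  | case1 a b c l ih =>
    obtain ⟨ha, hb, hc, hl⟩ := hseg
    simp only [List.length_cons] at *
    have hdiv : (l.length + 1 + 1 + 1) / 3 = l.length / 3 + 1 := by omega
    rw [hdiv] at hq ⊢
    refine Runs.loop_step (T := 7 + (7 + 2)) (U := 6 * l.length + 1) (P := fun s' => s.LoopFrame s' ∧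
      s'.nreg 14 = s.nreg 14 + 1 + 1 + 1 ∧ s'.nreg 15 = l.length ∧ s'.nreg 16 = s.nreg 16 + 1 ∧
      s'.rmem (s.nreg 16) = med3 a b c ∧ ∀ i, i ≠ s.nreg 16 → s'.rmem i = s.rmem i)
      (by simp only [Test.Holds, h15, h19]; omega) ?_ (fun s' h => ?_) (by omega)
    · refine Runs.seq (T := 7) (U := 9) (P := fun s' => s.LoopFrame s' ∧ s'.rmem = s.rmem ∧
        s'.nreg 14 = s.nreg 14 + 1 + 1 + 1 ∧ s'.nreg 15 = l.length ∧ s'.nreg 16 = s.nreg 16 ∧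
        s'.rreg 12 = a ∧ s'.rreg 13 = b ∧ s'.rreg 14 = c) (Runs.of_pre ?_ le_rfl)
        (fun s₁ h₁ => Runs.seq (U := 2) (runs_median3 s₁) (fun s₂ h₂ => Runs.of_pre ?_ le_rfl) le_rfl)
        le_rfl
      · simp [block, Program.Pre, Instr.Safe, Instr.next, h15, h18, h19, ha, hb, hc]
        refine ⟨by omega, by omega, by omega, by omega, by omega, by omega, by omega,
          ⟨rfl, fun r h1 h2 h3 => by simp [h1, h2], fun r hr => ?_⟩⟩
        simp [show r ≠ 12 by omega, show r ≠ 13 by omega, show r ≠ 14 by omega]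
      · obtain ⟨f, fm, f14, f15, f16, e1, e2, e3⟩ := h₁
        obtain ⟨gn, gm, gr, gf, g12⟩ := h₂
        have h18' := f.nreg 18 (by omega) (by omega) (by omega)
        simp [block, Program.Pre, Instr.Safe, Instr.next, Function.update_apply, gr, f14, f15, f16,
          h18', h18, g12, e1, e2, e3, gm, fm]
        refine ⟨by omega, by omega, ⟨gn.trans f.nmem, fun r h1 h2 h3 => ?_, fun r hr => ?_⟩,
          fun i hi => by simp [hi]⟩
        · simp [h3, gr, f.nreg r h1 h2 h3]
        · exact (gf r hr).trans (f.rreg r hr)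
    · obtain ⟨hf, h14', h15', h16', hst, hmem⟩ := h
      have hseg' : Seg s'.rmem (s'.nreg 14) l := by
        rw [h14']
        exact hl.congr fun i h1 h2 => hmem i (by omega)
      refine (ih hseg' h15'
        (by rw [hf.nreg 18 (by omega) (by omega) (by omega), h18])
        (by rw [hf.nreg 19 (by omega) (by omega) (by omega), h19]) (by omega) (by omega)
        (by omega)).mono le_rfl fun s₂ h₂ => ?_
      · obtain ⟨gf, g16, gs, gm⟩ := h₂
        refine ⟨hf.trans gf, by omega, ⟨?_, by rwa [h16'] at gs⟩, fun i hi => ?_⟩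
        · rw [gm _ (by omega), hst]
        · rw [gm i (by omega), hmem i (by omega)]

end SelectionPrograms

/-! ### The selection algorithm with an explicit stack -/

section SelectionMain

variable {lim : Limits} {inp : Input}

/-- Count the elements for which `b` fails, in integer register `17`. -/
def countPass (b : Test) : Program :=
  .seq (block [.nadd 16 10 11, .nmove 14 10, .nmove 15 11])
    (.seq (filterLoop b) (block [.nsub 17 16 10, .nsub 17 17 11]))

/-- Keep only the elements for which `b` fails. -/
def prunePass (b : Test) : Program :=
  .seq (block [.nmove 16 10, .nmove 14 10, .nmove 15 11])
    (.seq (filterLoop b) (block [.nsub 11 16 10, .nconst 13 0]))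

/-- The memory from `p` on holds a list of `n` elements, and there is room for as many more. -/
structure Holds (lim : Limits) (s : State) (A : List ℝ) : Prop where
  seg : Seg s.rmem (s.nreg 10) A
  len : s.nreg 11 = A.length
  one : s.nreg 18 = 1
  mem : s.nreg 10 + 2 * A.length ≤ lim.mem
  word : s.nreg 10 + 2 * A.length ≤ lim.word
  pos : 1 ≤ lim.word

/-- Counting is filtering into the spare room behind the list. The copy is abandoned and only its
length is kept. -/
theorem runs_countPass {b : Test} {P : ℝ → ℝ → Prop}
    (hb : ∀ s : State, b.Holds s ↔ ¬ P (s.rreg 10) (s.rreg 12)) {A : List ℝ} {s : State}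
    (h : Holds lim s A) :
    Runs lim inp (countPass b) s (7 * A.length + 6) (fun s' => Holds lim s' A ∧
      s'.nmem = s.nmem ∧ (∀ r, r < 14 ∨ 18 ≤ r → s'.nreg r = s.nreg r) ∧
      (∀ r, r < 12 → s'.rreg r = s.rreg r) ∧ s'.nreg 17 = count (P (s.rreg 10)) A ∧
      ∀ i, i < s.nreg 10 + A.length → s'.rmem i = s.rmem i) := by
  obtain ⟨hseg, h11, h18, hm, hw, hw1⟩ := h
  refine Runs.seq (T := 3) (U := 7 * A.length + 1 + 2) (P := fun s' => s.LoopFrame s' ∧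
    s'.rmem = s.rmem ∧ s'.nreg 14 = s.nreg 10 ∧ s'.nreg 15 = A.length ∧
    s'.nreg 16 = s.nreg 10 + A.length) (Runs.of_pre ?_ le_rfl) (fun s₁ h₁ => ?_) (by omega)
  · simp [block, Program.Pre, Instr.Safe, Instr.next, h11]
    refine ⟨by omega, by omega, by omega, rfl, fun r h1 h2 h3 => by simp [h1, h2, h3], fun r _ => rfl⟩
  obtain ⟨f, fm, f14, f15, f16⟩ := h₁
  have hx : s₁.rreg 10 = s.rreg 10 := f.rreg 10 (by omega)
  refine Runs.seq (U := 2) (runs_filterLoop hb (K := s.nreg 10 + 2 * A.length) hm hw (A := A)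
    (by rwa [f14, fm]) f15 (by rw [f.nreg 18 (by omega) (by omega) (by omega), h18]) (by omega)
    (by omega) (by omega)) (fun s₂ h₂ => Runs.of_pre ?_ le_rfl) le_rfl
  obtain ⟨g, g16, -, gm⟩ := h₂
  have hc := count_le_length (P (s.rreg 10)) A
  have e := f.trans g
  have e10 := e.nreg 10 (by omega) (by omega) (by omega)
  have e11 := e.nreg 11 (by omega) (by omega) (by omega)
  have e18 := e.nreg 18 (by omega) (by omega) (by omega)
  rw [hx, f16] at g16
  have hmem : ∀ i, i < s.nreg 10 + A.length → s₂.rmem i = s.rmem i := fun i hi => by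
    rw [gm i (by omega), fm]
  simp [block, Program.Pre, Instr.Safe, Instr.next, g16, e10, e11, h11]
  refine ⟨by omega, by omega, ⟨?_, ?_, ?_, ?_, ?_, hw1⟩, e.nmem, fun r hr => ?_, e.rreg, by omega,
    hmem⟩
  · simp only [State.setN_nreg, e10]
    exact hseg.congr fun i _ hi => hmem i hi
  · simp [e11, h11]
  · simp [e18, h18]
  · simpa [e10] using hm
  · simpa [e10] using hw
  · rw [if_neg (by omega), if_neg (by omega), e.nreg r (by omega) (by omega) (by omega)]

theorem runs_prunePass {b : Test} {P : ℝ → ℝ → Prop}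
    (hb : ∀ s : State, b.Holds s ↔ ¬ P (s.rreg 10) (s.rreg 12)) {A : List ℝ} {s : State}
    (h : Holds lim s A) :
    Runs lim inp (prunePass b) s (7 * A.length + 6) (fun s' =>
      Holds lim s' (keep (P (s.rreg 10)) A) ∧ s'.nmem = s.nmem ∧
      (∀ r, r < 11 ∨ r = 12 ∨ 18 ≤ r → s'.nreg r = s.nreg r) ∧ s'.nreg 13 = 0 ∧
      (∀ r, r < 12 → s'.rreg r = s.rreg r) ∧
      ∀ i, i < s.nreg 10 → s'.rmem i = s.rmem i) := by
  obtain ⟨hseg, h11, h18, hm, hw, hw1⟩ := h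
  refine Runs.seq (T := 3) (U := 7 * A.length + 1 + 2) (P := fun s' => s.LoopFrame s' ∧
    s'.rmem = s.rmem ∧ s'.nreg 14 = s.nreg 10 ∧ s'.nreg 15 = A.length ∧
    s'.nreg 16 = s.nreg 10) (Runs.of_pre ?_ le_rfl) (fun s₁ h₁ => ?_) (by omega)
  · simp [block, Program.Pre, Instr.Safe, Instr.next, h11]
    refine ⟨by omega, by omega, rfl, fun r h1 h2 h3 => by simp [h1, h2, h3], fun r _ => rfl⟩
  obtain ⟨f, fm, f14, f15, f16⟩ := h₁
  have hx : s₁.rreg 10 = s.rreg 10 := f.rreg 10 (by omega)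
  refine Runs.seq (U := 2) (runs_filterLoop hb (K := s.nreg 10 + 2 * A.length) hm hw (A := A)
    (by rwa [f14, fm]) f15 (by rw [f.nreg 18 (by omega) (by omega) (by omega), h18]) (by omega)
    (by omega) (by omega)) (fun s₂ h₂ => Runs.of_pre ?_ le_rfl) le_rfl
  obtain ⟨g, g16, gs, gm⟩ := h₂
  have hc := count_le_length (P (s.rreg 10)) A
  have e := f.trans g
  have e10 := e.nreg 10 (by omega) (by omega) (by omega)
  have e18 := e.nreg 18 (by omega) (by omega) (by omega)
  rw [hx, f16] at g16 gs
  simp [block, Program.Pre, Instr.Safe, Instr.next, g16, e10]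
  refine ⟨by omega, ⟨?_, ?_, ?_, ?_, ?_, hw1⟩, e.nmem, fun r hr => ?_, e.rreg, fun i hi => ?_⟩
  · simpa [e10] using gs
  · simp [length_keep]
  · simp [e18, h18]
  · simp [e10, length_keep]; omega
  · simp [e10, length_keep]; omega
  · rw [if_neg (by omega), if_neg (by omega), e.nreg r (by omega) (by omega) (by omega)]
  · rw [gm i (by omega), fm]

/-- A selection problem that waits for its pivot, which will have at most `k` elements on either
side. -/
structure Pending where
  list : List ℝ
  target : ℝ
  bound : ℕ

/-- What a solution of the current selection problem is needed for. -/
def Goal (A₀ : List ℝ) (τ₀ : ℝ) : List Pending → ℝ → Prop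
  | [], x => Splits A₀ τ₀ x
  | f :: _, x => Balanced f.list f.bound x

/-- Every selection problem on the stack is solvable, and its solutions serve their purpose. -/
def Chain (A₀ : List ℝ) (τ₀ : ℝ) : List Pending → Prop
  | [] => True
  | f :: st => (∀ x, Splits f.list f.target x → Goal A₀ τ₀ st x) ∧ 0 ≤ f.target ∧
      f.target ≤ 2 * f.list.length ∧ f.list ≠ [] ∧ Chain A₀ τ₀ st

/-- The lists of the waiting problems precede cell `p`. -/
def Layout (m : ℕ → ℝ) (l : ℕ → ℕ) (p₀ n₀ : ℕ) : ℕ → List Pending → Prop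
  | p, [] => p = p₀
  | p, f :: st => ∃ q, p = q + f.list.length + 1 ∧ Seg m q f.list ∧
      m (q + f.list.length) = f.target ∧ l st.length = f.list.length ∧
      q + 2 * f.list.length ≤ p₀ + 2 * n₀ ∧ st.length + f.list.length ≤ n₀ ∧ Layout m l p₀ n₀ q st

theorem Layout.congr {m m' : ℕ → ℝ} {l l' : ℕ → ℕ} {p₀ n₀ p : ℕ} {st : List Pending}
    (h : Layout m l p₀ n₀ p st) (hm : ∀ i, i < p → m' i = m i)
    (hl : ∀ i, i < st.length → l' i = l i) : Layout m' l' p₀ n₀ p st := by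
  induction st generalizing p with
  | nil => exact h
  | cons f st ih =>
    obtain ⟨q, hp, hs, hτ, hn, h1, h2, h3⟩ := h
    simp only [List.length_cons] at hl
    refine ⟨q, hp, hs.congr fun i _ hi => hm i (by omega), by rw [hm _ (by omega), hτ],
      by rw [hl _ (by omega), hn], h1, h2, ih h3 (fun i hi => hm i (by omega))
      fun i hi => hl i (by omega)⟩

theorem Layout.le {m : ℕ → ℝ} {l : ℕ → ℕ} {p₀ n₀ p : ℕ} {st : List Pending}
    (h : Layout m l p₀ n₀ p st) : p₀ ≤ p := by
  induction st generalizing p with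
  | nil => exact (show p = p₀ from h).ge
  | cons f st ih =>
    obtain ⟨q, hp, -, -, -, -, -, h3⟩ := h
    have := ih h3
    omega

/-- Time reserved for a problem that waits for its pivot. -/
def Pending.cost (f : Pending) : ℕ := 1440 * f.bound + 40 * (f.list.length + 1)

/-- Invariant of the selection algorithm for a list of length `n₀` at cell `p₀`: the stack, the
current problem and the content of the status register `13`. -/
structure SelectInv (lim : Limits) (A₀ : List ℝ) (τ₀ : ℝ) (s₀ : State)
    (c : List Pending × Pending × ℕ) (s : State) : Prop where
  low : ∀ r, r < 10 → s.nreg r = s₀.nreg r ∧ s.rreg r = s₀.rreg r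
  rmem : ∀ i, i < s₀.nreg 10 → s.rmem i = s₀.rmem i
  status : s.nreg 13 = c.2.2
  one : s.nreg 18 = 1
  three : s.nreg 19 = 3
  eight : s.nreg 20 = 8
  done : c.2.2 = 2 → Splits A₀ τ₀ (s.rreg 10)
  status_le : c.2.2 ≤ 2
  holds : c.2.2 ≤ 1 → Holds lim s c.2.1.list
  space : c.2.2 ≤ 1 → s.nreg 10 + 2 * c.2.1.list.length ≤ s₀.nreg 10 + 2 * A₀.length
  depth : c.2.2 ≤ 1 → c.1.length + c.2.1.list.length ≤ A₀.length
  target : c.2.2 ≤ 1 → s.rreg 11 = c.2.1.target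
  height : c.2.2 ≤ 1 → s.nreg 12 = c.1.length
  layout : c.2.2 ≤ 1 → Layout s.rmem s.nmem (s₀.nreg 10) A₀.length (s.nreg 10) c.1
  chain : c.2.2 ≤ 1 → Chain A₀ τ₀ (c.2.1 :: c.1)
  pivot : c.2.2 = 1 → Balanced c.2.1.list c.2.1.bound (s.rreg 10)

/-- Time that suffices for the rest of the computation. -/
def selectPotential (c : List Pending × Pending × ℕ) : ℕ :=
  if c.2.2 = 0 then 1440 * c.2.1.list.length + (c.1.map Pending.cost).sum
  else if c.2.2 = 1 then c.2.1.cost + (c.1.map Pending.cost).sum else 0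

/-- Start the selection of a pivot among the medians of medians. -/
def push : Program :=
  .seq (block [.nadd 14 10 11, .rstore 14 11, .nstore 12 11, .nadd 12 12 18, .nadd 16 14 18,
    .nmove 17 16, .nmove 14 10, .nmove 15 11])
    (.seq medianLoop (.seq (block [.nsub 15 16 17, .nmove 14 17, .nmove 16 17, .nmove 10 17])
      (.seq medianLoop (block [.nsub 11 16 10, .rcast 11 11]))))

/-- The pivot solves the current problem; return to the preceding one, if there is one. -/
def pop : Program :=
  .branch (.nle 18 12)
    (block [.nsub 12 12 18, .nload 11 12, .nsub 10 10 11, .nsub 10 10 18, .nadd 14 10 11,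
      .rload 11 14]) (block [.nconst 13 2])

/-- Use the pivot. -/
def partition : Program :=
  .seq (countPass (.rle 12 10)) (.seq (block [.nadd 17 17 17, .rcast 13 17])
    (.branch (.rle 13 11)
      (.seq (countPass (.rle 10 12)) (.seq (block [.nsub 17 11 17, .nadd 17 17 17, .rcast 13 17])
        (.branch (.rle 11 13) pop (.seq (block [.rsub 11 11 13]) (prunePass (.rle 10 12))))))
      (prunePass (.rle 12 10))))

/-- One step of the selection algorithm. -/
def selectStep : Program :=
  .branch (.nle 18 13) partition
    (.branch (.nle 11 20) (block [.rload 10 10, .nmove 13 18]) push)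

/-- Selects from the `N11` numbers from cell `N10` on a threshold, in real register `10`, that
splits off half as many elements as real register `11` demands. -/
def select : Program :=
  .seq (block [.nconst 12 0, .nconst 13 0, .nconst 18 1, .nconst 19 3, .nconst 20 8])
    (.loop (.nle 13 18) selectStep)

/-- Status `0` means that a pivot is wanted, `1` that it is in real register `10`, and `2` that the
computation is finished. By `Chain` a solution of the current problem is a balanced pivot of the
waiting problem on top of the stack, which resumes with status `1` and the time reserved for it; if
the stack is empty, it is the answer. -/
theorem runs_pop {A₀ : List ℝ} {τ₀ : ℝ} {s₀ : State} {st : List Pending} {f : Pending} {s : State}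
    (h : SelectInv lim A₀ τ₀ s₀ (st, f, 1) s) (hx : Splits f.list f.target (s.rreg 10))
    (hw : 2 ≤ lim.word) (hm : A₀.length ≤ lim.mem)
    (hm' : s₀.nreg 10 + 2 * A₀.length ≤ lim.mem) (hw' : s₀.nreg 10 + 2 * A₀.length ≤ lim.word) :
    Runs lim inp pop s 7 (fun s' => ∃ c, SelectInv lim A₀ τ₀ s₀ c s' ∧
      selectPotential c ≤ (st.map Pending.cost).sum) := by
  have hc := h.chain (by simp)
  have hh := h.height (by simp)
  have hd := h.depth (by simp)
  simp only at hc hh hd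
  obtain ⟨hgoal, -, -, hne, hchain⟩ := hc
  have hpos := List.length_pos_iff.2 hne
  rcases st with _ | ⟨g, st⟩
  · refine Runs.branch (T := 6) (fun hb => ?_) (fun _ => Runs.of_pre ?_ (show 1 ≤ 6 by omega)) le_rfl
    · simp [Test.Holds, hh, h.one] at hb
    · simp [block, Program.Pre, Instr.Safe, Instr.next]
      refine ⟨hw, [], f, 2, ⟨fun r hr => ?_, h.rmem, rfl, ?_, ?_, ?_, fun _ => hgoal _ hx, le_rfl,
        ?_, ?_, ?_, ?_, ?_, ?_, ?_, ?_⟩, ?_⟩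
      · have := h.low r hr
        simpa [show r ≠ 13 by omega] using this
      · simp [h.one]
      · simp [h.three]
      · simp [h.eight]
      all_goals simp [selectPotential]
  · obtain ⟨q, hp, hseg, hτ, hl, h1, h2, h3⟩ := h.layout (by simp)
    simp only [List.length_cons] at hh hd
    have hgpos := List.length_pos_iff.2 hchain.2.2.2.1
    have hgoal' : Balanced g.list g.bound (s.rreg 10) := hgoal _ hx
    refine Runs.branch (T := 6) (fun _ => Runs.of_pre ?_ le_rfl) (fun hb => ?_) le_rfl
    · have e1 : q + g.list.length + 1 - (g.list.length + 1) = q := by omega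
      have e2 : q + g.list.length + 1 - g.list.length - 1 = q := by omega
      simp only [block, Program.Pre, Instr.Safe, Instr.next]
      simp [hh, hl, h.one, hp, e1, e2]
      refine ⟨by omega, by omega, by omega, by omega, by omega, by omega, st, g, 1,
        ⟨fun r hr => ?_, h.rmem, ?_, ?_, ?_, ?_, by simp, by simp, fun _ => ⟨?_, ?_, ?_, ?_, ?_, ?_⟩,
        ?_, ?_, ?_, ?_, ?_, fun _ => hchain, fun _ => ?_⟩, ?_⟩
      · have := h.low r hr
        simpa [show r ≠ 11 by omega, show r ≠ 12 by omega, show r ≠ 14 by omega,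
          show r ≠ 10 by omega] using this
      · simpa using h.status
      · simp [h.one]
      · simp [h.three]
      · simp [h.eight]
      · simpa using hseg
      · simp
      · simp [h.one]
      · simp; omega
      · simp; omega
      · omega
      · simp; omega
      · simp; omega
      · simp [hτ]
      · simp
      · simpa using h3
      · simpa using hgoal'
      · simp [selectPotential]
    · exact absurd (by simp only [Test.Holds, hh, h.one]; omega) hb

/-- Counting passes only touch the scratch registers and the cells behind the current list. -/
theorem SelectInv.congr {A₀ : List ℝ} {τ₀ : ℝ} {s₀ : State} {st : List Pending} {f : Pending}
    {s s' : State} (h : SelectInv lim A₀ τ₀ s₀ (st, f, 1) s) (hnm : s'.nmem = s.nmem)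
    (hn : ∀ r, r < 14 ∨ 18 ≤ r → s'.nreg r = s.nreg r) (hr : ∀ r, r < 12 → s'.rreg r = s.rreg r)
    (hm : ∀ i, i < s.nreg 10 + f.list.length → s'.rmem i = s.rmem i) :
    SelectInv lim A₀ τ₀ s₀ (st, f, 1) s' := by
  have e10 := hn 10 (by omega)
  have hL := h.layout (by simp)
  have hH := h.holds (by simp)
  refine ⟨fun r hr' => ?_, fun i hi => ?_, ?_, ?_, ?_, ?_, by simp, by simp, fun _ => ⟨?_, ?_, ?_,
    ?_, ?_, hH.pos⟩, ?_, h.depth, ?_, ?_, fun _ => ?_, h.chain, ?_⟩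
  · rw [hn r (by omega), hr r (by omega)]; exact h.low r hr'
  · have := hL.le
    rw [hm i (by omega), h.rmem i hi]
  · rw [hn 13 (by omega)]; exact h.status
  · rw [hn 18 (by omega), h.one]
  · rw [hn 19 (by omega), h.three]
  · rw [hn 20 (by omega), h.eight]
  · rw [e10]; exact hH.seg.congr fun i _ hi => hm i hi
  · rw [hn 11 (by omega), hH.len]
  · rw [hn 18 (by omega), h.one]
  · rw [e10]; exact hH.mem
  · rw [e10]; exact hH.word
  · rw [e10]; exact h.space
  · rw [hr 11 (by omega)]; exact h.target
  · rw [hn 12 (by omega)]; exact h.height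
  · rw [e10]
    exact hL.congr (fun i hi => hm i (by omega)) fun i _ => by rw [hnm]
  · rw [hr 10 (by omega)]; exact h.pivot

/-- The shrunken problem takes the place of the current one: by `hgoal` its solutions solve the
latter, so the chain of purposes below is unaffected. Its bound `0` is a placeholder, not consulted
in status `0`. -/
theorem SelectInv.prune {A₀ : List ℝ} {τ₀ : ℝ} {s₀ : State} {st : List Pending} {f : Pending}
    {s s' : State} (h : SelectInv lim A₀ τ₀ s₀ (st, f, 1) s) {B : List ℝ} {τ : ℝ}
    (hB : B.length ≤ f.list.length) (hH : Holds lim s' B) (hnm : s'.nmem = s.nmem)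
    (hn : ∀ r, r < 11 ∨ r = 12 ∨ 18 ≤ r → s'.nreg r = s.nreg r) (h13 : s'.nreg 13 = 0)
    (hr : ∀ r, r < 11 → s'.rreg r = s.rreg r) (hτ : s'.rreg 11 = τ)
    (hm : ∀ i, i < s.nreg 10 → s'.rmem i = s.rmem i)
    (hgoal : ∀ x, Splits B τ x → Splits f.list f.target x) (h0 : 0 ≤ τ) (h2 : τ ≤ 2 * B.length)
    (hne : B ≠ []) : SelectInv lim A₀ τ₀ s₀ (st, ⟨B, τ, 0⟩, 0) s' := by
  have e10 := hn 10 (by omega)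
  have hL := h.layout (by simp)
  have hsp := h.space (by simp)
  have hd := h.depth (by simp)
  have hc := h.chain (by simp)
  simp only at hL hsp hd hc
  refine ⟨fun r hr' => ?_, fun i hi => ?_, h13, ?_, ?_, ?_, by simp, by simp, fun _ => hH, fun _ => ?_,
    fun _ => ?_, fun _ => hτ, fun _ => ?_, fun _ => ?_, fun _ => ?_, by simp⟩
  · rw [hn r (by omega), hr r (by omega)]; exact h.low r hr'
  · have := hL.le
    rw [hm i (by omega), h.rmem i hi]
  · rw [hn 18 (by omega), h.one]
  · rw [hn 19 (by omega), h.three]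
  · rw [hn 20 (by omega), h.eight]
  · simp only [e10]; omega
  · simp only; omega
  · rw [hn 12 (by omega)]; exact h.height (by simp)
  · simp only [e10]
    exact hL.congr hm fun i _ => by rw [hnm]
  · exact ⟨fun x hx => hc.1 x (hgoal x hx), h0, h2, hne, hc.2.2.2.2⟩

/-- The target is compared with twice the number of elements above the pivot and twice the number of
those at least as large. Below the first, the search continues above the pivot; beyond the second,
it continues below with a reduced target; in between the pivot is a solution. Balance bounds the
size of either remainder. -/
theorem runs_partition {A₀ : List ℝ} {τ₀ : ℝ} {s₀ : State} {st : List Pending} {f : Pending}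
    {s : State} (h : SelectInv lim A₀ τ₀ s₀ (st, f, 1) s) (hw : 2 ≤ lim.word)
    (hm : A₀.length ≤ lim.mem)
    (hm' : s₀.nreg 10 + 2 * A₀.length ≤ lim.mem) (hw' : s₀.nreg 10 + 2 * A₀.length ≤ lim.word) :
    Runs lim inp partition s (40 * f.list.length + 30) (fun s' => ∃ c, SelectInv lim A₀ τ₀ s₀ c s' ∧
      selectPotential c ≤ 1440 * f.bound + (st.map Pending.cost).sum) := by
  obtain ⟨hb1, hb2⟩ := h.pivot rfl
  obtain ⟨hgoal, hτ0, hτ2, hne, hchain⟩ := h.chain (by simp)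
  have hH : Holds lim s f.list := h.holds (by simp)
  have hτ : s.rreg 11 = f.target := h.target (by simp)
  simp only at hb1 hb2 hτ0 hτ2
  have hg := count_le_length (fun v => s.rreg 10 < v) f.list
  have hpart := count_le_add_count_lt f.list (s.rreg 10)
  have hgt : ∀ s : State, (Test.rle 12 10).Holds s ↔ ¬ (fun x v => x < v) (s.rreg 10) (s.rreg 12) :=
    fun s => by simp [Test.Holds]
  have hlt : ∀ s : State, (Test.rle 10 12).Holds s ↔ ¬ (fun x v => v < x) (s.rreg 10) (s.rreg 12) :=
    fun s => by simp [Test.Holds]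
  have hK : f.list.length + f.list.length ≤ lim.word := by have := hH.word; omega
  refine Runs.seq (U := 32 * f.list.length + 24) (runs_countPass (P := fun x v => x < v) hgt hH) (fun s₁ h₁ => ?_) (by omega)
  obtain ⟨-, gn, gr, grr, g17, gm⟩ := h₁
  have i1 := h.congr gn gr grr gm
  have x1 : s₁.rreg 10 = s.rreg 10 := grr 10 (by omega)
  rw [← x1] at hb1 hb2 hg hpart g17
  generalize hG : count (fun v => s₁.rreg 10 < v) f.list = G at hg hb1 g17
  refine Runs.seq (T := 2) (U := 30 * f.list.length + 22) (P := fun s₂ =>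
    SelectInv lim A₀ τ₀ s₀ (st, f, 1) s₂ ∧ s₂.rreg 10 = s₁.rreg 10 ∧ s₂.rreg 13 = 2 * G)
    (Runs.of_pre ?_ le_rfl) (fun s₂ h₂ => ?_) (by omega)
  · simp [block, Program.Pre, Instr.Safe, Instr.next, g17]
    exact ⟨by omega, i1.congr rfl (fun r hr => by simp [show r ≠ 17 by omega])
      (fun r hr => by simp [show r ≠ 13 by omega]) (fun _ _ => rfl), by ring⟩
  obtain ⟨i2, x2, h13⟩ := h₂
  have hH2 : Holds lim s₂ f.list := i2.holds (by simp)
  have t2 : s₂.rreg 11 = f.target := i2.target (by simp)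
  rw [← x2] at hb2 hpart hG
  refine Runs.branch (T := 30 * f.list.length + 21) (fun hle => ?_) (fun hnle => ?_) (by omega)
  · simp only [Test.Holds, h13, t2] at hle
    refine Runs.seq (U := 20 * f.list.length + 14) (runs_countPass (P := fun x v => v < x) hlt hH2) (fun s₃ h₃ => ?_)
      (by omega)
    obtain ⟨-, gn, gr, grr, g17, gm⟩ := h₃
    have i3 := i2.congr gn gr grr gm
    have x3 : s₃.rreg 10 = s₂.rreg 10 := grr 10 (by omega)
    have n3 : s₃.nreg 11 = f.list.length := (i3.holds (by simp)).len
    rw [← x3] at hb2 hpart hG g17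
    generalize hE : count (fun v => s₃.rreg 10 ≤ v) f.list = E at hpart
    generalize hL : count (fun v => v < s₃.rreg 10) f.list = L at hpart g17 hb2
    have hEL : f.list.length - L = E := by omega
    refine Runs.seq (T := 3) (U := 20 * f.list.length + 11) (P := fun s₄ =>
      SelectInv lim A₀ τ₀ s₀ (st, f, 1) s₄ ∧ s₄.rreg 10 = s₃.rreg 10 ∧ s₄.rreg 13 = 2 * E)
      (Runs.of_pre ?_ le_rfl) (fun s₄ h₄ => ?_) (by omega)
    · simp [block, Program.Pre, Instr.Safe, Instr.next, g17, n3, hEL]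
      exact ⟨by omega, by omega, i3.congr rfl (fun r hr => by simp [show r ≠ 17 by omega])
        (fun r hr => by simp [show r ≠ 13 by omega]) (fun _ _ => rfl), by ring⟩
    obtain ⟨i4, x4, h13'⟩ := h₄
    have hH4 : Holds lim s₄ f.list := i4.holds (by simp)
    have t4 : s₄.rreg 11 = f.target := i4.target (by simp)
    rw [← x4] at hG hE hL
    refine Runs.branch (T := 20 * f.list.length + 10) (fun hle' => ?_) (fun hnle' => ?_) (by omega)
    · simp only [Test.Holds, h13', t4] at hle'
      refine (runs_pop i4 ⟨by rw [hG]; exact hle, by rw [hE]; exact hle'⟩ hw hm hm' hw').mono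
        (by omega) fun s' hs' => ?_
      obtain ⟨c, hc, hcc⟩ := hs'
      exact ⟨c, hc, by omega⟩
    · simp only [Test.Holds, h13', t4, not_le] at hnle'
      refine Runs.seq (T := 1) (U := 7 * f.list.length + 6) (P := fun s₅ => s₅.nreg = s₄.nreg ∧
        s₅.nmem = s₄.nmem ∧ s₅.rmem = s₄.rmem ∧ (∀ r, r ≠ 11 → s₅.rreg r = s₄.rreg r) ∧
        s₅.rreg 11 = f.target - 2 * E) (Runs.of_pre ?_ le_rfl) (fun s₅ h₅ => ?_) (by omega)
      · simp [block, Program.Pre, Instr.Safe, Instr.next, t4, h13']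
        simp +contextual
      obtain ⟨j1, j2, j3, j4, j5⟩ := h₅
      have hH5 : Holds lim s₅ f.list := ⟨by rw [j1, j3]; exact hH4.seg, by rw [j1, hH4.len],
        by rw [j1, hH4.one], by rw [j1]; exact hH4.mem, by rw [j1]; exact hH4.word, hH4.pos⟩
      refine (runs_prunePass (P := fun x v => v < x) hlt hH5).mono le_rfl fun s' hs' => ?_
      obtain ⟨k1, k2, k3, k4, k5, k6⟩ := hs'
      rw [j4 10 (by omega)] at k1
      have hτE : f.target - 2 * (E : ℝ) ≤ 2 * ((keep (fun v => v < s₄.rreg 10) f.list).length : ℝ) := by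
        rw [length_keep, hL]
        have : (E : ℝ) + L = f.list.length := by exact_mod_cast hpart
        linarith
      refine ⟨_, i4.prune (B := keep (fun v => v < s₄.rreg 10) f.list) (τ := f.target - 2 * E)
        (by rw [length_keep]; exact count_le_length _ _) k1 (by rw [k2, j2])
        (fun r hr => by rw [k3 r hr, j1]) k4
        (fun r hr => by rw [k5 r (by omega), j4 r (by omega)]) (by rw [k5 11 (by omega), j5])
        (fun i hi => by rw [k6 i (by rw [j1]; exact hi), j3])
        (fun x hx => splits_of_keep_lt (by rw [hE]; exact hnle') (by rw [hE]; exact hx))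
        (by linarith) hτE ?_, ?_⟩
      -- An empty remainder contradicts the strict inequality that led to this branch.
      · intro h0
        rw [h0] at hτE
        simp at hτE
        linarith
      · simp [selectPotential, length_keep, hL]
        omega
  · simp only [Test.Holds, h13, t2, not_le] at hnle
    refine (runs_prunePass (P := fun x v => x < v) hgt hH2).mono (by omega) fun s' hs' => ?_
    obtain ⟨k1, k2, k3, k4, k5, k6⟩ := hs'
    refine ⟨_, i2.prune (B := keep (fun v => s₂.rreg 10 < v) f.list) (τ := f.target)
      (by rw [length_keep]; exact count_le_length _ _) k1 k2 k3 k4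
      (fun r hr => k5 r (by omega)) (by rw [k5 11 (by omega), t2]) k6
      (fun x hx => splits_of_keep_gt (by rw [hG]; exact hnle) hx)
      hτ0 (by rw [length_keep, hG]; exact hnle.le) ?_, ?_⟩
    · intro h0
      have : G = 0 := by rw [← hG, ← length_keep, h0]; rfl
      rw [this] at hnle
      simp at hnle
      linarith
    · simp [selectPotential, length_keep, hG]
      omega

/-- The state after `push`, relative to the state before it. -/
structure Pushed (lim : Limits) (A : List ℝ) (s s' : State) : Prop where
  low : ∀ r, r < 10 → s'.nreg r = s.nreg r ∧ s'.rreg r = s.rreg r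
  base : s'.nreg 10 = s.nreg 10 + A.length + 1
  height : s'.nreg 12 = s.nreg 12 + 1
  same : ∀ r, r = 13 ∨ 18 ≤ r → s'.nreg r = s.nreg r
  holds : Holds lim s' (med3s (med3s A))
  target : s'.rreg 11 = (A.length / 9 : ℕ)
  saved : s'.rmem (s.nreg 10 + A.length) = s.rreg 11
  rmem : ∀ i, i < s.nreg 10 + A.length → s'.rmem i = s.rmem i
  len : s'.nmem (s.nreg 12) = A.length
  nmem : ∀ i, i < s.nreg 12 → s'.nmem i = s.nmem i

-- The target is saved in the cell behind the list and the length in the integer memory at the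
-- height of the stack. The medians go behind that cell, and their medians replace them in place.
set_option maxHeartbeats 400000 in
theorem runs_push' {A : List ℝ} {s : State} (hH : Holds lim s A) (h9 : 9 ≤ A.length)
    (h19 : s.nreg 19 = 3) (hm : s.nreg 12 < lim.mem) (hw : s.nreg 12 + 1 ≤ lim.word) :
    Runs lim inp push s (20 * A.length + 20) (fun s' => Pushed lim A s s') := by
  have hpw := hH.word
  have hpm := hH.mem
  have h11 := hH.len
  have h18 := hH.one
  refine Runs.seq (T := 8) (U := 12 * A.length + 10) (P := fun s₁ =>
    (∀ r, r < 12 ∨ r = 13 ∨ 18 ≤ r → s₁.nreg r = s.nreg r) ∧ s₁.nreg 12 = s.nreg 12 + 1 ∧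
    s₁.nreg 14 = s.nreg 10 ∧ s₁.nreg 15 = A.length ∧ s₁.nreg 16 = s.nreg 10 + A.length + 1 ∧
    s₁.nreg 17 = s.nreg 10 + A.length + 1 ∧ s₁.rreg = s.rreg ∧
    s₁.rmem (s.nreg 10 + A.length) = s.rreg 11 ∧
    (∀ i, i < s.nreg 10 + A.length → s₁.rmem i = s.rmem i) ∧
    s₁.nmem (s.nreg 12) = A.length ∧ ∀ i, i < s.nreg 12 → s₁.nmem i = s.nmem i)
    (Runs.of_pre ?_ le_rfl) (fun s₁ h₁ => ?_) (by omega)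
  · simp [block, Program.Pre, Instr.Safe, Instr.next, Function.update_apply, h11, h18]
    refine ⟨by omega, by omega, by omega, by omega, by omega, by omega, by omega,
      fun r hr => ?_, fun i h1 h2 => by omega, fun i h1 h2 => by omega⟩
    simp [show r ≠ 16 by omega, show r ≠ 17 by omega, show r ≠ 15 by omega, show r ≠ 14 by omega,
      show r ≠ 12 by omega]
  obtain ⟨g, g12, g14, g15, g16, g17, grr, gτ, gm, gl, gll⟩ := h₁
  have hdiv : A.length / 3 / 3 = A.length / 9 := Nat.div_div_eq_div_mul _ _ _
  have hdiv3 : A.length / 3 ≤ A.length := Nat.div_le_self _ _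
  have hl1 := length_med3s A
  -- The new list, again with room for its double, fits into the room of the old one. This uses `9 ≤
  -- A.length`, and it is why the stack never needs more than twice the original length.
  have hfit : s.nreg 10 + A.length + 1 + 2 * (A.length / 9) ≤ s.nreg 10 + 2 * A.length := by omega
  refine Runs.seq (U := 6 * A.length + 8) (runs_medianLoop (A := A) (K := s.nreg 10 + 2 * A.length)
    hpm hpw ?_ g15 (by rw [g 18 (by omega), h18]) (by rw [g 19 (by omega), h19]) (by omega)
    (by omega) (by omega)) (fun s₂ h₂ => ?_) (by omega)
  · rw [g14]
    exact hH.seg.congr fun i _ hi => gm i hi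
  obtain ⟨e, e16, es, em⟩ := h₂
  rw [g16] at e16 es em
  refine Runs.seq (T := 4) (U := 6 * A.length + 4) (P := fun s₃ => s₃.rmem = s₂.rmem ∧
    s₃.nmem = s₂.nmem ∧ s₃.rreg = s₂.rreg ∧
    (∀ r, r ≠ 10 → r ≠ 14 → r ≠ 15 → r ≠ 16 → s₃.nreg r = s₂.nreg r) ∧
    s₃.nreg 10 = s.nreg 10 + A.length + 1 ∧ s₃.nreg 14 = s.nreg 10 + A.length + 1 ∧
    s₃.nreg 16 = s.nreg 10 + A.length + 1 ∧ s₃.nreg 15 = (med3s A).length)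
    (Runs.of_pre ?_ le_rfl) (fun s₃ h₃ => ?_) (by omega)
  · have e17 := e.nreg 17 (by omega) (by omega) (by omega)
    simp [block, Program.Pre, Instr.Safe, Instr.next, e16, e17, g17, hl1]
    exact ⟨by omega, by omega, by simp +contextual⟩
  obtain ⟨k1, k2, k3, k4, k10, k14, k16, k15⟩ := h₃
  have k18 : s₃.nreg 18 = 1 := by
    rw [k4 18 (by omega) (by omega) (by omega) (by omega), e.nreg 18 (by omega) (by omega) (by omega),
      g 18 (by omega), h18]
  have k19 : s₃.nreg 19 = 3 := by
    rw [k4 19 (by omega) (by omega) (by omega) (by omega), e.nreg 19 (by omega) (by omega) (by omega),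
      g 19 (by omega), h19]
  refine Runs.seq (U := 2) (runs_medianLoop (A := med3s A) (K := s.nreg 10 + 2 * A.length)
    hpm hpw (by rw [k14, k1]; exact es) k15 k18 k19 (by omega) (by omega) (by omega))
    (fun s₄ h₄ => Runs.of_pre ?_ le_rfl) (by omega)
  obtain ⟨q, q16, qs, qm⟩ := h₄
  rw [k16] at q16 qs qm
  rw [hl1, hdiv] at q16
  have hmem : ∀ i, i < s.nreg 10 + A.length + 1 → s₄.rmem i = s₁.rmem i := fun i hi => by
    rw [qm i (by omega), k1, em i (by omega)]
  have hnmem : s₄.nmem = s₁.nmem := by rw [q.nmem, k2, e.nmem]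
  have hnreg : ∀ r, r < 10 ∨ r = 13 ∨ 18 ≤ r → s₄.nreg r = s.nreg r :=
    fun r hr => by rw [q.nreg r (by omega) (by omega) (by omega),
      k4 r (by omega) (by omega) (by omega) (by omega), e.nreg r (by omega) (by omega) (by omega),
      g r (by omega)]
  have hrreg : ∀ r, r < 12 → s₄.rreg r = s.rreg r := fun r hr => by
    rw [q.rreg r hr, k3, e.rreg r hr, grr]
  have q10 : s₄.nreg 10 = s.nreg 10 + A.length + 1 := by
    rw [q.nreg 10 (by omega) (by omega) (by omega), k10]
  have q12 : s₄.nreg 12 = s.nreg 12 + 1 := by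
    rw [q.nreg 12 (by omega) (by omega) (by omega),
      k4 12 (by omega) (by omega) (by omega) (by omega), e.nreg 12 (by omega) (by omega) (by omega),
      g12]
  have q18 : s₄.nreg 18 = 1 := by rw [hnreg 18 (by omega), h18]
  have hlen : (med3s (med3s A)).length = A.length / 9 := by rw [length_med3s, hl1, hdiv]
  have e1 : s.nreg 10 + A.length + 1 + A.length / 9 - (s.nreg 10 + A.length + 1) = A.length / 9 := by
    omega
  simp only [block, Program.Pre, Instr.Safe, Instr.next, q16, q10, e1]
  refine ⟨by omega, trivial, ⟨fun r hr => ?_, ?_, ?_, fun r hr => ?_, ⟨?_, ?_, ?_, ?_, ?_, hH.pos⟩,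
    ?_, ?_, fun i hi => ?_, ?_, fun i hi => ?_⟩⟩
  · rw [State.setR_nreg, State.setN_nreg, if_neg (by omega), State.setR_rreg, if_neg (by omega),
      State.setN_rreg, hnreg r (by omega), hrreg r (by omega)]
    exact ⟨rfl, rfl⟩
  · simpa using q10
  · simpa using q12
  · rw [State.setR_nreg, State.setN_nreg, if_neg (by omega), hnreg r (by omega)]
  · simpa [q10] using qs
  · simp [hlen]
  · simpa using q18
  · simpa [q10, hlen] using hfit.trans hpm
  · simpa [q10, hlen] using hfit.trans hpw
  · simp
  · simp [hmem, gτ]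
  · simp [hmem i (by omega), gm i hi]
  · simp [hnmem, gl]
  · simp [hnmem, gll i hi]

/-- The new target is the length of the new list, so its solution is a median, and
`balanced_of_splits_medians` turns it into the pivot awaited by the saved problem. -/
theorem runs_push {A₀ : List ℝ} {τ₀ : ℝ} {s₀ : State} {st : List Pending} {f : Pending}
    {s : State} (h : SelectInv lim A₀ τ₀ s₀ (st, f, 0) s) (h9 : 9 ≤ f.list.length)
    (hm : A₀.length ≤ lim.mem) (hw : A₀.length ≤ lim.word) :
    Runs lim inp push s (20 * f.list.length + 20) (fun s' => ∃ c, SelectInv lim A₀ τ₀ s₀ c s' ∧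
      selectPotential c = 1440 * (f.list.length / 9) + 1440 * (f.list.length - 2 * (f.list.length / 9))
        + 40 * (f.list.length + 1) + (st.map Pending.cost).sum) := by
  obtain ⟨hgoal, hτ0, hτ2, hne, hchain⟩ := h.chain (by simp)
  have hH : Holds lim s f.list := h.holds (by simp)
  have hτ : s.rreg 11 = f.target := h.target (by simp)
  have hd := h.depth (by simp)
  have hsp := h.space (by simp)
  have hh := h.height (by simp)
  have hL := h.layout (by simp)
  simp only at hd hsp hh hL
  refine (runs_push' hH h9 h.three (by omega) (by omega)).mono le_rfl fun s' p => ?_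
  have hlen : (med3s (med3s f.list)).length = f.list.length / 9 := by
    rw [length_med3s, length_med3s, Nat.div_div_eq_div_mul]
  refine ⟨(⟨f.list, f.target, f.list.length - 2 * (f.list.length / 9)⟩ :: st,
    ⟨med3s (med3s f.list), ((f.list.length / 9 : ℕ) : ℝ), 0⟩, 0), ⟨fun r hr => ?_, fun i hi => ?_,
      ?_, ?_, ?_, ?_, by simp, by simp,
      fun _ => p.holds, fun _ => ?_, fun _ => ?_, fun _ => p.target, fun _ => ?_, fun _ => ?_,
      fun _ => ⟨fun x hx => balanced_of_splits_medians hx, ?_, ?_, ?_, hgoal, hτ0, hτ2, hne, hchain⟩,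
      by simp⟩, ?_⟩
  · rw [(p.low r hr).1, (p.low r hr).2]
    exact h.low r hr
  · have := hL.le
    rw [p.rmem i (by omega), h.rmem i hi]
  · rw [p.same 13 (by omega)]; exact h.status
  · rw [p.same 18 (by omega), h.one]
  · rw [p.same 19 (by omega), h.three]
  · rw [p.same 20 (by omega), h.eight]
  · simp only [p.base, hlen]; omega
  · simp only [hlen, List.length_cons]; omega
  · simp only [p.height, hh, List.length_cons]
  · refine ⟨s.nreg 10, p.base, hH.seg.congr fun i _ hi => p.rmem i hi, by rw [p.saved, hτ],
      by rw [← hh, p.len], hsp, hd, hL.congr (fun i hi => p.rmem i (by omega))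
        fun i hi => p.nmem i (by omega)⟩
  · positivity
  · rw [hlen]
    have : (0 : ℝ) ≤ ((f.list.length / 9 : ℕ) : ℝ) := by positivity
    linarith
  · intro h0
    have h0' : med3s (med3s f.list) = [] := h0
    rw [h0'] at hlen
    simp at hlen
    omega
  · simp [selectPotential, Pending.cost, hlen]
    ring

/-- The numbers in the cells below `N10` and the registers below `10` are not changed. -/
structure State.SelectFrame (s s' : State) : Prop where
  low : ∀ r, r < 10 → s'.nreg r = s.nreg r ∧ s'.rreg r = s.rreg r
  rmem : ∀ i, i < s.nreg 10 → s'.rmem i = s.rmem i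

/-- The potential is `1440` per element of a problem that wants a pivot; a waiting problem has
reserved the time of its partition and `1440` per element of its largest possible remainder. Thus
the recurrence with sizes `n/9` and `n - 2⌊n/9⌋` turns into a potential that pays for every step. -/
theorem runs_select {A : List ℝ} {τ : ℝ} {s : State} (hne : A ≠ [])
    (hseg : Seg s.rmem (s.nreg 10) A) (h11 : s.nreg 11 = A.length) (hτ : s.rreg 11 = τ)
    (h0 : 0 ≤ τ) (h2 : τ ≤ 2 * A.length) (hm : s.nreg 10 + 2 * A.length ≤ lim.mem)
    (hw : s.nreg 10 + 2 * A.length ≤ lim.word) (hw8 : 8 ≤ lim.word) :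
    Runs lim inp select s (1440 * A.length + 6) (fun s' => s.SelectFrame s' ∧
      Splits A τ (s'.rreg 10)) := by
  refine Runs.seq (T := 5) (U := 1440 * A.length + 1) (P := fun s₁ =>
    SelectInv lim A τ s ([], ⟨A, τ, 0⟩, 0) s₁) (Runs.of_pre ?_ le_rfl) (fun s₁ h₁ => ?_) (by omega)
  · simp [block, Program.Pre, Instr.Safe, Instr.next]
    refine ⟨by omega, by omega, hw8, ⟨fun r hr => ?_, fun _ _ => rfl, by simp, by simp, by simp,
      by simp, by simp, by simp, fun _ => ⟨by simpa using hseg, by simpa using h11, by simp,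
        by simpa using hm, by simpa using hw, by omega⟩, fun _ => ?_, fun _ => ?_, fun _ => ?_,
        fun _ => ?_, fun _ => ?_, fun _ => ⟨fun x hx => hx, h0, h2, hne, trivial⟩, by simp⟩⟩
    · simp [show r ≠ 20 by omega, show r ≠ 19 by omega, show r ≠ 18 by omega, show r ≠ 13 by omega,
        show r ≠ 12 by omega]
    · simp
    · simp
    · simpa using hτ
    · simp
    · simp [Layout]
  refine Runs.amortized (SelectInv lim A τ s) selectPotential (fun c s' h hb => ?_)
    (fun c s' h hb => ?_) h₁ (by simp [selectPotential])
  · have h13 := h.status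
    have hle := h.status_le
    simp only [Test.Holds, h13, h.one] at hb
    exact ⟨⟨h.low, h.rmem⟩, h.done (by omega)⟩
  · obtain ⟨st, f, fl⟩ := c
    have h13 : s'.nreg 13 = fl := h.status
    simp only [Test.Holds, h13, h.one] at hb
    interval_cases fl
    · have hH : Holds lim s' f.list := h.holds (by simp)
      obtain ⟨hgoal, hτ0, hτ2, hne', hchain⟩ := h.chain (by simp)
      rcases le_or_gt f.list.length 8 with h8 | h8
      -- Up to eight elements the head serves as pivot; the remainder is shorter by one, and `1440`
      -- pays for the partition of such a short list.
      · refine ⟨4, Runs.branch (T := 3) (fun hb => ?_) (fun _ => Runs.branch (T := 2)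
          (fun _ => Runs.of_pre ?_ le_rfl) (fun hb => ?_) le_rfl) le_rfl⟩
        · simp [Test.Holds, h13, h.one] at hb
        · obtain ⟨v, B, hvB⟩ := List.exists_cons_of_ne_nil hne'
          have hs := hH.seg
          rw [hvB] at hs
          have hlen : f.list.length = B.length + 1 := by rw [hvB]; rfl
          have hmm := hH.mem
          simp [block, Program.Pre, Instr.Safe, Instr.next, h.one]
          refine ⟨by omega, by omega, st, ⟨f.list, f.target, B.length⟩, 1, ⟨fun r hr => ?_, h.rmem,
            by simp, by simp [h.one], by simp [h.three], by simp [h.eight], by simp, by simp,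
            fun _ => ⟨by simpa using hH.seg, by simpa using hH.len, by simp [h.one],
              by simpa using hH.mem, by simpa using hH.word, hH.pos⟩, ?_, fun _ => h.depth (by simp), ?_, ?_, ?_,
              fun _ => ⟨hgoal, hτ0, hτ2, hne', hchain⟩, fun _ => ?_⟩, ?_⟩
          · have := h.low r hr
            simpa [show r ≠ 13 by omega, show r ≠ 10 by omega] using this
          · simpa using h.space
          · simpa using h.target
          · simpa using h.height
          · simpa using h.layout
          · have hb : Balanced f.list B.length v := by rw [hvB]; exact balanced_head v B
            simpa [hs.1] using hb
          · simp [selectPotential, Pending.cost]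
            omega
        · exact absurd (by simpa [Test.Holds, hH.len, h.eight] using h8) hb
      -- The two subproblems together are shorter by `⌊n/9⌋`. The `1440 ⌊n/9⌋` gained cover `60 n +
      -- 63`, which is the cost of `push` and the time reserved for the partition; the tightest case
      -- is `n = 17`.
      · refine ⟨20 * f.list.length + 22, Runs.branch (T := 20 * f.list.length + 21) (fun hb => ?_)
          (fun _ => Runs.branch (T := 20 * f.list.length + 20)
          (fun hb => ?_) (fun _ => (runs_push h h8 (by omega) (by omega)).mono le_rfl
            fun s₂ hs₂ => ?_) le_rfl) le_rfl⟩
        · simp [Test.Holds, h13, h.one] at hb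
        · simp only [Test.Holds, hH.len, h.eight] at hb
          omega
        · obtain ⟨c, hc, hcc⟩ := hs₂
          refine ⟨c, hc, ?_⟩
          rw [hcc]
          simp [selectPotential]
          omega
    · refine ⟨40 * f.list.length + 31, (Runs.branch (fun _ => runs_partition h (by omega) (by omega)
        hm hw) (fun hb => ?_) le_rfl).mono le_rfl fun s₂ hs₂ => ?_⟩
      · exact absurd (by simp [Test.Holds, h13, h.one]) hb
      · obtain ⟨c, hc, hcc⟩ := hs₂
        refine ⟨c, hc, ?_⟩
        rw [show selectPotential (st, f, 1) = 1440 * f.bound + 40 * (f.list.length + 1) +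
          (st.map Pending.cost).sum by simp [selectPotential, Pending.cost]]
        omega

end SelectionMain

/-! ### Factor models -/

theorem seg_of_getElem {m : ℕ → ℝ} {p : ℕ} {A : List ℝ}
    (h : ∀ i (hi : i < A.length), m (p + i) = A[i]) : Seg m p A := by
  induction A generalizing p with
  | nil => trivial
  | cons v A ih =>
    refine ⟨h 0 (by simp), ih fun i hi => ?_⟩
    have := h (i + 1) (by simpa using hi)
    rw [show p + 1 + i = p + (i + 1) by omega, this]
    rfl

open Classical in
theorem count_ofFn {n : ℕ} (P : ℝ → Prop) (c : Fin n → ℝ) :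
    (count P (List.ofFn c) : ℝ) = ∑ i, if P (c i) then (1 : ℝ) else 0 := by
  have h : ∀ A : List ℝ, (count P A : ℝ) = (A.map fun v => if P v then (1 : ℝ) else 0).sum := by
    intro A
    induction A with
    | nil => simp [count_nil]
    | cons v A ih => rw [count_cons, List.map_cons, List.sum_cons, ← ih]; push_cast; ring
  rw [h, List.map_ofFn, List.sum_ofFn]
  rfl

namespace FactorModel

/-- Total loadings of the customers of `S`. -/
def loading (a : FactorModel) (S : Finset (Fin a.n)) (f : Fin a.F) : ℝ := ∑ i ∈ S, a.Psi i f

theorem load_eq (a : FactorModel) (S : Finset (Fin a.n)) (xi : Fin a.F → ℝ) :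
    ∑ i ∈ S, (a.q0 + a.Psi.mulVec xi) i = ∑ i ∈ S, a.q0 i + ∑ f, a.loading S f * xi f := by
  simp only [Pi.add_apply, Finset.sum_add_distrib, Matrix.mulVec, dotProduct, loading,
    Finset.sum_mul]
  rw [Finset.sum_comm]

-- Weak duality comes from `∑ c_f ξ_f = ∑ (c_f - x) ξ_f + x ∑ ξ_f`. Equality holds if `ξ_f` is the
-- sign of `c_f - x` and `∑ ξ_f` is the extremal value `t`. The coordinates with `c_f = x` are free,
-- and the condition `Splits` with target `F + t` says exactly that they can adjust the sum to `t`.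
open Classical in
theorem isWorstCaseLoad (a : FactorModel) (S : Finset (Fin a.n)) {x t : ℝ}
    (hx : Splits (List.ofFn (a.loading S)) (a.F + t) x) (ht : |t| ≤ a.beta * a.F)
    (hxt : x * t = |x| * (a.beta * a.F)) :
    IsWorstCaseLoad a.set S
      (∑ i ∈ S, a.q0 i + |x| * (a.beta * a.F) + ∑ f, |a.loading S f - x|) := by
  have hsum : ∀ xi : Fin a.F → ℝ, ∑ f, a.loading S f * xi f =
      ∑ f, (a.loading S f - x) * xi f + x * ∑ f, xi f := fun xi => by
    rw [Finset.mul_sum, ← Finset.sum_add_distrib]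
    exact Finset.sum_congr rfl fun f _ => by ring
  constructor
  · obtain ⟨h1, h2⟩ := hx
    rw [count_ofFn] at h1 h2
    set g : ℝ := ∑ f, if x < a.loading S f then (1 : ℝ) else 0
    set e : ℝ := ∑ f, if a.loading S f = x then (1 : ℝ) else 0 with he
    set l : ℝ := ∑ f, if a.loading S f < x then (1 : ℝ) else 0
    have hge : ∑ f, (if x ≤ a.loading S f then (1 : ℝ) else 0) = g + e := by
      rw [← Finset.sum_add_distrib]
      refine Finset.sum_congr rfl fun f _ => ?_
      rcases lt_trichotomy x (a.loading S f) with h | h | h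
      · simp [h, h.le, h.ne']
      · simp [h.le, ← h]
      · simp [h, h.not_gt, h.not_ge, h.ne]
    have hF : (a.F : ℝ) = g + e + l := by
      rw [← hge, ← Finset.sum_add_distrib]
      have : (a.F : ℝ) = ∑ _f : Fin a.F, (1 : ℝ) := by simp
      rw [this]
      refine Finset.sum_congr rfl fun f _ => ?_
      rcases le_or_gt x (a.loading S f) with h | h
      · simp [h, h.not_gt]
      · simp [h, h.not_ge]
    rw [hge] at h2
    have he0 : 0 ≤ e := Finset.sum_nonneg fun f _ => by split_ifs <;> norm_num
    -- With `g`, `e` and `l` coordinates above, at and below `x`, the attainable sums are those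
    -- between `g - l - e` and `g - l + e`; `θ` is the common value of the tied coordinates.
    obtain ⟨θ, hθ1, hθ2, hθ⟩ : ∃ θ : ℝ, -1 ≤ θ ∧ θ ≤ 1 ∧ g - l + θ * e = t := by
      rcases he0.eq_or_lt with h | h
      · exact ⟨0, by norm_num, by norm_num, by linarith⟩
      · refine ⟨(t - (g - l)) / e, ?_, ?_, ?_⟩
        · rw [le_div_iff₀ h]; linarith
        · rw [div_le_iff₀ h]; linarith
        · rw [div_mul_cancel₀ _ h.ne']; ring
    let xi : Fin a.F → ℝ := fun f => if x < a.loading S f then 1 else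
      if a.loading S f < x then -1 else θ
    have hxi : ∑ f, xi f = t := by
      rw [← hθ, he, Finset.mul_sum, ← Finset.sum_sub_distrib, ← Finset.sum_add_distrib]
      refine Finset.sum_congr rfl fun f _ => ?_
      rcases lt_trichotomy x (a.loading S f) with h | h | h
      · simp [xi, h, h.not_gt, h.ne']
      · simp [xi, ← h]
      · simp [xi, h, h.not_gt, h.ne]
    refine ⟨_, ⟨xi, fun f => ?_, by rwa [hxi], rfl⟩, ?_⟩
    · simp only [xi]
      split_ifs
      · norm_num
      · norm_num
      · exact ⟨hθ1, hθ2⟩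
    · simp only [load_eq, hsum xi, hxi, hxt]
      have : ∑ f, (a.loading S f - x) * xi f = ∑ f, |a.loading S f - x| := by
        refine Finset.sum_congr rfl fun f _ => ?_
        rcases lt_trichotomy x (a.loading S f) with h | h | h
        · simp [xi, h, abs_of_pos (sub_pos.2 h)]
        · simp [← h]
        · simp [xi, h, h.not_gt, abs_of_neg (sub_neg.2 h)]
      rw [this]
      ring
  · rintro _ ⟨_, ⟨xi, hxi, hs, rfl⟩, rfl⟩
    simp only [load_eq, hsum xi]
    have h1 : ∑ f, (a.loading S f - x) * xi f ≤ ∑ f, |a.loading S f - x| :=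
      Finset.sum_le_sum fun f _ => by
        refine (le_abs_self _).trans ?_
        rw [abs_mul]
        exact mul_le_of_le_one_right (abs_nonneg _) (abs_le.2 (hxi f))
    have h2 : x * ∑ f, xi f ≤ |x| * (a.beta * a.F) := by
      refine (le_abs_self _).trans ?_
      rw [abs_mul]
      exact mul_le_mul_of_nonneg_left hs (abs_nonneg _)
    linarith

theorem isWorstCaseLoad_of_nonneg (a : FactorModel) (S : Finset (Fin a.n)) {x : ℝ}
    (hx : Splits (List.ofFn (a.loading S)) (a.F + a.beta * a.F) x) (h0 : 0 ≤ x) :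
    IsWorstCaseLoad a.set S
      (∑ i ∈ S, a.q0 i + |x| * (a.beta * a.F) + ∑ f, |a.loading S f - x|) :=
  a.isWorstCaseLoad S hx (abs_of_nonneg (mul_nonneg a.beta_nonneg (Nat.cast_nonneg _))).le
    (by rw [abs_of_nonneg h0])

theorem isWorstCaseLoad_of_nonpos (a : FactorModel) (S : Finset (Fin a.n)) {x : ℝ}
    (hx : Splits (List.ofFn (a.loading S)) (a.F - a.beta * a.F) x) (h0 : x ≤ 0) :
    IsWorstCaseLoad a.set S
      (∑ i ∈ S, a.q0 i + |x| * (a.beta * a.F) + ∑ f, |a.loading S f - x|) :=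
  a.isWorstCaseLoad S (t := -(a.beta * a.F)) (by rwa [← sub_eq_add_neg])
    (by rw [abs_neg, abs_of_nonneg (mul_nonneg a.beta_nonneg (Nat.cast_nonneg _))])
    (by rw [abs_of_nonpos h0]; ring)

/-- A larger target gives a lower threshold. If the threshold for the sum `βF` is negative and that
for `-βF` is positive, the constraint on the sum does not bind: the multiplier is `0`, and some `t`
between the two bounds is attained. -/
theorem isWorstCaseLoad_zero (a : FactorModel) (S : Finset (Fin a.n)) {x y : ℝ}
    (hx : Splits (List.ofFn (a.loading S)) (a.F + a.beta * a.F) x) (hx0 : x < 0)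
    (hy : Splits (List.ofFn (a.loading S)) (a.F - a.beta * a.F) y) (hy0 : 0 < y) :
    IsWorstCaseLoad a.set S
      (∑ i ∈ S, a.q0 i + |(0 : ℝ)| * (a.beta * a.F) + ∑ f, |a.loading S f - 0|) := by
  have hg : (count (fun v => 0 < v) (List.ofFn (a.loading S)) : ℝ) ≤
      count (fun v => x < v) (List.ofFn (a.loading S)) := by
    exact_mod_cast count_mono (fun v hv => hx0.trans hv) _
  have hl : (count (fun v => y ≤ v) (List.ofFn (a.loading S)) : ℝ) ≤
      count (fun v => 0 ≤ v) (List.ofFn (a.loading S)) := by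
    exact_mod_cast count_mono (fun v hv => hy0.le.trans hv) _
  have hgl : (count (fun v => 0 < v) (List.ofFn (a.loading S)) : ℝ) ≤
      count (fun v => 0 ≤ v) (List.ofFn (a.loading S)) := by
    exact_mod_cast count_mono (fun v hv => le_of_lt hv) _
  have hb : 0 ≤ a.beta * a.F := mul_nonneg a.beta_nonneg (Nat.cast_nonneg _)
  obtain ⟨hx1, -⟩ := hx
  obtain ⟨-, hy2⟩ := hy
  -- The least `t ≥ -βF` that satisfies the first inequality of `Splits` at `0`.
  refine a.isWorstCaseLoad S (t := max (-(a.beta * a.F))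
    (2 * count (fun v => 0 < v) (List.ofFn (a.loading S)) - a.F)) ⟨?_, ?_⟩ ?_ (by simp)
  · have := le_max_right (-(a.beta * a.F))
      (2 * count (fun v => 0 < v) (List.ofFn (a.loading S)) - a.F : ℝ)
    linarith
  · rcases max_choice (-(a.beta * a.F))
      (2 * count (fun v => 0 < v) (List.ofFn (a.loading S)) - a.F : ℝ) with h | h <;> rw [h] <;>
    linarith
  · exact abs_le.2 ⟨le_max_left _ _, max_le (by linarith) (by linarith)⟩

/-- Contents of the machine when it holds the data structure for `S`. -/
structure Rep (a : FactorModel) (S : Finset (Fin a.n)) (s : State) : Prop where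
  nominal : s.rreg 1 = ∑ i ∈ S, a.q0 i
  out : IsWorstCaseLoad a.set S (s.rreg 0)
  loading : ∀ f : Fin a.F, s.rmem f = a.loading S f

/-- Initialization. -/
def start : Program :=
  .seq (block [.nconst 3 0, .rcast 0 3, .rcast 1 3, .rcast 5 3, .nconst 3 1, .ninput 4 1 3]) fill

/-- Update the loadings. -/
def updateLoading : Program :=
  .seq (block [.nconst 3 1, .ninput 4 1 3, .rinput 4 0 0 0, .rmul 4 4 3, .radd 1 1 4])
    (countdown (block [.rinput 4 1 0 4, .rmul 4 4 3, .rload 5 4, .radd 5 5 4, .rstore 4 5]))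

/-- Copy the loadings. -/
def copyLoading : Program :=
  .seq (block [.nconst 3 1, .ninput 4 1 3, .nmove 10 4, .nmove 11 4, .rinput 6 2 3 3, .rcast 7 4,
    .rmul 2 6 7])
    (countdown (block [.rload 5 4, .nadd 5 4 10, .rstore 5 5]))

/-- Compute the optimal multiplier of the cardinality constraint, in real register `3`. -/
def multiplier : Program :=
  .seq copyLoading (.seq (block [.radd 11 7 2]) (.seq select
    (.seq (block [.rmove 3 10, .nconst 3 0, .rcast 4 3])
      (.branch (.rle 4 3) .skip (.seq copyLoading (.seq (block [.rsub 11 7 2]) (.seq select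
        (.seq (block [.rmove 3 10]) (.branch (.rle 3 4) .skip (block [.rmove 3 4]))))))))))

/-- Evaluate the dual function. -/
def dualValue : Program :=
  .seq (.branch (.rle 3 4) (block [.rsub 5 4 3]) (block [.rmove 5 3]))
    (.seq (block [.rmul 5 5 2, .radd 0 1 5, .nconst 3 1, .ninput 4 1 3])
      (countdown (.seq (block [.rload 5 4, .rsub 5 5 3])
        (.branch (.rle 5 4) (block [.rsub 0 0 5]) (block [.radd 0 0 5])))))

/-- Addition or removal of the customer in integer register `0`, depending on real register `3`. -/
def update : Program := .seq updateLoading (.seq multiplier dualValue)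

theorem isWorstCaseLoad_empty (a : FactorModel) : IsWorstCaseLoad a.set ∅ 0 := by
  refine ⟨⟨_, ⟨0, fun f => by simp, ?_, rfl⟩, by simp⟩, ?_⟩
  · simpa using mul_nonneg a.beta_nonneg (Nat.cast_nonneg a.F)
  · rintro _ ⟨q, -, rfl⟩
    simp

section Runs

variable (a : FactorModel) {lim : Limits} {query : List ℕ}

theorem runs_start {s : State} (hm : 4 * a.F ≤ lim.mem) (hw : 10 * (a.n + a.F + 2) ≤ lim.word) :
    Runs lim (a.toInstance.input query) start s (15 * a.F) (fun s' => a.Rep ∅ s' ∧ s.Keeps s') := by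
  have hF := a.F_pos
  refine Runs.seq (T := 6) (U := a.F * 3 + 1) (P := fun s' => s'.rreg 0 = 0 ∧ s'.rreg 1 = 0 ∧
      s'.rreg 5 = 0 ∧ s'.nreg 3 = 1 ∧ s'.nreg 4 = a.F ∧ s.Keeps s')
    (Runs.of_pre ?_ le_rfl) (fun s₁ h₁ => (runs_fill (n := a.F) (by omega) (by omega)
      h₁.2.2.2.1 h₁.2.2.2.2.1 le_rfl).mono le_rfl fun s₂ h₂ => ?_) (by omega)
  · simp [block, Program.Pre, Instr.Safe, Instr.next, Instance.input, toInstance, State.Keeps]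
    omega
  · obtain ⟨h0, h1, h5, -, -, hk⟩ := h₁
    refine ⟨⟨by simp [h₂.1, h1], by rw [h₂.1, h0]; exact a.isWorstCaseLoad_empty,
      fun f => by simp [h₂.2.2.2 f f.2, h5, FactorModel.loading]⟩, ?_, ?_⟩
    · rw [h₂.2.2.1 _ (by omega), hk.1]
    · rw [h₂.2.2.1 _ (by omega), hk.2]

/-- The loadings and the nominal load are up to date. -/
structure Loaded (S : Finset (Fin a.n)) (s s' : State) : Prop where
  nominal : s'.rreg 1 = ∑ i ∈ S, a.q0 i
  loading : ∀ f : Fin a.F, s'.rmem f = a.loading S f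
  keeps : s.Keeps s'

theorem runs_updateLoading {s : State} (hm : 4 * a.F ≤ lim.mem)
    (hw : 10 * (a.n + a.F + 2) ≤ lim.word) {S S' : Finset (Fin a.n)} {j : Fin a.n} {σ : ℝ}
    (hs : a.Rep S s) (h : Toggle S S' j σ) (h0 : s.nreg 0 = j.val) (hσ : s.rreg 3 = σ) :
    Runs lim (a.toInstance.input query) updateLoading s (7 * a.F + 6) (a.Loaded S' s) := by
  refine Runs.seq (T := 5) (U := a.F * 7 + 1) (P := fun s' => s'.rreg 1 = ∑ i ∈ S', a.q0 i ∧
      s'.rmem = s.rmem ∧ s'.nreg 0 = j.val ∧ s'.rreg 3 = σ ∧ s'.nreg 3 = 1 ∧ s'.nreg 4 = a.F ∧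
      s.Keeps s')
    (Runs.of_pre ?_ le_rfl) (fun s₁ h₁ => ?_) (by omega)
  · rw [h.sum]
    simp [block, Program.Pre, Instr.Safe, Instr.next, Instance.input, toInstance, State.Keeps, h0,
      hσ, hs.nominal, mul_comm σ]
    omega
  · obtain ⟨h1, hmem, hj0, h3, hn3, hn4, hk⟩ := h₁
    refine (runs_countdown (t := 5) (n := a.F) (fun i s' => s'.rreg 1 = s₁.rreg 1 ∧
      s'.rreg 3 = s₁.rreg 3 ∧ s'.nreg 0 = s₁.nreg 0 ∧ s₁.Keeps s' ∧
      ∀ k : Fin a.F, s'.rmem k = if i ≤ k then a.loading S' k else a.loading S k)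
      (fun i s v h => by simpa [State.Keeps] using h) (by omega)
      (fun i s₂ hi h₂ hn3 hn4 => Runs.of_pre ?_ le_rfl) ?_ hn3 hn4 le_rfl).mono le_rfl fun s' h' => ?_
    · obtain ⟨g1, g3, gn, gk, gm⟩ := h₂
      have hi' := gm ⟨i, hi⟩
      have ha := array2_matrix a.Psi j ⟨i, hi⟩
      simp only at hi' ha
      rw [if_neg (by omega)] at hi'
      have hval : a.loading S ⟨i, hi⟩ + a.Psi j ⟨i, hi⟩ * σ = a.loading S' ⟨i, hi⟩ := by
        rw [FactorModel.loading, FactorModel.loading, h.sum]; ring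
      simp [block, Program.Pre, Instr.Safe, Instr.next, Instance.input, toInstance, State.Keeps,
        g1, g3, gn, gk.1, gk.2, hn3, hn4, hj0, h3, hi', ha, hval, Function.update_apply]
      refine ⟨by omega, fun k => ?_⟩
      rcases eq_or_ne (k : ℕ) i with hki | hki
      · obtain rfl : k = ⟨i, hi⟩ := Fin.ext hki
        simp
      · rw [if_neg hki, gm k]
        by_cases hik : i + 1 ≤ k
        · rw [if_pos hik, if_pos (by omega)]
        · rw [if_neg hik, if_neg (by omega)]
    · refine ⟨rfl, rfl, rfl, ⟨rfl, rfl⟩, fun k => ?_⟩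
      rw [if_neg (by omega), hmem, hs.loading]
    · obtain ⟨g1, g3, gn, gk, gm⟩ := h'
      exact ⟨by rw [g1, h1], fun i => by simp [gm i], by rw [gk.1, hk.1], by rw [gk.2, hk.2]⟩

theorem runs_copyLoading {s₀ s : State} (hm : 4 * a.F ≤ lim.mem)
    (hw : 10 * (a.n + a.F + 2) ≤ lim.word) {S : Finset (Fin a.n)} (hs : a.Loaded S s₀ s) :
    Runs lim (a.toInstance.input query) copyLoading s (5 * a.F + 8) (fun s' => a.Loaded S s₀ s' ∧
      s'.nreg 10 = a.F ∧ s'.nreg 11 = a.F ∧ s'.rreg 7 = a.F ∧ s'.rreg 2 = a.beta * a.F ∧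
      s'.rreg 3 = s.rreg 3 ∧ s'.rreg 4 = s.rreg 4 ∧ Seg s'.rmem a.F (List.ofFn (a.loading S))) := by
  refine Runs.seq (T := 7) (U := a.F * 5 + 1) (P := fun s' => a.Loaded S s₀ s' ∧
      s'.nreg 10 = a.F ∧ s'.nreg 11 = a.F ∧ s'.rreg 7 = a.F ∧ s'.rreg 2 = a.beta * a.F ∧
      s'.rreg 3 = s.rreg 3 ∧ s'.rreg 4 = s.rreg 4 ∧ s'.nreg 3 = 1 ∧ s'.nreg 4 = a.F)
    (Runs.of_pre ?_ le_rfl) (fun s₁ h₁ => ?_) (by omega)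
  · simp [block, Program.Pre, Instr.Safe, Instr.next, Instance.input, toInstance]
    refine ⟨by omega, by omega, ⟨by simpa using hs.nominal, by simpa using hs.loading, ?_⟩⟩
    simpa [State.Keeps] using hs.keeps
  · obtain ⟨h1, h10, h11, h7, h2, h3, h4, hn3, hn4⟩ := h₁
    refine (runs_countdown (t := 3) (n := a.F) (fun i s' => a.Loaded S s₀ s' ∧
      s'.nreg 10 = a.F ∧ s'.nreg 11 = a.F ∧ s'.rreg 7 = a.F ∧ s'.rreg 2 = a.beta * a.F ∧
      s'.rreg 3 = s.rreg 3 ∧ s'.rreg 4 = s.rreg 4 ∧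
      ∀ k : Fin a.F, i ≤ k → s'.rmem (a.F + k) = a.loading S k)
      (fun i s v h => ⟨⟨h.1.nominal, h.1.loading, by simpa [State.Keeps] using h.1.keeps⟩,
        by simpa using h.2⟩) (by omega)
      (fun i s₂ hi h₂ hn3 hn4 => Runs.of_pre ?_ le_rfl)
      ⟨h1, h10, h11, h7, h2, h3, h4, fun k hk => by omega⟩ hn3 hn4 le_rfl).mono le_rfl
      fun s' h' => ?_
    · obtain ⟨g1, g10, g11, g7, g2, g3, g4, gm⟩ := h₂
      have hi' := g1.loading ⟨i, hi⟩
      simp only at hi'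
      simp [block, Program.Pre, Instr.Safe, Instr.next, hn3, hn4, g10, g11, g7, g2, g3, g4, hi',
        Function.update_apply]
      refine ⟨by omega, by omega, by omega, ⟨by simpa using g1.nominal, fun f => ?_,
        by simpa [State.Keeps] using g1.keeps⟩, fun k hk => ?_⟩
      · simp [show (f : ℕ) ≠ i + a.F by omega, g1.loading f]
      · by_cases hki : (k : ℕ) = i
        · obtain rfl : k = ⟨i, hi⟩ := Fin.ext hki
          simp [add_comm]
        · rw [if_neg (by omega)]
          exact gm k (by omega)
    · obtain ⟨g1, g10, g11, g7, g2, g3, g4, gm⟩ := h'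
      refine ⟨g1, g10, g11, g7, g2, g3, g4, seg_of_getElem fun i hi => ?_⟩
      rw [List.length_ofFn] at hi
      rw [List.getElem_ofFn]
      exact gm ⟨i, hi⟩ (Nat.zero_le _)

/-- Selection destroys its list, so it works on a copy behind the loadings, and the second selection
gets a fresh one. The loadings themselves are below the base of the copy and survive by
`State.SelectFrame`. -/
theorem runs_multiplier {s₀ s : State} (hm : 4 * a.F ≤ lim.mem)
    (hw : 10 * (a.n + a.F + 2) ≤ lim.word) {S : Finset (Fin a.n)} (hs : a.Loaded S s₀ s) :
    Runs lim (a.toInstance.input query) multiplier s (3000 * a.F + 50) (fun s' =>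
      a.Loaded S s₀ s' ∧ s'.rreg 2 = a.beta * a.F ∧ s'.rreg 4 = 0 ∧ IsWorstCaseLoad a.set S
        (∑ i ∈ S, a.q0 i + |s'.rreg 3| * (a.beta * a.F) + ∑ f, |a.loading S f - s'.rreg 3|)) := by
  have hF := a.F_pos
  have hne : List.ofFn (a.loading S) ≠ [] := by
    rw [← List.length_pos_iff, List.length_ofFn]; exact hF
  have hb0 : 0 ≤ a.beta * a.F := mul_nonneg a.beta_nonneg (Nat.cast_nonneg _)
  have hb1 : a.beta * a.F ≤ a.F := mul_le_of_le_one_left (Nat.cast_nonneg _) a.beta_le_one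
  have hsel : ∀ (τ : ℝ) (s : State), 0 ≤ τ → τ ≤ 2 * a.F → a.Loaded S s₀ s →
      s.nreg 10 = a.F → s.nreg 11 = a.F → s.rreg 11 = τ → s.rreg 2 = a.beta * a.F →
      Seg s.rmem a.F (List.ofFn (a.loading S)) →
      Runs lim (a.toInstance.input query) select s (1440 * a.F + 6) (fun s' => a.Loaded S s₀ s' ∧
        s'.rreg 2 = a.beta * a.F ∧ s'.rreg 4 = s.rreg 4 ∧
        Splits (List.ofFn (a.loading S)) τ (s'.rreg 10)) := by
    intro τ s h0 h2 hl h10 h11 hτ hβ hseg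
    have := runs_select (lim := lim) (inp := a.toInstance.input query) hne
      (by rw [h10]; exact hseg) (by rw [h11, List.length_ofFn]) hτ h0
      (by rw [List.length_ofFn]; exact h2) (by rw [h10, List.length_ofFn]; omega)
      (by rw [h10, List.length_ofFn]; omega) (by omega)
    rw [List.length_ofFn] at this
    refine this.mono le_rfl fun s' hs' => ?_
    obtain ⟨⟨hlow, hmem⟩, hsp⟩ := hs'
    refine ⟨⟨?_, fun f => ?_, ?_, ?_⟩, ?_, (hlow 4 (by omega)).2, hsp⟩
    · rw [(hlow 1 (by omega)).2, hl.nominal]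
    · rw [hmem f (by rw [h10]; exact f.2), hl.loading]
    · rw [(hlow 1 (by omega)).1, hl.keeps.1]
    · rw [(hlow 2 (by omega)).1, hl.keeps.2]
    · rw [(hlow 2 (by omega)).2, hβ]
  refine Runs.seq (U := 2900 * a.F + 40) (runs_copyLoading a hm hw hs) (fun s₁ h₁ => ?_) (by omega)
  obtain ⟨l1, h10, h11, h7, h2, -, -, hseg⟩ := h₁
  refine Runs.seq (T := 1) (U := 2900 * a.F + 39) (P := fun s' => a.Loaded S s₀ s' ∧
    s'.nreg 10 = a.F ∧ s'.nreg 11 = a.F ∧ s'.rreg 11 = a.F + a.beta * a.F ∧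
    s'.rreg 2 = a.beta * a.F ∧ Seg s'.rmem a.F (List.ofFn (a.loading S)))
    (Runs.of_pre ?_ le_rfl) (fun s₂ h₂ => ?_) (by omega)
  · simp [block, Program.Pre, Instr.Safe, Instr.next, h10, h11, h7, h2, hseg]
    exact ⟨by simpa using l1.nominal, l1.loading, l1.keeps⟩
  obtain ⟨l2, h10, h11, hτ, h2, hseg⟩ := h₂
  refine Runs.seq (U := 1450 * a.F + 33) (hsel _ s₂ (by linarith) (by linarith) l2 h10 h11 hτ h2 hseg)
    (fun s₃ h₃ => ?_) (by omega)
  obtain ⟨l3, h2, -, hsplit⟩ := h₃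
  refine Runs.seq (T := 3) (U := 1450 * a.F + 30) (P := fun s' => a.Loaded S s₀ s' ∧
    s'.rreg 2 = a.beta * a.F ∧ s'.rreg 4 = 0 ∧
    Splits (List.ofFn (a.loading S)) (a.F + a.beta * a.F) (s'.rreg 3))
    (Runs.of_pre ?_ le_rfl) (fun s₄ h₄ => ?_) (by omega)
  · simp [block, Program.Pre, Instr.Safe, Instr.next, h2, hsplit]
    exact ⟨by simpa using l3.nominal, l3.loading, by simpa [State.Keeps] using l3.keeps⟩
  obtain ⟨l4, h2, h4, hsplit⟩ := h₄
  refine Runs.branch (T := 1450 * a.F + 29) (fun hle => ?_) (fun hnle => ?_) (by omega)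
  · simp only [Test.Holds, h4] at hle
    refine Runs.of_pre ?_ (by simp [Program.cost])
    exact ⟨l4, h2, h4, a.isWorstCaseLoad_of_nonneg S hsplit hle⟩
  simp only [Test.Holds, h4, not_le] at hnle
  refine Runs.seq (U := 1445 * a.F + 21) (runs_copyLoading a hm hw l4) (fun s₅ h₅ => ?_) (by omega)
  obtain ⟨l5, h10, h11, h7, h2, h3, h4', hseg⟩ := h₅
  rw [h4] at h4'
  refine Runs.seq (T := 1) (U := 1445 * a.F + 20) (P := fun s' => a.Loaded S s₀ s' ∧
    s'.nreg 10 = a.F ∧ s'.nreg 11 = a.F ∧ s'.rreg 11 = a.F - a.beta * a.F ∧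
    s'.rreg 2 = a.beta * a.F ∧ s'.rreg 4 = 0 ∧ Seg s'.rmem a.F (List.ofFn (a.loading S)))
    (Runs.of_pre ?_ le_rfl) (fun s₆ h₆ => ?_) (by omega)
  · simp [block, Program.Pre, Instr.Safe, Instr.next, h10, h11, h7, h2, hseg, h4']
    exact ⟨by simpa using l5.nominal, l5.loading, l5.keeps⟩
  obtain ⟨l6, h10, h11, hτ, h2, h4'', hseg⟩ := h₆
  refine Runs.seq (U := 14) (hsel _ s₆ (by linarith) (by linarith) l6 h10 h11 hτ h2 hseg)
    (fun s₇ h₇ => ?_) (by omega)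
  obtain ⟨l7, h2, h47, hsplit'⟩ := h₇
  rw [h4''] at h47
  refine Runs.seq (T := 1) (U := 13) (P := fun s' => a.Loaded S s₀ s' ∧
    s'.rreg 2 = a.beta * a.F ∧ s'.rreg 4 = 0 ∧
    Splits (List.ofFn (a.loading S)) (a.F - a.beta * a.F) (s'.rreg 3))
    (Runs.of_pre ?_ le_rfl) (fun s₈ h₈ => ?_) (by omega)
  · simp [block, Program.Pre, Instr.Safe, Instr.next, h2, hsplit', h47]
    exact ⟨by simpa using l7.nominal, l7.loading, l7.keeps⟩
  obtain ⟨l8, h2, h4, hsplit'⟩ := h₈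
  refine Runs.branch (T := 12) (fun hle => ?_) (fun hnle' => ?_) (by omega)
  · simp only [Test.Holds, h4] at hle
    refine Runs.of_pre ?_ (by simp [Program.cost])
    exact ⟨l8, h2, h4, a.isWorstCaseLoad_of_nonpos S hsplit' hle⟩
  · simp only [Test.Holds, h4, not_le] at hnle'
    refine Runs.of_pre ?_ (show 1 ≤ 12 by omega)
    have := a.isWorstCaseLoad_zero S hsplit hnle hsplit' hnle'
    simp only [block, Program.Pre, Instr.Safe, Instr.next, State.setR_rreg, h4, true_and]
    simp only [if_true]
    exact ⟨⟨by simpa using l8.nominal, l8.loading, l8.keeps⟩, by simpa using h2, by simp [h4],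
      this⟩

theorem runs_dualValue {s₀ s : State} (hm : 4 * a.F ≤ lim.mem)
    (hw : 10 * (a.n + a.F + 2) ≤ lim.word) {S : Finset (Fin a.n)} (hs : a.Loaded S s₀ s)
    (h2 : s.rreg 2 = a.beta * a.F) (h4 : s.rreg 4 = 0) :
    Runs lim (a.toInstance.input query) dualValue s (6 * a.F + 10) (fun s' => a.Loaded S s₀ s' ∧
      s'.rreg 0 = ∑ i ∈ S, a.q0 i + |s.rreg 3| * (a.beta * a.F) +
        ∑ f, |a.loading S f - s.rreg 3|) := by
  refine Runs.seq (T := 2) (U := 6 * a.F + 5) (P := fun s' => a.Loaded S s₀ s' ∧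
    s'.rreg 2 = a.beta * a.F ∧ s'.rreg 4 = 0 ∧ s'.rreg 3 = s.rreg 3 ∧ s'.rreg 5 = |s.rreg 3|)
    (Runs.of_pre ?_ le_rfl) (fun s₁ h₁ => ?_) (by omega)
  · simp [block, Program.Pre, Instr.Safe, Instr.next, Test.Holds, h2, h4]
    exact ⟨fun h => ⟨⟨by simpa using hs.nominal, hs.loading, hs.keeps⟩, (abs_of_nonpos h).symm⟩,
      fun h => ⟨⟨by simpa using hs.nominal, hs.loading, hs.keeps⟩, (abs_of_pos h).symm⟩⟩
  obtain ⟨l1, h2, h4, h3, h5⟩ := h₁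
  refine Runs.seq (T := 4) (U := a.F * 6 + 1) (P := fun s' => a.Loaded S s₀ s' ∧
    s'.rreg 0 = ∑ i ∈ S, a.q0 i + |s.rreg 3| * (a.beta * a.F) ∧ s'.rreg 4 = 0 ∧
    s'.rreg 3 = s.rreg 3 ∧ s'.nreg 3 = 1 ∧ s'.nreg 4 = a.F)
    (Runs.of_pre ?_ le_rfl) (fun s₂ h₂ => ?_) (by omega)
  · simp [block, Program.Pre, Instr.Safe, Instr.next, Instance.input, toInstance, h2, h4, h3, h5,
      l1.nominal]
    exact ⟨by omega, by omega, ⟨by simpa using l1.nominal, l1.loading,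
      by simpa [State.Keeps] using l1.keeps⟩⟩
  obtain ⟨l2, h0, h4, h3, hn3, hn4⟩ := h₂
  refine (runs_countdown (t := 4) (n := a.F) (fun i s' => a.Loaded S s₀ s' ∧
    s'.rreg 3 = s.rreg 3 ∧ s'.rreg 4 = 0 ∧
    s'.rreg 0 = ∑ i ∈ S, a.q0 i + |s.rreg 3| * (a.beta * a.F) +
      ∑ f with i ≤ f.val, |a.loading S f - s.rreg 3|)
    (fun i s v h => ⟨⟨h.1.nominal, h.1.loading, by simpa [State.Keeps] using h.1.keeps⟩, h.2⟩)
    (by omega) (fun i s₃ hi h₃ hn3 hn4 => Runs.of_pre ?_ le_rfl) ⟨l2, h3, h4, ?_⟩ hn3 hn4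
    le_rfl).mono le_rfl fun s' h' => ?_
  · obtain ⟨g1, g3, g4, g0⟩ := h₃
    have hi' := g1.loading ⟨i, hi⟩
    have hset : (Finset.univ.filter fun f : Fin a.F => i ≤ f.val) =
        insert ⟨i, hi⟩ (Finset.univ.filter fun f : Fin a.F => i + 1 ≤ f.val) := by
      ext k
      simp [Fin.ext_iff]
      omega
    have hL : ∀ s' : State, s'.rmem = s₃.rmem → s'.nreg = s₃.nreg → s'.rreg 1 = s₃.rreg 1 →
        a.Loaded S s₀ s' := fun s' e1 e2 e3 => ⟨by rw [e3, g1.nominal],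
          fun f => by rw [e1, g1.loading], by rw [State.Keeps, e2]; exact g1.keeps⟩
    simp only at hi'
    rw [hset, Finset.sum_insert (by simp)]
    simp [block, Program.Pre, Instr.Safe, Instr.next, Test.Holds, hn3, hn4, g0, g3, g4, hi']
    refine ⟨by omega, fun h => ⟨hL _ rfl rfl rfl, ?_⟩, fun h => ⟨hL _ rfl rfl rfl, ?_⟩⟩
    · rw [abs_of_nonpos (sub_nonpos.2 h)]; ring
    · rw [abs_of_pos (sub_pos.2 h)]; ring
  · rw [h0, Finset.filter_false_of_mem (fun k _ => by have := k.2; omega)]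
    simp
  · refine ⟨h'.1, ?_⟩
    rw [h'.2.2.2]
    simp

theorem runs_update {s : State} (hm : 4 * a.F ≤ lim.mem) (hw : 10 * (a.n + a.F + 2) ≤ lim.word)
    {S S' : Finset (Fin a.n)} {j : Fin a.n} {σ : ℝ} (hs : a.Rep S s) (h : Toggle S S' j σ)
    (h0 : s.nreg 0 = j.val) (hσ : s.rreg 3 = σ) :
    Runs lim (a.toInstance.input query) update s (3100 * a.F)
      (fun s' => a.Rep S' s' ∧ s.Keeps s') := by
  have hF := a.F_pos
  refine Runs.seq (U := 3006 * a.F + 60) (a.runs_updateLoading hm hw hs h h0 hσ) (fun s₁ l1 => ?_)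
    (by omega)
  refine Runs.seq (U := 6 * a.F + 10) (a.runs_multiplier hm hw l1) (fun s₂ h₂ => ?_) (by omega)
  obtain ⟨l2, h2, h4, hv⟩ := h₂
  refine (a.runs_dualValue hm hw l2 h2 h4).mono le_rfl fun s' h' => ?_
  exact ⟨⟨h'.1.nominal, by rw [h'.2]; exact hv, h'.1.loading⟩, h'.1.keeps⟩

end Runs

/-- The data structure for factor models. -/
noncomputable def maintenance (T : FactorModel → ℕ) (hT : ∀ a, a.F ≤ 2 * T a) :
    Maintenance True FactorModel.toInstance (fun a => a.F) (fun a _ => T a) (fun a => a.F) :=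
  -- `6200 = 2 · 3100`, since the update takes `3100 F` steps and `F ≤ 2 T`.
  .ofToggle _ _ T _ start update 6200 (fun a => by have := hT a; have := a.F_pos; omega) Rep
    (fun (a : FactorModel) S s s' h hs => ⟨by rw [h.rreg, hs.nominal], by rw [h.rreg]; exact hs.out,
      by rw [h.rmem]; exact hs.loading⟩)
    (fun (a : FactorModel) S s s' σ h hs => ⟨by rw [h.rreg _ (by simp) (by simp), hs.nominal],
      by rw [h.rreg _ (by simp) (by simp)]; exact hs.out, by rw [h.rmem]; exact hs.loading⟩)
    (fun (a : FactorModel) S s hs => hs.out)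
    (fun (a : FactorModel) lim query s hm hw => (a.runs_start (le_trans (by omega) hm)
      (le_trans (by simp [toInstance]) hw)).mono (by omega) fun _ => id)
    (fun (a : FactorModel) lim query S S' s j σ hm hw hs h h0 hσ =>
      (a.runs_update (le_trans (by omega) hm) (le_trans (by simp [toInstance]) hw) hs h h0
        hσ).mono (by have := hT a; omega) fun _ => id)

/-- The update is linear in `F`; the logarithm of the table is slack. The summand `1` matters for `F
= 1`, where the logarithm vanishes. -/
theorem incrementallyUpdatable : IncrementallyUpdatable True FactorModel.toInstance
    (fun a _ => a.F * Nat.log 2 a.F + 1) (fun a => a.F) :=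
  (maintenance (fun a => a.F * Nat.log 2 a.F + 1) fun a => by
    rcases Nat.lt_or_ge a.F 2 with h | h
    · omega
    · have := Nat.mul_le_mul_left a.F (Nat.log_pos one_lt_two h)
      omega).incrementallyUpdatable (fun a => by simp [toInstance])
    (fun a => by simp [toInstance]; omega) (fun _ _ => by omega)

theorem computableFromScratch : ComputableFromScratch FactorModel.toInstance
    (fun a k => k * a.F + a.F * Nat.log 2 a.F + 1) :=
  (maintenance (fun a => a.F) fun a => by omega).computableFromScratch (C := 2) (τ := fun a => a.F)
    (fun a => by simp [toInstance]) (fun a => by simp [toInstance]; omega) (fun _ _ => by omega)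
    (fun _ _ => le_rfl) (fun a => a.F_pos) (fun a k hk _ => by nlinarith)

end FactorModel

/-! ### Cardinality-constrained sets: computation from scratch -/

open Classical in
theorem count_map {n : ℕ} (P : ℝ → Prop) (h : Fin n → ℝ) {R : List (Fin n)} (hR : R.Nodup) :
    count P (R.map h) = (R.toFinset.filter fun i => P (h i)).card := by
  induction R with
  | nil => simp [count_nil]
  | cons j R ih =>
    obtain ⟨hj, hR⟩ := List.nodup_cons.1 hR
    rw [List.map_cons, count_cons, ih hR, List.toFinset_cons, Finset.filter_insert]
    split_ifs
    · rw [Finset.card_insert_of_notMem (by simp [hj])]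
    · rfl

namespace Cardinality

open Classical in
/-- Linear programming duality: `x` is the multiplier of the cardinality constraint. -/
theorem isWorstCaseLoad (a : Cardinality) (S : Finset (Fin a.n)) {x : ℝ} (hx : 0 ≤ x)
    (hle : ((S.filter fun i => x < a.qhat i).card : ℝ) ≤ a.Gamma)
    (hge : x = 0 ∨ a.Gamma ≤ (S.filter fun i => x ≤ a.qhat i).card) :
    IsWorstCaseLoad a.set S
      (∑ i ∈ S, a.q0 i + a.Gamma * x + ∑ i ∈ S, max 0 (a.qhat i - x)) := by
  have hsum : ∀ xi : Fin a.n → ℝ, ∑ i ∈ S, (a.q0 + a.qhat * xi) i =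
      ∑ i ∈ S, a.q0 i + x * ∑ i ∈ S, xi i + ∑ i ∈ S, (a.qhat i - x) * xi i := fun xi => by
    rw [Finset.mul_sum, ← Finset.sum_add_distrib, ← Finset.sum_add_distrib]
    exact Finset.sum_congr rfl fun i _ => by simp only [Pi.add_apply, Pi.mul_apply]; ring
  set p : ℝ := ((S.filter fun i => x < a.qhat i).card : ℝ) with hp
  set e : ℝ := ((S.filter fun i => a.qhat i = x).card : ℝ) with he
  have hpe : ((S.filter fun i => x ≤ a.qhat i).card : ℝ) = p + e := by
    rw [hp, he, ← Nat.cast_add, ← Finset.card_union_of_disjoint]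
    · congr 2
      ext i
      simp only [Finset.mem_filter, Finset.mem_union, le_iff_lt_or_eq, eq_comm (a := x)]
      tauto
    · exact Finset.disjoint_filter.2 fun i _ h h' => h.ne' h'
  rw [hpe] at hge
  have he0 : 0 ≤ e := Nat.cast_nonneg _
  -- `p` customers lie above the threshold and `e` on it. The former deviate fully and the latter by
  -- the common fraction `t` that exhausts `Γ`; if `x = 0`, the ties contribute nothing and `t = 0`
  -- will do.
  obtain ⟨t, ht0, ht1, htle, htx⟩ : ∃ t : ℝ, 0 ≤ t ∧ t ≤ 1 ∧ p + t * e ≤ a.Gamma ∧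
      x * (p + t * e) = a.Gamma * x := by
    rcases hge with rfl | hge
    · exact ⟨0, le_rfl, zero_le_one, by simpa using hle, by simp⟩
    · rcases he0.eq_or_lt with h | h
      · refine ⟨0, le_rfl, zero_le_one, by simpa using hle, ?_⟩
        rw [le_antisymm (by simpa [← h] using hge) hle]
        ring
      · refine ⟨(a.Gamma - p) / e, div_nonneg (by linarith) he0, (div_le_one h).2 (by linarith), ?_,
          ?_⟩ <;> rw [div_mul_cancel₀ _ h.ne']
        · linarith
        · ring
  constructor
  · let xi : Fin a.n → ℝ := fun i =>
      if i ∈ S then (if x < a.qhat i then 1 else 0) + t * (if a.qhat i = x then 1 else 0) else 0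
    have hxi : ∀ i, 0 ≤ xi i ∧ xi i ≤ 1 := fun i => by
      simp only [xi]
      split_ifs with h1 h2 h3 h3
      · exact absurd h3 h2.ne'
      all_goals constructor <;> linarith
    have htot : ∑ i ∈ S, xi i = p + t * e := by
      have : ∀ i ∈ S, xi i = (if x < a.qhat i then 1 else 0) + t * (if a.qhat i = x then 1 else 0) :=
        fun i hi => by simp [xi, hi]
      rw [Finset.sum_congr rfl this, Finset.sum_add_distrib, ← Finset.mul_sum, Finset.sum_boole,
        Finset.sum_boole]
    refine ⟨a.q0 + a.qhat * xi, ⟨⟨fun i => ?_, fun i => ?_⟩, xi, hxi, ?_, rfl⟩, ?_⟩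
    · simpa using mul_nonneg (a.qhat_nonneg i) (hxi i).1
    · simpa using mul_le_of_le_one_right (a.qhat_nonneg i) (hxi i).2
    · rw [← Finset.sum_subset (Finset.subset_univ S) fun i _ hi => by simp [xi, hi], htot]
      exact htle
    · simp only [hsum, htot, htx]
      congr 1
      refine Finset.sum_congr rfl fun i hi => ?_
      simp only [xi, hi, if_true]
      rcases lt_trichotomy x (a.qhat i) with h | h | h
      · simp [h, h.ne', h.le]
      · simp [h]
      · simp [h.not_gt, h.ne, h.le]
  · rintro _ ⟨_, ⟨-, xi, hxi, htot, rfl⟩, rfl⟩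
    simp only [hsum]
    have h1 : ∑ i ∈ S, xi i ≤ a.Gamma :=
      (Finset.sum_le_sum_of_subset_of_nonneg (Finset.subset_univ S) fun i _ _ => (hxi i).1).trans
        htot
    have h2 : ∑ i ∈ S, (a.qhat i - x) * xi i ≤ ∑ i ∈ S, max 0 (a.qhat i - x) :=
      Finset.sum_le_sum fun i _ => (mul_le_mul_of_nonneg_right (le_max_right 0 _) (hxi i).1).trans
        (mul_le_of_le_one_right (le_max_left 0 _) (hxi i).2)
    nlinarith [mul_le_mul_of_nonneg_left h1 hx]

/-- Copy the deviations of the customers of the query and sum up. -/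
def collect : Program :=
  .seq (block [.nconst 3 0, .rcast 1 3, .rcast 2 3, .rcast 5 3, .rinput 3 2 3 3])
    (forQuery (block [.rinput 4 0 0 0, .radd 1 1 4, .rinput 4 1 0 0, .radd 2 2 4, .rstore 3 4,
      .nconst 4 1, .nadd 3 3 4]))

/-- Add the part of each deviation that exceeds real register `7`. -/
def addExcess : Program :=
  forQuery (.seq (block [.rinput 4 1 0 0, .rsub 4 4 7])
    (.branch (.rle 4 5) .skip (block [.radd 0 0 4])))

/-- Computation from scratch. -/
def scratch : Program :=
  .seq collect (.seq (block [.rcast 4 3]) (.branch (.rle 4 3) (block [.radd 0 1 2])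
    (.seq (block [.nconst 10 0, .nmove 11 3, .radd 11 3 3]) (.seq select
      (.seq (block [.rmove 7 10, .rmul 4 3 7, .radd 0 1 4]) addExcess)))))

section Runs

variable (a : Cardinality) {lim : Limits} {R : List (Fin a.n)}

/-- The first `k` customers of `R` have been collected. -/
structure Collected (R : List (Fin a.n)) (k : ℕ) (s : State) : Prop where
  nominal : s.rreg 1 = ((R.take k).map a.q0).sum
  deviation : s.rreg 2 = ((R.take k).map a.qhat).sum
  gamma : s.rreg 3 = a.Gamma
  zero : s.rreg 5 = 0
  number : s.nreg 3 = k
  cells : ∀ i (_ : i < R.length), i < k → s.rmem i = a.qhat R[i]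

theorem runs_forCustomers (hw : 2 * (a.n + 2) ≤ lim.word) (hR : R.Nodup) {p : Program} {t : ℕ}
    (I : ℕ → State → Prop) (hI : ∀ i s s', s.Agree s' → I i s → I i s')
    (hp : ∀ i (hi : i < R.length) s, I i s → s.nreg 0 = (R[i] : ℕ) →
      Runs lim (a.toInstance.input (routeQuery R)) p s t (fun s' => I (i + 1) s' ∧ s.Keeps s'))
    {s : State} (hs : I 0 s) {u : ℕ} (hu : R.length * (t + 4) + 4 ≤ u) :
    Runs lim (a.toInstance.input (routeQuery R)) (forQuery p) s u (I R.length) :=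
  runs_forQuery a.toInstance le_rfl le_rfl hw hR I hI hp hs hu

theorem runs_collect (hR : R.Nodup) (hm : 2 * (a.n + 2) ≤ lim.mem) (hw : 2 * (a.n + 2) ≤ lim.word)
    {s : State} : Runs lim (a.toInstance.input (routeQuery R)) collect s (R.length * 11 + 9)
      (a.Collected R R.length) := by
  have hl := length_le hR
  refine Runs.seq (T := 5) (P := a.Collected R 0) (Runs.of_pre ?_ le_rfl) (fun s₁ h₁ =>
    a.runs_forCustomers (t := 7) hw hR (fun k s => a.Collected R k s)
      (fun k s s' h hs => ⟨by rw [h.rreg, hs.nominal], by rw [h.rreg, hs.deviation],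
        by rw [h.rreg, hs.gamma], by rw [h.rreg, hs.zero], by rw [h.nreg 3 le_rfl, hs.number],
        fun i hi => by rw [h.rmem]; exact hs.cells i hi⟩)
      (fun k hk s hs h0 => Runs.of_pre ?_ le_rfl) h₁ le_rfl) (by omega)
  · simp [block, Program.Pre, Instr.Safe, Instr.next, Instance.input, toInstance]
    exact ⟨by simp, by simp, by simp, by simp, by simp, fun i _ h => by omega⟩
  · have hR' : (R.map a.q0).take (k + 1) = (R.map a.q0).take k ++ [a.q0 R[k]] := by
      rw [List.take_add_one]; simp [hk]
    have hR'' : (R.map a.qhat).take (k + 1) = (R.map a.qhat).take k ++ [a.qhat R[k]] := by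
      rw [List.take_add_one]; simp [hk]
    simp [block, Program.Pre, Instr.Safe, Instr.next, Instance.input, toInstance, h0, hs.number,
      State.Keeps]
    refine ⟨by omega, by omega, by omega, ⟨?_, ?_, ?_, ?_, ?_, fun i hi hik => ?_⟩⟩
    · simp [hs.nominal, List.map_take, hR']
    · simp [hs.deviation, List.map_take, hR'']
    · simp [hs.gamma]
    · simp [hs.zero]
    · simp
    · rcases eq_or_ne i k with rfl | h
      · simp
      · simp [Function.update_apply, h, hs.cells i hi (by omega)]

theorem sum_map_list (hR : R.Nodup) (f : Fin a.n → ℝ) : (R.map f).sum = ∑ i ∈ R.toFinset, f i :=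
  (List.sum_toFinset f hR).symm

theorem runs_addExcess (hR : R.Nodup) (hw : 2 * (a.n + 2) ≤ lim.word) {s : State}
    (h5 : s.rreg 5 = 0) :
    Runs lim (a.toInstance.input (routeQuery R)) addExcess s (R.length * 8 + 4) (fun s' =>
      s'.rreg 0 = s.rreg 0 + ∑ i ∈ R.toFinset, max 0 (a.qhat i - s.rreg 7)) := by
  refine (a.runs_forCustomers (t := 4) hw hR (fun k s' => s'.rreg 5 = 0 ∧
    s'.rreg 7 = s.rreg 7 ∧ s'.rreg 0 = s.rreg 0 +
      ((R.map fun i => max 0 (a.qhat i - s.rreg 7)).take k).sum)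
    (fun k s s' h hs => by simpa [h.rreg] using hs)
    (fun k hk s' hs h0 => Runs.of_pre ?_ le_rfl) (by simp [h5]) le_rfl).mono le_rfl fun s' h => ?_
  · obtain ⟨g5, g7, g0⟩ := hs
    rw [List.take_add_one]
    simp [block, Program.Pre, Instr.Safe, Instr.next, Instance.input, toInstance, h0, hk,
      State.Keeps, Test.Holds, g5, g7, g0]
    intro h
    rw [max_eq_right (by linarith)]
    ring
  · rw [h.2.2, ← sum_map_list a hR, List.take_of_length_le (by simp)]

/-- If the route has at most `Γ` customers, the multiplier `0` is optimal and all of them deviate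
fully. Otherwise the multiplier is the threshold that splits off `Γ` deviations; the target is `2Γ`
because `Splits` doubles its counts. -/
theorem runs_scratch (hR : R.Nodup) (hm : 10 * (a.n + 2) ≤ lim.mem) (hw : 10 * (a.n + 2) ≤ lim.word)
    {s : State} : Runs lim (a.toInstance.input (routeQuery R)) scratch s (1500 * (R.length + 1))
      (fun s' => IsWorstCaseLoad a.set R.toFinset s'.output) := by
  have hl := length_le hR
  have hΓ := a.Gamma_nonneg
  refine Runs.seq (T := R.length * 11 + 9) (U := R.length * 1448 + 100)
    (a.runs_collect hR (by omega) (by omega)) (fun s₁ h₁ => ?_) (by omega)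
  refine Runs.seq (T := 1) (U := R.length * 1448 + 99)
    (P := fun s' => a.Collected R R.length s' ∧ s'.rreg 4 = R.length)
    (Runs.of_pre ?_ le_rfl) (fun s₂ h₂ => ?_) (by omega)
  · simp [block, Program.Pre, Instr.Safe, Instr.next, h₁.number]
    exact ⟨by simpa using h₁.nominal, by simpa using h₁.deviation, by simpa using h₁.gamma,
      by simpa using h₁.zero, by simpa using h₁.number, h₁.cells⟩
  obtain ⟨c2, h4⟩ := h₂
  have hnom := c2.nominal
  have hdev := c2.deviation
  rw [List.take_length, sum_map_list a hR] at hnom hdev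
  refine Runs.branch (T := R.length * 1448 + 98) (fun hle => ?_) (fun hlt => ?_) (by omega)
  · simp only [Test.Holds, h4, c2.gamma] at hle
    refine Runs.of_pre ?_ (show 1 ≤ _ by omega)
    simp only [block, Program.Pre, Instr.Safe, Instr.next, State.output, State.setR_rreg, if_true,
      true_and, hnom, hdev]
    have hcard : R.toFinset.card ≤ R.length := List.toFinset_card_le R
    have := a.isWorstCaseLoad R.toFinset le_rfl (le_trans (by
      exact_mod_cast (Finset.card_filter_le _ _).trans hcard) hle) (.inl rfl)
    rwa [mul_zero, add_zero, Finset.sum_congr rfl fun i _ =>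
      (max_eq_right (by simpa using a.qhat_nonneg i) : max 0 (a.qhat i - 0) = a.qhat i - 0),
      Finset.sum_congr rfl fun i _ => sub_zero (a.qhat i)] at this
  · simp only [Test.Holds, h4, c2.gamma, not_le] at hlt
    have hne : R.map a.qhat ≠ [] := by
      rintro h
      simp only [List.map_eq_nil_iff] at h
      simp [h] at hlt
      linarith
    refine Runs.seq (T := 3) (U := R.length * 1448 + 95) (P := fun s' =>
      s'.rreg 1 = s₂.rreg 1 ∧ s'.rreg 3 = a.Gamma ∧ s'.rreg 5 = 0 ∧ s'.nreg 10 = 0 ∧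
      s'.nreg 11 = R.length ∧ s'.rreg 11 = 2 * a.Gamma ∧ s'.rmem = s₂.rmem)
      (Runs.of_pre ?_ le_rfl) (fun s₃ h₃ => ?_) (by omega)
    · simp [block, Program.Pre, Instr.Safe, Instr.next, c2.number, c2.gamma, c2.zero, two_mul]
      omega
    obtain ⟨h1, h3, h5, n10, n11, r11, hmem⟩ := h₃
    have hsel := runs_select (lim := lim) (inp := a.toInstance.input (routeQuery R))
      (A := R.map a.qhat) (τ := 2 * a.Gamma) (s := s₃) hne (seg_of_getElem fun i hi => by
        simp only [List.length_map] at hi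
        rw [hmem, n10, zero_add, c2.cells i hi hi]; simp) (by simpa using n11) r11 (by linarith)
      (by simp; linarith) (by simp; omega) (by simp; omega) (by omega)
    rw [List.length_map] at hsel
    refine Runs.seq (U := R.length * 8 + 7) hsel (fun s₄ h₄ => ?_) (by omega)
    obtain ⟨hf, hs1, hs2⟩ := h₄
    rw [count_map _ _ hR] at hs1 hs2
    set x := s₄.rreg 10
    refine Runs.seq (T := 3) (U := R.length * 8 + 4) (P := fun s' =>
      s'.rreg 0 = ∑ i ∈ R.toFinset, a.q0 i + a.Gamma * x ∧ s'.rreg 5 = 0 ∧ s'.rreg 7 = x)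
      (Runs.of_pre ?_ le_rfl) (fun s₅ h₅ => ?_) (by omega)
    · simp [block, Program.Pre, Instr.Safe, Instr.next, hf.low 1, hf.low 3, hf.low 5, h1, h3, h5,
        hnom, x]
    · obtain ⟨g0, g5, g7⟩ := h₅
      refine (a.runs_addExcess hR (by omega) g5).mono le_rfl fun s' h' => ?_
      rw [State.output, h', g0, g7]
      refine a.isWorstCaseLoad _ ?_ (by linarith) (.inr (by linarith))
      -- A negative threshold would lie below all deviations, so more than `Γ` of them would exceed
      -- it.
      by_contra hx
      rw [Finset.filter_true_of_mem fun i _ => (not_le.1 hx).trans_le (a.qhat_nonneg i),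
        List.toFinset_card_of_nodup hR] at hs1
      linarith

end Runs

theorem computableFromScratch :
    ComputableFromScratch Cardinality.toInstance (fun _ k => k + 1) := by
  obtain ⟨c, hc⟩ : ∃ c, c = 1500 := ⟨_, rfl⟩
  refine ⟨scratch, c, fun a R hR s => ?_⟩
  have hw : 10 * (a.n + 2) ≤ (a.n + 2) ^ c :=
    (Nat.mul_le_mul_right _ (by omega)).trans (word_bound a.n c)
  obtain ⟨s', t, he, ht, h⟩ := a.runs_scratch (lim := ⟨_, _⟩) hR hw hw (s := s)
  exact ⟨s', t, he, h, hc ▸ ht⟩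

end Cardinality

/-! ### Tournament trees

The nodes of a tree with `m` leaves are `1, …, 2 m - 1`; the children of the node `v < m` are
`2 v` and `2 v + 1`. Every node holds an item, the better one of those of its children. -/

/-- The item of node `u` is the better one of the items of its children. -/
def Wins (key : ℕ → ℝ) (w : ℕ → ℕ) (u : ℕ) : Prop :=
  (w u = w (2 * u) ∨ w u = w (2 * u + 1)) ∧ key (w (2 * u)) ≤ key (w u) ∧
    key (w (2 * u + 1)) ≤ key (w u)

/-- The tree is in order, except possibly at the proper ancestors of node `v`. -/
def WinsExcept (key : ℕ → ℝ) (w : ℕ → ℕ) (m v : ℕ) : Prop :=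
  ∀ u, 1 ≤ u → u < m → (∀ k, 1 ≤ k → u ≠ v / 2 ^ k) → Wins key w u

theorem Wins.congr {key : ℕ → ℝ} {w w' : ℕ → ℕ} {u : ℕ} (h : Wins key w u) (h0 : w' u = w u)
    (h1 : w' (2 * u) = w (2 * u)) (h2 : w' (2 * u + 1) = w (2 * u + 1)) : Wins key w' u := by
  rwa [Wins, h0, h1, h2]

/-- Node `v / 2` occurs in the conditions of itself, of its parent and of its children's subtrees
only as a parent. Once it is in order, the possible exceptions are its own proper ancestors. -/
theorem WinsExcept.update {key : ℕ → ℝ} {w w' : ℕ → ℕ} {m v : ℕ}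
    (h : WinsExcept key w m v) (hw : ∀ u, u ≠ v / 2 → w' u = w u) (hv : Wins key w' (v / 2)) :
    WinsExcept key w' m (v / 2) := by
  intro u h1 hm hu
  by_cases huv : u = v / 2
  · rwa [huv]
  · have hc := hu 1 le_rfl
    rw [pow_one] at hc
    refine (h u h1 hm fun k hk => ?_).congr (hw u huv) (hw _ (by omega)) (hw _ (by omega))
    obtain ⟨k, rfl⟩ := Nat.exists_eq_add_of_le' hk
    rcases Nat.eq_zero_or_pos k with rfl | hk0
    · simpa using huv
    · have := hu k hk0
      rwa [Nat.div_div_eq_div_mul, ← pow_succ'] at this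

/-- Items `X ⊆ {0, …, N - 1}` at the leaves of a tree in order; `pos` is the inverse of `w` on the
leaves and vanishes on the other items. -/
structure Tournament (key : ℕ → ℝ) (w pos : ℕ → ℕ) (N m : ℕ) (X : Finset ℕ) : Prop where
  item_lt : ∀ c ∈ X, c < N
  node_lt : ∀ u, 1 ≤ u → u < 2 * m → w u < N
  leaf : ∀ l, m ≤ l → l < 2 * m → w l ∈ X ∧ pos (w l) = l
  position : ∀ c ∈ X, m ≤ pos c ∧ pos c < 2 * m ∧ w (pos c) = c
  absent : ∀ c, c < N → c ∉ X → pos c = 0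
  wins : ∀ u, 1 ≤ u → u < m → Wins key w u
  -- Node `0` lies outside the tree, but insertion into an empty tree and deletion from a tree with
  -- one leaf read it and use its content as an item.
  zero : w 0 = 0

namespace Tournament

variable {key : ℕ → ℝ} {w pos : ℕ → ℕ} {N m : ℕ} {X : Finset ℕ}

/-- `pos` is a bijection from the items onto the leaves `m, …, 2 m - 1`. -/
theorem card (h : Tournament key w pos N m X) : X.card = m := by
  have : X.card = (Finset.Ico m (2 * m)).card :=
    Finset.card_bij (fun c _ => pos c)
      (fun c hc => Finset.mem_Ico.2 ⟨(h.position c hc).1, (h.position c hc).2.1⟩)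
      (fun c hc d hd e => by rw [← (h.position c hc).2.2, e, (h.position d hd).2.2])
      (fun l hl => ⟨w l, (h.leaf l (Finset.mem_Ico.1 hl).1 (Finset.mem_Ico.1 hl).2).1,
        (h.leaf l (Finset.mem_Ico.1 hl).1 (Finset.mem_Ico.1 hl).2).2⟩)
  rw [this, Nat.card_Ico]
  omega

theorem le (h : Tournament key w pos N m X) : m ≤ N := by
  rw [← h.card]
  simpa using Finset.card_le_card fun c hc => Finset.mem_range.2 (h.item_lt c hc)

theorem lt (h : Tournament key w pos N m X) {c : ℕ} (hc : c < N) (hX : c ∉ X) : m < N := by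
  rw [← h.card]
  have := Finset.card_lt_card (s := X) (t := Finset.range N)
    (Finset.ssubset_iff_subset_ne.2 ⟨fun c hc => Finset.mem_range.2 (h.item_lt c hc),
      fun e => hX (e ▸ Finset.mem_range.2 hc)⟩)
  simpa using this

/-- The array of positions doubles as a constant-time membership test, because no leaf has number
`0`. -/
theorem mem_iff (h : Tournament key w pos N m X) {c : ℕ} (hc : c < N) : c ∈ X ↔ 1 ≤ pos c := by
  constructor
  · intro hX
    have := h.position c hX
    omega
  · intro hp
    by_contra hX
    have := h.absent c hc hX
    omega

theorem node_mem (h : Tournament key w pos N m X) {v : ℕ} (h1 : 1 ≤ v) (hv : v < 2 * m) :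
    w v ∈ X := by
  induction hk : 2 * m - v using Nat.strong_induction_on generalizing v with
  | _ k ih =>
    rcases Nat.lt_or_ge v m with hm | hm
    · rcases (h.wins v h1 hm).1 with e | e <;> rw [e]
      · exact ih _ (by omega) (by omega) (by omega) rfl
      · exact ih _ (by omega) (by omega) (by omega) rfl
    · exact (h.leaf v hm hv).1

theorem root_mem (h : Tournament key w pos N m X) (hm : 0 < m) : w 1 ∈ X :=
  h.node_mem le_rfl (by omega)

/-- Keys do not decrease on the way from a leaf to the root. -/
theorem key_le_root (h : Tournament key w pos N m X) {c : ℕ} (hc : c ∈ X) :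
    key c ≤ key (w 1) := by
  have key : ∀ v, 1 ≤ v → v < 2 * m → key (w v) ≤ key (w 1) := by
    intro v
    induction v using Nat.strong_induction_on with
    | _ v ih =>
      intro h1 hv
      rcases h1.eq_or_lt with rfl | h1
      · exact le_rfl
      · obtain ⟨-, hl, hr⟩ := h.wins (v / 2) (by omega) (by omega)
        have hp := ih (v / 2) (by omega) (by omega) (by omega)
        rcases Nat.even_or_odd' v with ⟨u, rfl | rfl⟩
        · rw [show 2 * u / 2 = u by omega] at hl hp
          exact hl.trans hp
        · rw [show (2 * u + 1) / 2 = u by omega] at hr hp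
          exact hr.trans hp
  obtain ⟨h1, h2, h3⟩ := h.position c hc
  have := key (pos c) (by omega) h2
  rwa [h3] at this

/-- All nodes hold items of `X`, so the keys of other items may change freely. -/
theorem congr (h : Tournament key w pos N m X) {key' : ℕ → ℝ} {w' pos' : ℕ → ℕ}
    (hk : ∀ c ∈ X, key' c = key c)
    (hw : ∀ u, u < 2 * N → w' u = w u) (hp : ∀ c, c < N → pos' c = pos c) (hN : 0 < N) :
    Tournament key' w' pos' N m X := by
  have hm := h.le
  refine ⟨h.item_lt, fun u h1 hu => by rw [hw u (by omega)]; exact h.node_lt u h1 hu,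
    fun l h1 hl => ?_, fun c hc => ?_, fun c hc hX => by rw [hp c hc]; exact h.absent c hc hX,
    fun u h1 hu => ?_, by rw [hw 0 (by omega)]; exact h.zero⟩
  · rw [hw l (by omega), hp _ (h.item_lt _ (h.leaf l h1 hl).1)]
    exact h.leaf l h1 hl
  · have := h.position c hc
    rw [hp c (h.item_lt c hc), hw _ (by omega)]
    exact this
  · rw [Wins, hw u (by omega), hw (2 * u) (by omega), hw (2 * u + 1) (by omega),
      hk _ (h.node_mem h1 (by omega)), hk _ (h.node_mem (v := 2 * u) (by omega) (by omega)),
      hk _ (h.node_mem (v := 2 * u + 1) (by omega) (by omega))]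
    exact h.wins u h1 hu

/-- The leaf `m` becomes an inner node; its former item moves to the new leaf `2 m` and the new item
to `2 m + 1`. All other leaves keep their numbers. -/
theorem insert (h : Tournament key w pos N m X) {c : ℕ} (hc : c < N) (hX : c ∉ X)
    {w' pos' : ℕ → ℕ} (hw : ∀ l, m + 1 ≤ l → l < 2 * (m + 1) →
      w' l = if l = 2 * m + 1 then c else if l = 2 * m then w m else w l)
    (hp : ∀ x, x < N → pos' x = if x = c then 2 * m + 1 else if x = w m then 2 * m else pos x)
    (hlt : ∀ u, 1 ≤ u → u < 2 * (m + 1) → w' u < N)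
    (hwins : ∀ u, 1 ≤ u → u < m + 1 → Wins key w' u) (h0 : w' 0 = 0) :
    Tournament key w' pos' N (m + 1) (Insert.insert c X) := by
  have hne : ∀ x ∈ X, x ≠ c := fun x hx e => hX (e ▸ hx)
  refine ⟨fun x hx => ?_, hlt, fun l h1 h2 => ?_, fun x hx => ?_, fun x hx hxX => ?_, hwins, h0⟩
  · rcases Finset.mem_insert.1 hx with rfl | hx
    · exact hc
    · exact h.item_lt x hx
  · rw [hw l h1 h2]
    split_ifs with e e'
    · exact ⟨Finset.mem_insert_self _ _, by rw [hp c hc, if_pos rfl, e]⟩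
    · have := h.leaf m le_rfl (by omega)
      refine ⟨Finset.mem_insert_of_mem this.1, ?_⟩
      rw [hp _ (h.item_lt _ this.1), if_neg (hne _ this.1), if_pos rfl, e']
    · have := h.leaf l (by omega) (by omega)
      refine ⟨Finset.mem_insert_of_mem this.1, ?_⟩
      rw [hp _ (h.item_lt _ this.1), if_neg (hne _ this.1), if_neg, this.2]
      intro e''
      have := h.leaf m le_rfl (by omega)
      rw [← e''] at this
      omega
  · rcases Finset.mem_insert.1 hx with rfl | hx
    · rw [hp x hc, if_pos rfl, hw _ (by omega) (by omega), if_pos rfl]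
      omega
    · have := h.position x hx
      rw [hp x (h.item_lt x hx), if_neg (hne x hx)]
      split_ifs with e
      · rw [hw _ (by omega) (by omega), if_neg (by omega), if_pos rfl]
        exact ⟨by omega, by omega, e.symm⟩
      · have hm : pos x ≠ m := fun e' => e (by rw [← e', this.2.2])
        rw [hw _ (by omega) (by omega), if_neg (by omega), if_neg (by omega)]
        exact ⟨by omega, by omega, this.2.2⟩
  · rw [Finset.mem_insert, not_or] at hxX
    rw [hp x hx, if_neg hxX.1]
    split_ifs with e
    · rcases Nat.eq_zero_or_pos m with rfl | hm
      · rfl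
      · exact absurd (e ▸ (h.leaf m le_rfl (by omega)).1) hxX.2
    · exact h.absent x hx hxX.2

-- The item `z` of the last leaf replaces `c` at `l`. The leaves `2 m - 2` and `2 m - 1` then
-- disappear, and their parent `m - 1` becomes a leaf with the item `y` of the former, which is `z`
-- if `l = 2 m - 2`. The order of the cases for `pos'` settles the coincidences `z = c` and `y = z`.
set_option maxHeartbeats 1000000 in
theorem erase (h : Tournament key w pos N m X) {c l y z : ℕ} (hX : c ∈ X) (hl : pos c = l)
    (hz : w (2 * m - 1) = z) (hy : (if l = 2 * m - 2 then z else w (2 * m - 2)) = y)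
    {w' pos' : ℕ → ℕ} (hw : ∀ u, m - 1 ≤ u → u < 2 * (m - 1) →
      w' u = if u = m - 1 then y else if u = l then z else w u)
    (hp : ∀ x, x < N → pos' x = if x = c then 0 else if x = y then m - 1 else if x = z then l
      else pos x) (hlt : ∀ u, 1 ≤ u → u < 2 * (m - 1) → w' u < N)
    (hwins : ∀ u, 1 ≤ u → u < m - 1 → Wins key w' u) (h0 : w' 0 = 0) :
    Tournament key w' pos' N (m - 1) (X.erase c) := by
  obtain ⟨hl1, hl2, hwl⟩ := h.position c hX
  rw [hl] at hl1 hl2 hwl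
  have hzleaf := h.leaf (2 * m - 1) (by omega) (by omega)
  rw [hz] at hzleaf
  have hinj : ∀ u v, m ≤ u → u < 2 * m → m ≤ v → v < 2 * m → w u = w v → u = v :=
    fun u v h1 h2 h3 h4 e => by rw [← (h.leaf u h1 h2).2, e, (h.leaf v h3 h4).2]
  have hzc : z = c → l = 2 * m - 1 := fun e => by rw [← hl, ← e, hzleaf.2]
  have hyX : 2 ≤ m → y ∈ X ∧ y ≠ c ∧ (y = z → l = 2 * m - 2) ∧
      (l ≠ 2 * m - 2 → pos y = 2 * m - 2) := fun hm => by
    have := h.leaf (2 * m - 2) (by omega) (by omega)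
    split_ifs at hy with e
    · subst hy
      exact ⟨hzleaf.1, fun e => by have := hzc e; omega, fun _ => e, fun e' => absurd e e'⟩
    · rw [hy] at this
      refine ⟨this.1, fun e' => e ?_, fun e' => ?_, fun _ => this.2⟩
      · rw [← hl, ← e', this.2]
      · have h1 := this.2
        rw [e', hzleaf.2] at h1
        omega
  refine ⟨fun x hx => h.item_lt x (Finset.mem_of_mem_erase hx), hlt, fun u h1 h2 => ?_,
    fun x hx => ?_, fun x hx hxX => ?_, hwins, h0⟩
  · obtain ⟨y1, y2, y3, y4⟩ := hyX (by omega)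
    rw [hw u h1 h2]
    split_ifs with e e'
    · exact ⟨Finset.mem_erase.2 ⟨y2, y1⟩, by rw [hp y (h.item_lt y y1), if_neg y2, if_pos rfl, e]⟩
    · have hzc' : z ≠ c := fun e => by have := hzc e; omega
      refine ⟨Finset.mem_erase.2 ⟨hzc', hzleaf.1⟩, ?_⟩
      rw [hp z (h.item_lt z hzleaf.1), if_neg hzc', if_neg, if_pos rfl, e']
      intro e''
      have := y3 e''.symm
      omega
    · have hu := h.leaf u (by omega) (by omega)
      have huc : w u ≠ c := fun e'' => e' (by rw [← hl, ← e'', hu.2])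
      have huz : w u ≠ z := fun e'' => by
        have := hinj u (2 * m - 1) (by omega) (by omega) (by omega) (by omega) (e''.trans hz.symm)
        omega
      refine ⟨Finset.mem_erase.2 ⟨huc, hu.1⟩, ?_⟩
      rw [hp _ (h.item_lt _ hu.1), if_neg huc, if_neg, if_neg huz, hu.2]
      intro e''
      split_ifs at hy with e3
      · exact huz (e''.trans hy.symm)
      · have := hinj u (2 * m - 2) (by omega) (by omega) (by omega) (by omega) (e''.trans hy.symm)
        omega
  · obtain ⟨hxc, hxX⟩ := Finset.mem_erase.1 hx
    obtain ⟨x1, x2, x3⟩ := h.position x hxX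
    have hm : 2 ≤ m := by
      by_contra hm
      apply hxc
      rw [← hwl, ← x3]
      congr 1
      omega
    obtain ⟨y1, y2, y3, y4⟩ := hyX hm
    rw [hp x (h.item_lt x hxX), if_neg hxc]
    split_ifs with e e'
    · rw [hw _ le_rfl (by omega), if_pos rfl]
      exact ⟨le_rfl, by omega, e.symm⟩
    · have hl3 : l ≠ 2 * m - 1 := fun e3 => hxc (by rw [e', ← hwl, e3, hz])
      have hl4 : l ≠ 2 * m - 2 := fun e3 => e (by rw [e', ← hy, if_pos e3])
      rw [hw l (by omega) (by omega), if_neg (by omega), if_pos rfl]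
      exact ⟨by omega, by omega, e'.symm⟩
    · have hp1 : pos x ≠ 2 * m - 1 := fun e3 => e' (by rw [← x3, e3, hz])
      have hp2 : pos x ≠ l := fun e3 => hxc (by rw [← x3, e3, hwl])
      have hp3 : pos x ≠ 2 * m - 2 := fun e3 => e (by
        rw [← hy, if_neg (fun e4 => hp2 (e3.trans e4.symm)), ← x3, e3])
      rw [hw _ (by omega) (by omega), if_neg (by omega), if_neg hp2]
      exact ⟨by omega, by omega, x3⟩
  · rw [hp x hx]
    split_ifs with e e' e''
    · rfl
    · rcases Nat.lt_or_ge m 2 with hm | hm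
      · omega
      · exact absurd (Finset.mem_erase.2 ⟨e, e' ▸ (hyX hm).1⟩) hxX
    · exact absurd (Finset.mem_erase.2 ⟨e, e'' ▸ hzleaf.1⟩) hxX
    · exact h.absent x hx fun hX' => hxX (Finset.mem_erase.2 ⟨e, hX'⟩)

end Tournament

/-! Programs for the tree with base address in integer register `10`, base address of the array of
positions in `11` and size in `12`; the keys are the contents of the real memory times real
register `10`. -/

/-- Put the proper ancestors of the node in integer register `13` in order. -/
def fixup : Program :=
  .seq (block [.nconst 14 2]) (.loop (.nle 14 13)
    (.seq (block [.nhalf 13 13, .nadd 15 10 13, .nadd 16 15 13, .nload 17 16, .nconst 18 1,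
      .nadd 16 16 18, .nload 18 16, .rload 11 17, .rmul 11 11 10, .rload 12 18, .rmul 12 12 10])
      (.branch (.rle 12 11) (block [.nstore 15 17]) (block [.nstore 15 18]))))

/-- Insert the item in integer register `19`. -/
def insertItem : Program :=
  .seq (block [.nadd 14 10 12, .nload 15 14, .nadd 14 14 12, .nstore 14 15, .nadd 16 11 15,
    .nadd 17 12 12, .nstore 16 17, .nconst 18 1, .nadd 14 14 18, .nstore 14 19, .nadd 13 17 18,
    .nadd 16 11 19, .nstore 16 13, .nadd 12 12 18]) fixup

/-- Delete the item in integer register `19`. -/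
def deleteItem : Program :=
  .seq (block [.nadd 14 11 19, .nload 13 14, .nadd 15 10 12, .nadd 15 15 12, .nconst 18 1,
    .nsub 15 15 18, .nload 16 15, .nadd 15 10 13, .nstore 15 16, .nadd 15 11 16, .nstore 15 13])
  (.seq fixup (.seq (block [.nconst 18 1, .nadd 15 10 12, .nsub 15 15 18, .nsub 13 12 18,
    .nadd 16 15 13, .nload 17 16, .nstore 15 17, .nadd 16 11 17, .nstore 16 13, .nmove 12 13])
  (.seq fixup (block [.nconst 18 0, .nadd 15 11 19, .nstore 15 18]))))

/-- The states differ only in registers used by the programs for trees, in integer register `12` and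
in the integer memory. -/
structure State.TreeFrame (s s' : State) : Prop where
  nreg : ∀ r, r < 12 → s'.nreg r = s.nreg r
  item : s'.nreg 19 = s.nreg 19
  rreg : ∀ r, r < 11 → s'.rreg r = s.rreg r
  rmem : s'.rmem = s.rmem

theorem State.TreeFrame.trans {s₁ s₂ s₃ : State} (h : s₁.TreeFrame s₂) (h' : s₂.TreeFrame s₃) :
    s₁.TreeFrame s₃ :=
  ⟨fun r hr => (h'.nreg r hr).trans (h.nreg r hr), h'.item.trans h.item,
    fun r hr => (h'.rreg r hr).trans (h.rreg r hr), h'.rmem.trans h.rmem⟩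

section Runs

variable {lim : Limits} {inp : Input}

/-- At each node on the way to the root the exception set of `WinsExcept` moves up, and at the root
it contains no node of the tree. Halving the node number gives the logarithm. The alternative `v ≤
1` covers the empty tree, where the loop is not entered. -/
theorem runs_fixup {B N m v : ℕ} {σ : ℝ} {s : State} (hm : B + 2 * N ≤ lim.mem)
    (hw : B + 2 * N + 2 ≤ lim.word) (hmN : m ≤ N) (hv : v < 2 * m ∨ v ≤ 1) (h10 : s.nreg 10 = B)
    (h13 : s.nreg 13 = v) (hσ : s.rreg 10 = σ)
    (hlt : ∀ u, 1 ≤ u → u < 2 * m → s.nmem (B + u) < N)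
    (hwin : WinsExcept (fun c => s.rmem c * σ) (fun u => s.nmem (B + u)) m v) :
    Runs lim inp fixup s (14 * Nat.log 2 v + 2) (fun s' => s.TreeFrame s' ∧
      s'.nreg 12 = s.nreg 12 ∧ (∀ x, (x < B + 1 ∨ B + m ≤ x) → s'.nmem x = s.nmem x) ∧
      (∀ u, 1 ≤ u → u < 2 * m → s'.nmem (B + u) < N) ∧
      ∀ u, 1 ≤ u → u < m → Wins (fun c => s.rmem c * σ) (fun u => s'.nmem (B + u)) u) := by
  let I : ℕ → State → Prop := fun v s' => (v < 2 * m ∨ v ≤ 1) ∧ s'.nreg 13 = v ∧ s'.nreg 14 = 2 ∧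
    s.TreeFrame s' ∧ s'.nreg 12 = s.nreg 12 ∧
    (∀ x, (x < B + 1 ∨ B + m ≤ x) → s'.nmem x = s.nmem x) ∧
    (∀ u, 1 ≤ u → u < 2 * m → s'.nmem (B + u) < N) ∧
    WinsExcept (fun c => s.rmem c * σ) (fun u => s'.nmem (B + u)) m v
  refine Runs.seq (T := 1) (U := 14 * Nat.log 2 v + 1) (P := I v) (Runs.of_pre ?_ le_rfl)
    (fun s₁ h₁ => Runs.amortized I (fun v => 14 * Nat.log 2 v) (fun v s' h hb => ?_)
      (fun v s' h hb => ⟨13, ?_⟩) h₁ le_rfl) (by omega)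
  · simp [block, Program.Pre, Instr.Safe, Instr.next, I, h13]
    refine ⟨by omega, hv, ⟨fun r hr => ?_, rfl, fun _ _ => rfl, rfl⟩, hlt, hwin⟩
    simp [show r ≠ 14 by omega]
  · obtain ⟨-, h13, h14, hf, h12, hn, hlt, hwin⟩ := h
    simp only [Test.Holds, h13, h14, not_le] at hb
    refine ⟨hf, h12, hn, hlt, fun u h1 hu => hwin u h1 hu fun k hk e => ?_⟩
    have : v / 2 ^ k = 0 := Nat.div_eq_of_lt (hb.trans_le (by
      simpa using Nat.pow_le_pow_right (show 1 ≤ 2 by omega) hk))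
    omega
  · obtain ⟨hv, h13, h14, hf, h12, hn, hlt, hwin⟩ := h
    simp only [Test.Holds, h13, h14] at hb
    have hvm : v / 2 < m := by omega
    have hlog : Nat.log 2 v = Nat.log 2 (v / 2) + 1 := by
      rw [Nat.log_of_one_lt_of_le one_lt_two hb]
    have hl := hlt (2 * (v / 2)) (by omega) (by omega)
    have hr := hlt (2 * (v / 2) + 1) (by omega) (by omega)
    have hl' : s'.nmem (B + v / 2 + v / 2) = s'.nmem (B + 2 * (v / 2)) := by
      congr 1; omega
    have hr' : s'.nmem (B + v / 2 + v / 2 + 1) = s'.nmem (B + (2 * (v / 2) + 1)) := by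
      congr 1; omega
    have hB := hf.nreg 10 (by omega)
    have hσ' := hf.rreg 10 (by omega)
    have hfr : ∀ s₂ : State, (∀ r, r < 12 ∨ r = 12 ∨ r = 19 → s₂.nreg r = s'.nreg r) →
        (∀ r, r < 11 → s₂.rreg r = s'.rreg r) → s₂.rmem = s'.rmem → s₂.nreg 13 = v / 2 →
        s₂.nreg 14 = 2 → ∀ c, (c = s'.nmem (B + 2 * (v / 2)) ∨
          c = s'.nmem (B + (2 * (v / 2) + 1))) →
        s.rmem (s'.nmem (B + 2 * (v / 2))) * σ ≤ s.rmem c * σ →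
        s.rmem (s'.nmem (B + (2 * (v / 2) + 1))) * σ ≤ s.rmem c * σ →
        s₂.nmem = Function.update s'.nmem (B + v / 2) c → I (v / 2) s₂ := by
      intro s₂ e1 e2 e3 e4 e5 c hc hk1 hk2 e6
      have hself : s₂.nmem (B + v / 2) = c := by rw [e6]; simp
      have hne : ∀ x, x ≠ B + v / 2 → s₂.nmem x = s'.nmem x := fun x hx => by
        rw [e6, Function.update_of_ne hx]
      refine ⟨by omega, e4, e5, hf.trans ⟨fun r hr => e1 r (.inl hr), e1 19 (by omega), e2, e3⟩,
        by rw [e1 12 (by omega), h12], fun x hx => by rw [hne x (by omega), hn x hx],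
        fun u h1 hu => ?_, ?_⟩
      · by_cases hu' : u = v / 2
        · rw [hu', hself]
          rcases hc with rfl | rfl <;> assumption
        · rw [hne _ (by omega)]; exact hlt u h1 hu
      · refine hwin.update (fun u hu => hne _ (by omega)) ?_
        simp only [Wins, hself, hne (B + 2 * (v / 2)) (by omega),
          hne (B + (2 * (v / 2) + 1)) (by omega)]
        exact ⟨hc, hk1, hk2⟩
    refine Runs.of_pre' ?_ |>.mono (show _ ≤ 13 by simp [block, Program.cost]) fun s₂ h₂ =>
      ⟨v / 2, h₂, by rw [hlog]; omega⟩
    simp [block, Program.Pre, Instr.Safe, Instr.next, Test.Holds, h13, hB, h10, hl', hr', hf.rmem,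
      hσ', hσ]
    refine ⟨by omega, by omega, by omega, by omega, by omega, by omega, by omega, by omega,
      by omega, fun h => ⟨⟨by omega, by omega⟩, ?_⟩, fun h => ⟨⟨by omega, by omega⟩, ?_⟩⟩
    · refine hfr _ (fun r hr => ?_) (fun r hr => ?_) ?_ ?_ ?_ _ (.inl rfl)
        le_rfl h ?_
      · simp [show r ≠ 18 by omega, show r ≠ 17 by omega, show r ≠ 16 by omega,
          show r ≠ 15 by omega, show r ≠ 13 by omega]
      · simp [show r ≠ 11 by omega, show r ≠ 12 by omega]
      · exact hf.rmem.symm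
      · simp
      · simp [h14]
      · rfl
    · refine hfr _ (fun r hr => ?_) (fun r hr => ?_) ?_ ?_ ?_ _ (.inr rfl)
        h.le le_rfl ?_
      · simp [show r ≠ 18 by omega, show r ≠ 17 by omega, show r ≠ 16 by omega,
          show r ≠ 15 by omega, show r ≠ 13 by omega]
      · simp [show r ≠ 11 by omega, show r ≠ 12 by omega]
      · exact hf.rmem.symm
      · simp
      · simp [h14]
      · rfl

/-- One repair suffices: the new inner node `m` is the parent of both new leaves, so the path from
`2 m + 1` contains every node whose children have changed. -/
theorem runs_insertItem {B N m c : ℕ} {X : Finset ℕ} {σ : ℝ} {s : State}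
    (hm : B + 3 * N ≤ lim.mem) (hw : B + 3 * N + 2 ≤ lim.word) (h10 : s.nreg 10 = B)
    (h11 : s.nreg 11 = B + 2 * N) (h12 : s.nreg 12 = m) (h19 : s.nreg 19 = c) (hσ : s.rreg 10 = σ)
    (h : Tournament (fun c => s.rmem c * σ) (fun u => s.nmem (B + u))
      (fun c => s.nmem (B + 2 * N + c)) N m X) (hc : c < N) (hX : c ∉ X) :
    Runs lim inp insertItem s (14 * Nat.log 2 (m + 1) + 30) (fun s' => s.TreeFrame s' ∧
      s'.nreg 12 = m + 1 ∧ (∀ x, (x < B ∨ B + 3 * N ≤ x) → s'.nmem x = s.nmem x) ∧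
      Tournament (fun c => s.rmem c * σ) (fun u => s'.nmem (B + u))
        (fun c => s'.nmem (B + 2 * N + c)) N (m + 1) (insert c X)) := by
  have hmN := h.lt hc hX
  have hz : s.nmem (B + m) < N := by
    rcases Nat.eq_zero_or_pos m with rfl | hm
    · have := h.zero
      omega
    · exact h.node_lt m hm (by omega)
  refine Runs.seq (T := 14) (U := 14 * Nat.log 2 (2 * m + 1) + 2) (P := fun s₁ =>
    s.TreeFrame s₁ ∧ s₁.nreg 12 = m + 1 ∧ s₁.nreg 13 = 2 * m + 1 ∧
    (∀ x, (x < B ∨ B + 3 * N ≤ x) → s₁.nmem x = s.nmem x) ∧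
    (∀ u, u < 2 * N → s₁.nmem (B + u) = if u = 2 * m + 1 then c else if u = 2 * m then
      s.nmem (B + m) else s.nmem (B + u)) ∧
    ∀ x, x < N → s₁.nmem (B + 2 * N + x) = if x = c then 2 * m + 1 else if x = s.nmem (B + m) then
      2 * m else s.nmem (B + 2 * N + x)) (Runs.of_pre ?_ le_rfl) (fun s₁ h₁ => ?_) ?_
  · have hBm : B + m + m = B + 2 * m := by omega
    have hmm : m + m = 2 * m := by omega
    simp [block, Program.Pre, Instr.Safe, Instr.next, h10, h11, h12, h19, hBm, hmm]
    refine ⟨by omega, by omega, by omega, by omega, by omega, by omega, by omega, by omega,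
      by omega, by omega, by omega, by omega, by omega, by omega,
      ⟨fun r hr => ?_, by simp, fun _ _ => rfl, rfl⟩, fun x hx => ?_, fun u hu => ?_,
      fun x hx => ?_⟩
    · simp (disch := omega) only [State.setN_nreg, if_neg]
    · simp (disch := omega) only [Function.update_apply, if_neg]
    · simp only [Function.update_apply]
      split_ifs <;> first | rfl | omega
    · simp only [Function.update_apply]
      split_ifs <;> first | rfl | omega
  · obtain ⟨hf, h12', h13, hout, hnode, hpos⟩ := h₁
    refine (runs_fixup (B := B) (N := N) (m := m + 1) (v := 2 * m + 1) (σ := σ) (by omega)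
      (by omega) (by omega) (by omega) (by rw [hf.nreg 10 (by omega), h10]) h13
      (by rw [hf.rreg 10 (by omega), hσ]) (fun u h1 hu => ?_) ?_).mono le_rfl fun s₂ h₂ => ?_
    · rw [hnode u (by omega)]
      split_ifs
      · exact hc
      · exact hz
      · exact h.node_lt u h1 (by omega)
    · intro u h1 hu hanc
      have hum : u ≠ m := by have := hanc 1 le_rfl; omega
      rw [hf.rmem]
      refine (h.wins u h1 (by omega)).congr ?_ ?_ ?_ <;> rw [hnode _ (by omega)]
      · split_ifs with e e'
        · omega
        · omega
        · rfl
      · split_ifs with e e'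
        · omega
        · omega
        · rfl
      · split_ifs with e e'
        · omega
        · omega
        · rfl
    · obtain ⟨hf', h12₂, hsame, hlt, hwins⟩ := h₂
      refine ⟨hf.trans hf', by rw [h12₂, h12'], fun x hx => ?_, ?_⟩
      · rw [hsame x (by omega), hout x hx]
      · rw [hf.rmem] at hwins
        refine h.insert hc hX (fun l h1 h2 => ?_) (fun x hx => ?_) hlt hwins ?_
        · rw [hsame _ (by omega), hnode l (by omega)]
        · rw [hsame _ (by omega), hpos x hx]
        · have := h.zero
          rw [hsame _ (by omega), hnode 0 (by omega), if_neg (by omega)]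
          split_ifs with e
          · rw [show m = 0 by omega, this]
          · exact this
  · have : Nat.log 2 (2 * m + 1) ≤ Nat.log 2 ((m + 1) * 2) := Nat.log_mono_right (by omega)
    rw [Nat.log_mul_base one_lt_two (by omega)] at this
    omega

/-- Two paths need repair: the one from `l`, whose item is replaced, while there are still `m`
leaves, and the one from `m - 1` after it has become a leaf. The position of `c` is cleared last
because `z` may be `c` itself. -/
theorem runs_deleteItem {B N m c : ℕ} {X : Finset ℕ} {σ : ℝ} {s : State}
    (hm : B + 3 * N ≤ lim.mem) (hw : B + 3 * N + 2 ≤ lim.word) (h10 : s.nreg 10 = B)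
    (h11 : s.nreg 11 = B + 2 * N) (h12 : s.nreg 12 = m) (h19 : s.nreg 19 = c) (hσ : s.rreg 10 = σ)
    (h : Tournament (fun c => s.rmem c * σ) (fun u => s.nmem (B + u))
      (fun c => s.nmem (B + 2 * N + c)) N m X) (hX : c ∈ X) :
    Runs lim inp deleteItem s (28 * Nat.log 2 m + 42) (fun s' => s.TreeFrame s' ∧
      s'.nreg 12 = m - 1 ∧ (∀ x, (x < B ∨ B + 3 * N ≤ x) → s'.nmem x = s.nmem x) ∧
      Tournament (fun c => s.rmem c * σ) (fun u => s'.nmem (B + u))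
        (fun c => s'.nmem (B + 2 * N + c)) N (m - 1) (X.erase c)) := by
  have hmN := h.le
  have hc := h.item_lt c hX
  have h0 := h.zero
  obtain ⟨l, hl⟩ : ∃ l, s.nmem (B + 2 * N + c) = l := ⟨_, rfl⟩
  obtain ⟨hl1, hl2, hwl⟩ := h.position c hX
  simp only [hl] at hl1 hl2 hwl
  obtain ⟨z, hz⟩ : ∃ z, s.nmem (B + (2 * m - 1)) = z := ⟨_, rfl⟩
  have hzN : z < N := hz ▸ h.node_lt (2 * m - 1) (by omega) (by omega)
  obtain ⟨y, hy⟩ : ∃ y, (if l = 2 * m - 2 then z else s.nmem (B + (2 * m - 2))) = y := ⟨_, rfl⟩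
  have hyN : y < N := by
    rw [← hy]
    split_ifs
    · exact hzN
    · rcases Nat.lt_or_ge m 2 with hm2 | hm2
      · rw [show 2 * m - 2 = 0 by omega, h0]; omega
      · exact h.node_lt (2 * m - 2) (by omega) (by omega)
  have hlog : ∀ v, v < 2 * m → Nat.log 2 v ≤ Nat.log 2 m + 1 := fun v hv => by
    rw [← Nat.log_mul_base one_lt_two (by omega)]
    exact Nat.log_mono_right (by omega)
  refine Runs.seq (T := 11) (U := 28 * Nat.log 2 m + 31) (P := fun s₁ =>
    s.TreeFrame s₁ ∧ s₁.nreg 12 = m ∧ s₁.nreg 13 = l ∧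
    (∀ x, (x < B ∨ B + 3 * N ≤ x) → s₁.nmem x = s.nmem x) ∧
    (∀ u, u < 2 * N → s₁.nmem (B + u) = if u = l then z else s.nmem (B + u)) ∧
    ∀ x, x < N → s₁.nmem (B + 2 * N + x) = if x = z then l else s.nmem (B + 2 * N + x))
    (Runs.of_pre ?_ le_rfl) (fun s₁ h₁ => ?_) (by omega)
  · have hBm : B + m + m - 1 = B + (2 * m - 1) := by omega
    simp [block, Program.Pre, Instr.Safe, Instr.next, h10, h11, h12, h19, hBm, hl, hz]
    refine ⟨by omega, ⟨by omega, by omega⟩, by omega, by omega, by omega, by omega, ⟨by omega, by omega⟩,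
      by omega, by omega, by omega, by omega,
      ⟨fun r hr => ?_, by simp, fun _ _ => rfl, rfl⟩, fun x hx => ?_, fun u hu => ?_,
      fun x hx => ?_⟩
    · simp (disch := omega) only [State.setN_nreg, if_neg]
    · simp (disch := omega) only [Function.update_apply, if_neg]
    · simp only [Function.update_apply]
      split_ifs <;> first | rfl | omega
    · simp only [Function.update_apply]
      split_ifs <;> first | rfl | omega
  obtain ⟨hf, h12₁, h13, hout, hnode, hpos⟩ := h₁
  refine Runs.seq (T := 14 * Nat.log 2 l + 2) (U := 14 * Nat.log 2 m + 15)
    (runs_fixup (B := B) (N := N) (m := m) (v := l) (σ := σ) (by omega)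
      (by omega) (by omega) (by omega) (by rw [hf.nreg 10 (by omega), h10]) h13
      (by rw [hf.rreg 10 (by omega), hσ]) (fun u h1 hu => ?_) ?_) (fun s₂ h₂ => ?_)
      (by have := hlog l hl2; omega)
  · rw [hnode u (by omega)]
    split_ifs
    · exact hzN
    · exact h.node_lt u h1 (by omega)
  · intro u h1 hu hanc
    have hum : u ≠ l / 2 := by simpa using hanc 1 le_rfl
    rw [hf.rmem]
    refine (h.wins u h1 (by omega)).congr ?_ ?_ ?_ <;> rw [hnode _ (by omega), if_neg (by omega)]
  obtain ⟨hf₂, h12₂, hsame, hlt, hwins⟩ := h₂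
  rw [hf.rmem] at hwins
  have hf' := hf.trans hf₂
  have hB₂ := hf'.nreg 10 (by omega)
  have hP₂ := hf'.nreg 11 (by omega)
  have hy₂ : s₂.nmem (B + (2 * m - 2)) = y := by
    rw [hsame _ (by omega), hnode _ (by omega), ← hy]
    simp only [eq_comm]
  refine Runs.seq (T := 10) (U := 14 * Nat.log 2 m + 5) (P := fun s₃ =>
    s.TreeFrame s₃ ∧ s₃.nreg 12 = m - 1 ∧ s₃.nreg 13 = m - 1 ∧
    (∀ x, (x < B ∨ B + 3 * N ≤ x) → s₃.nmem x = s.nmem x) ∧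
    (∀ u, u < 2 * N → s₃.nmem (B + u) = if u = m - 1 then y else s₂.nmem (B + u)) ∧
    ∀ x, x < N → s₃.nmem (B + 2 * N + x) = if x = y then m - 1 else if x = z then l else
      s.nmem (B + 2 * N + x))
    (Runs.of_pre ?_ le_rfl) (fun s₃ h₃ => ?_) (by omega)
  · have hBm : B + m - 1 = B + (m - 1) := by omega
    have hBm' : B + (m - 1) + (m - 1) = B + (2 * m - 2) := by omega
    simp [block, Program.Pre, Instr.Safe, Instr.next, hB₂, hP₂, h10, h11, h12₁, h12₂, hBm, hBm', hy₂]
    refine ⟨by omega, by omega, by omega, by omega, by omega, ⟨by omega, by omega⟩,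
      ⟨by omega, by omega⟩, by omega, ⟨by omega, by omega⟩, by omega,
      hf'.trans ⟨fun r hr => ?_, by simp, fun _ _ => rfl, rfl⟩, fun x hx => ?_, fun u hu => ?_,
      fun x hx => ?_⟩
    · simp (disch := omega) only [State.setN_nreg, if_neg]
    · simp (disch := omega) only [Function.update_apply, if_neg]
      rw [hsame x (by omega), hout x hx]
    · simp only [Function.update_apply]
      split_ifs <;> first | rfl | omega
    · simp only [Function.update_apply]
      rw [← hpos x hx, ← hsame (B + 2 * N + x) (by omega)]
      split_ifs <;> first | rfl | omega
  obtain ⟨hf₃, h12₃, h13₃, hout₃, hnode₃, hpos₃⟩ := h₃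
  refine Runs.seq (T := 14 * Nat.log 2 (m - 1) + 2) (U := 3)
    (runs_fixup (B := B) (N := N) (m := m - 1) (v := m - 1) (σ := σ) (by omega)
      (by omega) (by omega) (by omega) (by rw [hf₃.nreg 10 (by omega), h10]) h13₃
      (by rw [hf₃.rreg 10 (by omega), hσ]) (fun u h1 hu => ?_) ?_) (fun s₄ h₄ => ?_)
      (by have := Nat.log_mono_right (b := 2) (show m - 1 ≤ m by omega); omega)
  · rw [hnode₃ u (by omega)]
    split_ifs
    · exact hyN
    · exact hlt u h1 (by omega)
  · intro u h1 hu hanc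
    have hum : u ≠ (m - 1) / 2 := by simpa using hanc 1 le_rfl
    rw [hf₃.rmem]
    refine (hwins u h1 (by omega)).congr ?_ ?_ ?_ <;> rw [hnode₃ _ (by omega), if_neg (by omega)]
  obtain ⟨hf₄, h12₄, hsame₄, hlt₄, hwins₄⟩ := h₄
  rw [hf₃.rmem] at hwins₄
  have hf₄' := hf₃.trans hf₄
  have hP₄ := hf₄'.nreg 11 (by omega)
  have hI₄ := hf₄'.item
  refine Runs.of_pre ?_ le_rfl
  simp [block, Program.Pre, Instr.Safe, Instr.next, hP₄, hI₄, h11, h19, h12₄, h12₃]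
  refine ⟨by omega, by omega, hf₄'.trans ⟨fun r hr => ?_, by simp, fun _ _ => rfl, rfl⟩,
    fun x hx => ?_, h.erase hX hl hz hy (fun u h1 hu => ?_) (fun x hx => ?_) (fun u h1 hu => ?_)
      (fun u h1 hu => ?_) ?_⟩
  · simp (disch := omega) only [State.setN_nreg, if_neg]
  · rw [Function.update_of_ne (by omega), hsame₄ x (by omega), hout₃ x hx]
  · rw [Function.update_of_ne (by omega), hsame₄ _ (by omega), hnode₃ u (by omega)]
    split_ifs with e e'
    · rfl
    · rw [hsame _ (by omega), hnode u (by omega), if_pos e']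
    · rw [hsame _ (by omega), hnode u (by omega), if_neg e']
  · rcases eq_or_ne x c with rfl | e
    · simp
    · rw [Function.update_of_ne (by omega), hsame₄ _ (by omega), hpos₃ x hx, if_neg e]
  · rw [Function.update_of_ne (by omega)]
    exact hlt₄ u h1 hu
  · refine (hwins₄ u h1 hu).congr ?_ ?_ ?_ <;> rw [Function.update_of_ne (by omega)]
  · rw [Function.update_of_ne (by omega), hsame₄ _ (by omega), hnode₃ 0 (by omega)]
    have hB0 : s₂.nmem (B + 0) = 0 := by
      rw [hsame _ (by omega), hnode 0 (by omega), if_neg (by omega), h0]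
    split_ifs with e
    · rw [← hy, if_neg (by omega), show 2 * m - 2 = 0 by omega, h0]
    · exact hB0

end Runs

/-! ### Cardinality-constrained sets: incremental updates -/

/-- The integer memory from `B` on holds a tournament tree of the items `X`, whose keys are the
contents of the real memory times `σ`. -/
def State.HasTree (s : State) (σ : ℝ) (B N : ℕ) (X : Finset ℕ) : Prop :=
  Tournament (fun c => s.rmem c * σ) (fun u => s.nmem (B + u)) (fun c => s.nmem (B + 2 * N + c))
    N X.card X

theorem State.HasTree.congr {s s' : State} {σ : ℝ} {B N : ℕ} {X : Finset ℕ}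
    (h : s.HasTree σ B N X) (hN : 0 < N) (hr : ∀ c ∈ X, s'.rmem c = s.rmem c)
    (hn : ∀ x, B ≤ x → x < B + 3 * N → s'.nmem x = s.nmem x) : s'.HasTree σ B N X :=
  Tournament.congr h (fun c hc => by simp only [hr c hc])
    (fun u hu => hn _ (by omega) (by omega)) (fun c hc => hn _ (by omega) (by omega)) hN

theorem State.HasTree.empty {s : State} {σ : ℝ} {B N : ℕ} (h0 : s.nmem B = 0)
    (hp : ∀ c, c < N → s.nmem (B + 2 * N + c) = 0) : s.HasTree σ B N ∅ :=
  ⟨by simp, fun u h1 h2 => by simp at h2, fun l h1 h2 => by simp at h2, by simp,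
    fun c hc _ => hp c hc, fun u h1 h2 => by simp at h2, h0⟩

/-- The states differ only in the integer memory and in registers from `10` on, and in integer
register `d`. -/
structure State.TreeChange (d : ℕ) (s s' : State) : Prop where
  nreg : ∀ r, r < 10 → r ≠ d → s'.nreg r = s.nreg r
  item : s'.nreg 19 = s.nreg 19
  rreg : ∀ r, r < 10 → s'.rreg r = s.rreg r
  rmem : s'.rmem = s.rmem

/-- The state `s'` arises from `s` by setting the parameters of a tree. -/
structure State.Enters (s s' : State) (σ : ℝ) (B N m : ℕ) : Prop where
  base : s'.nreg 10 = B
  positions : s'.nreg 11 = B + 2 * N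
  size : s'.nreg 12 = m
  sign : s'.rreg 10 = σ
  nreg : ∀ r, r < 10 → s'.nreg r = s.nreg r
  item : s'.nreg 19 = s.nreg 19
  rreg : ∀ r, r < 10 → s'.rreg r = s.rreg r
  nmem : s'.nmem = s.nmem
  rmem : s'.rmem = s.rmem

/-- Perform the program `p` on the tree whose parameters are set by `enter` and whose size is kept in
integer register `d`. -/
def onTree (enter : List Instr) (d : ℕ) (p : Program) : Program :=
  .seq (block enter) (.seq p (block [.nmove d 12]))

/-- Parameters of the tree at the bottom of the memory. -/
def lowTree : List Instr := [.nconst 10 0, .nadd 11 3 3, .nmove 12 4, .rmove 10 4]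

/-- Parameters of the tree above the one at the bottom of the memory. -/
def highTree : List Instr :=
  [.nadd 10 3 3, .nadd 10 10 3, .nadd 11 10 3, .nadd 11 11 3, .nmove 12 5, .rmove 10 5]

section Runs

variable {lim : Limits} {inp : Input}

theorem runs_onTree {enter : List Instr} {d t te B N c : ℕ} {σ : ℝ} {X X' : Finset ℕ}
    {p : Program} {s : State} (hd : d < 10)
    (he : Runs lim inp (block enter) s te (fun s₁ => s.Enters s₁ σ B N X.card))
    (h19 : s.nreg 19 = c) (h : s.HasTree σ B N X) (hX' : X'.card ≤ lim.word)
    (hp : ∀ s₁ : State, s₁.nreg 10 = B → s₁.nreg 11 = B + 2 * N → s₁.nreg 12 = X.card →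
      s₁.nreg 19 = c → s₁.rreg 10 = σ → Tournament (fun c => s₁.rmem c * σ)
        (fun u => s₁.nmem (B + u)) (fun c => s₁.nmem (B + 2 * N + c)) N X.card X →
      Runs lim inp p s₁ t (fun s' => s₁.TreeFrame s' ∧
        s'.nreg 12 = X'.card ∧ (∀ x, (x < B ∨ B + 3 * N ≤ x) → s'.nmem x = s₁.nmem x) ∧
        Tournament (fun c => s₁.rmem c * σ) (fun u => s'.nmem (B + u))
          (fun c => s'.nmem (B + 2 * N + c)) N X'.card X')) :
    Runs lim inp (onTree enter d p) s (te + t + 1) (fun s' => s.TreeChange d s' ∧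
      s'.nreg d = X'.card ∧ (∀ x, (x < B ∨ B + 3 * N ≤ x) → s'.nmem x = s.nmem x) ∧
      s'.HasTree σ B N X') := by
  refine Runs.seq (U := t + 1) he (fun s₁ h₁ => ?_) (by omega)
  refine Runs.seq (U := 1) (hp s₁ h₁.base h₁.positions h₁.size (by rw [h₁.item, h19]) h₁.sign (by
    rw [h₁.nmem, h₁.rmem]; exact h)) (fun s₂ h₂ => Runs.of_pre ?_ le_rfl) le_rfl
  obtain ⟨hf, h12, hout, htree⟩ := h₂
  simp [block, Program.Pre, Instr.Safe, Instr.next, h12]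
  refine ⟨hX', ⟨fun r hr hrd => ?_, ?_, fun r hr => ?_, ?_⟩, fun x hx => ?_, ?_⟩
  · simp [hrd, hf.nreg r (by omega), h₁.nreg r hr]
  · simp [show 19 ≠ d by omega, hf.item, h₁.item]
  · simp [hf.rreg r (by omega), h₁.rreg r hr]
  · simp [hf.rmem, h₁.rmem]
  · rw [hout x hx, h₁.nmem]
  · rw [State.HasTree, State.setN_rmem, hf.rmem]
    exact htree

theorem runs_insert_onTree {enter : List Instr} {d te B N c : ℕ} {σ : ℝ} {X : Finset ℕ}
    {s : State} (hd : d < 10)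
    (he : Runs lim inp (block enter) s te (fun s₁ => s.Enters s₁ σ B N X.card))
    (h19 : s.nreg 19 = c) (h : s.HasTree σ B N X) (hm : B + 3 * N ≤ lim.mem)
    (hw : B + 3 * N + 2 ≤ lim.word) (hc : c < N) (hX : c ∉ X) :
    Runs lim inp (onTree enter d insertItem) s (te + (14 * Nat.log 2 (X.card + 1) + 30) + 1)
      (fun s' => s.TreeChange d s' ∧ s'.nreg d = (insert c X).card ∧
        (∀ x, (x < B ∨ B + 3 * N ≤ x) → s'.nmem x = s.nmem x) ∧ s'.HasTree σ B N (insert c X)) := by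
  have := Tournament.lt h hc hX
  refine runs_onTree hd he h19 h (by rw [Finset.card_insert_of_notMem hX]; omega)
    fun s₁ h10 h11 h12 h19 hσ h => ?_
  rw [Finset.card_insert_of_notMem hX]
  exact runs_insertItem hm hw h10 h11 h12 h19 hσ h hc hX

theorem runs_delete_onTree {enter : List Instr} {d te B N c : ℕ} {σ : ℝ} {X : Finset ℕ}
    {s : State} (hd : d < 10)
    (he : Runs lim inp (block enter) s te (fun s₁ => s.Enters s₁ σ B N X.card))
    (h19 : s.nreg 19 = c) (h : s.HasTree σ B N X) (hm : B + 3 * N ≤ lim.mem)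
    (hw : B + 3 * N + 2 ≤ lim.word) (hX : c ∈ X) :
    Runs lim inp (onTree enter d deleteItem) s (te + (28 * Nat.log 2 X.card + 42) + 1)
      (fun s' => s.TreeChange d s' ∧ s'.nreg d = (X.erase c).card ∧
        (∀ x, (x < B ∨ B + 3 * N ≤ x) → s'.nmem x = s.nmem x) ∧ s'.HasTree σ B N (X.erase c)) := by
  have := Tournament.le h
  refine runs_onTree hd he h19 h (by rw [Finset.card_erase_of_mem hX]; omega)
    fun s₁ h10 h11 h12 h19 hσ h => ?_
  rw [Finset.card_erase_of_mem hX]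
  exact runs_deleteItem hm hw h10 h11 h12 h19 hσ h hX

theorem runs_lowTree {N m : ℕ} {σ : ℝ} {s : State} (hw : 2 * N ≤ lim.word) (hm : m ≤ N)
    (h3 : s.nreg 3 = N) (h4 : s.nreg 4 = m) (hσ : s.rreg 4 = σ) :
    Runs lim inp (block lowTree) s 4 (fun s₁ => s.Enters s₁ σ 0 N m) := by
  refine Runs.of_pre ?_ le_rfl
  simp [lowTree, block, Program.Pre, Instr.Safe, Instr.next, h3, h4, hσ]
  refine ⟨by omega, by omega, by simp, by simp; omega, by simp, by simp, fun r hr => ?_, by simp,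
    fun r hr => ?_, rfl, rfl⟩
  · simp (disch := omega) only [State.setN_nreg, State.setR_nreg, if_neg]
  · simp (disch := omega) only [State.setR_rreg, if_neg, State.setN_rreg]

theorem runs_highTree {N m : ℕ} {σ : ℝ} {s : State} (hw : 5 * N ≤ lim.word) (hm : m ≤ N)
    (h3 : s.nreg 3 = N) (h5 : s.nreg 5 = m) (hσ : s.rreg 5 = σ) :
    Runs lim inp (block highTree) s 6 (fun s₁ => s.Enters s₁ σ (3 * N) N m) := by
  refine Runs.of_pre ?_ le_rfl
  simp [highTree, block, Program.Pre, Instr.Safe, Instr.next, h3, h5, hσ]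
  refine ⟨by omega, by omega, by omega, by omega, by omega, by simp; omega, by simp; omega, by simp,
    by simp, fun r hr => ?_, by simp, fun r hr => ?_, rfl, rfl⟩
  · simp (disch := omega) only [State.setN_nreg, State.setR_nreg, if_neg]
  · simp (disch := omega) only [State.setR_rreg, if_neg, State.setN_rreg]

end Runs

/-! ### The customers with the largest deviations and the rest -/

namespace Cardinality

/-- The customers of `S` with the largest deviations are `T`; there are `⌊Γ⌋` of them unless the set
`R` of the others is empty. -/
structure Top (a : Cardinality) (S T R : Finset (Fin a.n)) : Prop where
  disjoint : Disjoint T R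
  union : T ∪ R = S
  le : ∀ i ∈ T, ∀ j ∈ R, a.qhat j ≤ a.qhat i
  card_le : T.card ≤ ⌊a.Gamma⌋₊
  card_eq : R.Nonempty → T.card = ⌊a.Gamma⌋₊

/-- The number is the largest deviation of the customers of `R`. -/
def IsPeak (a : Cardinality) (R : Finset (Fin a.n)) (x : ℝ) : Prop :=
  (R = ∅ ∧ x = 0) ∨ ∃ j ∈ R, x = a.qhat j ∧ ∀ i ∈ R, a.qhat i ≤ x

variable {a : Cardinality} {S T R : Finset (Fin a.n)}

/-- The largest deviation `x` outside `T` is an optimal multiplier: whatever exceeds it lies in `T`.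
The dual value `Γ x + ∑_T (q̂_i - x)` gives the formula, since `T` has `⌊Γ⌋` elements unless `R` is
empty, and then `x = 0`. -/
theorem Top.isWorstCaseLoad (h : a.Top S T R) {x : ℝ} (hx : a.IsPeak R x) :
    IsWorstCaseLoad a.set S
      (∑ i ∈ S, a.q0 i + ∑ i ∈ T, a.qhat i + x * (a.Gamma - ⌊a.Gamma⌋₊)) := by
  have hfl := Nat.floor_le a.Gamma_nonneg
  have hx0 : 0 ≤ x := by
    rcases hx with ⟨-, rfl⟩ | ⟨j, -, rfl, -⟩
    · exact le_rfl
    · exact a.qhat_nonneg j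
  have hR : ∀ i ∈ R, a.qhat i ≤ x := by
    rcases hx with ⟨rfl, -⟩ | ⟨j, -, -, h⟩
    · simp
    · exact h
  have hT : ∀ i ∈ T, x ≤ a.qhat i := by
    rcases hx with ⟨-, rfl⟩ | ⟨j, hj, rfl, -⟩
    · exact fun i _ => a.qhat_nonneg i
    · exact fun i hi => h.le i hi j hj
  have := a.isWorstCaseLoad S hx0 ?_ ?_
  · convert this using 1
    rw [← h.union, Finset.sum_union (f := fun i => max 0 (a.qhat i - x)) h.disjoint,
      Finset.sum_congr rfl fun i hi => max_eq_right (sub_nonneg.2 (hT i hi)),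
      Finset.sum_congr rfl fun i (hi : i ∈ R) => max_eq_left (sub_nonpos.2 (hR i hi)),
      Finset.sum_sub_distrib, Finset.sum_const, nsmul_eq_mul, Finset.sum_const_zero]
    have : (T.card : ℝ) * x = ⌊a.Gamma⌋₊ * x := by
      rcases hx with ⟨-, rfl⟩ | ⟨j, hj, -, -⟩
      · simp
      · rw [h.card_eq ⟨j, hj⟩]
    linear_combination this
  · refine le_trans ?_ ((Nat.cast_le.2 h.card_le).trans hfl)
    refine Nat.cast_le.2 (Finset.card_le_card fun i hi => ?_)
    rw [← h.union, Finset.mem_filter, Finset.mem_union] at hi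
    exact hi.1.resolve_right fun hiR => (hR i hiR).not_gt hi.2
  · rcases hx with ⟨-, rfl⟩ | ⟨j, hj, hxj, -⟩
    · exact .inl rfl
    · right
      have hcard : (insert j T).card = ⌊a.Gamma⌋₊ + 1 := by
        rw [Finset.card_insert_of_notMem (Finset.disjoint_right.1 h.disjoint hj),
          h.card_eq ⟨j, hj⟩]
      have hle : (insert j T).card ≤ (S.filter fun i => x ≤ a.qhat i).card := by
        refine Finset.card_le_card fun i hi => ?_
        rw [← h.union, Finset.mem_filter, Finset.mem_union]
        rcases Finset.mem_insert.1 hi with rfl | hi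
        · exact ⟨.inr hj, hxj.le⟩
        · exact ⟨.inl hi, hT i hi⟩
      rw [hcard] at hle
      refine (Nat.lt_floor_add_one a.Gamma).le.trans ?_
      exact_mod_cast hle

theorem top_empty (a : Cardinality) : a.Top ∅ ∅ ∅ :=
  ⟨by simp, by simp, by simp, by simp, by simp⟩

/-- As long as `T` is not full, `R` is empty, so nothing has to be compared. -/
theorem Top.insert_of_lt (h : a.Top S T R) {j : Fin a.n} (hT : T.card + 1 ≤ ⌊a.Gamma⌋₊) :
    a.Top (insert j S) (insert j T) R := by
  have hR : R = ∅ := by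
    by_contra hR
    have := h.card_eq (Finset.nonempty_iff_ne_empty.2 hR)
    omega
  refine ⟨by simp [hR], by rw [Finset.insert_union, h.union], by simp [hR],
    (Finset.card_insert_le _ _).trans hT, by simp [hR]⟩

/-- The new customer enters a full `T` and the smallest of the `⌊Γ⌋ + 1` deviations leaves it,
possibly that of the new customer itself. -/
theorem Top.insert_of_ge (h : a.Top S T R) {j c : Fin a.n} (hj : j ∉ S)
    (hT : ⌊a.Gamma⌋₊ ≤ T.card) (hc : c ∈ insert j T)
    (hmin : ∀ i ∈ insert j T, a.qhat c ≤ a.qhat i) :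
    a.Top (insert j S) ((insert j T).erase c) (insert c R) := by
  have hjT : j ∉ T := fun h' => hj (h.union ▸ Finset.mem_union_left _ h')
  have hjR : j ∉ R := fun h' => hj (h.union ▸ Finset.mem_union_right _ h')
  have hcard : ((insert j T).erase c).card = ⌊a.Gamma⌋₊ := by
    have := h.card_le
    rw [Finset.card_erase_of_mem hc, Finset.card_insert_of_notMem hjT]
    omega
  refine ⟨?_, ?_, fun i hi k hk => ?_, hcard.le, fun _ => hcard⟩
  · rw [Finset.disjoint_insert_right]
    refine ⟨by simp, Finset.disjoint_of_subset_left (Finset.erase_subset _ _) ?_⟩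
    exact Finset.disjoint_insert_left.2 ⟨hjR, h.disjoint⟩
  · rw [Finset.union_insert, ← Finset.insert_union, Finset.insert_erase hc, Finset.insert_union,
      h.union]
  · obtain ⟨hic, hi'⟩ := Finset.mem_erase.1 hi
    rcases Finset.mem_insert.1 hk with rfl | hk
    · exact hmin i hi'
    · rcases Finset.mem_insert.1 hi' with rfl | hi'
      · rcases Finset.mem_insert.1 hc with rfl | hc
        · exact absurd rfl hic
        · exact (h.le c hc k hk).trans (hmin i (Finset.mem_insert_self _ _))
      · exact h.le i hi' k hk

theorem Top.erase_rest (h : a.Top S T R) {j : Fin a.n} (hj : j ∈ R) :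
    a.Top (S.erase j) T (R.erase j) := by
  refine ⟨Finset.disjoint_of_subset_right (Finset.erase_subset _ _) h.disjoint, ?_,
    fun i hi k hk => h.le i hi k (Finset.mem_of_mem_erase hk), h.card_le, fun _ => h.card_eq ⟨j, hj⟩⟩
  rw [← h.union, Finset.erase_union_distrib,
    Finset.erase_eq_of_notMem (Finset.disjoint_right.1 h.disjoint hj)]

theorem Top.erase_of_empty (h : a.Top S T ∅) {j : Fin a.n} : a.Top (S.erase j) (T.erase j) ∅ := by
  refine ⟨by simp, ?_, by simp, (Finset.card_erase_le).trans h.card_le, by simp⟩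
  rw [← h.union, Finset.union_empty, Finset.union_empty]

/-- The gap in `T` is filled by the largest deviation of the rest. -/
theorem Top.erase_top (h : a.Top S T R) {j c : Fin a.n} (hj : j ∈ T) (hc : c ∈ R)
    (hmax : ∀ i ∈ R, a.qhat i ≤ a.qhat c) :
    a.Top (S.erase j) (insert c (T.erase j)) (R.erase c) := by
  have hcT := Finset.disjoint_right.1 h.disjoint hc
  have hjR := Finset.disjoint_left.1 h.disjoint hj
  have hcard : (insert c (T.erase j)).card = ⌊a.Gamma⌋₊ := by
    have := Finset.card_pos.2 ⟨j, hj⟩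
    rw [Finset.card_insert_of_notMem fun h' => hcT (Finset.mem_of_mem_erase h'),
      Finset.card_erase_of_mem hj, ← h.card_eq ⟨c, hc⟩]
    omega
  refine ⟨?_, ?_, fun i hi k hk => ?_, hcard.le, fun _ => hcard⟩
  · rw [Finset.disjoint_insert_left]
    exact ⟨by simp, (h.disjoint.mono_left (Finset.erase_subset _ _)).mono_right
      (Finset.erase_subset _ _)⟩
  · rw [Finset.insert_union, ← Finset.union_insert, Finset.insert_erase hc, ← h.union,
      Finset.erase_union_distrib, Finset.erase_eq_of_notMem hjR]
  · have hk' := Finset.mem_of_mem_erase hk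
    rcases Finset.mem_insert.1 hi with rfl | hi
    · exact hmax k hk'
    · exact h.le i (Finset.mem_of_mem_erase hi) k hk'

end Cardinality

/-! ### Two tournament trees for `T` and `R`, and additions -/

namespace Cardinality

/-- Customers as items of a tree. -/
def items {n : ℕ} (X : Finset (Fin n)) : Finset ℕ := X.map Fin.valEmbedding

@[simp] theorem card_items {n : ℕ} (X : Finset (Fin n)) : (items X).card = X.card :=
  Finset.card_map _

@[simp] theorem mem_items {n : ℕ} (X : Finset (Fin n)) (j : Fin n) : j.val ∈ items X ↔ j ∈ X := by
  simp [items, Fin.val_inj]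

theorem items_insert {n : ℕ} (X : Finset (Fin n)) (j : Fin n) :
    items (insert j X) = insert j.val (items X) := by
  simp [items, Finset.map_insert]

theorem items_erase {n : ℕ} (X : Finset (Fin n)) (j : Fin n) :
    items (X.erase j) = (items X).erase j.val := by
  simp [items, Finset.map_erase]

theorem exists_of_mem_items {n : ℕ} {X : Finset (Fin n)} {c : ℕ} (hc : c ∈ items X) :
    ∃ j ∈ X, c = j.val := by
  simp only [items, Finset.mem_map] at hc
  obtain ⟨j, hj, rfl⟩ := hc
  exact ⟨j, hj, rfl⟩

/-- The two trees: `T` with the smallest deviation at the root, `R` with the largest one. -/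
structure Store (a : Cardinality) (T R : Finset (Fin a.n)) (s : State) : Prop where
  number : s.nreg 3 = a.n
  low_card : s.nreg 4 = T.card
  high_card : s.nreg 5 = R.card
  minus : s.rreg 4 = -1
  plus : s.rreg 5 = 1
  key : ∀ j : Fin a.n, s.rmem j = a.qhat j
  low : s.HasTree (-1) 0 a.n (items T)
  high : s.HasTree 1 (3 * a.n) a.n (items R)

/-- Registers that the operations on the trees do not change. -/
structure Same (s s' : State) : Prop where
  nreg : ∀ r, r < 10 → r ≠ 4 → r ≠ 5 → s'.nreg r = s.nreg r
  item : s'.nreg 19 = s.nreg 19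
  rreg : ∀ r, r < 10 → s'.rreg r = s.rreg r

theorem Store.congr {a : Cardinality} {T R : Finset (Fin a.n)} {s s' : State} (h : a.Store T R s)
    (h3 : s'.nreg 3 = s.nreg 3) (h4 : s'.nreg 4 = s.nreg 4) (h5 : s'.nreg 5 = s.nreg 5)
    (r4 : s'.rreg 4 = s.rreg 4) (r5 : s'.rreg 5 = s.rreg 5) (hn : s'.nmem = s.nmem)
    (hr : s'.rmem = s.rmem) : a.Store T R s' :=
  ⟨h3.trans h.number, h4.trans h.low_card, h5.trans h.high_card, r4.trans h.minus,
    r5.trans h.plus, by rw [hr]; exact h.key, by rw [State.HasTree, hn, hr]; exact h.low,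
    by rw [State.HasTree, hn, hr]; exact h.high⟩

section Runs

variable {a : Cardinality} {lim : Limits} {inp : Input} {T R : Finset (Fin a.n)} {s : State}
  {j : Fin a.n}

/-- The trees occupy disjoint ranges of the integer memory, so an operation on one leaves the other
intact. -/
theorem Store.of_low {T' : Finset (Fin a.n)} (h : a.Store T R s) {s' : State} (j : Fin a.n)
    (hc : s.TreeChange 4 s') (h4 : s'.nreg 4 = T'.card)
    (hout : ∀ x, (x < 0 ∨ 0 + 3 * a.n ≤ x) → s'.nmem x = s.nmem x)
    (ht : s'.HasTree (-1) 0 a.n (items T')) : a.Store T' R s' ∧ Same s s' :=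
  ⟨⟨by rw [hc.nreg 3 (by omega) (by omega), h.number], h4,
    by rw [hc.nreg 5 (by omega) (by omega), h.high_card], by rw [hc.rreg 4 (by omega), h.minus],
    by rw [hc.rreg 5 (by omega), h.plus], by rw [hc.rmem]; exact h.key, ht,
    h.high.congr (by have := j.2; omega) (fun _ _ => by rw [hc.rmem])
      (fun x hx _ => hout x (by omega))⟩,
    ⟨fun r hr h4 _ => hc.nreg r hr h4, hc.item, hc.rreg⟩⟩

theorem Store.of_high {R' : Finset (Fin a.n)} (h : a.Store T R s) {s' : State} (j : Fin a.n)
    (hc : s.TreeChange 5 s') (h5 : s'.nreg 5 = R'.card)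
    (hout : ∀ x, (x < 3 * a.n ∨ 3 * a.n + 3 * a.n ≤ x) → s'.nmem x = s.nmem x)
    (ht : s'.HasTree 1 (3 * a.n) a.n (items R')) : a.Store T R' s' ∧ Same s s' :=
  ⟨⟨by rw [hc.nreg 3 (by omega) (by omega), h.number],
    by rw [hc.nreg 4 (by omega) (by omega), h.low_card], h5, by rw [hc.rreg 4 (by omega), h.minus],
    by rw [hc.rreg 5 (by omega), h.plus], by rw [hc.rmem]; exact h.key,
    h.low.congr (by have := j.2; omega) (fun _ _ => by rw [hc.rmem])
      (fun x _ hx => hout x (by omega)), ht⟩,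
    ⟨fun r hr _ h5 => hc.nreg r hr h5, hc.item, hc.rreg⟩⟩

theorem card_le_n (X : Finset (Fin a.n)) : X.card ≤ a.n := by
  simpa using Finset.card_le_univ X

theorem runs_insertLow (h : a.Store T R s) (hm : 6 * a.n ≤ lim.mem) (hw : 6 * a.n + 2 ≤ lim.word)
    (h19 : s.nreg 19 = j.val) (hj : j ∉ T) :
    Runs lim inp (onTree lowTree 4 insertItem) s (14 * Nat.log 2 (T.card + 1) + 40)
      (fun s' => a.Store (insert j T) R s' ∧ Same s s') :=
  (runs_insert_onTree (by omega) (runs_lowTree (by omega)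
    (by rw [card_items]; exact card_le_n T) h.number (by rw [h.low_card, card_items]) h.minus) h19
    h.low (by omega) (by omega) j.2 (by rwa [mem_items])).mono (by rw [card_items]; omega)
    fun _ h' => h.of_low j h'.1 (by rw [h'.2.1, ← items_insert, card_items]) h'.2.2.1
      (by rw [items_insert]; exact h'.2.2.2)

theorem runs_deleteLow (h : a.Store T R s) (hm : 6 * a.n ≤ lim.mem) (hw : 6 * a.n + 2 ≤ lim.word)
    (h19 : s.nreg 19 = j.val) (hj : j ∈ T) :
    Runs lim inp (onTree lowTree 4 deleteItem) s (28 * Nat.log 2 T.card + 50)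
      (fun s' => a.Store (T.erase j) R s' ∧ Same s s') :=
  (runs_delete_onTree (by omega) (runs_lowTree (by omega)
    (by rw [card_items]; exact card_le_n T) h.number (by rw [h.low_card, card_items]) h.minus) h19
    h.low (by omega) (by omega) (by rwa [mem_items])).mono (by rw [card_items]; omega)
    fun _ h' => h.of_low j h'.1 (by rw [h'.2.1, ← items_erase, card_items]) h'.2.2.1
      (by rw [items_erase]; exact h'.2.2.2)

theorem runs_insertHigh (h : a.Store T R s) (hm : 6 * a.n ≤ lim.mem) (hw : 6 * a.n + 2 ≤ lim.word)
    (h19 : s.nreg 19 = j.val) (hj : j ∉ R) :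
    Runs lim inp (onTree highTree 5 insertItem) s (14 * Nat.log 2 (R.card + 1) + 40)
      (fun s' => a.Store T (insert j R) s' ∧ Same s s') :=
  (runs_insert_onTree (by omega) (runs_highTree (by omega)
    (by rw [card_items]; exact card_le_n R) h.number (by rw [h.high_card, card_items]) h.plus) h19
    h.high (by omega) (by omega) j.2 (by rwa [mem_items])).mono (by rw [card_items]; omega)
    fun _ h' => h.of_high j h'.1 (by rw [h'.2.1, ← items_insert, card_items]) h'.2.2.1
      (by rw [items_insert]; exact h'.2.2.2)

theorem runs_deleteHigh (h : a.Store T R s) (hm : 6 * a.n ≤ lim.mem) (hw : 6 * a.n + 2 ≤ lim.word)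
    (h19 : s.nreg 19 = j.val) (hj : j ∈ R) :
    Runs lim inp (onTree highTree 5 deleteItem) s (28 * Nat.log 2 R.card + 50)
      (fun s' => a.Store T (R.erase j) s' ∧ Same s s') :=
  (runs_delete_onTree (by omega) (runs_highTree (by omega)
    (by rw [card_items]; exact card_le_n R) h.number (by rw [h.high_card, card_items]) h.plus) h19
    h.high (by omega) (by omega) (by rwa [mem_items])).mono (by rw [card_items]; omega)
    fun _ h' => h.of_high j h'.1 (by rw [h'.2.1, ← items_erase, card_items]) h'.2.2.1
      (by rw [items_erase]; exact h'.2.2.2)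

theorem Store.low_root (h : a.Store T R s) (hT : T.Nonempty) :
    ∃ c ∈ T, s.nmem 1 = c.val ∧ ∀ i ∈ T, a.qhat c ≤ a.qhat i := by
  have h1 := Tournament.root_mem h.low (by rw [card_items]; exact hT.card_pos)
  obtain ⟨c, hc, e⟩ := exists_of_mem_items h1
  simp only [zero_add] at e
  refine ⟨c, hc, e, fun i hi => ?_⟩
  have := Tournament.key_le_root h.low ((mem_items T i).2 hi)
  simp only [zero_add, e, h.key] at this
  linarith

theorem Store.high_root (h : a.Store T R s) (hR : R.Nonempty) :
    ∃ c ∈ R, s.nmem (3 * a.n + 1) = c.val ∧ ∀ i ∈ R, a.qhat i ≤ a.qhat c := by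
  have h1 := Tournament.root_mem h.high (by rw [card_items]; exact hR.card_pos)
  obtain ⟨c, hc, e⟩ := exists_of_mem_items h1
  refine ⟨c, hc, e, fun i hi => ?_⟩
  have := Tournament.key_le_root h.high ((mem_items R i).2 hi)
  simp only [e, h.key] at this
  linarith

theorem Store.mem_low (h : a.Store T R s) (j : Fin a.n) : j ∈ T ↔ 1 ≤ s.nmem (2 * a.n + j) := by
  have := Tournament.mem_iff h.low j.2
  rwa [mem_items, zero_add] at this

end Runs

/-- The sums of the data structure; the output register may be out of date. -/
structure Sums (a : Cardinality) (S T R : Finset (Fin a.n)) (s : State) : Prop where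
  store : a.Store T R s
  top : a.Top S T R
  floor : s.nreg 6 = ⌊a.Gamma⌋₊
  nominal : s.rreg 1 = ∑ i ∈ S, a.q0 i
  deviation : s.rreg 2 = ∑ i ∈ T, a.qhat i
  frac : s.rreg 3 = a.Gamma - ⌊a.Gamma⌋₊

/-- Contents of the machine when it holds the data structure for `S`. -/
def Rep (a : Cardinality) (S : Finset (Fin a.n)) (s : State) : Prop :=
  (∃ T R, a.Sums S T R s) ∧ IsWorstCaseLoad a.set S s.output

/-- Compute the worst-case load from the sums. -/
def output : Program :=
  .seq (block [.nconst 7 1]) (.seq (.branch (.nle 7 5)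
    (block [.nadd 8 3 3, .nadd 8 8 3, .nadd 8 8 7, .nload 8 8, .rload 6 8]) (block [.rsub 6 5 5]))
    (block [.rmul 6 6 3, .radd 0 1 2, .radd 0 0 6]))

/-- Move the root of the lower tree to the upper tree. -/
def evict : Program :=
  .seq (block [.nconst 7 1, .nload 19 7, .rload 6 19, .rsub 2 2 6])
    (.seq (onTree lowTree 4 deleteItem) (onTree highTree 5 insertItem))

/-- Move the root of the upper tree, if there is one, to the lower tree. -/
def refill : Program :=
  .seq (block [.nconst 7 1]) (.branch (.nle 7 5)
    (.seq (block [.nadd 8 3 3, .nadd 8 8 3, .nadd 8 8 7, .nload 19 8, .rload 6 19, .radd 2 2 6])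
      (.seq (onTree highTree 5 deleteItem) (onTree lowTree 4 insertItem))) .skip)

/-- Add the customer in integer register `0`. -/
def add : Program :=
  .seq (block [.rinput 6 0 0 0, .radd 1 1 6, .rload 6 0, .radd 2 2 6, .nmove 19 0])
    (.seq (onTree lowTree 4 insertItem) (.seq (.branch (.nle 4 6) .skip evict) output))

/-- Remove the customer in integer register `0`. -/
def remove : Program :=
  .seq (block [.rinput 6 0 0 0, .rsub 1 1 6, .nmove 19 0, .nadd 8 3 3, .nadd 8 8 0, .nload 8 8,
    .nconst 7 1])
    (.seq (.branch (.nle 7 8)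
      (.seq (block [.rload 6 19, .rsub 2 2 6]) (.seq (onTree lowTree 4 deleteItem) refill))
      (onTree highTree 5 deleteItem)) output)

section Runs

variable {a : Cardinality} {lim : Limits} {query : List ℕ} {S T R : Finset (Fin a.n)} {s : State}
  {j : Fin a.n}

theorem log_succ_le (k : ℕ) : Nat.log 2 (k + 1) ≤ Nat.log 2 k + 1 := by
  rcases Nat.eq_zero_or_pos k with rfl | hk
  · simp
  · rw [← Nat.log_mul_base one_lt_two (by omega)]
    exact Nat.log_mono_right (by omega)

theorem log_card_le {n k : ℕ} {X : Finset (Fin n)} (h : X.card ≤ k + 1) :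
    Nat.log 2 X.card ≤ Nat.log 2 k + 1 :=
  (Nat.log_mono_right h).trans (log_succ_le k)

theorem runs_output (h : a.Sums S T R s) (hm : 6 * a.n + 2 ≤ lim.mem)
    (hw : 6 * a.n + 2 ≤ lim.word) :
    Runs lim (a.toInstance.input query) output s 10 (fun s' => a.Rep S s' ∧ s.Keeps s') := by
  refine Runs.seq (T := 1) (U := 9) (P := fun s' => a.Sums S T R s' ∧ s'.nreg 7 = 1 ∧ s.Keeps s')
    (Runs.of_pre ?_ le_rfl) (fun s₁ h₁ => ?_) (by omega)
  · simp [block, Program.Pre, Instr.Safe, Instr.next, State.Keeps]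
    exact ⟨by omega, h.store.congr (by simp) (by simp) (by simp) rfl rfl rfl rfl, h.top,
      by simpa using h.floor, h.nominal, h.deviation, h.frac⟩
  obtain ⟨h1, h7, hk⟩ := h₁
  refine Runs.seq (T := 6) (U := 3) (P := fun s' => a.Sums S T R s' ∧ a.IsPeak R (s'.rreg 6) ∧
    s.Keeps s') (Runs.branch (T := 5) (fun hb => ?_) (fun hb => ?_) le_rfl) (fun s₂ h₂ => ?_)
    (by omega)
  · simp only [Test.Holds, h7, h1.store.high_card] at hb
    obtain ⟨c, hc, e, hmax⟩ := h1.store.high_root (Finset.card_pos.1 hb)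
    have h3n : a.n + a.n + a.n + 1 = 3 * a.n + 1 := by omega
    have hcn := c.2
    refine Runs.of_pre ?_ le_rfl
    simp [block, Program.Pre, Instr.Safe, Instr.next, State.Keeps, h7, h1.store.number, h3n, e,
      h1.store.key]
    refine ⟨by omega, by omega, by omega, ⟨by omega, by omega⟩, by omega, ⟨?_, h1.top,
      by simpa using h1.floor, by simpa using h1.nominal, by simpa using h1.deviation,
      by simpa using h1.frac⟩, .inr ⟨c, hc, rfl, hmax⟩, hk.1, hk.2⟩
    exact h1.store.congr (by simp) (by simp) (by simp) (by simp) (by simp) rfl rfl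
  · simp only [Test.Holds, h7, h1.store.high_card, not_le, Nat.lt_one_iff,
      Finset.card_eq_zero] at hb
    refine Runs.of_pre ?_ (show 1 ≤ 5 by omega)
    simp [block, Program.Pre, Instr.Safe, Instr.next, State.Keeps]
    exact ⟨⟨h1.store.congr (by simp) (by simp) (by simp) (by simp) (by simp) rfl rfl, h1.top,
      by simpa using h1.floor, by simpa using h1.nominal, by simpa using h1.deviation,
      by simpa using h1.frac⟩, .inl ⟨hb, rfl⟩, hk.1, hk.2⟩
  · obtain ⟨h2, hp, hk⟩ := h₂
    refine Runs.of_pre ?_ le_rfl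
    simp [block, Program.Pre, Instr.Safe, Instr.next, State.Keeps]
    refine ⟨⟨⟨T, R, ⟨h2.store.congr (by simp) (by simp) (by simp) (by simp) (by simp) rfl rfl,
      h2.top, by simpa using h2.floor, by simpa using h2.nominal, by simpa using h2.deviation,
      by simpa using h2.frac⟩⟩, ?_⟩, hk.1, hk.2⟩
    have := h2.top.isWorstCaseLoad hp
    simpa [State.output, h2.nominal, h2.deviation, h2.frac] using this

/-- `k` stands for `|S|` before the addition; `T` already contains the new customer, hence `k + 1`.
-/
theorem runs_evict (h : a.Store T R s) (hT : T.Nonempty) (hTR : Disjoint T R) {k : ℕ}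
    (hTk : T.card ≤ k + 1) (hRk : R.card ≤ k)
    (hm : 6 * a.n + 2 ≤ lim.mem) (hw : 6 * a.n + 2 ≤ lim.word) :
    Runs lim (a.toInstance.input query) evict s (42 * Nat.log 2 k + 150) (fun s' => ∃ c ∈ T,
      (∀ i ∈ T, a.qhat c ≤ a.qhat i) ∧ a.Store (T.erase c) (insert c R) s' ∧
      s'.nreg 6 = s.nreg 6 ∧ s'.rreg 1 = s.rreg 1 ∧ s'.rreg 2 = s.rreg 2 - a.qhat c ∧
      s'.rreg 3 = s.rreg 3 ∧ s.Keeps s') := by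
  obtain ⟨c, hc, e, hmin⟩ := h.low_root hT
  have hcn := c.2
  refine Runs.seq (T := 4) (U := 42 * Nat.log 2 k + 146) (P := fun s' => a.Store T R s' ∧
      s'.nreg 19 = c.val ∧ s'.nreg 6 = s.nreg 6 ∧ s'.rreg 1 = s.rreg 1 ∧
      s'.rreg 2 = s.rreg 2 - a.qhat c ∧ s'.rreg 3 = s.rreg 3 ∧ s.Keeps s')
    (Runs.of_pre ?_ le_rfl) (fun s₁ h₁ => ?_) (by omega)
  · simp [block, Program.Pre, Instr.Safe, Instr.next, State.Keeps, e, h.key]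
    exact ⟨by omega, ⟨by omega, by omega⟩, by omega,
      h.congr (by simp) (by simp) (by simp) (by simp) (by simp) rfl rfl⟩
  obtain ⟨h1, h19, h6, r1, r2, r3, hk⟩ := h₁
  refine Runs.seq (U := 14 * Nat.log 2 k + 60) (runs_deleteLow h1 (by omega) (by omega) h19 hc)
    (fun s₂ h₂ => ?_) (by have := log_card_le hTk; omega)
  refine (runs_insertHigh h₂.1 (by omega) (by omega) (h₂.2.item.trans h19)
    (Finset.disjoint_left.1 hTR hc)).mono ?_ fun s₃ h₃ => ⟨c, hc, hmin, h₃.1, ?_, ?_, ?_, ?_, ?_, ?_⟩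
  · have := Nat.log_mono_right (b := 2) (Nat.succ_le_succ hRk)
    have := log_succ_le k
    simp only [Nat.succ_eq_add_one] at *
    omega
  · rw [h₃.2.nreg 6 (by omega) (by omega) (by omega), h₂.2.nreg 6 (by omega) (by omega) (by omega),
      h6]
  · rw [h₃.2.rreg 1 (by omega), h₂.2.rreg 1 (by omega), r1]
  · rw [h₃.2.rreg 2 (by omega), h₂.2.rreg 2 (by omega), r2]
  · rw [h₃.2.rreg 3 (by omega), h₂.2.rreg 3 (by omega), r3]
  · rw [h₃.2.nreg 1 (by omega) (by omega) (by omega), h₂.2.nreg 1 (by omega) (by omega) (by omega),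
      hk.1]
  · rw [h₃.2.nreg 2 (by omega) (by omega) (by omega), h₂.2.nreg 2 (by omega) (by omega) (by omega),
      hk.2]

/-- The customer always enters the lower tree, whose root is evicted if the tree has become too
large. No comparison with the current deviations is needed. -/
theorem runs_add (h : a.Rep S s) (hj : j ∉ S) (h0 : s.nreg 0 = j.val)
    (hm : 6 * a.n + 2 ≤ lim.mem) (hw : 6 * a.n + 2 ≤ lim.word) :
    Runs lim (a.toInstance.input query) add s (300 * (Nat.log 2 S.card + 1))
      (fun s' => a.Rep (insert j S) s' ∧ s.Keeps s') := by
  obtain ⟨⟨T, R, h⟩, -⟩ := h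
  have hjT : j ∉ T := fun h' => hj (h.top.union ▸ Finset.mem_union_left _ h')
  have hjR : j ∉ R := fun h' => hj (h.top.union ▸ Finset.mem_union_right _ h')
  have hTS : T.card ≤ S.card := Finset.card_le_card (h.top.union ▸ Finset.subset_union_left)
  have hRS : R.card ≤ S.card := Finset.card_le_card (h.top.union ▸ Finset.subset_union_right)
  have hjn := j.2
  have hst := h.store
  refine Runs.seq (T := 5) (U := 56 * Nat.log 2 S.card + 250) (P := fun s' => a.Store T R s' ∧
      s'.nreg 19 = j.val ∧ s'.nreg 6 = ⌊a.Gamma⌋₊ ∧ s'.rreg 1 = ∑ i ∈ insert j S, a.q0 i ∧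
      s'.rreg 2 = ∑ i ∈ insert j T, a.qhat i ∧ s'.rreg 3 = a.Gamma - ⌊a.Gamma⌋₊ ∧ s.Keeps s')
    (Runs.of_pre ?_ le_rfl) (fun s₁ h₁ => ?_) (by omega)
  · rw [Finset.sum_insert hj, Finset.sum_insert hjT]
    simp [block, Program.Pre, Instr.Safe, Instr.next, State.Keeps, Instance.input, toInstance, h0,
      hst.key, h.floor, h.nominal, h.deviation, h.frac, add_comm]
    exact ⟨by omega, by omega,
      hst.congr (by simp) (by simp) (by simp) (by simp) (by simp) rfl rfl⟩
  obtain ⟨h1, h19, h6, r1, r2, r3, hk⟩ := h₁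
  refine Runs.seq (U := 42 * Nat.log 2 S.card + 190) (runs_insertLow h1 (by omega) (by omega) h19
    hjT) (fun s₂ h₂ => ?_) ?_
  · obtain ⟨h2, hsame⟩ := h₂
    have h6₂ := (hsame.nreg 6 (by omega) (by omega) (by omega)).trans h6
    have r1₂ := (hsame.rreg 1 (by omega)).trans r1
    have r2₂ := (hsame.rreg 2 (by omega)).trans r2
    have r3₂ := (hsame.rreg 3 (by omega)).trans r3
    have hk₂ : s.Keeps s₂ := ⟨(hsame.nreg 1 (by omega) (by omega) (by omega)).trans hk.1,
      (hsame.nreg 2 (by omega) (by omega) (by omega)).trans hk.2⟩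
    have hcard := Finset.card_insert_of_notMem hjT
    refine Runs.seq (T := 42 * Nat.log 2 S.card + 151) (U := 10) (P := fun s' =>
      (∃ T R, a.Sums (insert j S) T R s') ∧ s.Keeps s') (Runs.branch
      (T := 42 * Nat.log 2 S.card + 150) (fun hb => ?_) (fun hb => ?_) le_rfl) (fun s₃ h₃ => ?_)
      (by omega)
    · simp only [Test.Holds, h2.low_card, h6₂, hcard] at hb
      exact Runs.of_pre ⟨⟨_, _, h2, h.top.insert_of_lt hb, h6₂, r1₂, r2₂, r3₂⟩, hk₂⟩
        (Nat.zero_le _)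
    · simp only [Test.Holds, h2.low_card, h6₂, hcard, not_le] at hb
      refine (runs_evict h2 ⟨j, Finset.mem_insert_self _ _⟩
        (Finset.disjoint_insert_left.2 ⟨hjR, h.top.disjoint⟩) (by omega) hRS hm hw).mono le_rfl ?_
      rintro s₃ ⟨c, hc, hmin, h3, n6, g1, g2, g3, gk⟩
      refine ⟨⟨_, _, h3, h.top.insert_of_ge hj (by omega) hc hmin, n6.trans h6₂, g1.trans r1₂, ?_,
        g3.trans r3₂⟩, gk.1.trans hk₂.1, gk.2.trans hk₂.2⟩
      rw [g2, r2₂, ← Finset.add_sum_erase _ _ hc]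
      ring
    · obtain ⟨⟨T', R', h3⟩, hk₃⟩ := h₃
      exact (runs_output h3 hm hw).mono le_rfl fun s' h' =>
        ⟨h'.1, h'.2.1.trans hk₃.1, h'.2.2.trans hk₃.2⟩
  · have := Nat.log_mono_right (b := 2) (Nat.succ_le_succ hTS)
    have := log_succ_le S.card
    simp only [Nat.succ_eq_add_one] at *
    omega

end Runs
end Cardinality

/-! ### Removals and initialization -/

namespace Cardinality

section Runs

variable {a : Cardinality} {lim : Limits} {query : List ℕ} {S T R : Finset (Fin a.n)} {s : State}
  {j : Fin a.n}

/-- Completes the removal of `j` from `T`: either the root of the upper tree takes its place, or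
there is no rest and `T` may stay short. -/
theorem runs_refill (h : a.Store (T.erase j) R s) (ht : a.Top S T R) (hj : j ∈ T)
    (h6 : s.nreg 6 = ⌊a.Gamma⌋₊) (r1 : s.rreg 1 = ∑ i ∈ S.erase j, a.q0 i)
    (r2 : s.rreg 2 = ∑ i ∈ T.erase j, a.qhat i) (r3 : s.rreg 3 = a.Gamma - ⌊a.Gamma⌋₊)
    (hm : 6 * a.n + 2 ≤ lim.mem) (hw : 6 * a.n + 2 ≤ lim.word) :
    Runs lim (a.toInstance.input query) refill s (42 * Nat.log 2 S.card + 150) (fun s' =>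
      (∃ T R, a.Sums (S.erase j) T R s') ∧ s.Keeps s') := by
  have hTS : T.card ≤ S.card := Finset.card_le_card (ht.union ▸ Finset.subset_union_left)
  have hRS : R.card ≤ S.card := Finset.card_le_card (ht.union ▸ Finset.subset_union_right)
  have hTpos : 0 < T.card := Finset.card_pos.2 ⟨j, hj⟩
  refine Runs.seq (T := 1) (U := 42 * Nat.log 2 S.card + 149) (P := fun s' =>
      a.Store (T.erase j) R s' ∧ s'.nreg 7 = 1 ∧ s'.nreg 6 = s.nreg 6 ∧ s'.rreg 1 = s.rreg 1 ∧
      s'.rreg 2 = s.rreg 2 ∧ s'.rreg 3 = s.rreg 3 ∧ s.Keeps s')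
    (Runs.of_pre ?_ le_rfl) (fun s₁ h₁ => ?_) (by omega)
  · simp [block, Program.Pre, Instr.Safe, Instr.next, State.Keeps]
    exact ⟨by omega, h.congr (by simp) (by simp) (by simp) rfl rfl rfl rfl⟩
  obtain ⟨h1, h7, g6, g1, g2, g3, hk⟩ := h₁
  refine Runs.branch (T := 42 * Nat.log 2 S.card + 148) (fun hb => ?_) (fun hb => ?_) le_rfl
  · simp only [Test.Holds, h7, h1.high_card] at hb
    obtain ⟨c, hc, e, hmax⟩ := h1.high_root (Finset.card_pos.1 hb)
    have hcT := Finset.disjoint_right.1 ht.disjoint hc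
    have hcT' : c ∉ T.erase j := fun h' => hcT (Finset.mem_of_mem_erase h')
    have h3n : a.n + a.n + a.n + 1 = 3 * a.n + 1 := by omega
    have hcn := c.2
    refine Runs.seq (T := 6) (U := 42 * Nat.log 2 S.card + 142) (P := fun s' =>
        a.Store (T.erase j) R s' ∧ s'.nreg 19 = c.val ∧ s'.nreg 6 = s.nreg 6 ∧
        s'.rreg 1 = s.rreg 1 ∧ s'.rreg 2 = s.rreg 2 + a.qhat c ∧ s'.rreg 3 = s.rreg 3 ∧
        s.Keeps s')
      (Runs.of_pre ?_ le_rfl) (fun s₂ h₂ => ?_) (by omega)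
    · simp [block, Program.Pre, Instr.Safe, Instr.next, State.Keeps, h7, h1.number, h3n, e, h1.key,
        g6, g1, g2, g3, hk.1, hk.2]
      exact ⟨by omega, by omega, by omega, ⟨by omega, by omega⟩, by omega,
        h1.congr (by simp) (by simp) (by simp) (by simp) (by simp) rfl rfl⟩
    obtain ⟨h2, h19, g6, g1, g2, g3, hk⟩ := h₂
    refine Runs.seq (U := 14 * Nat.log 2 S.card + 60)
      (runs_deleteHigh h2 (by omega) (by omega) h19 hc) (fun s₃ h₃ => ?_)
      (by have := Nat.log_mono_right (b := 2) hRS; omega)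
    refine (runs_insertLow h₃.1 (by omega) (by omega) (h₃.2.item.trans h19) hcT').mono ?_
      fun s₄ h₄ => ⟨⟨_, _, h₄.1, ht.erase_top hj hc hmax, ?_, ?_, ?_, ?_⟩, ?_, ?_⟩
    · rw [Finset.card_erase_of_mem hj, Nat.sub_add_cancel hTpos]
      have := Nat.log_mono_right (b := 2) hTS
      omega
    · rw [h₄.2.nreg 6 (by omega) (by omega) (by omega),
        h₃.2.nreg 6 (by omega) (by omega) (by omega), g6, h6]
    · rw [h₄.2.rreg 1 (by omega), h₃.2.rreg 1 (by omega), g1, r1]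
    · rw [h₄.2.rreg 2 (by omega), h₃.2.rreg 2 (by omega), g2, r2, Finset.sum_insert hcT', add_comm]
    · rw [h₄.2.rreg 3 (by omega), h₃.2.rreg 3 (by omega), g3, r3]
    · rw [h₄.2.nreg 1 (by omega) (by omega) (by omega),
        h₃.2.nreg 1 (by omega) (by omega) (by omega), hk.1]
    · rw [h₄.2.nreg 2 (by omega) (by omega) (by omega),
        h₃.2.nreg 2 (by omega) (by omega) (by omega), hk.2]
  · simp only [Test.Holds, h7, h1.high_card, not_le, Nat.lt_one_iff, Finset.card_eq_zero] at hb
    subst hb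
    exact Runs.of_pre ⟨⟨_, _, h1, ht.erase_of_empty, g6.trans h6, g1.trans r1, g2.trans r2,
      g3.trans r3⟩, hk⟩ (Nat.zero_le _)

/-- Whether the customer belongs to `T` or `R` is read off its position in the lower tree; only in
the first case does the sum of the top deviations change. -/
theorem runs_remove (h : a.Rep S s) (hj : j ∈ S) (h0 : s.nreg 0 = j.val)
    (hm : 6 * a.n + 2 ≤ lim.mem) (hw : 6 * a.n + 2 ≤ lim.word) :
    Runs lim (a.toInstance.input query) remove s (300 * (Nat.log 2 S.card + 1))
      (fun s' => a.Rep (S.erase j) s' ∧ s.Keeps s') := by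
  obtain ⟨⟨T, R, h⟩, -⟩ := h
  have hTS : T.card ≤ S.card := Finset.card_le_card (h.top.union ▸ Finset.subset_union_left)
  have hRS : R.card ≤ S.card := Finset.card_le_card (h.top.union ▸ Finset.subset_union_right)
  have hTR := h.top.disjoint
  have hjn := j.2
  have hst := h.store
  -- The position is loaded in either case, so it must respect the word limit also when it is `0`.
  have hpos : s.nmem (2 * a.n + j) ≤ 2 * a.n := by
    by_cases hjT : j ∈ T
    · have := Tournament.position hst.low _ ((mem_items T j).2 hjT)
      have h1 := Tournament.le hst.low
      simp only [zero_add] at this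
      omega
    · rw [hst.mem_low] at hjT
      omega
  refine Runs.seq (T := 7) (U := 70 * Nat.log 2 S.card + 280) (P := fun s' => a.Store T R s' ∧
      s'.nreg 19 = j.val ∧ s'.nreg 6 = ⌊a.Gamma⌋₊ ∧ s'.rreg 1 = ∑ i ∈ S.erase j, a.q0 i ∧
      s'.rreg 2 = ∑ i ∈ T, a.qhat i ∧ s'.rreg 3 = a.Gamma - ⌊a.Gamma⌋₊ ∧ s'.nreg 7 = 1 ∧
      s'.nreg 8 = s.nmem (2 * a.n + j) ∧ s.Keeps s')
    (Runs.of_pre ?_ le_rfl) (fun s₁ h₁ => ?_) (by omega)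
  · have hnn : a.n + a.n + j.val = 2 * a.n + j := by omega
    rw [Finset.sum_erase_eq_sub hj]
    simp [block, Program.Pre, Instr.Safe, Instr.next, State.Keeps, Instance.input, toInstance, h0,
      hst.number, hst.key, h.floor, h.nominal, h.deviation, h.frac, hnn]
    exact ⟨by omega, by omega, by omega, ⟨by omega, by omega⟩, by omega,
      hst.congr (by simp) (by simp) (by simp) (by simp) (by simp) rfl rfl⟩
  obtain ⟨h1, h19, h6, r1, r2, r3, h7, h8, hk⟩ := h₁
  refine Runs.seq (T := 70 * Nat.log 2 S.card + 260) (U := 10) (P := fun s' =>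
    (∃ T R, a.Sums (S.erase j) T R s') ∧ s.Keeps s') (Runs.branch
    (T := 70 * Nat.log 2 S.card + 250) (fun hb => ?_) (fun hb => ?_) (by omega)) (fun s₂ h₂ => ?_)
    (by omega)
  · simp only [Test.Holds, h7, h8, ← hst.mem_low] at hb
    refine Runs.seq (T := 2) (U := 70 * Nat.log 2 S.card + 240) (P := fun s' => a.Store T R s' ∧
        s'.nreg 19 = j.val ∧ s'.nreg 6 = ⌊a.Gamma⌋₊ ∧ s'.rreg 1 = ∑ i ∈ S.erase j, a.q0 i ∧
        s'.rreg 2 = ∑ i ∈ T.erase j, a.qhat i ∧ s'.rreg 3 = a.Gamma - ⌊a.Gamma⌋₊ ∧ s.Keeps s')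
      (Runs.of_pre ?_ le_rfl) (fun s₂ h₂ => ?_) (by omega)
    · rw [Finset.sum_erase_eq_sub hb]
      simp [block, Program.Pre, Instr.Safe, Instr.next, State.Keeps, h19, h1.key, h6, r1, r2, r3,
        hk.1, hk.2]
      exact ⟨by omega, h1.congr (by simp) (by simp) (by simp) (by simp) (by simp) rfl rfl⟩
    obtain ⟨h2, h19, h6, r1, r2, r3, hk⟩ := h₂
    refine Runs.seq (U := 42 * Nat.log 2 S.card + 150)
      (runs_deleteLow h2 (by omega) (by omega) h19 hb) (fun s₃ h₃ => ?_)
      (by have := Nat.log_mono_right (b := 2) hTS; omega)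
    obtain ⟨h3, hs⟩ := h₃
    exact (runs_refill h3 h.top hb ((hs.nreg 6 (by omega) (by omega) (by omega)).trans h6)
      ((hs.rreg 1 (by omega)).trans r1) ((hs.rreg 2 (by omega)).trans r2)
      ((hs.rreg 3 (by omega)).trans r3) hm hw).mono le_rfl fun s' h' => ⟨h'.1,
        h'.2.1.trans ((hs.nreg 1 (by omega) (by omega) (by omega)).trans hk.1),
        h'.2.2.trans ((hs.nreg 2 (by omega) (by omega) (by omega)).trans hk.2)⟩
  · simp only [Test.Holds, h7, h8, ← hst.mem_low] at hb
    have hjR : j ∈ R := (Finset.mem_union.1 (h.top.union ▸ hj)).resolve_left hb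
    refine (runs_deleteHigh h1 (by omega) (by omega) h19 hjR).mono
      (by have := Nat.log_mono_right (b := 2) hRS; omega) fun s₂ h₂ => ?_
    obtain ⟨h2, hs⟩ := h₂
    exact ⟨⟨_, _, h2, h.top.erase_rest hjR, (hs.nreg 6 (by omega) (by omega) (by omega)).trans h6,
      (hs.rreg 1 (by omega)).trans r1, (hs.rreg 2 (by omega)).trans r2,
      (hs.rreg 3 (by omega)).trans r3⟩,
        (hs.nreg 1 (by omega) (by omega) (by omega)).trans hk.1,
        (hs.nreg 2 (by omega) (by omega) (by omega)).trans hk.2⟩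
  · obtain ⟨⟨T', R', h3⟩, hk₃⟩ := h₂
    exact (runs_output h3 hm hw).mono le_rfl fun s' h' =>
      ⟨h'.1, h'.2.1.trans hk₃.1, h'.2.2.trans hk₃.2⟩

end Runs

/-- Compute the integer part of `Γ` in integer register `6` and the rest in real register `3`; set
the real registers `0`, `1`, `2` and `7` to `0` and the real registers `4` and `5` to `∓1`. -/
def splitGamma : Program :=
  .seq (block [.nconst 6 0, .rcast 0 6, .rcast 1 6, .rcast 2 6, .rcast 7 6, .rinput 3 2 6 6,
    .nconst 9 1, .rcast 5 9, .rsub 4 7 5])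
    (.loop (.rle 5 3) (.seq (block [.nadd 6 6 9]) (block [.rsub 3 3 5])))

/-- The machine cannot round, so the integer part is found by repeated subtraction of `1`. This
takes linear time because `Γ ≤ n`. -/
theorem runs_splitGamma {a : Cardinality} {lim : Limits} {query : List ℕ} {s : State}
    (hw : a.n + 1 ≤ lim.word) :
    Runs lim (a.toInstance.input query) splitGamma s (3 * a.n + 10) (fun s' =>
      s'.nreg 6 = ⌊a.Gamma⌋₊ ∧ s'.rreg 0 = 0 ∧ s'.rreg 1 = 0 ∧ s'.rreg 2 = 0 ∧
      s'.rreg 3 = a.Gamma - ⌊a.Gamma⌋₊ ∧ s'.rreg 4 = -1 ∧ s'.rreg 5 = 1 ∧ s'.rreg 7 = 0 ∧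
      s'.nreg 9 = 1 ∧ s.Keeps s') := by
  have hfl := Nat.floor_le a.Gamma_nonneg
  have hn : ⌊a.Gamma⌋₊ ≤ a.n := Nat.floor_le_of_le a.Gamma_le
  let I : ℕ → State → Prop := fun i s' => s'.nreg 6 = i ∧ s'.rreg 0 = 0 ∧ s'.rreg 1 = 0 ∧
    s'.rreg 2 = 0 ∧ s'.rreg 3 = a.Gamma - i ∧ s'.rreg 4 = -1 ∧ s'.rreg 5 = 1 ∧ s'.rreg 7 = 0 ∧
    s'.nreg 9 = 1 ∧ s.Keeps s'
  refine Runs.seq (T := 9) (U := ⌊a.Gamma⌋₊ * 3 + 1) (P := I 0) (Runs.of_pre ?_ le_rfl)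
    (fun s₁ h₁ => Runs.counted (T := 2) I (fun i s' hi h => ?_)
      (fun i s' hi h => Runs.of_pre ?_ le_rfl) (Nat.zero_le _) h₁ le_rfl) (by omega)
  · simp [block, Program.Pre, Instr.Safe, Instr.next, Instance.input, toInstance, I, State.Keeps]
    omega
  · obtain ⟨-, -, -, -, r3, -, r5, -⟩ := h
    simp only [Test.Holds, r3, r5]
    rw [le_sub_iff_add_le, Nat.lt_iff_add_one_le, Nat.le_floor_iff a.Gamma_nonneg]
    push_cast
    rw [add_comm]
  · obtain ⟨n6, r0, r1, r2, r3, r4, r5, r7, n9, hk⟩ := h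
    simp [block, Program.Pre, Instr.Safe, Instr.next, I, State.Keeps, n6, r0, r1, r2, r3, r4, r5, r7,
      n9, hk.1, hk.2]
    exact ⟨by omega, by ring⟩

/-- Initialization. -/
def start : Program :=
  .seq splitGamma (.seq (block [.nconst 7 0, .nconst 3 1, .ninput 4 1 7, .nadd 5 4 4, .nadd 8 5 4,
      .nstore 7 7, .nstore 8 7, .nadd 8 8 5])
    (.seq (countdown (block [.rinput 6 1 4 4, .rstore 4 6, .nadd 9 5 4, .nstore 9 7, .nadd 9 8 4,
      .nstore 9 7]))
    (block [.ninput 3 1 7, .nmove 4 7, .nmove 5 7])))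

/-- An empty tree only needs its positions and its node `0` cleared; its other nodes may contain
anything. -/
theorem runs_start {a : Cardinality} {lim : Limits} {query : List ℕ} {s : State}
    (hm : 6 * a.n + 2 ≤ lim.mem) (hw : 6 * a.n + 2 ≤ lim.word) :
    Runs lim (a.toInstance.input query) start s (15 * (a.n + 2))
      (fun s' => a.Rep ∅ s' ∧ s.Keeps s') := by
  refine Runs.seq (U := 8 * a.n + 20) (runs_splitGamma (by omega)) (fun s₁ h₁ => ?_) (by omega)
  obtain ⟨n6, r0, r1, r2, r3, r4, r5, r7, n9, hk⟩ := h₁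
  let J : State → Prop := fun s' => s'.nreg 5 = 2 * a.n ∧ s'.nreg 8 = 5 * a.n ∧ s'.nreg 7 = 0 ∧
    s'.nreg 6 = ⌊a.Gamma⌋₊ ∧ s'.rreg 0 = 0 ∧ s'.rreg 1 = 0 ∧ s'.rreg 2 = 0 ∧
    s'.rreg 3 = a.Gamma - ⌊a.Gamma⌋₊ ∧ s'.rreg 4 = -1 ∧ s'.rreg 5 = 1 ∧ s.Keeps s' ∧
    s'.nmem 0 = 0 ∧ s'.nmem (3 * a.n) = 0
  refine Runs.seq (T := 8) (U := 8 * a.n + 4) (P := fun s' => J s' ∧ s'.nreg 3 = 1 ∧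
    s'.nreg 4 = a.n) (Runs.of_pre ?_ le_rfl) (fun s₂ h₂ => ?_) (by omega)
  · have h3n : a.n + a.n + a.n = 3 * a.n := by omega
    have h5n : 3 * a.n + (a.n + a.n) = 5 * a.n := by omega
    simp [block, Program.Pre, Instr.Safe, Instr.next, Instance.input, toInstance, J, State.Keeps,
      h3n, h5n, r0, r1, r2, r3, r4, r5, n6, hk.1, hk.2, Function.update_apply]
    omega
  refine Runs.seq (T := a.n * 8 + 1) (U := 3) (P := fun s' => J s' ∧
      ∀ i, i < a.n → s'.rmem i = array1 a.qhat i i ∧ s'.nmem (2 * a.n + i) = 0 ∧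
        s'.nmem (5 * a.n + i) = 0)
    ((runs_countdown (t := 6) (n := a.n) (fun i s' => J s' ∧
      ∀ k, k < a.n → i ≤ k → s'.rmem k = array1 a.qhat k k ∧ s'.nmem (2 * a.n + k) = 0 ∧
        s'.nmem (5 * a.n + k) = 0) (fun i s' v h => by simpa [J, State.Keeps] using h) (by omega)
      (fun i s' hi h h3 h4 => Runs.of_pre ?_ le_rfl) ⟨h₂.1, fun k h1 h2 => by omega⟩ h₂.2.1 h₂.2.2
      le_rfl).mono le_rfl fun s' h' => ⟨h'.1, fun i hi => h'.2 i hi (Nat.zero_le _)⟩)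
    (fun s₃ h₃ => Runs.of_pre ?_ le_rfl) (by omega)
  · obtain ⟨⟨n5, n8, n7, n6, r0, r1, r2, r3, r4, r5, hk, m0, m3⟩, hc⟩ := h
    simp [block, Program.Pre, Instr.Safe, Instr.next, Instance.input, toInstance, J, State.Keeps,
      h3, h4, n5, n6, n7, n8, r0, r1, r2, r3, r4, r5, hk.1, hk.2]
    refine ⟨by omega, by omega, by omega, by omega, by omega, ⟨?_, ?_⟩, fun k hk hik => ?_⟩
    · rw [Function.update_apply, Function.update_apply, m0]
      split_ifs <;> rfl
    · rw [Function.update_apply, Function.update_apply, m3]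
      split_ifs <;> rfl
    · rcases hik.eq_or_lt with rfl | hik
      · simp [Function.update_apply]
      · obtain ⟨c1, c2, c3⟩ := hc k hk hik
        simp only [Function.update_apply, c1, c2, c3]
        refine ⟨if_neg (by omega), ?_, ?_⟩ <;> split_ifs <;> rfl
  · obtain ⟨⟨n5, n8, n7, n6, r0, r1, r2, r3, r4, r5, hk, m0, m3⟩, hc⟩ := h₃
    simp [block, Program.Pre, Instr.Safe, Instr.next, Instance.input, toInstance, State.Keeps,
      n7, hk.1, hk.2]
    refine ⟨by omega, ⟨∅, ∅, ⟨by simp, by simp, by simp, by simp [r4], by simp [r5], fun j => ?_,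
      .empty m0 fun c hc' => ?_, .empty m3 fun c hc' => ?_⟩, a.top_empty, by simp [n6], by simp [r1],
      by simp [r2], by simp [r3]⟩, ?_⟩
    · simp [(hc j j.2).1]
    · simpa using (hc c hc').2.1
    · simpa [show 3 * a.n + 2 * a.n = 5 * a.n by omega] using (hc c hc').2.2
    · have := a.top_empty.isWorstCaseLoad (.inl ⟨rfl, rfl⟩)
      simpa [State.output, r0] using this

/-- The data structure for cardinality-constrained sets. -/
noncomputable def maintenance : Maintenance True Cardinality.toInstance (fun a => a.n + 1)
    (fun _ k => Nat.log 2 k + 1) (fun a => a.n + 1) where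
  start := start
  add := add
  remove := remove
  c := 300
  Rep := Rep
  agree := fun (a : Cardinality) S s s' h hs => by
    obtain ⟨⟨T, R, hs⟩, hv⟩ := hs
    refine ⟨⟨T, R, ⟨hs.store.congr (h.nreg 3 (by omega)) (h.nreg 4 (by omega)) (h.nreg 5 (by omega))
      (by rw [h.rreg]) (by rw [h.rreg]) h.nmem h.rmem, hs.top, (h.nreg 6 (by omega)).trans hs.floor,
      by rw [h.rreg, hs.nominal], by rw [h.rreg, hs.deviation], by rw [h.rreg, hs.frac]⟩⟩, ?_⟩
    rwa [State.output, h.rreg]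
  load := fun _ _ _ h => h.2
  start_runs := fun (a : Cardinality) lim query s hm hw =>
    have hw : 300 * (a.n + 2) ≤ lim.word := hw
    (runs_start (by omega) (by omega)).mono (by omega) fun _ => id
  add_runs := fun (a : Cardinality) lim query S s j hm hw hs hj h0 =>
    have hw : 300 * (a.n + 2) ≤ lim.word := hw
    runs_add hs hj h0 (by omega) (by omega)
  remove_runs := fun _ (a : Cardinality) lim query S s j hm hw hs hj h0 =>
    have hw : 300 * (a.n + 2) ≤ lim.word := hw
    runs_remove hs hj h0 (by omega) (by omega)

theorem incrementallyUpdatable : IncrementallyUpdatable True Cardinality.toInstance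
    (fun _ k => Nat.log 2 k + 1) (fun a => a.n + 1) :=
  maintenance.incrementallyUpdatable (fun _ => le_rfl) (fun _ => le_rfl) (fun _ _ => by omega)

end Cardinality

namespace Cardinality

/-! Without removals it suffices to store the deviations of the customers of `T`, in the slots
`0, …, ⌊Γ⌋`, and the largest deviation of the others. -/

/-- The occupied slots are those of `X`; the slot `x` is occupied by the customer `g x` of `T`. -/
structure Slots (a : Cardinality) (T : Finset (Fin a.n)) (X : Finset ℕ) (g : ℕ → Fin a.n)
    (s : State) : Prop where
  number : s.nreg 3 = ⌊a.Gamma⌋₊ + 1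
  card : s.nreg 4 = X.card
  minus : s.rreg 4 = -1
  image : X.image g = T
  inj : Set.InjOn g X
  key : ∀ x ∈ X, s.rmem x = a.qhat (g x)
  tree : s.HasTree (-1) 0 (⌊a.Gamma⌋₊ + 1) X

/-- Contents of the machine when it holds the data structure for `S` without removals. -/
def AddRep (a : Cardinality) (S : Finset (Fin a.n)) (s : State) : Prop :=
  IsWorstCaseLoad a.set S s.output ∧ (0 < a.n → ∃ T R X g, a.Slots T X g s ∧ a.Top S T R ∧ a.IsPeak R (s.rreg 7) ∧ s.nreg 6 = ⌊a.Gamma⌋₊ ∧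
    s.rreg 1 = ∑ i ∈ S, a.q0 i ∧ s.rreg 2 = ∑ i ∈ T, a.qhat i ∧
    s.rreg 3 = a.Gamma - ⌊a.Gamma⌋₊ ∧ s.nreg 5 ∉ X ∧ s.nreg 5 ≤ ⌊a.Gamma⌋₊ ∧
    (X.card < ⌊a.Gamma⌋₊ → X = Finset.range (s.nreg 5)))

/-- Initialization without removals. -/
def addStart : Program :=
  .seq splitGamma (.seq (block [.nadd 8 6 9, .nmove 3 9, .nmove 4 8, .nadd 5 8 8, .nconst 7 0,
      .nstore 7 7])
    (.seq (countdown (block [.nadd 9 5 4, .nstore 9 7]))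
      (block [.nmove 3 8, .nmove 4 7, .nmove 5 7])))

/-- Free the slot of the smallest deviation. -/
def freeSlot : Program :=
  .seq (block [.nconst 7 1, .nload 19 7, .nmove 5 19, .rload 6 19, .rsub 2 2 6])
    (.seq (.branch (.rle 6 7) .skip (block [.rmove 7 6])) (onTree lowTree 4 deleteItem))

/-- Add the customer in integer register `0`, without provision for removals. -/
def addOnly : Program :=
  .seq (block [.rinput 6 0 0 0, .radd 1 1 6, .rinput 6 1 0 0, .radd 2 2 6, .rstore 5 6,
      .nmove 19 5])
    (.seq (onTree lowTree 4 insertItem) (.seq (.branch (.nle 4 6) (block [.nmove 5 4]) freeSlot)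
      (block [.rmul 6 7 3, .radd 0 1 2, .radd 0 0 6])))

variable {a : Cardinality} {lim : Limits} {query : List ℕ} {S T R : Finset (Fin a.n)} {s : State}
  {j : Fin a.n} {X : Finset ℕ} {g : ℕ → Fin a.n}

theorem Slots.congr (h : a.Slots T X g s) {s' : State} (h3 : s'.nreg 3 = s.nreg 3)
    (h4 : s'.nreg 4 = s.nreg 4) (r4 : s'.rreg 4 = s.rreg 4) (hn : s'.nmem = s.nmem)
    (hr : s'.rmem = s.rmem) : a.Slots T X g s' :=
  ⟨h3.trans h.number, h4.trans h.card, r4.trans h.minus, h.image, h.inj, by rw [hr]; exact h.key,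
    by rw [State.HasTree, hn, hr]; exact h.tree⟩

theorem Slots.card_eq (h : a.Slots T X g s) : T.card = X.card := by
  rw [← h.image, Finset.card_image_of_injOn h.inj]

/-- A customer that leaves `T` updates the maximum of the rest; the start value `0` is right because
deviations are nonnegative. -/
theorem IsPeak.insert {x : ℝ} (h : a.IsPeak R x) (c : Fin a.n) :
    a.IsPeak (insert c R) (max x (a.qhat c)) := by
  right
  rcases h with ⟨rfl, rfl⟩ | ⟨i, hi, rfl, hmax⟩
  · exact ⟨c, by simp, max_eq_right (a.qhat_nonneg c), by simp⟩
  · rcases le_total (a.qhat c) (a.qhat i) with hle | hle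
    · rw [max_eq_left hle]
      refine ⟨i, Finset.mem_insert_of_mem hi, rfl, fun k hk => ?_⟩
      rcases Finset.mem_insert.1 hk with rfl | hk
      · exact hle
      · exact hmax k hk
    · rw [max_eq_right hle]
      refine ⟨c, Finset.mem_insert_self _ _, rfl, fun k hk => ?_⟩
      rcases Finset.mem_insert.1 hk with rfl | hk
      · exact le_rfl
      · exact (hmax k hk).trans hle

theorem Slots.root (h : a.Slots T X g s) (hX : X.Nonempty) :
    s.nmem 1 ∈ X ∧ ∀ i ∈ T, a.qhat (g (s.nmem 1)) ≤ a.qhat i := by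
  have h1 := Tournament.root_mem h.tree hX.card_pos
  simp only [zero_add] at h1
  refine ⟨h1, fun i hi => ?_⟩
  rw [← h.image, Finset.mem_image] at hi
  obtain ⟨x, hx, rfl⟩ := hi
  have := Tournament.key_le_root h.tree hx
  simp only [zero_add, h.key _ h1, h.key x hx] at this
  linarith

/-- A deviation written into a free slot does not disturb the tree, whose keys are those of the
occupied slots. -/
theorem Slots.store (h : a.Slots T X g s) {f : ℕ} (hf : f ∉ X) {s' : State}
    (h3 : s'.nreg 3 = s.nreg 3) (h4 : s'.nreg 4 = s.nreg 4) (r4 : s'.rreg 4 = s.rreg 4)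
    (hn : s'.nmem = s.nmem) (hr : s'.rmem = Function.update s.rmem f (a.qhat j)) :
    a.Slots T X (Function.update g f j) s' := by
  have hne : ∀ x ∈ X, x ≠ f := fun x hx e => hf (e ▸ hx)
  have hg : ∀ x ∈ X, Function.update g f j x = g x := fun x hx => Function.update_of_ne (hne x hx) ..
  refine ⟨h3.trans h.number, h4.trans h.card, r4.trans h.minus, ?_, ?_, fun x hx => ?_, ?_⟩
  · rw [← h.image]
    exact Finset.image_congr hg
  · exact h.inj.congr fun x hx => (hg x hx).symm
  · rw [hr, Function.update_of_ne (hne x hx), hg x hx, h.key x hx]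
  · exact h.tree.congr (Nat.succ_pos _) (fun x hx => by rw [hr, Function.update_of_ne (hne x hx)])
      (fun x _ _ => by rw [hn])

theorem runs_insertSlot {f : ℕ} (h : a.Slots T X g s) (hf : f ∉ X) (hfk : f ≤ ⌊a.Gamma⌋₊)
    (hgf : g f = j) (hj : j ∉ T) (hkey : s.rmem f = a.qhat j)
    (hm : 3 * (⌊a.Gamma⌋₊ + 1) ≤ lim.mem) (hw : 3 * (⌊a.Gamma⌋₊ + 1) + 2 ≤ lim.word)
    (h19 : s.nreg 19 = f) :
    Runs lim (a.toInstance.input query) (onTree lowTree 4 insertItem) s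
      (14 * Nat.log 2 (X.card + 1) + 40)
      (fun s' => a.Slots (insert j T) (insert f X) g s' ∧ s.TreeChange 4 s') := by
  refine (runs_insert_onTree (by omega) (runs_lowTree (by omega) (Tournament.le h.tree) h.number
    h.card h.minus) h19 h.tree (by omega) (by omega) (by omega) hf).mono (by omega) fun s' h' => ?_
  obtain ⟨hc, h4, -, ht⟩ := h'
  refine ⟨⟨by rw [hc.nreg 3 (by omega) (by omega), h.number], h4,
    by rw [hc.rreg 4 (by omega), h.minus], by rw [Finset.image_insert, h.image, hgf], ?_,
    fun x hx => ?_, ht⟩, hc⟩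
  · rw [Finset.coe_insert, Set.injOn_insert (by exact_mod_cast hf)]
    refine ⟨h.inj, fun hmem => hj ?_⟩
    rw [hgf, ← Finset.coe_image, h.image] at hmem
    exact_mod_cast hmem
  · rw [hc.rmem]
    rcases Finset.mem_insert.1 hx with rfl | hx
    · rw [hkey, hgf]
    · exact h.key x hx

theorem runs_deleteSlot {c : ℕ} (h : a.Slots T X g s) (hcX : c ∈ X)
    (hm : 3 * (⌊a.Gamma⌋₊ + 1) ≤ lim.mem) (hw : 3 * (⌊a.Gamma⌋₊ + 1) + 2 ≤ lim.word)
    (h19 : s.nreg 19 = c) :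
    Runs lim (a.toInstance.input query) (onTree lowTree 4 deleteItem) s
      (28 * Nat.log 2 X.card + 50)
      (fun s' => a.Slots (T.erase (g c)) (X.erase c) g s' ∧ s.TreeChange 4 s') := by
  refine (runs_delete_onTree (by omega) (runs_lowTree (by omega) (Tournament.le h.tree) h.number
    h.card h.minus) h19 h.tree (by omega) (by omega) hcX).mono (by omega) fun s' h' => ?_
  obtain ⟨hc, h4, -, ht⟩ := h'
  refine ⟨⟨by rw [hc.nreg 3 (by omega) (by omega), h.number], h4,
    by rw [hc.rreg 4 (by omega), h.minus], ?_, ?_, fun x hx => ?_, ht⟩, hc⟩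
  · rw [← h.image]
    ext i
    simp only [Finset.mem_image, Finset.mem_erase]
    constructor
    · rintro ⟨x, ⟨hxc, hx⟩, rfl⟩
      exact ⟨fun e => hxc (h.inj hx hcX e), x, hx, rfl⟩
    · rintro ⟨hi, x, hx, rfl⟩
      exact ⟨x, ⟨fun e => hi (e ▸ rfl), hx⟩, rfl⟩
  · exact h.inj.mono (by exact_mod_cast Finset.erase_subset _ _)
  · rw [hc.rmem]
    exact h.key x (Finset.mem_of_mem_erase hx)

theorem runs_freeSlot (h : a.Slots T X g s) (hX : X.Nonempty)
    (hm : 3 * (⌊a.Gamma⌋₊ + 1) ≤ lim.mem) (hw : 3 * (⌊a.Gamma⌋₊ + 1) + 2 ≤ lim.word) :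
    Runs lim (a.toInstance.input query) freeSlot s (28 * Nat.log 2 X.card + 60) (fun s' =>
      ∃ c ∈ X, (∀ i ∈ T, a.qhat (g c) ≤ a.qhat i) ∧ a.Slots (T.erase (g c)) (X.erase c) g s' ∧
      s'.nreg 5 = c ∧ s'.nreg 6 = s.nreg 6 ∧ s'.rreg 1 = s.rreg 1 ∧
      s'.rreg 2 = s.rreg 2 - a.qhat (g c) ∧ s'.rreg 3 = s.rreg 3 ∧
      s'.rreg 7 = max (s.rreg 7) (a.qhat (g c)) ∧ s.Keeps s') := by
  obtain ⟨hcX, hmin⟩ := h.root hX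
  obtain ⟨c, hc⟩ : ∃ c, s.nmem 1 = c := ⟨_, rfl⟩
  rw [hc] at hcX hmin
  have hcN := Tournament.item_lt h.tree c hcX
  refine Runs.seq (T := 5) (U := 28 * Nat.log 2 X.card + 52) (P := fun s' => a.Slots T X g s' ∧
      s'.nreg 19 = c ∧ s'.nreg 5 = c ∧ s'.nreg 6 = s.nreg 6 ∧ s'.rreg 1 = s.rreg 1 ∧
      s'.rreg 2 = s.rreg 2 - a.qhat (g c) ∧ s'.rreg 3 = s.rreg 3 ∧ s'.rreg 7 = s.rreg 7 ∧
      s'.rreg 6 = a.qhat (g c) ∧ s.Keeps s')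
    (Runs.of_pre ?_ le_rfl) (fun s₁ h₁ => ?_) (by omega)
  · simp [block, Program.Pre, Instr.Safe, Instr.next, State.Keeps, hc, h.key c hcX]
    exact ⟨by omega, ⟨by omega, by omega⟩, by omega, by omega,
      h.congr (by simp) (by simp) (by simp) rfl rfl⟩
  obtain ⟨h1, h19, h5, h6, r1, r2, r3, r7, r6, hk⟩ := h₁
  refine Runs.seq (T := 2) (U := 28 * Nat.log 2 X.card + 50) (P := fun s' => a.Slots T X g s' ∧
      s'.nreg 19 = c ∧ s'.nreg 5 = c ∧ s'.nreg 6 = s.nreg 6 ∧ s'.rreg 1 = s.rreg 1 ∧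
      s'.rreg 2 = s.rreg 2 - a.qhat (g c) ∧ s'.rreg 3 = s.rreg 3 ∧
      s'.rreg 7 = max (s.rreg 7) (a.qhat (g c)) ∧ s.Keeps s')
    (Runs.of_pre ?_ le_rfl) (fun s₂ h₂ => ?_) (by omega)
  · simp [block, Program.Pre, Instr.Safe, Instr.next, Test.Holds, State.Keeps, h19, h5, h6, r1, r2,
      r3, r7, r6, hk.1, hk.2, h1]
    exact fun hlt => ⟨h1.congr rfl rfl (by simp) rfl rfl, hlt.le⟩
  obtain ⟨h2, h19, h5, h6, r1, r2, r3, r7, hk⟩ := h₂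
  refine (runs_deleteSlot h2 hcX hm hw h19).mono le_rfl fun s' h' => ⟨c, hcX, hmin, h'.1, ?_⟩
  have hf := h'.2
  exact ⟨(hf.nreg 5 (by omega) (by omega)).trans h5, (hf.nreg 6 (by omega) (by omega)).trans h6,
    (hf.rreg 1 (by omega)).trans r1, (hf.rreg 2 (by omega)).trans r2,
    (hf.rreg 3 (by omega)).trans r3, (hf.rreg 7 (by omega)).trans r7,
    (hf.nreg 1 (by omega) (by omega)).trans hk.1, (hf.nreg 2 (by omega) (by omega)).trans hk.2⟩

/-- The tree contains slots instead of customers, so its size depends on `⌊Γ⌋` and not on `n`; the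
customers behind the slots, `g`, exist only in the proof. At most `⌊Γ⌋` slots are occupied between
updates, which leaves one for the new customer. Nothing but its maximum is stored of the rest,
because nothing returns from there to `T`. -/
theorem runs_addOnly (h : a.AddRep S s) (hj : j ∉ S) (h0 : s.nreg 0 = j.val)
    (hm : 3 * (⌊a.Gamma⌋₊ + 1) ≤ lim.mem) (hw : 3 * (a.n + 1) + 2 ≤ lim.word) :
    Runs lim (a.toInstance.input query) addOnly s (300 * (Nat.log 2 ⌊a.Gamma⌋₊ + 1))
      (fun s' => a.AddRep (insert j S) s' ∧ s.Keeps s') := by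
  obtain ⟨T, R, X, g, h, ht, hp, h6, r1, r2, r3, hfX, hfk, hfree⟩ := h.2 j.pos
  have hn : ⌊a.Gamma⌋₊ ≤ a.n := Nat.floor_le_of_le a.Gamma_le
  have hjT : j ∉ T := fun h' => hj (ht.union ▸ Finset.mem_union_left _ h')
  have hjn := j.2
  have hTX := h.card_eq
  have hTk := ht.card_le
  obtain ⟨f, hf⟩ : ∃ f, s.nreg 5 = f := ⟨_, rfl⟩
  rw [hf] at hfX hfk hfree
  have hlog : Nat.log 2 (X.card + 1) ≤ Nat.log 2 ⌊a.Gamma⌋₊ + 1 :=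
    (Nat.log_mono_right (by omega)).trans (log_succ_le _)
  refine Runs.seq (T := 6) (U := 42 * Nat.log 2 ⌊a.Gamma⌋₊ + 200) (P := fun s' =>
      a.Slots T X (Function.update g f j) s' ∧ s'.nreg 19 = f ∧ s'.rmem f = a.qhat j ∧
      s'.nreg 6 = ⌊a.Gamma⌋₊ ∧ s'.rreg 1 = ∑ i ∈ insert j S, a.q0 i ∧
      s'.rreg 2 = ∑ i ∈ insert j T, a.qhat i ∧ s'.rreg 3 = a.Gamma - ⌊a.Gamma⌋₊ ∧
      s'.rreg 7 = s.rreg 7 ∧ s.Keeps s')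
    (Runs.of_pre ?_ le_rfl) (fun s₁ h₁ => ?_) (by omega)
  · rw [Finset.sum_insert hj, Finset.sum_insert hjT]
    simp [block, Program.Pre, Instr.Safe, Instr.next, State.Keeps, Instance.input, toInstance, h0,
      hf, h6, r1, r2, r3, add_comm]
    exact ⟨by omega, by omega, h.store hfX (by simp) (by simp) (by simp) rfl rfl⟩
  obtain ⟨h1, h19, hkey, h6, r1, r2, r3, r7, hk⟩ := h₁
  refine Runs.seq (U := 28 * Nat.log 2 ⌊a.Gamma⌋₊ + 140) (runs_insertSlot h1 hfX hfk (by simp) hjT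
    hkey hm (by omega) h19) (fun s₂ h₂ => ?_) (by omega)
  obtain ⟨h2, hs⟩ := h₂
  have h6 := (hs.nreg 6 (by omega) (by omega)).trans h6
  have r1 := (hs.rreg 1 (by omega)).trans r1
  have r2 := (hs.rreg 2 (by omega)).trans r2
  have r3 := (hs.rreg 3 (by omega)).trans r3
  have r7 := (hs.rreg 7 (by omega)).trans r7
  have hk : s.Keeps s₂ := ⟨(hs.nreg 1 (by omega) (by omega)).trans hk.1,
    (hs.nreg 2 (by omega) (by omega)).trans hk.2⟩
  have hcard := Finset.card_insert_of_notMem hfX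
  have hcardT := Finset.card_insert_of_notMem hjT
  refine Runs.seq (T := 28 * Nat.log 2 ⌊a.Gamma⌋₊ + 120) (U := 3) (P := fun s' => ∃ T R X g,
      a.Slots T X g s' ∧ a.Top (insert j S) T R ∧ a.IsPeak R (s'.rreg 7) ∧
      s'.nreg 6 = ⌊a.Gamma⌋₊ ∧ s'.rreg 1 = ∑ i ∈ insert j S, a.q0 i ∧
      s'.rreg 2 = ∑ i ∈ T, a.qhat i ∧ s'.rreg 3 = a.Gamma - ⌊a.Gamma⌋₊ ∧ s'.nreg 5 ∉ X ∧
      s'.nreg 5 ≤ ⌊a.Gamma⌋₊ ∧ (X.card < ⌊a.Gamma⌋₊ → X = Finset.range (s'.nreg 5)) ∧ s.Keeps s')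
    (Runs.branch (T := 28 * Nat.log 2 ⌊a.Gamma⌋₊ + 110) (fun hb => ?_) (fun hb => ?_) (by omega))
    (fun s₃ h₃ => Runs.of_pre ?_ le_rfl) (by omega)
  · simp only [Test.Holds, h2.card, h6, hcard] at hb
    -- Until `T` is full no slot has been freed: the occupied slots are an initial segment, and the
    -- next free one is their number. Afterwards the slot freed by an eviction is the one to be
    -- reused.
    have hXf := hfree (by omega)
    have hcf : X.card = f := by rw [hXf, Finset.card_range]
    have hXf' : insert f X = Finset.range (f + 1) := by rw [hXf, Finset.range_add_one]
    refine (Runs.of_pre (Q := fun s' => s' = s₂.setN 5 (f + 1)) ?_ le_rfl).mono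
      (show 1 ≤ _ by omega) ?_
    · simp [block, Program.Pre, Instr.Safe, Instr.next, h2.card, hcard, hcf]
      omega
    rintro _ rfl
    refine ⟨_, R, _, _, h2.congr (by simp) (by simp) (by simp) rfl rfl,
      ht.insert_of_lt (by omega), by simpa [r7] using hp, by simp [h6], by simp [r1], by simp [r2],
      by simp [r3], ?_, by simp; omega, fun _ => by simpa using hXf',
      by simpa [State.Keeps] using hk⟩
    rw [hXf']
    simp
  · simp only [Test.Holds, h2.card, h6, hcard, not_le] at hb
    refine (runs_freeSlot h2 ⟨f, Finset.mem_insert_self _ _⟩ hm (by omega)).mono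
      (by rw [hcard]; omega) ?_
    rintro s₃ ⟨c, hc, hmin, h3, g5, g6, g1, g2, g3, g7, gk⟩
    have hgc : Function.update g f j c ∈ insert j T := by
      rw [← h2.image]
      exact Finset.mem_image_of_mem _ hc
    have hcN := Tournament.item_lt h2.tree c hc
    refine ⟨_, _, _, _, h3, ht.insert_of_ge hj (by omega) hgc hmin, ?_, g6.trans h6, g1.trans r1, ?_,
      g3.trans r3, by simp [g5], by omega, fun hlt => ?_, gk.1.trans hk.1, gk.2.trans hk.2⟩
    · rw [g7, r7]
      exact hp.insert _
    · rw [g2, r2, ← Finset.add_sum_erase _ _ hgc]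
      ring
    · rw [Finset.card_erase_of_mem hc, hcard] at hlt
      omega
  · obtain ⟨T, R, X, g, h3, ht, hp, h6, r1, r2, r3, hfX, hfk, hfree, hk⟩ := h₃
    simp [block, Program.Pre, Instr.Safe, Instr.next, State.Keeps]
    refine ⟨⟨?_, fun _ => ⟨T, R, X, g, h3.congr (by simp) (by simp) (by simp) rfl rfl, ht,
      by simpa using hp, by simp [h6], by simp [r1], by simp [r2], by simp [r3], by simpa using hfX,
      by simpa using hfk, by simpa using hfree⟩⟩, hk.1, hk.2⟩
    simpa [State.output, r1, r2, r3] using ht.isWorstCaseLoad hp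

theorem runs_addStart (hm : 3 * (⌊a.Gamma⌋₊ + 1) ≤ lim.mem) (hw : 3 * (a.n + 1) + 2 ≤ lim.word) :
    Runs lim (a.toInstance.input query) addStart s (30 * (a.n + 1))
      (fun s' => a.AddRep ∅ s' ∧ s.Keeps s') := by
  have hn : ⌊a.Gamma⌋₊ ≤ a.n := Nat.floor_le_of_le a.Gamma_le
  refine Runs.seq (U := 4 * a.n + 20) (runs_splitGamma (by omega)) (fun s₁ h₁ => ?_) (by omega)
  obtain ⟨n6, r0, r1, r2, r3, r4, r5, r7, n9, hk⟩ := h₁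
  obtain ⟨N, hN⟩ : ∃ N, ⌊a.Gamma⌋₊ + 1 = N := ⟨_, rfl⟩
  let J : State → Prop := fun s' => s'.nreg 5 = 2 * N ∧ s'.nreg 8 = N ∧ s'.nreg 7 = 0 ∧
    s'.nreg 6 = ⌊a.Gamma⌋₊ ∧ s'.rreg 0 = 0 ∧ s'.rreg 1 = 0 ∧ s'.rreg 2 = 0 ∧
    s'.rreg 3 = a.Gamma - ⌊a.Gamma⌋₊ ∧ s'.rreg 4 = -1 ∧ s'.rreg 7 = 0 ∧ s.Keeps s' ∧
    s'.nmem 0 = 0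
  refine Runs.seq (T := 6) (U := 4 * a.n + 14) (P := fun s' => J s' ∧ s'.nreg 3 = 1 ∧
    s'.nreg 4 = N) (Runs.of_pre ?_ le_rfl) (fun s₂ h₂ => ?_) (by omega)
  · simp [block, Program.Pre, Instr.Safe, Instr.next, J, State.Keeps, r0, r1, r2, r3, r4, r7, n6,
      n9, hN, hk.1, hk.2]
    omega
  refine Runs.seq (T := N * 4 + 1) (U := 3) (P := fun s' => J s' ∧
      ∀ i, i < N → s'.nmem (2 * N + i) = 0)
    ((runs_countdown (t := 2) (n := N) (fun i s' => J s' ∧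
      ∀ k, k < N → i ≤ k → s'.nmem (2 * N + k) = 0) (fun i s' v h => by
        simpa [J, State.Keeps] using h) (by omega)
      (fun i s' hi h h3 h4 => Runs.of_pre ?_ le_rfl) ⟨h₂.1, fun k h1 h2 => by omega⟩ h₂.2.1 h₂.2.2
      le_rfl).mono le_rfl fun s' h' => ⟨h'.1, fun i hi => h'.2 i hi (Nat.zero_le _)⟩)
    (fun s₃ h₃ => Runs.of_pre ?_ le_rfl) (by omega)
  · obtain ⟨⟨n5, n8, n7, n6, r0, r1, r2, r3, r4, r7, hk, m0⟩, hc⟩ := h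
    simp [block, Program.Pre, Instr.Safe, Instr.next, J, State.Keeps,
      h3, h4, n5, n6, n7, n8, r0, r1, r2, r3, r4, r7, hk.1, hk.2]
    refine ⟨by omega, by omega, ?_, fun k hk hik => ?_⟩
    · rw [Function.update_apply, m0]
      split_ifs <;> rfl
    · rcases hik.eq_or_lt with rfl | hik
      · simp [Function.update_apply]
      · rw [Function.update_apply, hc k hk hik]
        split_ifs <;> rfl
  · obtain ⟨⟨n5, n8, n7, n6, r0, r1, r2, r3, r4, r7, hk, m0⟩, hc⟩ := h₃
    -- The map `g` needs a default customer even if no slot is occupied; this is the reason for the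
    -- condition `0 < a.n` in `AddRep`.
    simp [block, Program.Pre, Instr.Safe, Instr.next, State.Keeps, n7, n8, hk.1, hk.2]
    refine ⟨by omega, ?_, fun hpos => ⟨∅, ∅, ∅, fun _ => ⟨0, hpos⟩, ⟨by simpa using hN.symm,
      by simp, by simp [r4], by simp, by simp, by simp, .empty m0 fun c hc' => ?_⟩, a.top_empty,
      .inl ⟨rfl, by simp [r7]⟩, by simp [n6], by simp [r1], by simp [r2], by simp [r3], by simp,
      by simp, by simp⟩⟩
    · have := a.top_empty.isWorstCaseLoad (.inl ⟨rfl, rfl⟩)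
      simpa [State.output, r0] using this
    · rw [hN] at hc' ⊢
      simpa using hc c hc'

/-- The data structure for cardinality-constrained sets without removals. -/
noncomputable def addMaintenance : Maintenance False Cardinality.toInstance (fun a => a.n + 1)
    (fun a _ => Nat.log 2 ⌊a.Gamma⌋₊ + 1) (fun a => ⌊a.Gamma⌋₊ + 1) where
  start := addStart
  add := addOnly
  remove := .skip
  c := 300
  Rep := AddRep
  agree := fun (a : Cardinality) S s s' h hs => by
    refine ⟨by rw [State.output, h.rreg]; exact hs.1, fun hpos => ?_⟩
    obtain ⟨T, R, X, g, hs, ht, hp, h6, r1, r2, r3, hfX, hfk, hfree⟩ := hs.2 hpos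
    exact ⟨T, R, X, g, hs.congr (h.nreg 3 (by omega)) (h.nreg 4 (by omega)) (by rw [h.rreg]) h.nmem
      h.rmem, ht, by rwa [h.rreg], (h.nreg 6 (by omega)).trans h6, by rw [h.rreg, r1],
      by rw [h.rreg, r2], by rw [h.rreg, r3], by rwa [h.nreg 5 (by omega)],
      by rwa [h.nreg 5 (by omega)], by rwa [h.nreg 5 (by omega)]⟩
  load := fun _ _ _ h => h.1
  start_runs := fun (a : Cardinality) lim query s hm hw =>
    have hw : 300 * (a.n + 2) ≤ lim.word := hw
    (runs_addStart (by omega) (by omega)).mono (by omega) fun _ => id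
  add_runs := fun (a : Cardinality) lim query S s j hm hw hs hj h0 =>
    have hw : 300 * (a.n + 2) ≤ lim.word := hw
    runs_addOnly hs hj h0 (by omega) (by omega)
  remove_runs := False.elim

theorem incrementallyUpdatable_add : IncrementallyUpdatable False Cardinality.toInstance
    (fun a _ => Nat.log 2 ⌊a.Gamma⌋₊ + 1) (fun a => ⌊a.Gamma⌋₊ + 1) :=
  addMaintenance.incrementallyUpdatable (fun _ => le_rfl) (fun _ => le_rfl) (fun _ _ => by omega)

end Cardinality

end RobustVRP

open RobustVRP in
theorem proposition2 :
    -- budget sets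
    (ComputableAfterPreprocessing Budget.toInstance (fun _ k => k + 1) ∧
      IncrementallyUpdatable True Budget.toInstance (fun _ _ => 1) (fun a => a.L + 1)) ∧
    -- factor models
    (ComputableFromScratch FactorModel.toInstance
        (fun a k => k * a.F + a.F * Nat.log 2 a.F + 1) ∧
      IncrementallyUpdatable True FactorModel.toInstance
        (fun a _ => a.F * Nat.log 2 a.F + 1) (fun a => a.F)) ∧
    -- axis-parallel ellipsoids
    (ComputableFromScratch AxisParallelEllipsoid.toInstance (fun _ k => k + 1) ∧
      IncrementallyUpdatable True AxisParallelEllipsoid.toInstance (fun _ _ => 1) (fun _ => 1)) ∧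
    -- general ellipsoids
    (ComputableFromScratch Ellipsoid.toInstance (fun a k => k * a.n + 1) ∧
      IncrementallyUpdatable True Ellipsoid.toInstance (fun a _ => a.n + 1) (fun a => a.n + 1)) ∧
    -- cardinality-constrained sets, with the improvement when there are no removals
    (ComputableFromScratch Cardinality.toInstance (fun _ k => k + 1) ∧
      IncrementallyUpdatable True Cardinality.toInstance
        (fun _ k => Nat.log 2 k + 1) (fun a => a.n + 1) ∧
      IncrementallyUpdatable False Cardinality.toInstance
        (fun a _ => Nat.log 2 ⌊a.Gamma⌋₊ + 1) (fun a => ⌊a.Gamma⌋₊ + 1)) ∧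
    -- discrete sets
    (ComputableFromScratch Discrete.toInstance (fun a k => k * a.D + 1) ∧
      IncrementallyUpdatable True Discrete.toInstance (fun a _ => a.D) (fun a => a.D)) := by
  exact ⟨⟨Budget.computableAfterPreprocessing, Budget.incrementallyUpdatable⟩,
    ⟨FactorModel.computableFromScratch, FactorModel.incrementallyUpdatable⟩,
    ⟨AxisParallelEllipsoid.computableFromScratch, AxisParallelEllipsoid.incrementallyUpdatable⟩,
    ⟨Ellipsoid.computableFromScratch, Ellipsoid.incrementallyUpdatable⟩,
    ⟨Cardinality.computableFromScratch, Cardinality.incrementallyUpdatable, Cardinality.incrementallyUpdatable_add⟩,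
    ⟨Discrete.computableFromScratch, Discrete.incrementallyUpdatable⟩⟩
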